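/- **Setting.** Let $B$ be a closed connected $n$-manifold and $(E,g^E)\to B$ an oriented Euclidean vector bundle of rank $2$ with a Euclidean connection $\nabla^E$. Let $\pi\colon M=\{v\in E: |v|=1\}\to B$ be its unit circle bundle, with the horizontal distribution $T_HM=T_HE|_M$ given by $\nabla^E$ (write $X^H$ for horizontal lifts), let $e$ be the positively oriented vertical unit vector field, and $e^*$ the one-form on $M$ with $e^*(e)=1$, $e^*|_{T_HM}=0$. The torsion $T(X,Y)=-e^*([X^H,Y^H])$ is regarded as a two-form $T\in\Omega^2(B)$. Let $V\to M$ be a Hermitian line bundle with compatible connection $\nabla^V$; put $c(e)=-i$ and $D=c(e)\nabla^V_e=-i\nabla^V_e$, acting on the bundle $\pi_*V\to B$ whose fibre over $b$ is the space of smooth sections of $V$ over the circle $M_b$. Let $\nabla^{\pi_*V}_X=\nabla^V_{X^H}+\tfrac12k(X)$ with $k$ the mean curvature of the fibres, $c(T)=T\,c(e)$, and $$\mathbb A_t=\sqrt t\,D+\nabla^{\pi_*V}-\frac1{4\sqrt t}c(T)\quad(t>0),$$ the Bismut superconnection on $\Omega^\bullet(B,\pi_*V)$, where $c(e)$ anticommutes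 with one-forms on $B$. The holonomies $e^{-2\pi i a(b)}$ of $\nabla^V$ around the fibres $M_b$ define $a\colon B\to\mathbb R/\mathbb Z$; assume that $a$ crosses $[0]$ transversally, and put $B_0=a^{-1}([0])$. Below, $a(b)$ also denotes its representative in $[0,1)$. Assume that near each point of $B$ there are an open set $U\subset B$, a nowhere vanishing smooth section $\sigma$ of $V$ over $\pi^{-1}(U)$ with $D\sigma=f\sigma$ for a smooth $f\colon U\to\mathbb R$, and a complex valued one-form $\beta\in\Omega^1(U;\mathbb C)$ such that $\nabla^V\sigma=(if\,e^*+\pi^*\beta)\,\sigma$. **Theorem.** For every $b\in B$ and $t>0$ the operator $\exp(-\mathbb A_t^2)$ over $b$ is well defined by the heat equation, $\frac{d\mathbb A_t}{dt}\exp(-\mathbb A_t^2)$ has a trace in $\Lambda^\bullet T_b^*B\otimes\mathbb C$, and its even part $\mathrm{tr}^{ev}$ is integrable in $t$ over $(0,s]$ for every $s>0$. As $s\to\infty$ the form $$\alpha(s)_b=\frac1{\sqrt\pi}\int_0^s\mathrm{tr}^{ev}\Big(\frac{d\mathbb A_t}{dt}\exp(-\mathbb A_t^2)\Big)_b\,dt$$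 converges to some $\hat\eta_b\in\Lambda^{2\bullet}T_b^*B\otimes\mathbb C$. For any $(U,\sigma,f,\beta)$ as above with $b\in U$, the rescaled form $\tilde\eta_b=\sum_j(2\pi i)^{-j}(\hat\eta_b)_{[2j]}$ is given at $b$ by $$\tilde\eta_b=-\exp\Big(-\frac{d\beta+ifT}{2\pi i}\Big)\cdot\begin{cases}\displaystyle\sum_{k\ge1}\frac{B_k(a)}{k!}\Big(\frac T{2\pi}\Big)^{k-1},& b\in B\setminus B_0,\\[2mm]\displaystyle\sum_{k\ge1}\frac{B_{2k}}{(2k)!}\Big(\frac T{2\pi}\Big)^{2k-1},& b\in B_0,\end{cases}$$ $$\phantom{\tilde\eta_b}=\exp\Big(-\frac{d\beta+ifT}{2\pi i}\Big)\Big(-\frac T{2\pi}\Big)^{-1}\begin{cases}\displaystyle\frac{T/2\pi}{\exp(T/2\pi)-1}\exp\Big(\frac{aT}{2\pi}\Big)-1,& b\in B\setminus B_0,\\[2mm]\displaystyle\frac{T/2\pi}{\exp(T/2\pi)-1}-1+\frac T{4\pi},& b\in B_0.\end{cases}$$ Here $B_k(x)$ are the Bernoulli polynomials ($\sum_kB_k(x)y^k/k!=ye^{xy}/(e^y-1)$),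 $B_k=B_k(0)$, products are wedge products, and all series, including the quotient by $-T/2\pi$ of a power series without constant term, are formal power series evaluated at the nilpotent form $T/2\pi$. -/

import Mathlib

open Bundle Manifold Filter Topology
open scoped ContDiff TensorProduct

set_option linter.unusedSectionVars false
set_option linter.checkUnivs false

noncomputable section

namespace CircleEta

/-! ### The exterior algebra of a cotangent space -/

/-- The coordinate space `ℝⁿ`; every tangent space of an `n`-manifold is a copy of it. -/
abbrev Coord (n : ℕ) : Type := EuclideanSpace ℝ (Fin n)

/-- `Λ^• T_b^* B ⊗ ℂ` for a point `b` of an `n`-manifold: the exterior algebra over `ℂ` of the space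
of complex valued real linear functionals on the tangent space (which in Mathlib is `ℝⁿ`, identified
with `T_b B` through the preferred chart at `b`). The wedge product is the multiplication. -/
abbrev Forms (n : ℕ) : Type := ExteriorAlgebra ℂ (Coord n →ₗ[ℝ] ℂ)

/-- The `i`-th vector of the standard basis. -/
def stdVec {n : ℕ} (i : Fin n) : Coord n := EuclideanSpace.single i 1

/-- The coordinate one-form `dy_i`. -/
def dy {n : ℕ} (i : Fin n) : Forms n :=
  ExteriorAlgebra.ι ℂ
    (Complex.ofRealCLM.toLinearMap ∘ₗ (EuclideanSpace.proj (𝕜 := ℝ) i).toLinearMap)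

/-- The two-form `∑_{i<j} c_{ij} dy_i ∧ dy_j`. -/
def twoForm {n : ℕ} (c : Fin n → Fin n → ℂ) : Forms n :=
  ∑ i, ∑ j, if i < j then c i j • (dy i * dy j) else 0

/-- The parity operator on forms, `(-1)^k` on forms of degree `k`. -/
def parity (n : ℕ) : Forms n →ₗ[ℂ] Forms n :=
  (ExteriorAlgebra.map (-LinearMap.id : (Coord n →ₗ[ℝ] ℂ) →ₗ[ℂ] _)).toLinearMap

/-- The component of even degree of a form. -/
def evenPart {n : ℕ} (η : Forms n) : Forms n := (2⁻¹ : ℂ) • (η + parity n η)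

/-- The component of degree `k` of a form. -/
def degreePart {n : ℕ} (k : ℕ) (η : Forms n) : Forms n :=
  GradedRing.proj (fun i : ℕ => ⋀[ℂ]^i (Coord n →ₗ[ℝ] ℂ)) k η

/-- The rescaling `η ↦ ∑_j (2πi)^{-j} η_{[2j]}`. -/
def rescaleForm {n : ℕ} (η : Forms n) : Forms n :=
  ∑ j ∈ Finset.range (n + 1),
    ((2 * Real.pi * Complex.I : ℂ) ^ j)⁻¹ • degreePart (2 * j) η

/-- The value of a power series at a form `η` of positive degree; `η ^ k = 0` for `k > n`. -/
def evalAtForm {n : ℕ} (p : PowerSeries ℂ) (η : Forms n) : Forms n :=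
  ∑ k ∈ Finset.range (n + 1), PowerSeries.coeff k p • η ^ k

/-! ### Power series in the formula -/

/-- `-∑_{k ≥ 1} B_k(a)/k! X^{k-1}` with the Bernoulli polynomials `B_k`. -/
def bernoulliSeriesOff (a : ℝ) : PowerSeries ℂ :=
  -PowerSeries.mk fun m =>
    Polynomial.aeval (a : ℂ) (Polynomial.bernoulli (m + 1)) / ((m + 1).factorial : ℂ)

/-- `-∑_{k ≥ 1} B_{2k}/(2k)! X^{2k-1}` with the Bernoulli numbers `B_{2k}`. -/
def bernoulliSeriesOn : PowerSeries ℂ :=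
  -PowerSeries.mk fun m =>
    if Odd m then ((bernoulli (m + 1) : ℚ) : ℂ) / ((m + 1).factorial : ℂ) else 0

/-- The power series `X / (exp X - 1)`, the inverse of `∑_k X^k/(k+1)!`. -/
def toddSeries : PowerSeries ℂ :=
  (PowerSeries.mk fun k => (((k + 1).factorial : ℂ))⁻¹)⁻¹

/-- The quotient `p / X` of a power series `p` without constant term. -/
def divX (p : PowerSeries ℂ) : PowerSeries ℂ :=
  PowerSeries.mk fun k => PowerSeries.coeff (k + 1) p

/-- `(-X)⁻¹ (X/(exp X - 1) · exp (aX) - 1)`. -/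
def closedSeriesOff (a : ℝ) : PowerSeries ℂ :=
  -divX (toddSeries * PowerSeries.rescale (a : ℂ) (PowerSeries.exp ℂ) - 1)

/-- `(-X)⁻¹ (X/(exp X - 1) - 1 + X/2)`. -/
def closedSeriesOn : PowerSeries ℂ :=
  -divX (toddSeries - 1 + PowerSeries.C (2⁻¹ : ℂ) * PowerSeries.X)

/-! ### The circle bundle -/

/-- The model fibre of a real vector bundle of rank two. -/
abbrev Plane : Type := EuclideanSpace ℝ (Fin 2)

/-- The unit circle bundle `M = {v ∈ E | ‖v‖ = 1}` of a Euclidean plane bundle `E`. -/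
abbrev UnitCircle {B : Type*} (E : B → Type*) [∀ b, NormedAddCommGroup (E b)] : Type _ :=
  {v : TotalSpace Plane E // ‖v.2‖ = 1}

/-- The projection `π : M → B`. -/
def base {B : Type*} {E : B → Type*} [∀ b, NormedAddCommGroup (E b)] (x : UnitCircle E) : B :=
  x.1.proj

section Geometry

/-- The section `s` of a real vector bundle `W` over an `m`-manifold is smooth at `x`. -/
abbrev SmoothAt (m : ℕ) {X : Type*} [TopologicalSpace X] [ChartedSpace (Coord m) X]
    (F : Type*) [NormedAddCommGroup F] [NormedSpace ℝ F] {W : X → Type*}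
    [TopologicalSpace (TotalSpace F W)] [∀ x, TopologicalSpace (W x)] [FiberBundle F W]
    (s : Π x, W x) (x : X) : Prop :=
  ContMDiffAt (𝓡 m) ((𝓡 m).prod 𝓘(ℝ, F)) ∞ (fun y => TotalSpace.mk' F y (s y)) x

variable {n : ℕ} {B : Type*} [TopologicalSpace B] [ChartedSpace (Coord n) B]
  [IsManifold (𝓡 n) ∞ B]
  (E : B → Type*) [TopologicalSpace (TotalSpace Plane E)] [∀ b, NormedAddCommGroup (E b)]
  [∀ b, InnerProductSpace ℝ (E b)] [FiberBundle Plane E] [VectorBundle ℝ Plane E]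
  [ContMDiffVectorBundle ∞ Plane E (𝓡 n)] [IsContMDiffRiemannianBundle (𝓡 n) ∞ Plane E]
  [ChartedSpace (Coord (n + 1)) (UnitCircle E)] [IsManifold (𝓡 (n + 1)) ∞ (UnitCircle E)]
  (V : UnitCircle E → Type*) [TopologicalSpace (TotalSpace ℂ V)] [∀ x, NormedAddCommGroup (V x)]
  [∀ x, InnerProductSpace ℂ (V x)] [FiberBundle ℂ V] [VectorBundle ℝ ℂ V]
  [ContMDiffVectorBundle ∞ ℂ V (𝓡 (n + 1))]

/-- The geometric data: an orientation and a Euclidean connection on the Euclidean plane bundle `E`,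
and a compatible connection on the Hermitian line bundle `V` over the unit circle bundle of `E`.
`V` is a smooth real bundle with fibre `ℂ` whose complex structure and Hermitian metric are smooth.
The propositions say only that these objects are smooth and compatible with each other. -/
structure Setting where
  /-- `M` carries the smooth structure of a submanifold of `E`. -/
  isSmoothEmbedding : IsSmoothEmbedding (𝓡 (n + 1)) ((𝓡 n).prod 𝓘(ℝ, Plane)) ∞
    (Subtype.val : UnitCircle E → TotalSpace Plane E)
  /-- The orientation of `E`, given as the rotation by the angle `π/2` in the positive direction. -/
  J : ∀ b, E b →ₗᵢ[ℝ] E b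
  J_sq : ∀ b (v : E b), J b (J b v) = -v
  J_smooth : ∀ (s : Π b, E b) (b : B), SmoothAt n Plane s b → SmoothAt n Plane (fun y => J y (s y)) b
  /-- The Euclidean connection on `E`. -/
  connE : CovariantDerivative (𝓡 n) Plane E
  connE_smooth : CovariantDerivative.ContMDiffCovariantDerivative connE ∞
  connE_metric : connE.IsMetricCompatible
  I_smul_smooth : ∀ (s : Π x, V x) (x : UnitCircle E), SmoothAt (n + 1) ℂ s x →
    SmoothAt (n + 1) ℂ (fun y => Complex.I • s y) x
  inner_smooth : ∀ (s s' : Π x, V x) (x : UnitCircle E), SmoothAt (n + 1) ℂ s x → SmoothAt (n + 1) ℂ s' x →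
    ContMDiffAt (𝓡 (n + 1)) 𝓘(ℝ, ℂ) ∞ (fun y => (inner ℂ (s y) (s' y) : ℂ)) x
  /-- The connection on `V`. -/
  connV : CovariantDerivative (𝓡 (n + 1)) ℂ V
  connV_smooth : CovariantDerivative.ContMDiffCovariantDerivative connV ∞
  connV_I_smul : ∀ (s : Π x, V x) (x : UnitCircle E), SmoothAt (n + 1) ℂ s x →
    ∀ w, connV (fun y => Complex.I • s y) x w = Complex.I • connV s x w
  connV_metric : ∀ (s s' : Π x, V x) (x : UnitCircle E), SmoothAt (n + 1) ℂ s x → SmoothAt (n + 1) ℂ s' x →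
    ∀ w : TangentSpace (𝓡 (n + 1)) x,
      mfderiv (𝓡 (n + 1)) 𝓘(ℝ, ℂ) (fun y => (inner ℂ (s y) (s' y) : ℂ)) x w =
        (inner ℂ (connV s x w) (s' x) + inner ℂ (s x) (connV s' x w) : ℂ)

namespace Setting

variable {E V} (S : Setting (n := n) E V)

/-! #### The vertical and the horizontal directions of `M` -/

lemma rot_norm (x : UnitCircle E) (θ : ℝ) :
    ‖Real.cos θ • x.1.2 + Real.sin θ • S.J x.1.proj x.1.2‖ = 1 := by
  have h1 : (inner ℝ x.1.2 (S.J x.1.proj x.1.2) : ℝ) = 0 := by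
    have h := (S.J x.1.proj).inner_map_map x.1.2 (S.J x.1.proj x.1.2)
    rw [S.J_sq, inner_neg_right, real_inner_comm] at h
    linarith
  have h2 : ‖S.J x.1.proj x.1.2‖ = 1 := by rw [LinearIsometry.norm_map]; exact x.2
  have h3 := norm_add_sq_real (Real.cos θ • x.1.2) (Real.sin θ • S.J x.1.proj x.1.2)
  rw [inner_smul_left, inner_smul_right, h1, norm_smul, norm_smul, h2, x.2, Real.norm_eq_abs,
    Real.norm_eq_abs, mul_one, mul_one, sq_abs, sq_abs] at h3
  have h4 := Real.cos_sq_add_sin_sq θ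
  rw [← sq_eq_sq₀ (norm_nonneg _) zero_le_one, h3]
  simp only [mul_zero, add_zero]
  linarith

/-- The rotation of `x ∈ M` by the angle `θ` in its fibre. -/
def rot (θ : ℝ) (x : UnitCircle E) : UnitCircle E :=
  ⟨⟨x.1.proj, Real.cos θ • x.1.2 + Real.sin θ • S.J x.1.proj x.1.2⟩,
    S.rot_norm x θ⟩

/-- The vertical unit vector field `e`, the velocity of the rotation. -/
def e (x : UnitCircle E) : TangentSpace (𝓡 (n + 1)) x :=
  mfderiv 𝓘(ℝ, ℝ) (𝓡 (n + 1)) (fun θ : ℝ => S.rot θ x) 0 (1 : ℝ)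

/-- The differential of `π : M → B`. -/
def dbase (x : UnitCircle E) :
    TangentSpace (𝓡 (n + 1)) x →L[ℝ] TangentSpace (𝓡 n) (base x) :=
  mfderiv (𝓡 (n + 1)) (𝓡 n) base x

/-- `T_H M = T_H E ∩ TM`: the vector `w` is tangent to a section of `E` through `x` which is
parallel in the direction of `dπ w`. -/
def IsHorizontal (x : UnitCircle E) (w : TangentSpace (𝓡 (n + 1)) x) : Prop :=
  ∃ s : Π b, E b, SmoothAt n Plane s (base x) ∧ s (base x) = x.1.2 ∧
    S.connE s (base x) (dbase (n := n) x w) = 0 ∧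
    mfderiv (𝓡 (n + 1)) ((𝓡 n).prod 𝓘(ℝ, Plane))
        (Subtype.val : UnitCircle E → TotalSpace Plane E) x w =
      mfderiv (𝓡 n) ((𝓡 n).prod 𝓘(ℝ, Plane)) (fun y => TotalSpace.mk' Plane y (s y)) (base x)
        (dbase (n := n) x w)

/-- The horizontal lift to `T_x M` of a tangent vector of `B`. -/
def horLift (x : UnitCircle E) (X : TangentSpace (𝓡 n) (base x)) : TangentSpace (𝓡 (n + 1)) x :=
  Classical.epsilon fun w => S.IsHorizontal x w ∧ dbase (n := n) x w = X

/-- The dual `e^*` of `e` with kernel `T_H M`. -/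
def eDual (x : UnitCircle E) (w : TangentSpace (𝓡 (n + 1)) x) : ℝ :=
  Classical.epsilon fun c : ℝ => S.IsHorizontal x (w - c • S.e x)

/-! #### The operators over the domain `U` of the chart at a point `b` -/

variable (b : B)

/-- The coordinate vector field `∂_i` of the chart at `b`. -/
def coordField (i : Fin n) (y : B) : TangentSpace (𝓡 n) y :=
  (trivializationAt (Coord n) (TangentSpace (𝓡 n)) b).symmL ℝ y (stdVec i)

/-- The horizontal lift of `∂_i`. -/
def coordLift (i : Fin n) (x : UnitCircle E) : TangentSpace (𝓡 (n + 1)) x :=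
  S.horLift x (coordField b i (base x))

/-- The coefficient `g(T(∂_i, ∂_j), e)` of the torsion `T(X, Y) = -P[X^H, Y^H]`, where `P` is the
projection to the vertical tangent bundle. -/
def torsionCoeff (i j : Fin n) (x : UnitCircle E) : ℝ :=
  -S.eDual x (VectorField.mlieBracket (𝓡 (n + 1)) (S.coordLift b i) (S.coordLift b j) x)

/-- The mean curvature of the fibres, `k(X) = -e^*([X^H, e])`, in the direction of `∂_i`. -/
def meanCurvature (i : Fin n) (x : UnitCircle E) : ℝ :=
  -S.eDual x (VectorField.mlieBracket (𝓡 (n + 1)) (S.coordLift b i) S.e x)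

/-- The domain `U` of the chart at `b`. -/
def chartDomain : Set B := (chartAt (Coord n) b).source

lemma smul_eq (c : ℂ) (s : Π x, V x) :
    c • s = c.re • s + c.im • (fun y => Complex.I • s y) := by
  funext y
  have h : c • s y = (c.re + c.im * Complex.I : ℂ) • s y := by rw [Complex.re_add_im]
  simp only [Pi.add_apply, Pi.smul_apply]
  rw [h, add_smul, mul_smul, Complex.coe_smul, Complex.coe_smul]

/-- The sections of `V` that are smooth over `π⁻¹(U)`, that is the elements of `Γ(U, π_* V)`. -/
def smoothSections : Submodule ℂ (Π x, V x) where
  carrier := {s | ∀ x, base x ∈ chartDomain (n := n) b → SmoothAt (n + 1) ℂ s x}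
  add_mem' hs hs' x hx := (hs x hx).add_section (hs' x hx)
  zero_mem' x _ := contMDiffAt_zeroSection ℝ V
  smul_mem' c s hs x hx := by
    have h := ((hs x hx).const_smul_section (a := c.re)).add_section
      ((S.I_smul_smooth s x (hs x hx)).const_smul_section (a := c.im))
    rw [smul_eq c s]
    exact h

lemma covDeriv_smul (c : ℂ) (s : Π x, V x) (x : UnitCircle E) (hs : SmoothAt (n + 1) ℂ s x)
    (w : TangentSpace (𝓡 (n + 1)) x) : S.connV (c • s) x w = c • S.connV s x w := by
  have h1 := hs.mdifferentiableAt (by simp)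
  have h2 := S.I_smul_smooth s x hs
  have h3 := h2.mdifferentiableAt (by simp)
  have h4 := (hs.const_smul_section (a := c.re)).mdifferentiableAt (by simp)
  have h5 := (h2.const_smul_section (a := c.im)).mdifferentiableAt (by simp)
  rw [smul_eq c s, S.connV.isCovariantDerivativeOnUniv.add h4 h5,
    S.connV.isCovariantDerivativeOnUniv.smul_const _ h1,
    S.connV.isCovariantDerivativeOnUniv.smul_const _ h3]
  change c.re • S.connV s x w + c.im • S.connV (fun y => Complex.I • s y) x w = _
  rw [S.connV_I_smul s x hs w]
  rw [← Complex.coe_smul c.re, ← Complex.coe_smul c.im, smul_smul, ← add_smul,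
    Complex.re_add_im]

open Classical in
/-- Differentiation of sections over `π⁻¹(U)` in the direction of a vector field `w` on `M`. -/
def covDeriv (w : Π x : UnitCircle E, TangentSpace (𝓡 (n + 1)) x) :
    S.smoothSections b →ₗ[ℂ] (Π x, V x) where
  toFun s x := if base x ∈ chartDomain (n := n) b then S.connV s.1 x (w x) else 0
  map_add' s s' := by
    funext x
    by_cases hx : base x ∈ chartDomain (n := n) b
    · have h := S.connV.isCovariantDerivativeOnUniv.add
        ((s.2 x hx).mdifferentiableAt (by simp)) ((s'.2 x hx).mdifferentiableAt (by simp))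
      simp only [hx, if_true, Pi.add_apply]
      exact congrArg (fun L => L (w x)) h
    · simp [hx]
  map_smul' c s := by
    funext x
    by_cases hx : base x ∈ chartDomain (n := n) b
    · simp only [hx, if_true, Pi.smul_apply, RingHom.id_apply]
      exact S.covDeriv_smul c s.1 x (s.2 x hx) (w x)
    · simp [hx]

open Classical in
/-- Multiplication of sections over `π⁻¹(U)` by a function on `M`. -/
def mulFun (g : UnitCircle E → ℂ) : S.smoothSections b →ₗ[ℂ] (Π x, V x) where
  toFun s x := if base x ∈ chartDomain (n := n) b then g x • s.1 x else 0
  map_add' s s' := by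
    funext x
    by_cases hx : base x ∈ chartDomain (n := n) b <;> simp [hx]
  map_smul' c s := by
    funext x
    by_cases hx : base x ∈ chartDomain (n := n) b <;>
      simp [hx, smul_comm (g x) c]

/-- The space `Ω^•(U, π_* V) = Λ^• (ℝⁿ)^* ⊗ Γ(U, π_* V)` of forms over `U` with values in `π_* V`, where
the forms are written in the frame `dy_1, …, dy_n`. -/
abbrev LocalForms : Type _ := Forms n ⊗[ℂ] S.smoothSections b

/-- Forms with coefficients that are arbitrary sections. -/
abbrev RoughForms (_ : Setting (n := n) E V) : Type _ := Forms n ⊗[ℂ] (Π x, V x)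

/-- The inclusion of the smooth forms. -/
def incl : S.LocalForms b →ₗ[ℂ] S.RoughForms :=
  LinearMap.lTensor (Forms n) (S.smoothSections b).subtype

/-- Clifford multiplication `c(e) = -i`, as an operator that anticommutes with the `dy_i`. -/
def cliffordE (n : ℕ) : Forms n →ₗ[ℂ] Forms n := (-Complex.I) • parity n

/-- The vertical Dirac operator `D = c(e) ∇^V_e`. -/
def dirac : S.LocalForms b →ₗ[ℂ] S.RoughForms :=
  TensorProduct.map (cliffordE n) (S.covDeriv b S.e)

/-- The connection `∇^{π_* V} = ∑_i dy_i ∧ (∇^V_{∂_i^H} + k(∂_i)/2)`; in the coordinate frame the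
exterior derivatives of the `dy_i` vanish. -/
def piConnection : S.LocalForms b →ₗ[ℂ] S.RoughForms :=
  ∑ i, TensorProduct.map (LinearMap.mulLeft ℂ (dy i))
    (S.covDeriv b (S.coordLift b i) +
      (2⁻¹ : ℂ) • S.mulFun b fun x => (S.meanCurvature b i x : ℂ))

/-- Clifford multiplication with the torsion, `c(T) = ∑_{i<j} dy_i ∧ dy_j c(T(∂_i, ∂_j))`. -/
def cliffordT : S.LocalForms b →ₗ[ℂ] S.RoughForms :=
  ∑ i, ∑ j, if i < j then
    TensorProduct.map (LinearMap.mulLeft ℂ (dy i * dy j) ∘ₗ cliffordE n)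
      (S.mulFun b fun x => (S.torsionCoeff b i j x : ℂ))
  else 0

/-- The Bismut superconnection `𝔸_t = √t D + ∇^{π_* V} - c(T)/(4√t)` over `U`. -/
def superconnection (t : ℝ) : S.LocalForms b →ₗ[ℂ] S.RoughForms :=
  (Real.sqrt t : ℂ) • S.dirac b + S.piConnection b - (1 / (4 * Real.sqrt t) : ℂ) • S.cliffordT b

/-- The derivative `d𝔸_t/dt = D/(2√t) + c(T)/(8 t^{3/2})`. -/
def superconnectionDot (t : ℝ) : S.LocalForms b →ₗ[ℂ] S.RoughForms :=
  (1 / (2 * Real.sqrt t) : ℂ) • S.dirac b + (1 / (8 * t * Real.sqrt t) : ℂ) • S.cliffordT b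

/-! #### The operators on the fibre over `b` -/

/-- Arbitrary sections of `V` over the circle `M_b`. -/
abbrev FibreSections (_ : Setting (n := n) E V) (b : B) : Type _ :=
  Π x : {x : UnitCircle E // base x = b}, V x.1

/-- `Λ^• T_b^* B` with values in the sections of `V` over `M_b`. -/
abbrev FibreForms : Type _ := Forms n ⊗[ℂ] S.FibreSections b

/-- Restriction of sections to `M_b`. -/
def restrictSection : (Π x, V x) →ₗ[ℂ] S.FibreSections b where
  toFun s x := s x.1
  map_add' _ _ := rfl
  map_smul' _ _ := rfl

/-- Restriction of forms to the fibre over `b`. -/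
def restrictForm : S.RoughForms →ₗ[ℂ] S.FibreForms b :=
  LinearMap.lTensor (Forms n) (S.restrictSection b)

/-- Smooth sections over `M_b`, the elements of `(π_* V)_b`. -/
def IsSmoothSection (v : S.FibreSections b) : Prop :=
  ∃ s : S.smoothSections b, S.restrictSection b s.1 = v

/-- The elements of `Λ^• T_b^* B ⊗ (π_* V)_b`. -/
def IsSmoothForm (u : S.FibreForms b) : Prop :=
  ∃ s : S.LocalForms b, S.restrictForm b (S.incl b s) = u

/-- A smooth extension over `U` of a smooth element over `b`. -/
def extend (u : S.FibreForms b) : S.LocalForms b :=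
  Classical.epsilon fun s => S.restrictForm b (S.incl b s) = u

/-- The fibre over `b` of the curvature `𝔸_t²`: the operator `𝔸_t` is applied twice to an extension
(it preserves the smooth forms), and the result is restricted to the fibre. -/
def curvature (t : ℝ) (u : S.FibreForms b) : S.FibreForms b :=
  S.restrictForm b (S.superconnection b t
    (Classical.epsilon fun s => S.incl b s = S.superconnection b t (S.extend b u)))

/-- The fibre over `b` of the operator `d𝔸_t/dt`. -/
def fibreDot (t : ℝ) (u : S.FibreForms b) : S.FibreForms b :=
  S.restrictForm b (S.superconnectionDot b t (S.extend b u))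

lemma exists_base (_ : Setting (n := n) E V) (b : B) : ∃ x : UnitCircle E, base x = b := by
  let L := (trivializationAt Plane E b).continuousLinearEquivAt ℝ b
    (FiberBundle.mem_baseSet_trivializationAt' b)
  have hv : L.symm (stdVec 0) ≠ 0 := by
    intro h
    have h1 : (stdVec 0 : Plane) = 0 := by simpa using h
    have h2 := congrArg (fun v : Plane => v 0) h1
    simp [stdVec] at h2
  refine ⟨⟨⟨b, ‖L.symm (stdVec 0)‖⁻¹ • L.symm (stdVec 0)⟩, ?_⟩, rfl⟩
  change ‖‖L.symm (stdVec 0)‖⁻¹ • L.symm (stdVec 0)‖ = 1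
  rw [norm_smul, norm_inv, norm_norm, inv_mul_cancel₀ (norm_ne_zero_iff.mpr hv)]

/-- The parametrization of the circle `M_b` by arc length, from some point of it. -/
def circle (θ : ℝ) : {x : UnitCircle E // base x = b} :=
  ⟨S.rot θ (S.exists_base b).choose, (S.exists_base b).choose_spec⟩

/-- The `L²` inner product of sections over `M_b`. -/
def fibreInner (v w : S.FibreSections b) : ℂ :=
  ∫ θ in (0 : ℝ)..2 * Real.pi, (inner ℂ (v (S.circle b θ)) (w (S.circle b θ)) : ℂ)

/-- The square of the `L²` norm of sections over `M_b`. -/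
def fibreNormSq (v : S.FibreSections b) : ℝ :=
  ∫ θ in (0 : ℝ)..2 * Real.pi, ‖v (S.circle b θ)‖ ^ 2

/-- The coefficient of a form with values in sections, for a linear functional on `Λ^• T_b^* B`. -/
def coeff (φ : Module.Dual ℂ (Forms n)) : S.FibreForms b →ₗ[ℂ] S.FibreSections b :=
  (TensorProduct.lid ℂ (S.FibreSections b)).toLinearMap ∘ₗ
    LinearMap.rTensor (S.FibreSections b) φ

/-- `u` solves the heat equation `du/dτ = -𝔸_t² u`, `u(0) = u₀`, in `Λ^• T_b^* B ⊗ L²(M_b, V)`. -/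
structure IsHeatFlow (t : ℝ) (u₀ : S.FibreForms b) (u : ℝ → S.FibreForms b) : Prop where
  smooth : ∀ τ > 0, S.IsSmoothForm b (u τ)
  deriv : ∀ τ > 0, ∀ φ, Tendsto (fun h : ℝ => S.fibreNormSq b
    (S.coeff b φ ((h : ℂ)⁻¹ • (u (τ + h) - u τ) + S.curvature b t (u τ)))) (𝓝[≠] 0) (𝓝 0)
  initial : ∀ φ, Tendsto (fun τ : ℝ => S.fibreNormSq b (S.coeff b φ (u τ - u₀))) (𝓝[>] 0) (𝓝 0)

/-- `u₁ = exp(-𝔸_t²) u₀`, that is `u₁` is the value at time one of the solution of the heat equation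
with initial value `u₀`. -/
def IsHeatValue (t : ℝ) (u₀ u₁ : S.FibreForms b) : Prop :=
  ∃ u, S.IsHeatFlow b t u₀ u ∧ u 1 = u₁

/-- The operator `exp(-𝔸_t²)` over `b`. -/
def expNegCurvature (t : ℝ) (u₀ : S.FibreForms b) : S.FibreForms b :=
  Classical.epsilon (S.IsHeatValue b t u₀)

/-- An orthonormal basis of `L²(M_b, V)` that consists of smooth sections. -/
structure IsOrthonormalBasis (ψ : ℕ → S.FibreSections b) : Prop where
  smooth : ∀ k, S.IsSmoothSection b (ψ k)
  orthonormal : ∀ k l, S.fibreInner b (ψ k) (ψ l) = if k = l then 1 else 0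
  parseval : ∀ v, S.IsSmoothSection b v →
    HasSum (fun k => ‖S.fibreInner b (ψ k) v‖ ^ 2) (S.fibreNormSq b v)

/-- `η ∈ Λ^• T_b^* B` is the trace of the operator `K : (π_* V)_b → Λ^• T_b^* B ⊗ (π_* V)_b`, computed
in every orthonormal basis of smooth sections. -/
def IsTrace (K : S.FibreSections b → S.FibreForms b) (η : Forms n) : Prop :=
  (∃ ψ, S.IsOrthonormalBasis b ψ) ∧ ∀ ψ, S.IsOrthonormalBasis b ψ → ∀ φ : Module.Dual ℂ (Forms n),
    HasSum (fun k => S.fibreInner b (ψ k) (S.coeff b φ (K (ψ k)))) (φ η)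

/-- `η = tr^{ev}(d𝔸_t/dt exp(-𝔸_t²))` over `b`; the trace of an operator on `Ω^•(B, π_* V)` that is
linear over forms is the trace of its restriction to `1 ⊗ π_* V`. -/
def IsTraceEv (t : ℝ) (η : Forms n) : Prop :=
  ∃ ξ, S.IsTrace b (fun v => S.fibreDot b t (S.expNegCurvature b t (1 ⊗ₜ v))) ξ ∧ η = evenPart ξ

/-! #### Holonomy and local eigensections -/

/-- `p` is a parallel section of `V` along the curve `θ ↦ rot θ x` in a fibre of `M`, by the Leibniz rule
for sections of the form `g(θ) s(rot θ x)` with a section `s` of `V`. -/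
def IsParallel (x : UnitCircle E) (p : Π θ : ℝ, V (S.rot θ x)) : Prop :=
  ∀ θ : ℝ, ∃ (s : Π x, V x) (g : ℝ → ℂ) (g' : ℂ), SmoothAt (n + 1) ℂ s (S.rot θ x) ∧
    (∀ᶠ θ' in 𝓝 θ, p θ' = g θ' • s (S.rot θ' x)) ∧ HasDerivAt g g' θ ∧
    g' • s (S.rot θ x) + g θ • S.connV s (S.rot θ x) (S.e (S.rot θ x)) = 0

/-- The parallel transport once around the fibre over `b` in the positive direction is the
multiplication by `exp(-2πi a(b))`. -/
def IsHolonomy (a : B → UnitAddCircle) : Prop :=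
  ∀ (x : UnitCircle E) (p : Π θ : ℝ, V (S.rot θ x)), S.IsParallel x p →
    (⟨S.rot (2 * Real.pi) x, p (2 * Real.pi)⟩ : TotalSpace ℂ V) =
      ⟨S.rot 0 x, ((AddCircle.toCircle (a (base x)))⁻¹ : ℂ) • p 0⟩

/-- A local eigensection `σ` of `D` over `π⁻¹(U)` that trivializes `V`, with eigenvalue `f : U → ℝ`, such
that the connection is `∇^V = d + i f e^* + π^* β` in this trivialization, for a one-form `β` on `U`. -/
structure IsLocalEigenframe (U : Set B) (σ : Π x, V x) (f : B → ℝ)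
    (β : Π y : B, TangentSpace (𝓡 n) y →L[ℝ] ℂ) : Prop where
  isOpen : IsOpen U
  smooth : ∀ x, base x ∈ U → SmoothAt (n + 1) ℂ σ x
  ne_zero : ∀ x, base x ∈ U → σ x ≠ 0
  smooth_eigenvalue : ∀ y ∈ U, ContMDiffAt (𝓡 n) 𝓘(ℝ, ℝ) ∞ f y
  smooth_form : ∀ y ∈ U, ∀ i, ContMDiffAt (𝓡 n) 𝓘(ℝ, ℂ) ∞ (fun z => β z (coordField y i z)) y
  eigen : ∀ x, base x ∈ U → (-Complex.I) • S.connV σ x (S.e x) = (f (base x) : ℂ) • σ x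
  connection : ∀ x, base x ∈ U → ∀ w : TangentSpace (𝓡 (n + 1)) x, S.connV σ x w =
    (Complex.I * f (base x) * S.eDual x w + β (base x) (dbase x w)) • σ x

/-- The torsion two-form `T` at `b`, computed at the point `x` of `M_b`. -/
def torsionForm (x : UnitCircle E) : Forms n :=
  twoForm fun i j => (S.torsionCoeff b i j x : ℂ)

end Setting

/-- The map `a : B → ℝ/ℤ` crosses `[0]` transversally. -/
def CrossesZeroTransversally (n : ℕ) {B : Type*} [TopologicalSpace B] [ChartedSpace (Coord n) B]
    (a : B → UnitAddCircle) : Prop :=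
  ∀ y, a y = 0 → ∀ g : B → ℝ, ContMDiffAt (𝓡 n) 𝓘(ℝ, ℝ) ∞ g y →
    (∀ᶠ z in 𝓝 y, a z = (g z : UnitAddCircle)) → mfderiv (𝓡 n) 𝓘(ℝ, ℝ) g y ≠ 0

/-- The partial derivative `∂_i g` at `b` of a function in the chart at `b`. -/
def partialAt {n : ℕ} {B : Type*} [TopologicalSpace B] [ChartedSpace (Coord n) B]
    (i : Fin n) (g : B → ℂ) (b : B) : ℂ :=
  mfderiv (𝓡 n) 𝓘(ℝ, ℂ) g b (stdVec i)

/-- The exterior derivative `dβ` at `b` of a complex valued one-form `β`, in the chart at `b`. -/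
def extDerivAt {n : ℕ} {B : Type*} [TopologicalSpace B] [ChartedSpace (Coord n) B]
    [IsManifold (𝓡 n) ∞ B] (β : Π y : B, TangentSpace (𝓡 n) y →L[ℝ] ℂ) (b : B) : Forms n :=
  twoForm fun i j =>
    partialAt i (fun y => β y (Setting.coordField b j y)) b -
      partialAt j (fun y => β y (Setting.coordField b i y)) b

end Geometry
end CircleEta
end

/-! Over a point `b` the eigenframe `σ` identifies the smooth sections of `V` on the circle `M_b`
with rapidly decreasing Fourier coefficients, and `D` acts on the mode `e^{imθ} σ` as the number `l
= m + f(b)`. A unit section of `E` gives coordinates (base point, angle) on `M`. In them a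
horizontal vector satisfies `dθ = -ω`, with `ω` the connection form of `E`. Hence the mean curvature
of the fibres is zero, and `T` is the curvature of `E`, constant on each fibre. All commutators of
the covariant derivatives are then explicit, and the square of the superconnection on the mode `m`
is `t l² - (i/2) l T - T²/(16 t) + Ω + ρ·parity = t (l - iT/(4t))² + Ω + ρ·parity`, with `Ω = dβ + i
f T` and an odd form `ρ` (`superconnection_sq`, `exists_curvature_fibreSection`).

Apart from the number `t l²` this is nilpotent. So the heat equation is solved on each mode by an
exponential times a polynomial in time (`isHeatFlow_modeFlow`). The solution is unique because
convergence in `L²` forces convergence of every Fourier coefficient, which leaves a linear ordinary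
differential equation on each mode (`IsHeatFlow.eq_of_isHeatFlow`). The form `ρ` is odd, so `ρ² =
0`, and it enters the trace only through a factor `1 + ρ`, which the even part removes. Since
`d𝔸_t/dt` is `(l - iT/(4t))/(2√t)` times the parity, the even trace is `e^{-Ω} (2√t)⁻¹ ∑_m (m + z)
e^{-t(m+z)²}` with `z = f - iT/(4t)` (`isTraceEv`).

Poisson summation (`modeSeriesSum_mul_gaussSeries`) turns this into a sum over `k` whose coefficient
of `T^j` is a constant times `k^{j+1} e^{2πikf} t^{-j-2} e^{-π²k²/t}`. The term `k = 0` vanishes, so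
nothing is singular at time zero. The time integrals are incomplete gamma functions
(`hasSum_integral_traceCoeff`), and for large times there remains a multiple of `∑
e^{2πikf}/k^{j+1}`, the Fourier series of the Bernoulli polynomial `B_{j+1}`. By `holonomy_eq` the
eigenvalue `f(b)` is congruent to `a(b)` modulo the integers.

Only `j = 0` is not absolutely convergent. There the damped series `sawtooth` is compared with the
theta function: it converges to a multiple of `1/2 - a` if `a` is not an integer, and vanishes by
symmetry if it is. This is the only difference between the two cases of the formula: over `B₀` the
contribution of `B_1` is missing. The closed forms restate the generating function of the Bernoulli
polynomials. -/

noncomputable section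

namespace CircleEta

/-! ### Smooth maps into the total space of a vector bundle. -/

section TotalSpaceMaps

variable {EM : Type*} [NormedAddCommGroup EM] [NormedSpace ℝ EM] {HM : Type*} [TopologicalSpace HM]
  {IM : ModelWithCorners ℝ EM HM} {N : Type*} [TopologicalSpace N] [ChartedSpace HM N]
  {EB : Type*} [NormedAddCommGroup EB] [NormedSpace ℝ EB] {HB : Type*} [TopologicalSpace HB]
  {IB : ModelWithCorners ℝ EB HB} {B : Type*} [TopologicalSpace B] [ChartedSpace HB B]
  {F : Type*} [NormedAddCommGroup F] [NormedSpace ℝ F] {E : B → Type*}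
  [TopologicalSpace (TotalSpace F E)] [∀ b, TopologicalSpace (E b)] [∀ b, AddCommGroup (E b)]
  [∀ b, Module ℝ (E b)] [FiberBundle F E] [VectorBundle ℝ F E]

/-- A linear combination of two smooth maps to the total space over the same map to the base. -/
lemma contMDiffAt_smul_add_smul {k : ℕ∞ω} {p : N → B} {v w : ∀ x, E (p x)} {c d : N → ℝ} {x : N}
    (hv : ContMDiffAt IM (IB.prod 𝓘(ℝ, F)) k (fun y => TotalSpace.mk' F (p y) (v y)) x)
    (hw : ContMDiffAt IM (IB.prod 𝓘(ℝ, F)) k (fun y => TotalSpace.mk' F (p y) (w y)) x)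
    (hc : ContMDiffAt IM 𝓘(ℝ, ℝ) k c x) (hd : ContMDiffAt IM 𝓘(ℝ, ℝ) k d x) :
    ContMDiffAt IM (IB.prod 𝓘(ℝ, F)) k
      (fun y => TotalSpace.mk' F (p y) (c y • v y + d y • w y)) x := by
  rw [contMDiffAt_totalSpace] at hv hw ⊢
  refine ⟨hv.1, ?_⟩
  refine ((hc.smul hv.2).add (hd.smul hw.2)).congr_of_eventuallyEq ?_
  have h : ∀ᶠ y in 𝓝 x, p y ∈ (trivializationAt F E (p x)).baseSet :=
    hv.1.continuousAt.eventually_mem ((trivializationAt F E (p x)).open_baseSet.mem_nhds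
      (FiberBundle.mem_baseSet_trivializationAt' (p x)))
  filter_upwards [h] with y hy
  have hl := (trivializationAt F E (p x)).linear ℝ hy
  simp only [Pi.add_apply, Pi.smul_apply', TotalSpace.mk']
  rw [hl.map_add, hl.map_smul, hl.map_smul]

end TotalSpaceMaps

/-! ### Unit sections of the plane bundle. -/

section Frames

variable {n : ℕ} {B : Type*} [TopologicalSpace B] [ChartedSpace (Coord n) B]
  [IsManifold (𝓡 n) ∞ B]
  {E : B → Type*} [TopologicalSpace (TotalSpace Plane E)] [∀ b, NormedAddCommGroup (E b)]
  [∀ b, InnerProductSpace ℝ (E b)] [FiberBundle Plane E] [VectorBundle ℝ Plane E]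
  [ContMDiffVectorBundle ∞ Plane E (𝓡 n)] [IsContMDiffRiemannianBundle (𝓡 n) ∞ Plane E]

lemma finrank_fibre (b : B) : Module.finrank ℝ (E b) = 2 := by
  have L := (trivializationAt Plane E b).continuousLinearEquivAt ℝ b
    (FiberBundle.mem_baseSet_trivializationAt' b)
  rw [L.toLinearEquiv.finrank_eq]
  simp

/-- A smooth local section of unit length with a given value at a point. -/
lemma exists_unit_section (hE : ∀ b, ∃ v : E b, ‖v‖ = 1) (y₀ : B) (v₀ : E y₀) (hv₀ : ‖v₀‖ = 1) :
    ∃ (W : Set B) (s : Π y, E y), IsOpen W ∧ y₀ ∈ W ∧ (∀ y, ‖s y‖ = 1) ∧ s y₀ = v₀ ∧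
      ∀ y ∈ W, SmoothAt n Plane s y := by
  classical
  let e := trivializationAt Plane E y₀
  have hy₀ : y₀ ∈ e.baseSet := FiberBundle.mem_baseSet_trivializationAt' y₀
  let s₀ : Π y, E y := fun y => e.symm y (e ⟨y₀, v₀⟩).2
  have hs₀ : ∀ y ∈ e.baseSet, SmoothAt n Plane s₀ y := by
    intro y hy
    rw [SmoothAt, e.contMDiffAt_section_iff (F := Plane) (E := E) hy]
    refine (contMDiffAt_const (c := (e ⟨y₀, v₀⟩).2)).congr_of_eventuallyEq ?_
    filter_upwards [e.open_baseSet.mem_nhds hy] with z hz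
    simp only [s₀]
    rw [e.apply_mk_symm hz]
  have hval : s₀ y₀ = v₀ := e.symm_apply_apply_mk hy₀ v₀
  have hne : ∀ y ∈ e.baseSet, s₀ y ≠ 0 := by
    intro y hy h0
    have h1 : (e ⟨y, s₀ y⟩).2 = (e ⟨y₀, v₀⟩).2 := by
      simp only [s₀]
      rw [e.apply_mk_symm hy]
    rw [h0] at h1
    have h2 : (e ⟨y, (0 : E y)⟩).2 = 0 := (e.linear ℝ hy).map_zero
    have h3 : e.symm y₀ (e ⟨y₀, v₀⟩).2 = 0 := by
      rw [← h1, h2]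
      rw [← e.coe_symmₗ (R := ℝ) hy₀, map_zero]
    rw [e.symm_apply_apply_mk hy₀ v₀] at h3
    simp [h3] at hv₀
  -- The section is to have unit length over all of `B`. Outside the trivialization its values are
  -- arbitrary unit vectors, and smoothness is claimed only inside.
  choose u hu using hE
  refine ⟨e.baseSet, fun y => if y ∈ e.baseSet then ‖s₀ y‖⁻¹ • s₀ y else u y, e.open_baseSet, hy₀,
    ?_, ?_, ?_⟩
  · intro y
    by_cases hy : y ∈ e.baseSet
    · simp only [hy, if_true]
      rw [norm_smul, norm_inv, norm_norm, inv_mul_cancel₀ (norm_ne_zero_iff.mpr (hne y hy))]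
    · simp [hy, hu]
  · simp [hy₀, hval, hv₀]
  · intro y hy
    have h1 : ContMDiffAt (𝓡 n) 𝓘(ℝ, ℝ) ∞ (fun z => inner ℝ (s₀ z) (s₀ z)) y :=
      (hs₀ y hy).inner_bundle (hs₀ y hy)
    have h2 : ContMDiffAt (𝓡 n) 𝓘(ℝ, ℝ) ∞ (fun z => ‖s₀ z‖⁻¹) y := by
      -- The bundle metric is smooth as an inner product, so the norm is taken as a square root,
      -- which is smooth away from zero.
      have h3 : ContDiffAt ℝ ∞ (fun r : ℝ => (Real.sqrt r)⁻¹) (inner ℝ (s₀ y) (s₀ y)) := by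
        have h4 : (inner ℝ (s₀ y) (s₀ y) : ℝ) ≠ 0 := inner_self_ne_zero.mpr (hne y hy)
        refine (contDiffAt_id.sqrt h4).inv ?_
        have h5 : (0 : ℝ) < inner ℝ (s₀ y) (s₀ y) := real_inner_self_pos.mpr (hne y hy)
        exact (Real.sqrt_pos.mpr h5).ne'
      have h5 := h3.contMDiffAt.comp y h1
      refine h5.congr_of_eventuallyEq (Eventually.of_forall fun z => ?_)
      simp only [Function.comp]
      rw [real_inner_self_eq_norm_sq, Real.sqrt_sq (norm_nonneg _)]
    refine (h2.smul_section (hs₀ y hy)).congr_of_eventuallyEq ?_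
    filter_upwards [e.open_baseSet.mem_nhds hy] with z hz
    simp [hz]

end Frames

/-! ### The oriented Euclidean plane. -/

section PlaneGeometry

variable {P : Type*} [NormedAddCommGroup P] [InnerProductSpace ℝ P] (J : P →ₗᵢ[ℝ] P)

/-- An isometry with square `-1` is skew: apply it to both arguments. -/
lemma inner_rotation_right (hJ : ∀ v, J (J v) = -v) (u v : P) : inner ℝ u (J v) = -inner ℝ (J u) v := by
  have h := J.inner_map_map u (J v)
  rw [hJ, inner_neg_right] at h
  linarith

lemma inner_rotation_self (hJ : ∀ v, J (J v) = -v) (u : P) : inner ℝ u (J u) = (0 : ℝ) := by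
  have h := inner_rotation_right J hJ u u
  rw [real_inner_comm u (J u)] at h
  linarith

/-- The expansion of a vector of a plane in the orthonormal basis `u, J u`. -/
lemma eq_smul_add_smul_rotation (hJ : ∀ v, J (J v) = -v) (hP : Module.finrank ℝ P = 2) (u v : P) (hu : ‖u‖ = 1) :
    v = (inner ℝ u v : ℝ) • u + (inner ℝ (J u) v : ℝ) • J u := by
  have hon : Orthonormal ℝ ![u, J u] := by
    rw [orthonormal_iff_ite]
    have h3 := inner_rotation_self J hJ u
    have h4 : inner ℝ (J u) u = (0 : ℝ) := by rw [real_inner_comm, h3]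
    intro i j
    fin_cases i <;> fin_cases j <;> simp [h3, h4, hu]
  have : FiniteDimensional ℝ P := Module.finite_of_finrank_eq_succ hP
  let b := OrthonormalBasis.mk hon (by
    rw [top_le_iff]
    exact hon.linearIndependent.span_eq_top_of_card_eq_finrank' (by simp [hP]))
  have h := b.sum_repr' v
  rw [Fin.sum_univ_two] at h
  simpa [b] using h.symm

end PlaneGeometry

end CircleEta
end

noncomputable section

namespace CircleEta

/-! ### Covariant derivatives of local sections. -/

section CovariantDerivatives

variable {EM : Type*} [NormedAddCommGroup EM] [NormedSpace ℝ EM] {H : Type*} [TopologicalSpace H]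
  {I : ModelWithCorners ℝ EM H} {N : Type*} [TopologicalSpace N] [ChartedSpace H N]
  [IsManifold I ∞ N] {F : Type*} [NormedAddCommGroup F] [NormedSpace ℝ F] {W : N → Type*}
  [TopologicalSpace (TotalSpace F W)] [∀ x, AddCommGroup (W x)] [∀ x, Module ℝ (W x)]
  [∀ x, TopologicalSpace (W x)] [∀ x, IsTopologicalAddGroup (W x)] [∀ x, ContinuousSMul ℝ (W x)]
  [FiberBundle F W] [VectorBundle ℝ F W] [ContMDiffVectorBundle ∞ F W I]

/-- A smooth covariant derivative maps local smooth sections to smooth sections, where there is a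
smooth cutoff function. -/
lemma contMDiffAt_covariantDerivative (cov : CovariantDerivative I F W)
    (hcov : CovariantDerivative.ContMDiffCovariantDerivative cov ∞) {s : Π x, W x} {U : Set N}
    (hU : IsOpen U)
    (hs : ∀ x ∈ U, ContMDiffAt I (I.prod 𝓘(ℝ, F)) ∞ (fun y => TotalSpace.mk' F y (s y)) x)
    {χ : N → ℝ} (hχ : ContMDiff I 𝓘(ℝ, ℝ) ∞ χ) (hχU : tsupport χ ⊆ U) {x : N} (hx : x ∈ U)
    (hx1 : ∀ᶠ y in 𝓝 x, χ y = 1) :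
    ContMDiffAt I (I.prod 𝓘(ℝ, EM →L[ℝ] F)) ∞
      (fun y => TotalSpace.mk' (E := fun z => TangentSpace I z →L[ℝ] W z) (EM →L[ℝ] F) y (cov s y))
      x := by
  have hsU : ContMDiffOn I (I.prod 𝓘(ℝ, F)) ∞ (fun y => TotalSpace.mk' F y (s y)) U :=
    fun y hy => (hs y hy).contMDiffWithinAt
  -- The smoothness of the connection is used for the global smooth section `χ s`, which by locality
  -- has the same derivative as `s` wherever `χ` is one on a neighbourhood.
  have h1 : ContMDiff I (I.prod 𝓘(ℝ, F)) ∞ (fun y => TotalSpace.mk' F y ((χ • s) y)) :=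
    ContMDiffOn.smul_section_of_tsupport hχ.contMDiffOn hU hχU hsU
  have h2 := hcov.contMDiff.contMDiff (σ := χ • s) (h1.contMDiffOn.of_le (by simp))
  have h3 := h2.contMDiffAt (x := x) Filter.univ_mem
  refine h3.congr_of_eventuallyEq ?_
  filter_upwards [hx1.eventually_nhds, hU.mem_nhds hx] with y hy hyU
  have h4 : cov (χ • s) y = cov s y := by
    refine cov.isCovariantDerivativeOnUniv.congr_of_eventuallyEq
      (h1.mdifferentiableAt (by simp)) ((hs y hyU).mdifferentiableAt (by simp)) Filter.univ_mem ?_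
    filter_upwards [hy] with z hz
    simp [hz]
  rw [← h4]

end CovariantDerivatives

section Cutoff

/-- A smooth function on a manifold which is one near a point and supported in a neighborhood. -/
lemma exists_smooth_cutoff {n : ℕ} {B : Type*} [TopologicalSpace B] [T2Space B]
    [ChartedSpace (Coord n) B] [IsManifold (𝓡 n) ∞ B] {y : B} {U : Set B} (hU : U ∈ 𝓝 y) :
    ∃ χ : B → ℝ, ContMDiff (𝓡 n) 𝓘(ℝ, ℝ) ∞ χ ∧ tsupport χ ⊆ U ∧ ∀ᶠ z in 𝓝 y, χ z = 1 := by
  obtain ⟨g, -, hg⟩ := (SmoothBumpFunction.nhds_basis_tsupport (I := 𝓡 n) y).mem_iff.mp hU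
  exact ⟨g, g.contMDiff, hg, g.eventuallyEq_one⟩

end Cutoff

/-! ### The fibres of the circle bundle and its local parametrization. -/

section Geometry

variable {n : ℕ} {B : Type*} [TopologicalSpace B] [ChartedSpace (Coord n) B]
  [IsManifold (𝓡 n) ∞ B]
  {E : B → Type*} [TopologicalSpace (TotalSpace Plane E)] [∀ b, NormedAddCommGroup (E b)]
  [∀ b, InnerProductSpace ℝ (E b)] [FiberBundle Plane E] [VectorBundle ℝ Plane E]
  [ContMDiffVectorBundle ∞ Plane E (𝓡 n)] [IsContMDiffRiemannianBundle (𝓡 n) ∞ Plane E]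
  [ChartedSpace (Coord (n + 1)) (UnitCircle E)] [IsManifold (𝓡 (n + 1)) ∞ (UnitCircle E)]
  {V : UnitCircle E → Type*} [TopologicalSpace (TotalSpace ℂ V)] [∀ x, NormedAddCommGroup (V x)]
  [∀ x, InnerProductSpace ℂ (V x)] [FiberBundle ℂ V] [VectorBundle ℝ ℂ V]
  [ContMDiffVectorBundle ∞ ℂ V (𝓡 (n + 1))]

namespace Setting

variable (S : Setting (n := n) E V)

lemma contMDiff_base (S : Setting (n := n) E V) : ContMDiff (𝓡 (n + 1)) (𝓡 n) ∞ (base : UnitCircle E → B) :=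
  (Bundle.contMDiff_proj E).comp S.isSmoothEmbedding.contMDiff

lemma continuous_base (S : Setting (n := n) E V) : Continuous (base : UnitCircle E → B) := S.contMDiff_base.continuous

@[simp] lemma base_rot (θ : ℝ) (x : UnitCircle E) : base (S.rot θ x) = base x := rfl

lemma rot_rot (α θ : ℝ) (x : UnitCircle E) : S.rot α (S.rot θ x) = S.rot (α + θ) x := by
  apply Subtype.ext
  have h : Real.cos α • (Real.cos θ • x.1.2 + Real.sin θ • S.J x.1.proj x.1.2) +
      Real.sin α • S.J x.1.proj (Real.cos θ • x.1.2 + Real.sin θ • S.J x.1.proj x.1.2) =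
      Real.cos (α + θ) • x.1.2 + Real.sin (α + θ) • S.J x.1.proj x.1.2 := by
    rw [map_add, map_smul, map_smul, S.J_sq, Real.cos_add, Real.sin_add]
    module
  exact congrArg (fun v => (⟨x.1.proj, v⟩ : TotalSpace Plane E)) h

@[simp] lemma rot_zero (x : UnitCircle E) : S.rot 0 x = x := by
  apply Subtype.ext
  simp [rot]

lemma rot_add_two_pi (θ : ℝ) (x : UnitCircle E) : S.rot (θ + 2 * Real.pi) x = S.rot θ x := by
  simp [rot]

lemma exists_unit (S : Setting (n := n) E V) (b : B) : ∃ v : E b, ‖v‖ = 1 := by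
  obtain ⟨⟨⟨c, v⟩, hv⟩, rfl⟩ := S.exists_base b
  exact ⟨v, hv⟩

/-- The function `⟨s, x⟩ + i ⟨J s, x⟩` of `x` for a section `s` of `E`. -/
def frameCoord (s : Π y, E y) (x : UnitCircle E) : ℂ :=
  ⟨inner ℝ (s x.1.proj) x.1.2, inner ℝ (S.J _ (s x.1.proj)) x.1.2⟩

/-- The point of the circle bundle given by a unit section. -/
def unitPoint (s : Π y, E y) (hs : ∀ y, ‖s y‖ = 1) (y : B) : UnitCircle E := ⟨⟨y, s y⟩, hs y⟩

section

variable {s : Π y, E y} (hs : ∀ y, ‖s y‖ = 1)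

lemma frameCoord_rot_unitPoint (θ : ℝ) (y : B) :
    S.frameCoord s (S.rot θ (unitPoint s hs y)) = Complex.exp (θ * Complex.I) := by
  have h1 : (inner ℝ (s y) (s y) : ℝ) = 1 := by rw [real_inner_self_eq_norm_sq, hs]; norm_num
  have h2 := inner_rotation_self (S.J y) (S.J_sq y) (s y)
  have h3 : (inner ℝ (S.J y (s y)) (s y) : ℝ) = 0 := by rw [real_inner_comm, h2]
  have h4 : (inner ℝ (S.J y (s y)) (S.J y (s y)) : ℝ) = 1 := by rw [(S.J y).inner_map_map, h1]
  rw [Complex.exp_mul_I, ← Complex.ofReal_cos, ← Complex.ofReal_sin]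
  apply Complex.ext
  · change (inner ℝ (s y) (Real.cos θ • s y + Real.sin θ • S.J y (s y)) : ℝ) = _
    rw [inner_add_right, inner_smul_right, inner_smul_right, h1, h2]
    simp [-Complex.ofReal_cos, -Complex.ofReal_sin]
  · change (inner ℝ (S.J y (s y)) (Real.cos θ • s y + Real.sin θ • S.J y (s y)) : ℝ) = _
    rw [inner_add_right, inner_smul_right, inner_smul_right, h3, h4]
    simp [-Complex.ofReal_cos, -Complex.ofReal_sin]

/-- In a fibre of rank two `s` and `J s` form an orthonormal basis, so the two components of the
frame coordinate recover the vector. -/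
lemma eq_rot_of_frameCoord_eq {θ : ℝ} {x : UnitCircle E}
    (h : S.frameCoord s x = Complex.exp (θ * Complex.I)) :
    x = S.rot θ (unitPoint s hs (base x)) := by
  obtain ⟨⟨y, v⟩, hv⟩ := x
  have h1 := eq_smul_add_smul_rotation (S.J y) (S.J_sq y) (finrank_fibre y) (s y) v (hs y)
  rw [Complex.exp_mul_I, ← Complex.ofReal_cos, ← Complex.ofReal_sin] at h
  have hre : (inner ℝ (s y) v : ℝ) = Real.cos θ := by
    have := congrArg Complex.re h
    simpa [frameCoord, -Complex.ofReal_cos, -Complex.ofReal_sin] using this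
  have him : (inner ℝ (S.J y (s y)) v : ℝ) = Real.sin θ := by
    have := congrArg Complex.im h
    simpa [frameCoord, -Complex.ofReal_cos, -Complex.ofReal_sin] using this
  rw [hre, him] at h1
  apply Subtype.ext
  exact congrArg (fun v => (⟨y, v⟩ : TotalSpace Plane E)) h1

lemma norm_frameCoord {s : Π y, E y} (hs : ∀ y, ‖s y‖ = 1) (x : UnitCircle E) : ‖S.frameCoord s x‖ = 1 := by
  obtain ⟨⟨y, v⟩, hv⟩ := x
  have h1 := eq_smul_add_smul_rotation (S.J y) (S.J_sq y) (finrank_fibre y) (s y) v (hs y)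
  have h2 : (inner ℝ v v : ℝ) = 1 := by
    rw [real_inner_self_eq_norm_sq]
    have : ‖v‖ = 1 := hv
    rw [this]; norm_num
  have h3 : (inner ℝ v v : ℝ) = inner ℝ (s y) v * inner ℝ (s y) v +
      inner ℝ (S.J y (s y)) v * inner ℝ (S.J y (s y)) v := by
    conv_lhs => rw [h1]
    rw [inner_add_left, real_inner_smul_left, real_inner_smul_left]
    simp only [← h1]
  rw [← sq_eq_sq₀ (norm_nonneg _) zero_le_one, ← Complex.normSq_eq_norm_sq, Complex.normSq_apply]
  change inner ℝ (s y) v * inner ℝ (s y) v +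
      inner ℝ (S.J y (s y)) v * inner ℝ (S.J y (s y)) v = (1 : ℝ) ^ 2
  rw [← h3, h2]; norm_num

lemma exists_frameCoord_eq {s : Π y, E y} (hs : ∀ y, ‖s y‖ = 1) (x : UnitCircle E) :
    ∃ θ : ℝ, S.frameCoord s x = Complex.exp (θ * Complex.I) :=
  ⟨Complex.arg (S.frameCoord s x), by
    conv_lhs => rw [← Complex.norm_mul_exp_arg_mul_I (S.frameCoord s x), S.norm_frameCoord hs]
    simp⟩

end

/-- The unit section through `x` measures the angle of every point of the same circle; this angle is
the rotation. -/
lemma exists_rot_eq {x x' : UnitCircle E} (h : base x' = base x) : ∃ θ, S.rot θ x = x' := by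
  obtain ⟨W, s, -, -, hs, hsx, -⟩ := exists_unit_section (n := n) S.exists_unit (base x) x.1.2 x.2
  obtain ⟨θ, hθ⟩ := S.exists_frameCoord_eq hs x'
  refine ⟨θ, ?_⟩
  rw [S.eq_rot_of_frameCoord_eq hs hθ, h]
  congr 1
  apply Subtype.ext
  simp only [unitPoint]
  rw [hsx]
  rfl

lemma circle_surjective (b : B) : Function.Surjective (S.circle b) := by
  rintro ⟨x, hx⟩
  obtain ⟨θ, hθ⟩ := S.exists_rot_eq (x := (S.exists_base b).choose) (x' := x)
    (hx.trans (S.exists_base b).choose_spec.symm)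
  exact ⟨θ, Subtype.ext hθ⟩

section

variable {s : Π y, E y} (hs : ∀ y, ‖s y‖ = 1)

lemma contMDiffAt_frameCoord {x : UnitCircle E} (hsx : SmoothAt n Plane s (base x)) :
    ContMDiffAt (𝓡 (n + 1)) 𝓘(ℝ, ℂ) ∞ (S.frameCoord s) x := by
  have h0 : ContMDiffAt (𝓡 (n + 1)) ((𝓡 n).prod 𝓘(ℝ, Plane)) ∞
      (fun y : UnitCircle E => TotalSpace.mk' Plane y.1.proj y.1.2) x :=
    S.isSmoothEmbedding.contMDiff x
  have h1 : ContMDiffAt (𝓡 (n + 1)) ((𝓡 n).prod 𝓘(ℝ, Plane)) ∞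
      (fun y : UnitCircle E => TotalSpace.mk' Plane y.1.proj (s y.1.proj)) x :=
    ContMDiffAt.comp x hsx (S.contMDiff_base x)
  have h2 : ContMDiffAt (𝓡 (n + 1)) ((𝓡 n).prod 𝓘(ℝ, Plane)) ∞
      (fun y : UnitCircle E => TotalSpace.mk' Plane y.1.proj (S.J _ (s y.1.proj))) x :=
    ContMDiffAt.comp x (S.J_smooth s _ hsx) (S.contMDiff_base x)
  have h3 := h1.inner_bundle h0
  have h4 := h2.inner_bundle h0
  have h5 : ContDiff ℝ ∞ (fun p : ℝ × ℝ => (p.1 : ℂ) + p.2 * Complex.I) := by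
    have := Complex.ofRealCLM.contDiff (n := ∞)
    exact (this.comp contDiff_fst).add ((this.comp contDiff_snd).mul contDiff_const)
  have h6 := (h5.contMDiff _).comp x (h3.prodMk_space h4)
  refine h6.congr_of_eventuallyEq (Eventually.of_forall fun y => ?_)
  apply Complex.ext <;> simp [frameCoord]

/-- The parametrization of the circle bundle given by a chart of the base and a unit section. -/
def localParam (b : B) (p : Coord n × ℝ) : UnitCircle E :=
  S.rot p.2 (unitPoint s hs ((extChartAt (𝓡 n) b).symm p.1))

lemma contMDiffAt_localParam_val (b : B) (p : Coord n × ℝ) (hp : p.1 ∈ (extChartAt (𝓡 n) b).target)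
    (hsp : SmoothAt n Plane s ((extChartAt (𝓡 n) b).symm p.1)) :
    ContMDiffAt 𝓘(ℝ, Coord n × ℝ) ((𝓡 n).prod 𝓘(ℝ, Plane)) ∞
      (fun q => (S.localParam hs b q).1) p := by
  have h0 : ContMDiffAt 𝓘(ℝ, Coord n × ℝ) (𝓡 n) ∞
      (fun q : Coord n × ℝ => (extChartAt (𝓡 n) b).symm q.1) p := by
    have h1 : ContMDiffAt 𝓘(ℝ, Coord n) (𝓡 n) ∞ (extChartAt (𝓡 n) b).symm p.1 :=
      (contMDiffOn_extChartAt_symm b).contMDiffAt (extChartAt_target_mem_nhds' hp)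
    exact h1.comp p contDiff_fst.contMDiff.contMDiffAt
  exact contMDiffAt_smul_add_smul (p := fun q : Coord n × ℝ => (extChartAt (𝓡 n) b).symm q.1)
    (v := fun q => s _) (w := fun q => S.J _ (s _)) (c := fun q => Real.cos q.2)
    (d := fun q => Real.sin q.2)
    (ContMDiffAt.comp p hsp h0) (ContMDiffAt.comp p (S.J_smooth s _ hsp) h0)
    (Real.contDiff_cos.comp contDiff_snd).contMDiff.contMDiffAt
    (Real.contDiff_sin.comp contDiff_snd).contMDiff.contMDiffAt

/-- A continuous map to an immersed manifold is smooth as soon as it is smooth into the ambient one;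
the topological embedding supplies the continuity. -/
lemma contMDiffAt_localParam (b : B) (p : Coord n × ℝ) (hp : p.1 ∈ (extChartAt (𝓡 n) b).target)
    (hsp : SmoothAt n Plane s ((extChartAt (𝓡 n) b).symm p.1)) :
    ContMDiffAt 𝓘(ℝ, Coord n × ℝ) (𝓡 (n + 1)) ∞ (S.localParam hs b) p := by
  have h := S.contMDiffAt_localParam_val hs b p hp hsp
  rw [ContMDiffAt.iff_comp_isImmersionAt
    (S.isSmoothEmbedding.isImmersion.isImmersionAt (S.localParam hs b p))]
  exact ⟨S.isSmoothEmbedding.isEmbedding.continuousAt_iff.mpr h.continuousAt, h⟩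

end

end Setting
end Geometry
end CircleEta
end

noncomputable section

namespace CircleEta

section Geometry

variable {n : ℕ} {B : Type*} [TopologicalSpace B] [ChartedSpace (Coord n) B]
  [IsManifold (𝓡 n) ∞ B]
  {E : B → Type*} [TopologicalSpace (TotalSpace Plane E)] [∀ b, NormedAddCommGroup (E b)]
  [∀ b, InnerProductSpace ℝ (E b)] [FiberBundle Plane E] [VectorBundle ℝ Plane E]
  [ContMDiffVectorBundle ∞ Plane E (𝓡 n)] [IsContMDiffRiemannianBundle (𝓡 n) ∞ Plane E]
  [ChartedSpace (Coord (n + 1)) (UnitCircle E)] [IsManifold (𝓡 (n + 1)) ∞ (UnitCircle E)]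
  {V : UnitCircle E → Type*} [TopologicalSpace (TotalSpace ℂ V)] [∀ x, NormedAddCommGroup (V x)]
  [∀ x, InnerProductSpace ℂ (V x)] [FiberBundle ℂ V] [VectorBundle ℝ ℂ V]
  [ContMDiffVectorBundle ∞ ℂ V (𝓡 (n + 1))]

namespace Setting

variable (S : Setting (n := n) E V)

/-! ### The connection form of a unit section -/

/-- The connection form `⟨J s, ∇ s⟩` of a unit section `s` of `E`. -/
def connForm (s : Π y, E y) (y : B) (X : TangentSpace (𝓡 n) y) : ℝ :=
  inner ℝ (S.J y (s y)) (S.connE s y X)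

lemma mvfderiv_inner {σ τ : Π y, E y} {y : B} (hσ : SmoothAt n Plane σ y)
    (hτ : SmoothAt n Plane τ y) (X : TangentSpace (𝓡 n) y) :
    mvfderiv (𝓡 n) (fun z => (inner ℝ (σ z) (τ z) : ℝ)) y X =
      inner ℝ (S.connE σ y X) (τ y) + inner ℝ (σ y) (S.connE τ y X) :=
  S.connE_metric.mvfderiv_inner_eq (fun _ => (X : Coord n)) (hσ.mdifferentiableAt (by simp))
    (hτ.mdifferentiableAt (by simp))

section

variable {s : Π y, E y} (hs : ∀ y, ‖s y‖ = 1) {y : B} (hsy : SmoothAt n Plane s y)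

/-- Differentiating `|s|² = 1` kills the component of `∇ s` along `s`, and in a plane only the
component along `J s` is left. -/
lemma covariantDerivative_unit (hs : ∀ y, ‖s y‖ = 1) (hsy : SmoothAt n Plane s y)
    (X : TangentSpace (𝓡 n) y) : S.connE s y X = S.connForm s y X • S.J y (s y) := by
  have h := S.mvfderiv_inner hsy hsy X
  have h1 : (fun z => (inner ℝ (s z) (s z) : ℝ)) = fun _ => 1 := by
    funext z
    rw [real_inner_self_eq_norm_sq, hs]; norm_num
  rw [h1, mvfderiv_const, real_inner_comm (s y)] at h
  have h2 : (inner ℝ (s y) (S.connE s y X) : ℝ) = 0 := by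
    simp only [zero_apply] at h
    linarith
  have h3 := eq_smul_add_smul_rotation (S.J y) (S.J_sq y) (finrank_fibre y) (s y) (S.connE s y X)
    (hs y)
  rw [h2, zero_smul, zero_add] at h3
  exact h3

/-- Differentiating `⟨s, J s⟩ = 0` shows that `J s` has the same connection form as `s`. In effect
`J` is parallel, which is automatic in rank two and is not assumed in `Setting`. -/
lemma covariantDerivative_rotation_unit (hs : ∀ y, ‖s y‖ = 1) (hsy : SmoothAt n Plane s y)
    (X : TangentSpace (𝓡 n) y) :
    S.connE (fun z => S.J z (s z)) y X = -(S.connForm s y X • s y) := by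
  have hJs : ∀ z, ‖S.J z (s z)‖ = 1 := fun z => by rw [LinearIsometry.norm_map, hs]
  have hJsy := S.J_smooth s y hsy
  have h := S.mvfderiv_inner hsy hJsy X
  have h1 : (fun z => (inner ℝ (s z) (S.J z (s z)) : ℝ)) = fun _ => 0 := by
    funext z
    exact inner_rotation_self (S.J z) (S.J_sq z) (s z)
  rw [h1, mvfderiv_const, real_inner_comm (S.J y (s y))] at h
  simp only [zero_apply] at h
  have h2 : (inner ℝ (s y) (S.connE (fun z => S.J z (s z)) y X) : ℝ) = -S.connForm s y X := by
    rw [connForm]; linarith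
  have h3 := S.covariantDerivative_unit hJs hJsy X
  rw [S.J_sq] at h3
  have h4 : (inner ℝ (s y) (s y) : ℝ) = 1 := by rw [real_inner_self_eq_norm_sq, hs]; norm_num
  rw [h3, inner_smul_right, inner_neg_right, h4] at h2
  rw [h3]
  have h5 : S.connForm (fun z => S.J z (s z)) y X = S.connForm s y X := by linarith
  rw [h5, smul_neg]

lemma connForm_add (X Y : TangentSpace (𝓡 n) y) :
    S.connForm s y (X + Y) = S.connForm s y X + S.connForm s y Y := by
  simp [connForm, inner_add_right]

lemma connForm_smul (c : ℝ) (X : TangentSpace (𝓡 n) y) :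
    S.connForm s y (c • X) = c * S.connForm s y X := by
  simp [connForm, inner_smul_right]

/-- The connection form as a linear map. -/
def connFormₗ (s : Π y, E y) (y : B) : TangentSpace (𝓡 n) y →ₗ[ℝ] ℝ where
  toFun := S.connForm s y
  map_add' := S.connForm_add
  map_smul' := S.connForm_smul

end

/-! ### Coordinate fields -/

lemma mem_baseSet_of_mem_chartDomain {b y : B} (hy : y ∈ chartDomain (n := n) b) :
    y ∈ (trivializationAt (Coord n) (TangentSpace (𝓡 n)) b).baseSet := by
  rw [TangentBundle.trivializationAt_baseSet]
  exact hy

lemma chart_coordField {b y : B} (hy : y ∈ chartDomain (n := n) b) (i : Fin n) :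
    mfderiv (𝓡 n) 𝓘(ℝ, Coord n) (extChartAt (𝓡 n) b) y (coordField b i y) = stdVec i := by
  rw [← TangentBundle.continuousLinearMapAt_trivializationAt hy]
  exact (trivializationAt (Coord n) (TangentSpace (𝓡 n)) b).continuousLinearMapAt_symmL (R := ℝ)
    (mem_baseSet_of_mem_chartDomain hy) (stdVec i)

lemma eq_of_chart_eq {b y : B} (hy : y ∈ chartDomain (n := n) b) {X Y : TangentSpace (𝓡 n) y}
    (h : mfderiv (𝓡 n) 𝓘(ℝ, Coord n) (extChartAt (𝓡 n) b) y X =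
      mfderiv (𝓡 n) 𝓘(ℝ, Coord n) (extChartAt (𝓡 n) b) y Y) : X = Y := by
  rw [← TangentBundle.continuousLinearMapAt_trivializationAt hy] at h
  have h1 := (trivializationAt (Coord n) (TangentSpace (𝓡 n)) b).symmL_continuousLinearMapAt
    (R := ℝ) (mem_baseSet_of_mem_chartDomain hy)
  have h2 := congrArg ((trivializationAt (Coord n) (TangentSpace (𝓡 n)) b).symmL ℝ y) h
  exact (h1 X).symm.trans (h2.trans (h1 Y))

lemma eq_sum_coordField {b y : B} (hy : y ∈ chartDomain (n := n) b) (X : TangentSpace (𝓡 n) y) :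
    X = ∑ i, (show Coord n from mfderiv (𝓡 n) 𝓘(ℝ, Coord n) (extChartAt (𝓡 n) b) y X) i •
      (coordField b i y : TangentSpace (𝓡 n) y) := by
  apply eq_of_chart_eq hy
  rw [map_sum]
  simp_rw [map_smul, chart_coordField hy]
  set v : Coord n := mfderiv (𝓡 n) 𝓘(ℝ, Coord n) (extChartAt (𝓡 n) b) y X
  have := (EuclideanSpace.basisFun (Fin n) ℝ).sum_repr v
  simp only [EuclideanSpace.basisFun_repr, EuclideanSpace.basisFun_apply] at this
  exact this.symm

lemma connForm_eq_sum {b y : B} (hy : y ∈ chartDomain (n := n) b) (s : Π y, E y)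
    (X : TangentSpace (𝓡 n) y) :
    S.connForm s y X = ∑ i, S.connForm s y (coordField b i y) *
      (show Coord n from mfderiv (𝓡 n) 𝓘(ℝ, Coord n) (extChartAt (𝓡 n) b) y X) i := by
  conv_lhs => rw [eq_sum_coordField hy X]
  change S.connFormₗ s y _ = _
  rw [map_sum]
  refine Finset.sum_congr rfl fun i _ => ?_
  rw [map_smul, smul_eq_mul, mul_comm]
  rfl

lemma contMDiffAt_coordField {b y : B} (hy : y ∈ chartDomain (n := n) b) (i : Fin n) :
    ContMDiffAt (𝓡 n) ((𝓡 n).prod 𝓘(ℝ, Coord n)) ∞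
      (fun z => TotalSpace.mk' (Coord n) z (coordField b i z : TangentSpace (𝓡 n) z)) y := by
  have hy' : y ∈ (trivializationAt (Coord n) (TangentSpace (𝓡 n)) b).baseSet :=
    mem_baseSet_of_mem_chartDomain hy
  rw [(trivializationAt (Coord n) (TangentSpace (𝓡 n)) b).contMDiffAt_section_iff hy']
  refine (contMDiffAt_const (c := stdVec i)).congr_of_eventuallyEq ?_
  filter_upwards [(trivializationAt (Coord n) (TangentSpace (𝓡 n)) b).open_baseSet.mem_nhds hy']
    with z hz
  have h := (trivializationAt (Coord n) (TangentSpace (𝓡 n)) b).apply_mk_symm hz (stdVec i)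
  simp only [coordField]
  rw [Trivialization.symmL_apply _ hz]
  exact congrArg Prod.snd h

lemma contMDiffAt_connForm [T2Space B] {b y : B} {s : Π y, E y} {W : Set B} (hW : IsOpen W)
    (hs : ∀ z ∈ W, SmoothAt n Plane s z) (hy : y ∈ chartDomain (n := n) b) (hyW : y ∈ W)
    (i : Fin n) :
    ContMDiffAt (𝓡 n) 𝓘(ℝ, ℝ) ∞ (fun z => S.connForm s z (coordField b i z)) y := by
  obtain ⟨χ, hχ, hχW, hχ1⟩ := exists_smooth_cutoff (n := n) (hW.mem_nhds hyW)
  have h1 := contMDiffAt_covariantDerivative S.connE S.connE_smooth hW hs hχ hχW hyW hχ1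
  have h2 := h1.clm_bundle_apply (contMDiffAt_coordField hy i)
  exact (S.J_smooth s y (hs y hyW)).inner_bundle h2

end Setting
end Geometry
end CircleEta
end

noncomputable section

namespace CircleEta

section Geometry

variable {n : ℕ} {B : Type*} [TopologicalSpace B] [ChartedSpace (Coord n) B]
  [IsManifold (𝓡 n) ∞ B]
  {E : B → Type*} [TopologicalSpace (TotalSpace Plane E)] [∀ b, NormedAddCommGroup (E b)]
  [∀ b, InnerProductSpace ℝ (E b)] [FiberBundle Plane E] [VectorBundle ℝ Plane E]
  [ContMDiffVectorBundle ∞ Plane E (𝓡 n)] [IsContMDiffRiemannianBundle (𝓡 n) ∞ Plane E]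
  [ChartedSpace (Coord (n + 1)) (UnitCircle E)] [IsManifold (𝓡 (n + 1)) ∞ (UnitCircle E)]
  {V : UnitCircle E → Type*} [TopologicalSpace (TotalSpace ℂ V)] [∀ x, NormedAddCommGroup (V x)]
  [∀ x, InnerProductSpace ℂ (V x)] [FiberBundle ℂ V] [VectorBundle ℝ ℂ V]
  [ContMDiffVectorBundle ∞ ℂ V (𝓡 (n + 1))]

namespace Setting

variable (S : Setting (n := n) E V)

/-! ### Local coordinates of the circle bundle -/

/-- The coordinates of `M` given by the chart of `B` at `b` and the angle to a unit section `s`,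
with values near `θ₀`. -/
def localCoord (s : Π y, E y) (b : B) (θ₀ : ℝ) (x : UnitCircle E) : Coord n × ℝ :=
  (extChartAt (𝓡 n) b (base x),
    Complex.arg (S.frameCoord s x * Complex.exp (-θ₀ * Complex.I)) + θ₀)

/-- A domain of the coordinates `localCoord`. -/
def localDomain (s : Π y, E y) (W : Set B) (θ₀ : ℝ) : Set (UnitCircle E) :=
  base ⁻¹' W ∩ {x | S.frameCoord s x * Complex.exp (-θ₀ * Complex.I) ∈ Complex.slitPlane}

/-- `s` is a unit section of `E` which is smooth over the open subset `W` of the domain of the chart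
at `b`. -/
structure IsLocalFrame (_ : Setting (n := n) E V) (b : B) (W : Set B) (s : Π y, E y) : Prop where
  isOpen : IsOpen W
  subset : W ⊆ chartDomain (n := n) b
  norm_eq : ∀ y, ‖s y‖ = 1
  smooth : ∀ y ∈ W, SmoothAt n Plane s y

lemma exists_isLocalFrame {b : B} (x : UnitCircle E) (hx : base x ∈ chartDomain (n := n) b) :
    ∃ W s, S.IsLocalFrame b W s ∧ base x ∈ W ∧ s (base x) = x.1.2 := by
  obtain ⟨W, s, hW, hxW, hs, hsx, hsW⟩ :=
    exists_unit_section (n := n) S.exists_unit (base x) x.1.2 x.2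
  exact ⟨W ∩ chartDomain (n := n) b, s, ⟨hW.inter (chartAt (Coord n) b).open_source,
    Set.inter_subset_right, hs, fun y hy => hsW y hy.1⟩, ⟨hxW, hx⟩, hsx⟩

namespace IsLocalFrame

variable {S} {b : B} {W : Set B} {s : Π y, E y} (h : S.IsLocalFrame b W s) {θ₀ : ℝ}
  {x : UnitCircle E}
include h

lemma isOpen_localDomain : IsOpen (S.localDomain s W θ₀) := by
  have h1 : ContinuousOn (fun x => S.frameCoord s x * Complex.exp (-θ₀ * Complex.I))
      (base ⁻¹' W) := fun x hx =>
    ((S.contMDiffAt_frameCoord (h.smooth _ hx)).continuousAt.mul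
      continuousAt_const).continuousWithinAt
  exact h1.isOpen_inter_preimage (h.isOpen.preimage S.continuous_base) Complex.isOpen_slitPlane

/-- The shifted coordinate has modulus one, so it is recovered from its argument. This holds at
every point, also where the argument is discontinuous. -/
lemma frameCoord_eq (x : UnitCircle E) :
    S.frameCoord s x = Complex.exp ((S.localCoord s b θ₀ x).2 * Complex.I) := by
  have h1 := Complex.norm_mul_exp_arg_mul_I (S.frameCoord s x * Complex.exp (-θ₀ * Complex.I))
  have h2 : ‖Complex.exp (-θ₀ * Complex.I)‖ = 1 := by
    rw [← Complex.ofReal_neg, Complex.norm_exp_ofReal_mul_I]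
  rw [norm_mul, S.norm_frameCoord h.norm_eq, h2, mul_one, Complex.ofReal_one, one_mul] at h1
  simp only [localCoord]
  rw [Complex.ofReal_add, add_mul, Complex.exp_add, h1, mul_assoc, ← Complex.exp_add]
  simp

lemma rot_unitPoint (x : UnitCircle E) :
    S.rot (S.localCoord s b θ₀ x).2 (unitPoint s h.norm_eq (base x)) = x :=
  (S.eq_rot_of_frameCoord_eq h.norm_eq (h.frameCoord_eq x)).symm

lemma localParam_localCoord (hx : base x ∈ W) :
    S.localParam h.norm_eq b (S.localCoord s b θ₀ x) = x := by
  have h1 : (extChartAt (𝓡 n) b).symm (extChartAt (𝓡 n) b (base x)) = base x :=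
    (extChartAt (𝓡 n) b).left_inv (by rw [extChartAt_source]; exact h.subset hx)
  simp only [localParam]
  conv_rhs => rw [← h.rot_unitPoint (θ₀ := θ₀) x]
  simp only [localCoord]
  rw [h1]

lemma localCoord_fst_mem (hx : base x ∈ W) :
    (S.localCoord s b θ₀ x).1 ∈ (extChartAt (𝓡 n) b).target :=
  (extChartAt (𝓡 n) b).map_source (by rw [extChartAt_source]; exact h.subset hx)

/-- Off the slit the argument is strictly less than `π`, so nearby angles stay in `(θ₀ - π, θ₀ +
π)`, where the argument inverts the exponential. -/
lemma eventually_localCoord_localParam (hx : x ∈ S.localDomain s W θ₀) :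
    ∀ᶠ q in 𝓝 (S.localCoord s b θ₀ x), S.localCoord s b θ₀ (S.localParam h.norm_eq b q) = q := by
  have h1 : ∀ᶠ q : Coord n × ℝ in 𝓝 (S.localCoord s b θ₀ x),
      q.1 ∈ (extChartAt (𝓡 n) b).target :=
    continuousAt_fst.eventually_mem (extChartAt_target_mem_nhds' (h.localCoord_fst_mem hx.1))
  have h2 : ∀ᶠ q : Coord n × ℝ in 𝓝 (S.localCoord s b θ₀ x),
      q.2 - θ₀ ∈ Set.Ioo (-Real.pi) Real.pi := by
    have h3 : ContinuousAt (fun q : Coord n × ℝ => q.2 - θ₀) (S.localCoord s b θ₀ x) := by fun_prop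
    refine h3.eventually_mem (isOpen_Ioo.mem_nhds ?_)
    simp only [localCoord, add_sub_cancel_right]
    exact ⟨Complex.neg_pi_lt_arg _, lt_of_le_of_ne (Complex.arg_le_pi _)
      (Complex.mem_slitPlane_iff_arg.mp hx.2).1⟩
  filter_upwards [h1, h2] with q hq1 hq2
  have h4 : Complex.arg (Complex.exp (q.2 * Complex.I) * Complex.exp (-θ₀ * Complex.I)) + θ₀ =
      q.2 := by
    have h5 : Complex.exp (q.2 * Complex.I) * Complex.exp (-θ₀ * Complex.I) =
        Complex.exp ((q.2 - θ₀ : ℝ) * Complex.I) := by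
      rw [← Complex.exp_add]; congr 1; push_cast; ring
    rw [h5, ← Complex.log_im, Complex.log_exp] <;> simp
    · linarith [hq2.1]
    · linarith [hq2.2]
  simp only [localParam, localCoord, frameCoord_rot_unitPoint, base_rot]
  rw [h4]
  exact Prod.ext ((extChartAt (𝓡 n) b).right_inv hq1) rfl

lemma contMDiffAt_localCoord (hx : x ∈ S.localDomain s W θ₀) :
    ContMDiffAt (𝓡 (n + 1)) 𝓘(ℝ, Coord n × ℝ) ∞ (S.localCoord s b θ₀) x := by
  have h1 : ContMDiffAt (𝓡 (n + 1)) 𝓘(ℝ, Coord n) ∞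
      (fun y : UnitCircle E => extChartAt (𝓡 n) b (base y)) x :=
    (contMDiffAt_extChartAt' (h.subset hx.1)).comp x (S.contMDiff_base x)
  have h2 : ContDiffAt ℝ ∞ (fun z : ℂ => Complex.arg (z * Complex.exp (-θ₀ * Complex.I)) + θ₀)
      (S.frameCoord s x) := by
    have h3 : ContDiffAt ℝ ∞ Complex.log (S.frameCoord s x * Complex.exp (-θ₀ * Complex.I)) :=
      (Complex.contDiffAt_log hx.2).restrict_scalars ℝ
    have h4 : ContDiffAt ℝ ∞ (fun z : ℂ => z * Complex.exp (-θ₀ * Complex.I))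
      (S.frameCoord s x) := contDiffAt_id.mul contDiffAt_const
    have h5 := ContDiffAt.comp (g := Complex.log) (S.frameCoord s x) h3 h4
    have h6 := (Complex.imCLM.contDiff.contDiffAt.comp _ h5).add
      (contDiffAt_const (c := θ₀))
    refine h6.congr_of_eventuallyEq (Eventually.of_forall fun z => ?_)
    simp [Complex.log_im]
  exact h1.prodMk_space (h2.contMDiffAt.comp x (S.contMDiffAt_frameCoord (h.smooth _ hx.1)))

lemma contMDiffAt_param (hx : x ∈ S.localDomain s W θ₀) :
    ContMDiffAt 𝓘(ℝ, Coord n × ℝ) (𝓡 (n + 1)) ∞ (S.localParam h.norm_eq b)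
      (S.localCoord s b θ₀ x) := by
  refine S.contMDiffAt_localParam h.norm_eq b _ (h.localCoord_fst_mem hx.1) ?_
  have h1 : (extChartAt (𝓡 n) b).symm (extChartAt (𝓡 n) b (base x)) = base x :=
    (extChartAt (𝓡 n) b).left_inv (by rw [extChartAt_source]; exact h.subset hx.1)
  rw [localCoord, h1]
  exact h.smooth _ hx.1

/-- The differential of `localParam` at the coordinates of a point `x`, as a map to `T_x M`. -/
lemma exists_hasMFDerivAt_param (hx : x ∈ S.localDomain s W θ₀) :
    ∃ G : (Coord n × ℝ) ≃L[ℝ] TangentSpace (𝓡 (n + 1)) x,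
      HasMFDerivAt (𝓡 (n + 1)) 𝓘(ℝ, Coord n × ℝ) (S.localCoord s b θ₀) x
        (G.symm : TangentSpace (𝓡 (n + 1)) x →L[ℝ] Coord n × ℝ) ∧
      HasMFDerivAt 𝓘(ℝ, Coord n × ℝ) (𝓡 (n + 1)) (S.localParam h.norm_eq b)
        (S.localCoord s b θ₀ x) (show (Coord n × ℝ) →L[ℝ] Coord (n + 1) from
          (G : (Coord n × ℝ) →L[ℝ] TangentSpace (𝓡 (n + 1)) x)) := by
  have hF := ((h.contMDiffAt_localCoord hx).mdifferentiableAt (by simp)).hasMFDerivAt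
  have hG := ((h.contMDiffAt_param hx).mdifferentiableAt (by simp)).hasMFDerivAt
  have hGF := h.localParam_localCoord (θ₀ := θ₀) hx.1
  -- The point `localParam (localCoord x)` equals `x`, but not by definition, so the differential
  -- `F''` of the coordinates there is kept apart from the differential `F'` at `x`.
  have hF2 : MDifferentiableAt (𝓡 (n + 1)) 𝓘(ℝ, Coord n × ℝ) (S.localCoord s b θ₀)
      (S.localParam h.norm_eq b (S.localCoord s b θ₀ x)) := by
    rw [hGF]
    exact (h.contMDiffAt_localCoord hx).mdifferentiableAt (by simp)
  have hF2 := hF2.hasMFDerivAt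
  set F' : Coord (n + 1) →L[ℝ] Coord n × ℝ :=
    mfderiv (𝓡 (n + 1)) 𝓘(ℝ, Coord n × ℝ) (S.localCoord s b θ₀) x with hF'
  set F'' : Coord (n + 1) →L[ℝ] Coord n × ℝ :=
    mfderiv (𝓡 (n + 1)) 𝓘(ℝ, Coord n × ℝ) (S.localCoord s b θ₀)
      (S.localParam h.norm_eq b (S.localCoord s b θ₀ x)) with hF''
  set G' : Coord n × ℝ →L[ℝ] Coord (n + 1) :=
    mfderiv 𝓘(ℝ, Coord n × ℝ) (𝓡 (n + 1)) (S.localParam h.norm_eq b) (S.localCoord s b θ₀ x)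
    with hG'
  have e1 : G'.comp F' = ContinuousLinearMap.id ℝ (Coord (n + 1)) := by
    have h1 : HasMFDerivAt (𝓡 (n + 1)) (𝓡 (n + 1)) (S.localParam h.norm_eq b ∘ S.localCoord s b θ₀)
      x (G'.comp F') := HasMFDerivAt.comp x hG hF
    have h2 : HasMFDerivAt (𝓡 (n + 1)) (𝓡 (n + 1)) (S.localParam h.norm_eq b ∘ S.localCoord s b θ₀)
        x (ContinuousLinearMap.id ℝ (Coord (n + 1))) := by
      refine (hasMFDerivAt_id x).congr_of_eventuallyEq ?_
      filter_upwards [(h.isOpen.preimage S.continuous_base).mem_nhds hx.1] with y hy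
      exact h.localParam_localCoord hy
    exact hasMFDerivAt_unique h1 h2
  have e2 : F''.comp G' = ContinuousLinearMap.id ℝ (Coord n × ℝ) := by
    have h1 : HasMFDerivAt 𝓘(ℝ, Coord n × ℝ) 𝓘(ℝ, Coord n × ℝ)
      (S.localCoord s b θ₀ ∘ S.localParam h.norm_eq b) (S.localCoord s b θ₀ x)
      (F''.comp G') := HasMFDerivAt.comp _ hF2 hG
    have h2 : HasMFDerivAt 𝓘(ℝ, Coord n × ℝ) 𝓘(ℝ, Coord n × ℝ)
      (S.localCoord s b θ₀ ∘ S.localParam h.norm_eq b) (S.localCoord s b θ₀ x)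
        (ContinuousLinearMap.id ℝ (Coord n × ℝ)) :=
      (hasMFDerivAt_id _).congr_of_eventuallyEq (h.eventually_localCoord_localParam hx)
    exact hasMFDerivAt_unique h1 h2
  have e1' : ∀ v, G' (F' v) = v := fun v => DFunLike.congr_fun e1 v
  have e2' : ∀ v, F'' (G' v) = v := fun v => DFunLike.congr_fun e2 v
  -- `F'` is a right inverse and `F''` a left inverse of `G'`, so the two agree.
  have e3 : ∀ v, F' (G' v) = v := fun v => by
    rw [← e2' (F' (G' v)), e1', e2']
  refine ⟨ContinuousLinearEquiv.equivOfInverse G' F' e3 e1', ?_, ?_⟩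
  · exact hF
  · exact hG

end IsLocalFrame

end Setting
end Geometry
end CircleEta
end

noncomputable section

namespace CircleEta

section Geometry

variable {n : ℕ} {B : Type*} [TopologicalSpace B] [ChartedSpace (Coord n) B]
  [IsManifold (𝓡 n) ∞ B]
  {E : B → Type*} [TopologicalSpace (TotalSpace Plane E)] [∀ b, NormedAddCommGroup (E b)]
  [∀ b, InnerProductSpace ℝ (E b)] [FiberBundle Plane E] [VectorBundle ℝ Plane E]
  [ContMDiffVectorBundle ∞ Plane E (𝓡 n)] [IsContMDiffRiemannianBundle (𝓡 n) ∞ Plane E]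
  [ChartedSpace (Coord (n + 1)) (UnitCircle E)] [IsManifold (𝓡 (n + 1)) ∞ (UnitCircle E)]
  {V : UnitCircle E → Type*} [TopologicalSpace (TotalSpace ℂ V)] [∀ x, NormedAddCommGroup (V x)]
  [∀ x, InnerProductSpace ℂ (V x)] [FiberBundle ℂ V] [VectorBundle ℝ ℂ V]
  [ContMDiffVectorBundle ∞ ℂ V (𝓡 (n + 1))]

namespace Setting

variable (S : Setting (n := n) E V)

/-! ### Horizontal vectors in local coordinates -/

namespace IsLocalFrame

variable {S} {b : B} {W : Set B} {s : Π y, E y} (h : S.IsLocalFrame b W s) {θ₀ : ℝ}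
  {x : UnitCircle E}
include h

lemma fst_hasMFDerivAt (hx : x ∈ S.localDomain s W θ₀)
    {F' : TangentSpace (𝓡 (n + 1)) x →L[ℝ] Coord n × ℝ}
    (hF : HasMFDerivAt (𝓡 (n + 1)) 𝓘(ℝ, Coord n × ℝ) (S.localCoord s b θ₀) x F')
    (w : TangentSpace (𝓡 (n + 1)) x) :
    (F' w).1 = mfderiv (𝓡 n) 𝓘(ℝ, Coord n) (extChartAt (𝓡 n) b) (base x) (dbase (n := n) x w) := by
  have h1 : HasMFDerivAt (𝓡 (n + 1)) 𝓘(ℝ, Coord n) (fun y => (S.localCoord s b θ₀ y).1) x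
      ((ContinuousLinearMap.fst ℝ (Coord n) ℝ).comp F') :=
    HasMFDerivAt.comp x (ContinuousLinearMap.fst ℝ (Coord n) ℝ).hasFDerivAt.hasMFDerivAt hF
  have h2 : HasMFDerivAt (𝓡 (n + 1)) 𝓘(ℝ, Coord n)
      (extChartAt (𝓡 n) b ∘ (base : UnitCircle E → B)) x
      ((mfderiv (𝓡 n) 𝓘(ℝ, Coord n) (extChartAt (𝓡 n) b) (base x)).comp (dbase (n := n) x)) :=
    HasMFDerivAt.comp x (mdifferentiableAt_extChartAt (h.subset hx.1)).hasMFDerivAt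
      ((S.contMDiff_base x).mdifferentiableAt (by simp)).hasMFDerivAt
  exact DFunLike.congr_fun (hasMFDerivAt_unique h1 h2) w

/-- Rotation by `θ` adds `θ` to the angle coordinate and fixes the base point. -/
lemma e_eq (hx : x ∈ S.localDomain s W θ₀)
    {G' : (Coord n × ℝ) →L[ℝ] Coord (n + 1)}
    (hG : HasMFDerivAt 𝓘(ℝ, Coord n × ℝ) (𝓡 (n + 1)) (S.localParam h.norm_eq b)
        (S.localCoord s b θ₀ x) G') : S.e x = G' (0, 1) := by
  have h1 : (extChartAt (𝓡 n) b).symm (extChartAt (𝓡 n) b (base x)) = base x :=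
    (extChartAt (𝓡 n) b).left_inv (by rw [extChartAt_source]; exact h.subset hx.1)
  have h2 : (fun θ : ℝ => S.rot θ x) = S.localParam h.norm_eq b ∘
      (fun θ : ℝ => S.localCoord s b θ₀ x + ((0 : Coord n), θ)) := by
    funext θ
    have h3 : (S.localCoord s b θ₀ x + ((0 : Coord n), θ)).1 = extChartAt (𝓡 n) b (base x) := by
      simp [localCoord]
    simp only [Function.comp, localParam]
    rw [h3, h1]
    conv_lhs => rw [← h.rot_unitPoint (θ₀ := θ₀) x]
    rw [S.rot_rot, add_comm]
    rfl
  have h4 : HasFDerivAt (fun θ : ℝ => S.localCoord s b θ₀ x + ((0 : Coord n), θ))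
      (ContinuousLinearMap.inr ℝ (Coord n) ℝ) 0 :=
    (ContinuousLinearMap.inr ℝ (Coord n) ℝ).hasFDerivAt.const_add _
  have h5 : S.localCoord s b θ₀ x + ((0 : Coord n), (0 : ℝ)) = S.localCoord s b θ₀ x := by
    rw [← Prod.zero_eq_mk, add_zero]
  have hG2 : HasMFDerivAt 𝓘(ℝ, Coord n × ℝ) (𝓡 (n + 1)) (S.localParam h.norm_eq b)
        (S.localCoord s b θ₀ x + ((0 : Coord n), (0 : ℝ))) G' := by rw [h5]; exact hG
  have h6 := HasMFDerivAt.comp (0 : ℝ) hG2 h4.hasMFDerivAt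
  rw [← h2] at h6
  rw [e, h6.mfderiv]
  rfl

lemma hasMFDerivAt_angle {F' : TangentSpace (𝓡 (n + 1)) x →L[ℝ] Coord n × ℝ}
    (hF : HasMFDerivAt (𝓡 (n + 1)) 𝓘(ℝ, Coord n × ℝ) (S.localCoord s b θ₀) x F') {g : ℝ → ℝ}
    {g' : ℝ} (hg : HasDerivAt g g' (S.localCoord s b θ₀ x).2) :
    HasMFDerivAt (𝓡 (n + 1)) 𝓘(ℝ, ℝ) (fun y => g (S.localCoord s b θ₀ y).2) x
      (g' • (ContinuousLinearMap.snd ℝ (Coord n) ℝ).comp F') := by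
  have h1 : HasFDerivAt (fun q : Coord n × ℝ => g q.2)
      (g' • (ContinuousLinearMap.snd ℝ (Coord n) ℝ)) (S.localCoord s b θ₀ x) :=
    hg.comp_hasFDerivAt _ (ContinuousLinearMap.snd ℝ (Coord n) ℝ).hasFDerivAt
  exact HasMFDerivAt.comp x h1.hasMFDerivAt hF

/-- A horizontal vector `w` is tangent to a section `s'` with `∇ s' = 0` in its direction. Hence for
a section `u` of `E` the function `⟨u, x⟩` on `M` changes along `w` only through `∇ u`. For `u = s`
and `u = J s` these functions are `cos θ` and `sin θ`, and the derivatives of the frame are given by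
the connection form. -/
lemma snd_of_isHorizontal (hx : x ∈ S.localDomain s W θ₀)
    {F' : TangentSpace (𝓡 (n + 1)) x →L[ℝ] Coord n × ℝ}
    (hF : HasMFDerivAt (𝓡 (n + 1)) 𝓘(ℝ, Coord n × ℝ) (S.localCoord s b θ₀) x F')
    {w : TangentSpace (𝓡 (n + 1)) x} (hw : S.IsHorizontal x w) :
    (F' w).2 = -S.connForm s (base x) (dbase (n := n) x w) := by
  obtain ⟨s', hs', hs'x, hcov, hdw⟩ := hw
  -- Since `w` and `s'` have the same tangent vector in `E`, the derivative along `w` is that of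
  -- `⟨u, s'⟩` on `B`; metric compatibility and `∇ s' = 0` evaluate it.
  have key : ∀ u : Π y, E y, SmoothAt n Plane u (base x) →
      mfderiv (𝓡 (n + 1)) 𝓘(ℝ, ℝ) (fun y : UnitCircle E => (inner ℝ (u y.1.proj) y.1.2 : ℝ)) x w =
        (inner ℝ (S.connE u (base x) (dbase (n := n) x w)) x.1.2 : ℝ) := by
    intro u hu
    obtain ⟨⟨y, v⟩, hv⟩ := x
    change s' y = v at hs'x
    subst hs'x
    have hq : MDifferentiableAt ((𝓡 n).prod 𝓘(ℝ, Plane)) 𝓘(ℝ, ℝ)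
        (fun p : TotalSpace Plane E => (inner ℝ (u p.proj) p.2 : ℝ)) (TotalSpace.mk' Plane y (s' y)) := by
      have h1 : ContMDiffAt ((𝓡 n).prod 𝓘(ℝ, Plane)) ((𝓡 n).prod 𝓘(ℝ, Plane)) ∞
          (fun p : TotalSpace Plane E => TotalSpace.mk' Plane p.proj (u p.proj))
          (TotalSpace.mk' Plane y (s' y)) :=
        ContMDiffAt.comp (TotalSpace.mk' Plane y (s' y)) (g := fun z => TotalSpace.mk' Plane z (u z))
          hu (Bundle.contMDiff_proj E).contMDiffAt
      have h2 : ContMDiffAt ((𝓡 n).prod 𝓘(ℝ, Plane)) ((𝓡 n).prod 𝓘(ℝ, Plane)) ∞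
          (fun p : TotalSpace Plane E => TotalSpace.mk' Plane p.proj p.2)
          (TotalSpace.mk' Plane y (s' y)) := contMDiffAt_id
      exact (h1.inner_bundle h2).mdifferentiableAt (by simp)
    have hι : MDifferentiableAt (𝓡 (n + 1)) ((𝓡 n).prod 𝓘(ℝ, Plane))
        (Subtype.val : UnitCircle E → TotalSpace Plane E) ⟨⟨y, s' y⟩, hv⟩ :=
      (S.isSmoothEmbedding.contMDiff _).mdifferentiableAt (by simp)
    have hs'' : MDifferentiableAt (𝓡 n) ((𝓡 n).prod 𝓘(ℝ, Plane))
        (fun y => TotalSpace.mk' Plane y (s' y)) y := hs'.mdifferentiableAt (by simp)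
    have e1 := HasMFDerivAt.comp (⟨⟨y, s' y⟩, hv⟩ : UnitCircle E)
      (show HasMFDerivAt _ _ _ (Subtype.val (⟨⟨y, s' y⟩, hv⟩ : UnitCircle E)) _ from hq.hasMFDerivAt)
      hι.hasMFDerivAt
    have e2 := HasMFDerivAt.comp y hq.hasMFDerivAt hs''.hasMFDerivAt
    have e3 := S.mvfderiv_inner hu hs' (dbase (n := n) ⟨⟨y, s' y⟩, hv⟩ w)
    have hcov' : S.connE s' y (dbase (n := n) ⟨⟨y, s' y⟩, hv⟩ w) = 0 := hcov
    erw [hcov', inner_zero_right, add_zero] at e3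
    refine Eq.trans ?_ e3
    refine (DFunLike.congr_fun e1.mfderiv w).trans ?_
    refine Eq.trans ?_ (DFunLike.congr_fun e2.mfderiv _).symm
    exact congrArg _ hdw
  have hre : ∀ y : UnitCircle E, (inner ℝ (s y.1.proj) y.1.2 : ℝ) =
      Real.cos (S.localCoord s b θ₀ y).2 := fun y => by
    have := congrArg Complex.re (h.frameCoord_eq (θ₀ := θ₀) y)
    rwa [Complex.exp_ofReal_mul_I_re] at this
  have him : ∀ y : UnitCircle E, (inner ℝ (S.J _ (s y.1.proj)) y.1.2 : ℝ) =
      Real.sin (S.localCoord s b θ₀ y).2 := fun y => by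
    have := congrArg Complex.im (h.frameCoord_eq (θ₀ := θ₀) y)
    rwa [Complex.exp_ofReal_mul_I_im] at this
  have hsx := h.smooth _ hx.1
  have key' : ∀ (u : Π y, E y), SmoothAt n Plane u (base x) → ∀ (g : UnitCircle E → ℝ)
      (D : TangentSpace (𝓡 (n + 1)) x →L[ℝ] ℝ), HasMFDerivAt (𝓡 (n + 1)) 𝓘(ℝ, ℝ) g x D →
      (∀ y : UnitCircle E, (inner ℝ (u y.1.proj) y.1.2 : ℝ) = g y) →
      D w = (inner ℝ (S.connE u (base x) (dbase (n := n) x w)) x.1.2 : ℝ) := by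
    intro u hu g D hD hg
    obtain rfl : (fun y : UnitCircle E => (inner ℝ (u y.1.proj) y.1.2 : ℝ)) = g := funext hg
    exact (DFunLike.congr_fun hD.mfderiv w).symm.trans (key u hu)
  have k1 := key' s hsx _ _ (h.hasMFDerivAt_angle hF (Real.hasDerivAt_cos _)) hre
  have k2 := key' (fun z => S.J z (s z)) (S.J_smooth s _ hsx) _ _
    (h.hasMFDerivAt_angle hF (Real.hasDerivAt_sin _)) him
  have k1' : -Real.sin (S.localCoord s b θ₀ x).2 * (F' w).2 =
      S.connForm s (base x) (dbase (n := n) x w) * Real.sin (S.localCoord s b θ₀ x).2 := by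
    rw [← him x]
    rw [← him x] at k1
    exact k1.trans ((congrArg (fun v : E x.1.proj => (inner ℝ v x.1.2 : ℝ))
      (S.covariantDerivative_unit h.norm_eq hsx _)).trans
        (real_inner_smul_left (F := E x.1.proj) _ _ _))
  have k2' : Real.cos (S.localCoord s b θ₀ x).2 * (F' w).2 =
      -(S.connForm s (base x) (dbase (n := n) x w) * Real.cos (S.localCoord s b θ₀ x).2) := by
    rw [← hre x]
    rw [← hre x] at k2
    exact k2.trans (((congrArg (fun v : E x.1.proj => (inner ℝ v x.1.2 : ℝ))
      (S.covariantDerivative_rotation_unit h.norm_eq hsx _)).trans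
        (inner_neg_left (E := E x.1.proj) _ _)).trans
          (congrArg Neg.neg (real_inner_smul_left (F := E x.1.proj) _ _ _)))
  have k3 := Real.cos_sq_add_sin_sq (S.localCoord s b θ₀ x).2
  -- Each equation gives `dθ(w)` only up to a factor `sin θ` or `cos θ`; weighted by these factors
  -- they combine to `cos² + sin² = 1` times the claim.
  linear_combination Real.cos (S.localCoord s b θ₀ x).2 * k2' -
    Real.sin (S.localCoord s b θ₀ x).2 * k1' -
    ((F' w).2 + S.connForm s (base x) (dbase (n := n) x w)) * k3

/-- The required section is `s` turned by an angle `φ` that equals `θ` at the base point and has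
minus the connection form as differential there. Only the derivative at this point matters, so `φ`
may be affine in the chart. -/
lemma isHorizontal_of_snd (hx : x ∈ S.localDomain s W θ₀)
    {F' : TangentSpace (𝓡 (n + 1)) x →L[ℝ] Coord n × ℝ}
    (hF : HasMFDerivAt (𝓡 (n + 1)) 𝓘(ℝ, Coord n × ℝ) (S.localCoord s b θ₀) x F')
    {w : TangentSpace (𝓡 (n + 1)) x}
    (hw : (F' w).2 = -S.connForm s (base x) (dbase (n := n) x w)) : S.IsHorizontal x w := by
  set θ := (S.localCoord s b θ₀ x).2 with hθ
  have hb := h.subset hx.1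
  have hsx := h.smooth _ hx.1
  let ℓ : Coord n →L[ℝ] ℝ :=
    -∑ i, S.connForm s (base x) (coordField b i (base x)) • EuclideanSpace.proj (𝕜 := ℝ) i
  let χ' : TangentSpace (𝓡 n) (base x) →L[ℝ] Coord n :=
    mfderiv (𝓡 n) 𝓘(ℝ, Coord n) (extChartAt (𝓡 n) b) (base x)
  have hχ' : HasMFDerivAt (𝓡 n) 𝓘(ℝ, Coord n) (extChartAt (𝓡 n) b) (base x) χ' :=
    (mdifferentiableAt_extChartAt hb).hasMFDerivAt
  have hℓ : ∀ X : TangentSpace (𝓡 n) (base x), ℓ (χ' X) = -S.connForm s (base x) X := by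
    intro X
    rw [S.connForm_eq_sum hb s X]
    simp [ℓ, χ']
    rfl
  let φ : B → ℝ := fun y => θ + ℓ (extChartAt (𝓡 n) b y - extChartAt (𝓡 n) b (base x))
  have hφx : φ (base x) = θ := by simp [φ]
  have hφs : ContMDiffAt (𝓡 n) 𝓘(ℝ, ℝ) ∞ φ (base x) := by
    have h1 : ContDiff ℝ ∞ (fun v : Coord n => θ + ℓ (v - extChartAt (𝓡 n) b (base x))) := by
      fun_prop
    exact h1.contMDiff.contMDiffAt.comp _ (contMDiffAt_extChartAt' hb)
  have hφ' : HasMFDerivAt (𝓡 n) 𝓘(ℝ, ℝ) φ (base x) (ℓ.comp χ') := by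
    have h1 : HasFDerivAt (fun v : Coord n => θ + ℓ (v - extChartAt (𝓡 n) b (base x))) ℓ
        (extChartAt (𝓡 n) b (base x)) :=
      (ℓ.hasFDerivAt.comp _ ((hasFDerivAt_id _).sub_const _)).const_add θ
    exact HasMFDerivAt.comp (base x)
      (g := fun v : Coord n => θ + ℓ (v - extChartAt (𝓡 n) b (base x)))
      (f := extChartAt (𝓡 n) b) h1.hasMFDerivAt hχ'
  have hcos : HasMFDerivAt (𝓡 n) 𝓘(ℝ, ℝ) (fun y => Real.cos (φ y)) (base x)
      (-Real.sin θ • ℓ.comp χ') := by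
    have h1 : HasFDerivAt Real.cos (-Real.sin θ • ContinuousLinearMap.id ℝ ℝ) (φ (base x)) := by
      rw [hφx, hasFDerivAt_iff_hasDerivAt]
      simpa using Real.hasDerivAt_cos θ
    exact HasMFDerivAt.comp (base x) (g := Real.cos) (f := φ) h1.hasMFDerivAt hφ'
  have hsin : HasMFDerivAt (𝓡 n) 𝓘(ℝ, ℝ) (fun y => Real.sin (φ y)) (base x)
      (Real.cos θ • ℓ.comp χ') := by
    have h1 : HasFDerivAt Real.sin (Real.cos θ • ContinuousLinearMap.id ℝ ℝ) (φ (base x)) := by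
      rw [hφx, hasFDerivAt_iff_hasDerivAt]
      simpa using Real.hasDerivAt_sin θ
    exact HasMFDerivAt.comp (base x) (g := Real.sin) (f := φ) h1.hasMFDerivAt hφ'
  have hcosS : ContMDiffAt (𝓡 n) 𝓘(ℝ, ℝ) ∞ (fun y => Real.cos (φ y)) (base x) :=
    Real.contDiff_cos.contMDiff.contMDiffAt.comp _ hφs
  have hsinS : ContMDiffAt (𝓡 n) 𝓘(ℝ, ℝ) ∞ (fun y => Real.sin (φ y)) (base x) :=
    Real.contDiff_sin.contMDiff.contMDiffAt.comp _ hφs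
  let s' : Π y, E y := (fun y => Real.cos (φ y)) • s + (fun y => Real.sin (φ y)) • fun y => S.J y (s y)
  have hs'1 := hcosS.smul_section hsx
  have hs'2 := hsinS.smul_section (S.J_smooth s _ hsx)
  have hs' : SmoothAt n Plane s' (base x) := hs'1.add_section hs'2
  have hpar : ∀ y, (⟨y, s' y⟩ : TotalSpace Plane E) =
      (S.rot (φ y) (unitPoint s h.norm_eq y)).1 := fun y => rfl
  have hs'x : s' (base x) = x.1.2 := by
    have h1 := h.rot_unitPoint (θ₀ := θ₀) x
    have h2 := (hpar (base x)).trans (congrArg Subtype.val (by rw [hφx, hθ, h1]))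
    obtain ⟨⟨y, v⟩, hv⟩ := x
    exact eq_of_heq (TotalSpace.mk.inj h2).2
  refine ⟨s', hs', hs'x, ?_, ?_⟩
  · rw [S.connE.isCovariantDerivativeOnUniv.add (hs'1.mdifferentiableAt (by simp))
      (hs'2.mdifferentiableAt (by simp)),
      S.connE.isCovariantDerivativeOnUniv.leibniz (hsx.mdifferentiableAt (by simp))
        (hcosS.mdifferentiableAt (by simp)),
      S.connE.isCovariantDerivativeOnUniv.leibniz
        ((S.J_smooth s _ hsx).mdifferentiableAt (by simp)) (hsinS.mdifferentiableAt (by simp))]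
    set X := dbase (n := n) x w with hX
    have d1 : mvfderiv (𝓡 n) (fun y => Real.cos (φ y)) (base x) X =
        Real.sin θ * S.connForm s (base x) X := by
      refine (DFunLike.congr_fun hcos.mfderiv X).trans ?_
      change -Real.sin θ * ℓ (χ' X) = _
      rw [hℓ]; ring
    have d2 : mvfderiv (𝓡 n) (fun y => Real.sin (φ y)) (base x) X =
        -(Real.cos θ * S.connForm s (base x) X) := by
      refine (DFunLike.congr_fun hsin.mfderiv X).trans ?_
      change Real.cos θ * ℓ (χ' X) = _
      rw [hℓ]; ring
    simp only [add_apply, smul_apply, ContinuousLinearMap.smulRight_apply]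
    rw [d1, d2, S.covariantDerivative_unit h.norm_eq hsx,
      S.covariantDerivative_rotation_unit h.norm_eq hsx, hφx]
    module
  -- Both differentials factor through the differential `L` of the parametrization: the inclusion of
  -- `M` is the parametrization after the coordinates, and `s'` is the parametrization after
  -- `(chart, φ)`. It remains to compare vectors of `Coord n × ℝ`.
  · obtain ⟨G, hF2, hG⟩ := h.exists_hasMFDerivAt_param hx
    obtain rfl : F' = G.symm := hasMFDerivAt_unique hF hF2
    have hpt := h.localParam_localCoord (θ₀ := θ₀) hx.1
    have hL := (S.contMDiffAt_localParam_val h.norm_eq b (S.localCoord s b θ₀ x)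
      (h.localCoord_fst_mem hx.1) (by
        have h1 : (extChartAt (𝓡 n) b).symm (extChartAt (𝓡 n) b (base x)) = base x :=
          (extChartAt (𝓡 n) b).left_inv (by rw [extChartAt_source]; exact hb)
        rw [localCoord, h1]; exact hsx)).mdifferentiableAt (by simp)
    have hL := hL.hasMFDerivAt
    set L : (Coord n × ℝ) →L[ℝ] Coord n × Plane :=
      mfderiv 𝓘(ℝ, Coord n × ℝ) ((𝓡 n).prod 𝓘(ℝ, Plane))
        (fun q => (S.localParam h.norm_eq b q).1) (S.localCoord s b θ₀ x)
    have e1 : HasMFDerivAt (𝓡 (n + 1)) ((𝓡 n).prod 𝓘(ℝ, Plane))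
        (Subtype.val : UnitCircle E → TotalSpace Plane E) x
        (L.comp (G.symm : TangentSpace (𝓡 (n + 1)) x →L[ℝ] Coord n × ℝ)) := by
      refine (HasMFDerivAt.comp x hL hF).congr_of_eventuallyEq ?_
      filter_upwards [(h.isOpen.preimage S.continuous_base).mem_nhds hx.1] with y hy
      simp only [Function.comp]
      rw [h.localParam_localCoord hy]
    have hP : HasMFDerivAt (𝓡 n) 𝓘(ℝ, Coord n × ℝ) (fun y => (extChartAt (𝓡 n) b y, φ y)) (base x)
        (χ'.prod (ℓ.comp χ'))  :=
      ⟨hχ'.1.prodMk hφ'.1, hχ'.2.prodMk hφ'.2⟩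
    have hPx : (extChartAt (𝓡 n) b (base x), φ (base x)) = S.localCoord s b θ₀ x := by
      rw [hφx]; rfl
    have hL2 : HasMFDerivAt 𝓘(ℝ, Coord n × ℝ) ((𝓡 n).prod 𝓘(ℝ, Plane))
        (fun q => (S.localParam h.norm_eq b q).1) (extChartAt (𝓡 n) b (base x), φ (base x)) L := by
      rw [hPx]; exact hL
    have e2 : HasMFDerivAt (𝓡 n) ((𝓡 n).prod 𝓘(ℝ, Plane))
        (fun y => TotalSpace.mk' Plane y (s' y)) (base x) (L.comp (χ'.prod (ℓ.comp χ'))) := by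
      refine (HasMFDerivAt.comp (base x) hL2 hP).congr_of_eventuallyEq ?_
      filter_upwards [(chartAt (Coord n) b).open_source.mem_nhds hb] with y hy
      have h1 : (extChartAt (𝓡 n) b).symm (extChartAt (𝓡 n) b y) = y :=
        (extChartAt (𝓡 n) b).left_inv (by rw [extChartAt_source]; exact hy)
      simp only [Function.comp, localParam]
      rw [h1]
      exact hpar y
    rw [e1.mfderiv]
    refine Eq.trans ?_ (DFunLike.congr_fun e2.mfderiv _).symm
    change L (G.symm w) = L (χ' (dbase (n := n) x w), ℓ (χ' (dbase (n := n) x w)))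
    congr 1
    refine Prod.ext (h.fst_hasMFDerivAt hx hF w) ?_
    rw [hℓ]
    exact hw

end IsLocalFrame

end Setting
end Geometry
end CircleEta
end

noncomputable section

namespace CircleEta

section Geometry

variable {n : ℕ} {B : Type*} [TopologicalSpace B] [ChartedSpace (Coord n) B]
  [IsManifold (𝓡 n) ∞ B]
  {E : B → Type*} [TopologicalSpace (TotalSpace Plane E)] [∀ b, NormedAddCommGroup (E b)]
  [∀ b, InnerProductSpace ℝ (E b)] [FiberBundle Plane E] [VectorBundle ℝ Plane E]
  [ContMDiffVectorBundle ∞ Plane E (𝓡 n)] [IsContMDiffRiemannianBundle (𝓡 n) ∞ Plane E]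
  [ChartedSpace (Coord (n + 1)) (UnitCircle E)] [IsManifold (𝓡 (n + 1)) ∞ (UnitCircle E)]
  {V : UnitCircle E → Type*} [TopologicalSpace (TotalSpace ℂ V)] [∀ x, NormedAddCommGroup (V x)]
  [∀ x, InnerProductSpace ℂ (V x)] [FiberBundle ℂ V] [VectorBundle ℝ ℂ V]
  [ContMDiffVectorBundle ∞ ℂ V (𝓡 (n + 1))]

namespace Setting

variable (S : Setting (n := n) E V)

/-! ### The vertical and the horizontal fields in local coordinates -/

/-- The commutator of two derivations is the derivation by the Lie bracket. -/
lemma _root_.VectorField.fderiv_lieBracket {F G : Type*} [NormedAddCommGroup F] [NormedSpace ℝ F]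
    [NormedAddCommGroup G] [NormedSpace ℝ G] {g : F → G} {v w : F → F} {q : F}
    (hg : ContDiffAt ℝ ∞ g q) (hv : DifferentiableAt ℝ v q) (hw : DifferentiableAt ℝ w q) :
    fderiv ℝ (fun p => fderiv ℝ g p (w p)) q (v q) - fderiv ℝ (fun p => fderiv ℝ g p (v p)) q (w q) =
      fderiv ℝ g q (VectorField.lieBracket ℝ v w q) := by
  have h1 : DifferentiableAt ℝ (fderiv ℝ g) q :=
    (hg.fderiv_right (m := ∞) (by simp)).differentiableAt (by simp)
  have h2 : IsSymmSndFDerivAt ℝ g q := hg.isSymmSndFDerivAt (by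
    rw [minSmoothness_of_isRCLikeNormedField]
    exact WithTop.coe_le_coe.2 (le_top (a := (2 : ℕ∞))))
  rw [fderiv_clm_apply h1 hw, fderiv_clm_apply h1 hv, VectorField.lieBracket]
  simp only [add_apply, ContinuousLinearMap.comp_apply, ContinuousLinearMap.flip_apply, map_sub]
  rw [h2.eq (v q) (w q)]
  abel

namespace IsLocalFrame

variable {S} {b : B} {W : Set B} {s : Π y, E y} (h : S.IsLocalFrame b W s) {θ₀ : ℝ}
  {x : UnitCircle E}
include h

/-- With `θ₀` the argument at `x` itself the shifted coordinate is `1`, which lies off the slit. -/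
lemma exists_mem_localDomain (hx : base x ∈ W) : ∃ θ₀, x ∈ S.localDomain s W θ₀ := by
  refine ⟨Complex.arg (S.frameCoord s x), hx, ?_⟩
  have h1 := Complex.norm_mul_exp_arg_mul_I (S.frameCoord s x)
  rw [S.norm_frameCoord h.norm_eq, Complex.ofReal_one, one_mul] at h1
  have h2 : S.frameCoord s x * Complex.exp (-(Complex.arg (S.frameCoord s x)) * Complex.I) = 1 := by
    nth_rewrite 1 [← h1]
    rw [← Complex.exp_add]
    simp
  change S.frameCoord s x * Complex.exp (-(Complex.arg (S.frameCoord s x)) * Complex.I) ∈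
    Complex.slitPlane
  rw [h2]
  exact Complex.one_mem_slitPlane

lemma dbase_eq_iff (hx : x ∈ S.localDomain s W θ₀)
    {F' : TangentSpace (𝓡 (n + 1)) x →L[ℝ] Coord n × ℝ}
    (hF : HasMFDerivAt (𝓡 (n + 1)) 𝓘(ℝ, Coord n × ℝ) (S.localCoord s b θ₀) x F')
    (w : TangentSpace (𝓡 (n + 1)) x) (X : TangentSpace (𝓡 n) (base x)) :
    dbase (n := n) x w = X ↔
      (F' w).1 = mfderiv (𝓡 n) 𝓘(ℝ, Coord n) (extChartAt (𝓡 n) b) (base x) X := by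
  rw [h.fst_hasMFDerivAt hx hF w]
  exact ⟨fun h1 => by rw [h1], fun h1 => eq_of_chart_eq (h.subset hx.1) h1⟩

lemma isHorizontal_iff (hx : x ∈ S.localDomain s W θ₀)
    {F' : TangentSpace (𝓡 (n + 1)) x →L[ℝ] Coord n × ℝ}
    (hF : HasMFDerivAt (𝓡 (n + 1)) 𝓘(ℝ, Coord n × ℝ) (S.localCoord s b θ₀) x F')
    (w : TangentSpace (𝓡 (n + 1)) x) :
    S.IsHorizontal x w ↔ (F' w).2 = -S.connForm s (base x) (dbase (n := n) x w) :=
  ⟨h.snd_of_isHorizontal hx hF, h.isHorizontal_of_snd hx hF⟩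

lemma dbase_param (hx : x ∈ S.localDomain s W θ₀)
    {G : (Coord n × ℝ) ≃L[ℝ] TangentSpace (𝓡 (n + 1)) x}
    (hF : HasMFDerivAt (𝓡 (n + 1)) 𝓘(ℝ, Coord n × ℝ) (S.localCoord s b θ₀) x
        (G.symm : TangentSpace (𝓡 (n + 1)) x →L[ℝ] Coord n × ℝ))
    (X : TangentSpace (𝓡 n) (base x)) (r : ℝ) :
    dbase (n := n) x (G ((mfderiv (𝓡 n) 𝓘(ℝ, Coord n) (extChartAt (𝓡 n) b) (base x) X : Coord n),
      r)) = X := by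
  rw [h.dbase_eq_iff hx hF]
  exact congrArg Prod.fst (G.symm_apply_apply _)

/-- The projection fixes the base component of the lift and horizontality fixes its angle component,
so `Classical.epsilon` has exactly one candidate. -/
lemma horLift_eq (hx : x ∈ S.localDomain s W θ₀)
    {G : (Coord n × ℝ) ≃L[ℝ] TangentSpace (𝓡 (n + 1)) x}
    (hF : HasMFDerivAt (𝓡 (n + 1)) 𝓘(ℝ, Coord n × ℝ) (S.localCoord s b θ₀) x
        (G.symm : TangentSpace (𝓡 (n + 1)) x →L[ℝ] Coord n × ℝ))
    (X : TangentSpace (𝓡 n) (base x)) :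
    S.horLift x X = G ((mfderiv (𝓡 n) 𝓘(ℝ, Coord n) (extChartAt (𝓡 n) b) (base x) X : Coord n),
      -S.connForm s (base x) X) := by
  have key : ∀ w, (S.IsHorizontal x w ∧ dbase (n := n) x w = X) ↔
      w = G ((mfderiv (𝓡 n) 𝓘(ℝ, Coord n) (extChartAt (𝓡 n) b) (base x) X : Coord n),
        -S.connForm s (base x) X) := by
    intro w
    rw [h.isHorizontal_iff hx hF, and_comm]
    constructor
    · rintro ⟨rfl, h2⟩
      rw [← G.symm_apply_eq]
      exact Prod.ext (h.fst_hasMFDerivAt hx hF w) h2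
    · rintro rfl
      have h1 := h.dbase_param hx hF X (-S.connForm s (base x) X)
      refine ⟨h1, ?_⟩
      rw [h1]
      exact congrArg Prod.snd (G.symm_apply_apply _)
  simp only [horLift, key]
  exact Classical.epsilon_spec (p := fun w => w = _) ⟨_, rfl⟩

lemma dbase_e (hx : x ∈ S.localDomain s W θ₀) : dbase (n := n) x (S.e x) = 0 := by
  obtain ⟨G, hF, hG⟩ := h.exists_hasMFDerivAt_param hx
  rw [h.dbase_eq_iff hx hF, h.e_eq hx hG, map_zero]
  exact congrArg Prod.fst (G.symm_apply_apply (0, 1))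

/-- Subtracting `c e` lowers the angle component by `c` and keeps the base component, so exactly one
`c` leaves a horizontal vector, and `Classical.epsilon` must choose it. -/
lemma eDual_eq (hx : x ∈ S.localDomain s W θ₀) {F' : TangentSpace (𝓡 (n + 1)) x →L[ℝ] Coord n × ℝ}
    (hF : HasMFDerivAt (𝓡 (n + 1)) 𝓘(ℝ, Coord n × ℝ) (S.localCoord s b θ₀) x F')
    (w : TangentSpace (𝓡 (n + 1)) x) :
    S.eDual x w = (F' w).2 + S.connForm s (base x) (dbase (n := n) x w) := by
  obtain ⟨G, hF2, hG⟩ := h.exists_hasMFDerivAt_param hx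
  obtain rfl : F' = G.symm := hasMFDerivAt_unique hF hF2
  have he : G.symm (S.e x) = (0, 1) := by
    rw [h.e_eq hx hG]
    exact G.symm_apply_apply _
  have key : ∀ c : ℝ, S.IsHorizontal x (w - c • S.e x) ↔
      c = (G.symm w).2 + S.connForm s (base x) (dbase (n := n) x w) := by
    intro c
    have h0 : dbase (n := n) x (w - c • S.e x) = dbase (n := n) x w := by
      rw [map_sub, map_smul, h.dbase_e hx, smul_zero, sub_zero]
    rw [h.isHorizontal_iff hx hF, h0]
    have h1 : ((G.symm : TangentSpace (𝓡 (n + 1)) x →L[ℝ] Coord n × ℝ) (w - c • S.e x)).2 =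
        (G.symm w).2 - c := by
      change (G.symm (w - c • S.e x)).2 = _
      rw [map_sub, map_smul, he]
      simp
    rw [h1]
    constructor <;> intro h2 <;> linarith
  simp only [eDual, key]
  exact Classical.epsilon_spec (p := fun c => c = _) ⟨_, rfl⟩

end IsLocalFrame

/-- The coefficient of `dy_i` in the connection form, in the chart at `b`. -/
def connCoeff (s : Π y, E y) (b : B) (i : Fin n) (p : Coord n) : ℝ :=
  S.connForm s ((extChartAt (𝓡 n) b).symm p) (coordField b i ((extChartAt (𝓡 n) b).symm p))

/-- The horizontal lift of `∂_i` in local coordinates. -/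
def liftField (s : Π y, E y) (b : B) (i : Fin n) (q : Coord n × ℝ) : Coord n × ℝ :=
  (stdVec i, -S.connCoeff s b i q.1)

/-- The coefficients of the curvature of `E` in the chart at `b`. -/
def curvCoeff (s : Π y, E y) (b : B) (i j : Fin n) (p : Coord n) : ℝ :=
  fderiv ℝ (S.connCoeff s b j) p (stdVec i) - fderiv ℝ (S.connCoeff s b i) p (stdVec j)

namespace IsLocalFrame

variable {S} {b : B} {W : Set B} {s : Π y, E y} (h : S.IsLocalFrame b W s) {θ₀ : ℝ}
  {x : UnitCircle E}
include h

lemma connCoeff_chart {y : B} (hy : y ∈ W) (i : Fin n) :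
    S.connCoeff s b i (extChartAt (𝓡 n) b y) = S.connForm s y (coordField b i y) := by
  have h1 : (extChartAt (𝓡 n) b).symm (extChartAt (𝓡 n) b y) = y :=
    (extChartAt (𝓡 n) b).left_inv (by rw [extChartAt_source]; exact h.subset hy)
  rw [connCoeff, h1]

lemma contDiffAt_connCoeff [T2Space B] {y : B} (hy : y ∈ W) (i : Fin n) :
    ContDiffAt ℝ ∞ (S.connCoeff s b i) (extChartAt (𝓡 n) b y) := by
  have h1 : (extChartAt (𝓡 n) b).symm (extChartAt (𝓡 n) b y) = y :=
    (extChartAt (𝓡 n) b).left_inv (by rw [extChartAt_source]; exact h.subset hy)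
  have h2 := S.contMDiffAt_connForm h.isOpen h.smooth (h.subset hy) hy i
  rw [← h1] at h2
  have h3 := ((contMDiffOn_extChartAt_symm b).contMDiffAt (n := ∞) (I := 𝓡 n)
    (extChartAt_target_mem_nhds' ((extChartAt (𝓡 n) b).map_source
      (by rw [extChartAt_source]; exact h.subset hy))))
  exact (ContMDiffAt.comp _ h2 h3).contDiffAt

lemma isInvertible_mfderiv (hx : x ∈ S.localDomain s W θ₀) :
    (mfderiv (𝓡 (n + 1)) 𝓘(ℝ, Coord n × ℝ) (S.localCoord s b θ₀) x).IsInvertible := by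
  obtain ⟨G, hF, -⟩ := h.exists_hasMFDerivAt_param hx
  rw [hF.mfderiv]
  exact ⟨G.symm, rfl⟩

omit h in
lemma mpullback_eq {G : (Coord n × ℝ) ≃L[ℝ] TangentSpace (𝓡 (n + 1)) x}
    (hF : HasMFDerivAt (𝓡 (n + 1)) 𝓘(ℝ, Coord n × ℝ) (S.localCoord s b θ₀) x
        (G.symm : TangentSpace (𝓡 (n + 1)) x →L[ℝ] Coord n × ℝ)) (v : Coord n × ℝ → Coord n × ℝ) :
    VectorField.mpullback (𝓡 (n + 1)) 𝓘(ℝ, Coord n × ℝ) (S.localCoord s b θ₀) v x =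
      G (v (S.localCoord s b θ₀ x)) := by
  change (mfderiv (𝓡 (n + 1)) 𝓘(ℝ, Coord n × ℝ) (S.localCoord s b θ₀) x).inverse _ = _
  rw [hF.mfderiv]
  exact DFunLike.congr_fun (ContinuousLinearMap.inverse_equiv G.symm) _

lemma e_eq_mpullback (hx : x ∈ S.localDomain s W θ₀) :
    S.e x = VectorField.mpullback (𝓡 (n + 1)) 𝓘(ℝ, Coord n × ℝ) (S.localCoord s b θ₀)
      (fun _ => ((0, 1) : Coord n × ℝ)) x := by
  obtain ⟨G, hF, hG⟩ := h.exists_hasMFDerivAt_param hx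
  rw [mpullback_eq hF (fun _ => (0, 1)), h.e_eq hx hG]
  rfl

lemma coordLift_eq (hx : x ∈ S.localDomain s W θ₀)
    {G : (Coord n × ℝ) ≃L[ℝ] TangentSpace (𝓡 (n + 1)) x}
    (hF : HasMFDerivAt (𝓡 (n + 1)) 𝓘(ℝ, Coord n × ℝ) (S.localCoord s b θ₀) x
        (G.symm : TangentSpace (𝓡 (n + 1)) x →L[ℝ] Coord n × ℝ)) (i : Fin n) :
    S.coordLift b i x = G (S.liftField s b i (S.localCoord s b θ₀ x)) := by
  rw [coordLift, h.horLift_eq hx hF, chart_coordField (h.subset hx.1), liftField,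
    ← h.connCoeff_chart hx.1]
  rfl

lemma coordLift_eq_mpullback (hx : x ∈ S.localDomain s W θ₀) (i : Fin n) :
    S.coordLift b i x = VectorField.mpullback (𝓡 (n + 1)) 𝓘(ℝ, Coord n × ℝ) (S.localCoord s b θ₀)
      (S.liftField s b i) x := by
  obtain ⟨G, hF, hG⟩ := h.exists_hasMFDerivAt_param hx
  rw [mpullback_eq hF, h.coordLift_eq hx hF]

lemma eDual_e (hx : x ∈ S.localDomain s W θ₀) : S.eDual x (S.e x) = 1 := by
  obtain ⟨G, hF, hG⟩ := h.exists_hasMFDerivAt_param hx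
  have h0 : S.connForm s (base x) (0 : TangentSpace (𝓡 n) (base x)) = 0 := by
    simpa using S.connForm_smul (s := s) (y := base x) 0 0
  rw [h.eDual_eq hx hF, h.dbase_e hx, h.e_eq hx hG, h0, add_zero]
  exact congrArg Prod.snd (G.symm_apply_apply (0, 1))

lemma eDual_smul_e (hx : x ∈ S.localDomain s W θ₀) (c : ℝ) : S.eDual x (c • S.e x) = c := by
  obtain ⟨G, hF, hG⟩ := h.exists_hasMFDerivAt_param hx
  have h1 := h.eDual_e hx
  have h0 : S.connForm s (base x) (0 : TangentSpace (𝓡 n) (base x)) = 0 := by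
    simpa using S.connForm_smul (s := s) (y := base x) 0 0
  have h2 : dbase (n := n) x (c • S.e x) = 0 := by rw [map_smul, h.dbase_e hx, smul_zero]
  rw [h.eDual_eq hx hF, h.dbase_e hx, h0, add_zero] at h1
  rw [h.eDual_eq hx hF, h2, h0, add_zero, map_smul, Prod.smul_snd, h1, smul_eq_mul, mul_one]

lemma dbase_coordLift (hx : x ∈ S.localDomain s W θ₀) (i : Fin n) :
    dbase (n := n) x (S.coordLift b i x) = coordField b i (base x) := by
  obtain ⟨G, hF, hG⟩ := h.exists_hasMFDerivAt_param hx
  rw [coordLift, h.horLift_eq hx hF]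
  exact h.dbase_param hx hF _ _

lemma eDual_coordLift (hx : x ∈ S.localDomain s W θ₀) (i : Fin n) :
    S.eDual x (S.coordLift b i x) = 0 := by
  obtain ⟨G, hF, hG⟩ := h.exists_hasMFDerivAt_param hx
  rw [h.eDual_eq hx hF, h.dbase_coordLift hx, h.coordLift_eq hx hF]
  have h1 : ((G.symm : TangentSpace (𝓡 (n + 1)) x →L[ℝ] Coord n × ℝ)
    (G (S.liftField s b i (S.localCoord s b θ₀ x)))).2 = -S.connCoeff s b i (extChartAt (𝓡 n) b
      (base x)) := congrArg Prod.snd (G.symm_apply_apply _)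
  rw [h1, h.connCoeff_chart hx.1]
  ring

lemma contDiffAt_liftField [T2Space B] (hx : x ∈ S.localDomain s W θ₀) (i : Fin n) :
    ContDiffAt ℝ ∞ (S.liftField s b i) (S.localCoord s b θ₀ x) := by
  have h1 : ContDiffAt ℝ ∞ (fun q : Coord n × ℝ => S.connCoeff s b i q.1)
      (S.localCoord s b θ₀ x) :=
    ContDiffAt.comp (g := S.connCoeff s b i) (f := Prod.fst) _ (h.contDiffAt_connCoeff hx.1 i)
      contDiffAt_fst
  exact contDiffAt_const.prodMk h1.neg

lemma contMDiffAt_mpullback (hx : x ∈ S.localDomain s W θ₀) {v : Coord n × ℝ → Coord n × ℝ}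
    (hv : ContDiffAt ℝ ∞ v (S.localCoord s b θ₀ x)) :
    ContMDiffAt (𝓡 (n + 1)) ((𝓡 (n + 1)).prod 𝓘(ℝ, Coord (n + 1))) ∞
      (fun y => TotalSpace.mk' (Coord (n + 1)) y
        (VectorField.mpullback (𝓡 (n + 1)) 𝓘(ℝ, Coord n × ℝ) (S.localCoord s b θ₀) v y :
          TangentSpace (𝓡 (n + 1)) y)) x := by
  have h1 := (contMDiffAt_vectorSpace_iff_contDiffAt (𝕜 := ℝ)
    (V := fun q => (v q : TangentSpace 𝓘(ℝ, Coord n × ℝ) q))).2 hv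
  exact ContMDiffAt.mpullback_vectorField_preimage h1 (h.contMDiffAt_localCoord hx)
    (h.isInvertible_mfderiv hx) (by simp)

lemma contMDiffAt_e (hx : x ∈ S.localDomain s W θ₀) :
    ContMDiffAt (𝓡 (n + 1)) ((𝓡 (n + 1)).prod 𝓘(ℝ, Coord (n + 1))) ∞
      (fun y => TotalSpace.mk' (Coord (n + 1)) y (S.e y : TangentSpace (𝓡 (n + 1)) y)) x := by
  refine (h.contMDiffAt_mpullback hx
    (contDiffAt_const (c := ((0, 1) : Coord n × ℝ)))).congr_of_eventuallyEq ?_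
  filter_upwards [h.isOpen_localDomain.mem_nhds hx] with y hy
  rw [h.e_eq_mpullback hy]

lemma contMDiffAt_coordLift [T2Space B] (hx : x ∈ S.localDomain s W θ₀) (i : Fin n) :
    ContMDiffAt (𝓡 (n + 1)) ((𝓡 (n + 1)).prod 𝓘(ℝ, Coord (n + 1))) ∞
      (fun y => TotalSpace.mk' (Coord (n + 1)) y
        (S.coordLift b i y : TangentSpace (𝓡 (n + 1)) y)) x := by
  refine (h.contMDiffAt_mpullback hx (h.contDiffAt_liftField hx i)).congr_of_eventuallyEq ?_
  filter_upwards [h.isOpen_localDomain.mem_nhds hx] with y hy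
  rw [h.coordLift_eq_mpullback hy]

/-- Naturality of the Lie bracket: brackets of fields on `M` may be computed in `Coord n × ℝ`. -/
lemma mlieBracket_mpullback (hx : x ∈ S.localDomain s W θ₀) {v w : Coord n × ℝ → Coord n × ℝ}
    (hv : ContDiffAt ℝ ∞ v (S.localCoord s b θ₀ x))
    (hw : ContDiffAt ℝ ∞ w (S.localCoord s b θ₀ x)) :
    VectorField.mlieBracket (𝓡 (n + 1))
      (VectorField.mpullback (𝓡 (n + 1)) 𝓘(ℝ, Coord n × ℝ) (S.localCoord s b θ₀) v)
      (VectorField.mpullback (𝓡 (n + 1)) 𝓘(ℝ, Coord n × ℝ) (S.localCoord s b θ₀) w) x =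
    VectorField.mpullback (𝓡 (n + 1)) 𝓘(ℝ, Coord n × ℝ) (S.localCoord s b θ₀)
      (VectorField.lieBracket ℝ v w) x := by
  have h1 := fun (u : Coord n × ℝ → Coord n × ℝ) (hu : ContDiffAt ℝ ∞ u (S.localCoord s b θ₀ x)) =>
    ((contMDiffAt_vectorSpace_iff_contDiffAt (𝕜 := ℝ)
      (V := fun q => (u q : TangentSpace 𝓘(ℝ, Coord n × ℝ) q))).2 hu).mdifferentiableAt (by simp)
  have h2 : minSmoothness ℝ 2 ≤ (∞ : WithTop ℕ∞) := by
    rw [minSmoothness_of_isRCLikeNormedField]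
    exact WithTop.coe_le_coe.2 (le_top (a := (2 : ℕ∞)))
  have : IsManifold (𝓡 (n + 1)) (minSmoothness ℝ 2) (UnitCircle E) := IsManifold.of_le (n := ∞) h2
  have h3 : VectorField.mlieBracket 𝓘(ℝ, Coord n × ℝ) v w = VectorField.lieBracket ℝ v w :=
    (VectorField.mlieBracketWithin_univ (I := 𝓘(ℝ, Coord n × ℝ)) (V := v)
      (W := w)).symm.trans (VectorField.mlieBracketWithin_eq_lieBracketWithin.trans
        VectorField.lieBracketWithin_univ)
  exact (VectorField.mpullback_mlieBracket (h1 v hv) (h1 w hw) (h.contMDiffAt_localCoord hx)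
    h2).symm.trans (congrArg (fun u => VectorField.mpullback (𝓡 (n + 1)) 𝓘(ℝ, Coord n × ℝ)
      (S.localCoord s b θ₀) u x) h3)

lemma hasFDerivAt_liftField [T2Space B] (hx : x ∈ S.localDomain s W θ₀) (i : Fin n) :
    HasFDerivAt (S.liftField s b i)
      ((0 : (Coord n × ℝ) →L[ℝ] Coord n).prod
        (-(fderiv ℝ (S.connCoeff s b i) (S.localCoord s b θ₀ x).1).comp
          (ContinuousLinearMap.fst ℝ (Coord n) ℝ))) (S.localCoord s b θ₀ x) := by
  have h1 : HasFDerivAt (S.connCoeff s b i) (fderiv ℝ (S.connCoeff s b i) (S.localCoord s b θ₀ x).1)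
      (S.localCoord s b θ₀ x).1 :=
    ((h.contDiffAt_connCoeff hx.1 i).differentiableAt (by simp)).hasFDerivAt
  exact (hasFDerivAt_const (stdVec i : Coord n) (S.localCoord s b θ₀ x)).prodMk
    (HasFDerivAt.comp (g := S.connCoeff s b i) (f := Prod.fst) _ h1 hasFDerivAt_fst).neg

/-- The base components of the lifts are constant and their angle components depend on the base
only, so the bracket is vertical and given by the curl of the connection coefficients. -/
lemma lieBracket_liftField [T2Space B] (hx : x ∈ S.localDomain s W θ₀) (i j : Fin n) :
    VectorField.lieBracket ℝ (S.liftField s b i) (S.liftField s b j) (S.localCoord s b θ₀ x) =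
      (0, -S.curvCoeff s b i j (extChartAt (𝓡 n) b (base x))) := by
  rw [VectorField.lieBracket, (h.hasFDerivAt_liftField hx i).fderiv,
    (h.hasFDerivAt_liftField hx j).fderiv]
  refine Prod.ext ?_ ?_
  · simp [liftField]
  · simp [liftField, curvCoeff, localCoord]
    ring

lemma lieBracket_liftField_vertical [T2Space B] (hx : x ∈ S.localDomain s W θ₀) (i : Fin n) :
    VectorField.lieBracket ℝ (S.liftField s b i) (fun _ => (0, 1)) (S.localCoord s b θ₀ x) = 0 := by
  rw [VectorField.lieBracket, (h.hasFDerivAt_liftField hx i).fderiv]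
  simp

/-- The torsion of the circle bundle is the curvature of `E`. In particular it is constant along the
fibres. -/
lemma torsionCoeff_eq [T2Space B] (hx : x ∈ S.localDomain s W θ₀) (i j : Fin n) :
    S.torsionCoeff b i j x = S.curvCoeff s b i j (extChartAt (𝓡 n) b (base x)) := by
  have h1 : ∀ i, S.coordLift b i =ᶠ[𝓝 x] VectorField.mpullback (𝓡 (n + 1)) 𝓘(ℝ, Coord n × ℝ)
      (S.localCoord s b θ₀) (S.liftField s b i) := fun i => by
    filter_upwards [h.isOpen_localDomain.mem_nhds hx] with y hy
    exact h.coordLift_eq_mpullback hy i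
  obtain ⟨G, hF, hG⟩ := h.exists_hasMFDerivAt_param hx
  rw [torsionCoeff, (h1 i).mlieBracket_vectorField_eq (h1 j)]
  have h2 := (h.mlieBracket_mpullback hx (h.contDiffAt_liftField hx i)
    (h.contDiffAt_liftField hx j)).trans ((mpullback_eq hF _).trans
      (congrArg G (h.lieBracket_liftField hx i j)))
  have h3 : G ((0 : Coord n), -S.curvCoeff s b i j (extChartAt (𝓡 n) b (base x))) =
      (-S.curvCoeff s b i j (extChartAt (𝓡 n) b (base x))) • S.e x := by
    rw [h.e_eq hx hG]
    change _ = _ • G (0, 1)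
    rw [← map_smul]
    simp
  rw [h2, h3, h.eDual_smul_e hx, neg_neg]

/-- The lifts do not depend on the angle, hence commute with `e`. So the term `k/2` disappears from
the connection on `π_* V`. -/
lemma meanCurvature_eq [T2Space B] (hx : x ∈ S.localDomain s W θ₀) (i : Fin n) :
    S.meanCurvature b i x = 0 := by
  have h1 : S.coordLift b i =ᶠ[𝓝 x] VectorField.mpullback (𝓡 (n + 1)) 𝓘(ℝ, Coord n × ℝ)
      (S.localCoord s b θ₀) (S.liftField s b i) := by
    filter_upwards [h.isOpen_localDomain.mem_nhds hx] with y hy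
    exact h.coordLift_eq_mpullback hy i
  have h2 : S.e =ᶠ[𝓝 x] VectorField.mpullback (𝓡 (n + 1)) 𝓘(ℝ, Coord n × ℝ)
      (S.localCoord s b θ₀) (fun _ => ((0, 1) : Coord n × ℝ)) := by
    filter_upwards [h.isOpen_localDomain.mem_nhds hx] with y hy
    exact h.e_eq_mpullback hy
  obtain ⟨G, hF, hG⟩ := h.exists_hasMFDerivAt_param hx
  have h3 := (h.mlieBracket_mpullback hx (h.contDiffAt_liftField hx i)
    (contDiffAt_const (c := ((0, 1) : Coord n × ℝ)))).trans ((mpullback_eq hF _).trans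
      (congrArg G (h.lieBracket_liftField_vertical hx i)))
  have h0 : S.connForm s (base x) (0 : TangentSpace (𝓡 n) (base x)) = 0 := by
    simpa using S.connForm_smul (s := s) (y := base x) 0 0
  rw [meanCurvature, h1.mlieBracket_vectorField_eq h2, h3, h.eDual_eq hx hF, map_zero, map_zero,
    map_zero, h0]
  simp

end IsLocalFrame

end Setting
end Geometry
end CircleEta
end

noncomputable section

namespace CircleEta

section Geometry

variable {n : ℕ} {B : Type*} [TopologicalSpace B] [ChartedSpace (Coord n) B]
  [IsManifold (𝓡 n) ∞ B]
  {E : B → Type*} [TopologicalSpace (TotalSpace Plane E)] [∀ b, NormedAddCommGroup (E b)]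
  [∀ b, InnerProductSpace ℝ (E b)] [FiberBundle Plane E] [VectorBundle ℝ Plane E]
  [ContMDiffVectorBundle ∞ Plane E (𝓡 n)] [IsContMDiffRiemannianBundle (𝓡 n) ∞ Plane E]
  [ChartedSpace (Coord (n + 1)) (UnitCircle E)] [IsManifold (𝓡 (n + 1)) ∞ (UnitCircle E)]
  {V : UnitCircle E → Type*} [TopologicalSpace (TotalSpace ℂ V)] [∀ x, NormedAddCommGroup (V x)]
  [∀ x, InnerProductSpace ℂ (V x)] [FiberBundle ℂ V] [VectorBundle ℝ ℂ V]
  [ContMDiffVectorBundle ∞ ℂ V (𝓡 (n + 1))]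

namespace Setting

variable (S : Setting (n := n) E V)

/-! ### The operators preserve smooth sections -/

section Smooth

variable [T2Space B]

lemma contMDiffAt_e {b : B} {x : UnitCircle E} (hx : base x ∈ chartDomain (n := n) b) :
    ContMDiffAt (𝓡 (n + 1)) ((𝓡 (n + 1)).prod 𝓘(ℝ, Coord (n + 1))) ∞
      (fun y => TotalSpace.mk' (Coord (n + 1)) y (S.e y : TangentSpace (𝓡 (n + 1)) y)) x := by
  obtain ⟨W, s, h, hxW, -⟩ := S.exists_isLocalFrame x hx
  obtain ⟨θ₀, hθ⟩ := h.exists_mem_localDomain hxW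
  exact h.contMDiffAt_e hθ

lemma contMDiffAt_coordLift {b : B} {x : UnitCircle E} (hx : base x ∈ chartDomain (n := n) b)
    (i : Fin n) :
    ContMDiffAt (𝓡 (n + 1)) ((𝓡 (n + 1)).prod 𝓘(ℝ, Coord (n + 1))) ∞
      (fun y => TotalSpace.mk' (Coord (n + 1)) y
        (S.coordLift b i y : TangentSpace (𝓡 (n + 1)) y)) x := by
  obtain ⟨W, s, h, hxW, -⟩ := S.exists_isLocalFrame x hx
  obtain ⟨θ₀, hθ⟩ := h.exists_mem_localDomain hxW
  exact h.contMDiffAt_coordLift hθ i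

lemma IsLocalFrame.contDiffAt_curvCoeff {S : Setting (n := n) E V} {b : B} {W : Set B}
    {s : Π y, E y} (h : S.IsLocalFrame b W s) {y : B} (hy : y ∈ W) (i j : Fin n) :
    ContDiffAt ℝ ∞ (S.curvCoeff s b i j) (extChartAt (𝓡 n) b y) := by
  have h1 : ∀ i j : Fin n, ContDiffAt ℝ ∞ (fun p => fderiv ℝ (S.connCoeff s b j) p (stdVec i))
      (extChartAt (𝓡 n) b y) := fun i j =>
    ((h.contDiffAt_connCoeff hy j).fderiv_right (m := ∞) (by simp)).clm_apply contDiffAt_const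
  exact (h1 i j).sub (h1 j i)

lemma contMDiffAt_torsionCoeff {b : B} {x : UnitCircle E} (hx : base x ∈ chartDomain (n := n) b)
    (i j : Fin n) : ContMDiffAt (𝓡 (n + 1)) 𝓘(ℝ, ℝ) ∞ (S.torsionCoeff b i j) x := by
  obtain ⟨W, s, h, hxW, -⟩ := S.exists_isLocalFrame x hx
  obtain ⟨θ₀, hθ⟩ := h.exists_mem_localDomain hxW
  have h1 : ContMDiffAt (𝓡 (n + 1)) 𝓘(ℝ, Coord n) ∞
      (fun y : UnitCircle E => extChartAt (𝓡 n) b (base y)) x :=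
    (contMDiffAt_extChartAt' hx).comp x (S.contMDiff_base x)
  refine (ContMDiffAt.comp x (h.contDiffAt_curvCoeff hxW i j).contMDiffAt h1).congr_of_eventuallyEq ?_
  filter_upwards [h.isOpen_localDomain.mem_nhds hθ] with y hy
  exact h.torsionCoeff_eq hy i j

lemma meanCurvature_eq_zero {b : B} {x : UnitCircle E} (hx : base x ∈ chartDomain (n := n) b)
    (i : Fin n) : S.meanCurvature b i x = 0 := by
  obtain ⟨W, s, h, hxW, -⟩ := S.exists_isLocalFrame x hx
  obtain ⟨θ₀, hθ⟩ := h.exists_mem_localDomain hxW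
  exact h.meanCurvature_eq hθ i

lemma covDeriv_mem {b : B} {w : Π x : UnitCircle E, TangentSpace (𝓡 (n + 1)) x}
    (hw : ∀ x : UnitCircle E, base x ∈ chartDomain (n := n) b →
      ContMDiffAt (𝓡 (n + 1)) ((𝓡 (n + 1)).prod 𝓘(ℝ, Coord (n + 1))) ∞
      (fun y => TotalSpace.mk' (Coord (n + 1)) y (w y : TangentSpace (𝓡 (n + 1)) y)) x)
    (s : S.smoothSections b) : S.covDeriv b w s ∈ S.smoothSections b := by
  intro x hx
  have hU : IsOpen (base ⁻¹' chartDomain (n := n) b : Set (UnitCircle E)) :=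
    (chartAt (Coord n) b).open_source.preimage S.continuous_base
  -- The cutoff is taken on `B`, where the Hausdorff property is assumed, and pulled back to `M`.
  obtain ⟨χ, hχ, hχU, hχ1⟩ := exists_smooth_cutoff (n := n)
    ((chartAt (Coord n) b).open_source.mem_nhds hx)
  have h1 : tsupport (fun y : UnitCircle E => χ (base y)) ⊆ base ⁻¹' chartDomain (n := n) b :=
    (tsupport_comp_subset_preimage χ S.continuous_base).trans (Set.preimage_mono hχU)
  have h2 := contMDiffAt_covariantDerivative S.connV S.connV_smooth hU (fun y hy => s.2 y hy)
    (hχ.comp S.contMDiff_base) h1 hx (S.continuous_base.continuousAt.eventually hχ1)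
  refine (h2.clm_bundle_apply (hw x hx)).congr_of_eventuallyEq ?_
  filter_upwards [hU.mem_nhds hx] with y hy
  have hy' : base y ∈ chartDomain (n := n) b := hy
  simp [covDeriv, hy']

lemma mulFun_mem {b : B} {r : UnitCircle E → ℝ} (hr : ∀ x : UnitCircle E,
      base x ∈ chartDomain (n := n) b → ContMDiffAt (𝓡 (n + 1)) 𝓘(ℝ, ℝ) ∞ r x)
    (s : S.smoothSections b) : S.mulFun b (fun x => (r x : ℂ)) s ∈ S.smoothSections b := by
  intro x hx
  have hU : IsOpen (base ⁻¹' chartDomain (n := n) b : Set (UnitCircle E)) :=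
    (chartAt (Coord n) b).open_source.preimage S.continuous_base
  refine ((hr x hx).smul_section (s.2 x hx)).congr_of_eventuallyEq ?_
  filter_upwards [hU.mem_nhds hx] with y hy
  have hy' : base y ∈ chartDomain (n := n) b := hy
  simp [mulFun, hy']

variable (b : B)

/-- The derivative `∇_e` on smooth sections. -/
def vertDeriv : S.smoothSections b →ₗ[ℂ] S.smoothSections b :=
  (S.covDeriv b S.e).codRestrict _ (S.covDeriv_mem fun _ hx => S.contMDiffAt_e hx)

/-- The derivative in the direction of the horizontal lift of `∂_i` on smooth sections. -/
def horDeriv (i : Fin n) : S.smoothSections b →ₗ[ℂ] S.smoothSections b :=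
  (S.covDeriv b (S.coordLift b i)).codRestrict _
    (S.covDeriv_mem fun _ hx => S.contMDiffAt_coordLift hx i)

/-- Multiplication with a coefficient of the torsion on smooth sections. -/
def torsionMul (i j : Fin n) : S.smoothSections b →ₗ[ℂ] S.smoothSections b :=
  (S.mulFun b fun x => (S.torsionCoeff b i j x : ℂ)).codRestrict _
    (S.mulFun_mem fun _ hx => S.contMDiffAt_torsionCoeff hx i j)

/-- The superconnection as an operator on smooth forms. -/
def smoothSuperconnection (t : ℝ) : S.LocalForms b →ₗ[ℂ] S.LocalForms b :=
  (Real.sqrt t : ℂ) • TensorProduct.map (cliffordE n) (S.vertDeriv b) +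
    ∑ i, TensorProduct.map (LinearMap.mulLeft ℂ (dy i)) (S.horDeriv b i) -
    (1 / (4 * Real.sqrt t) : ℂ) • ∑ i, ∑ j, if i < j then
      TensorProduct.map (LinearMap.mulLeft ℂ (dy i * dy j) ∘ₗ cliffordE n) (S.torsionMul b i j)
    else 0

lemma _root_.LinearMap.comp_finset_sum {R M N P ι : Type*} [CommRing R] [AddCommGroup M] [Module R M]
    [AddCommGroup N] [Module R N] [AddCommGroup P] [Module R P] (s : Finset ι) (g : N →ₗ[R] P)
    (f : ι → M →ₗ[R] N) : g ∘ₗ (∑ i ∈ s, f i) = ∑ i ∈ s, g ∘ₗ f i := by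
  ext x
  simp [LinearMap.sum_apply]

lemma incl_map (A : Forms n →ₗ[ℂ] Forms n) {P : S.smoothSections b →ₗ[ℂ] Π x, V x}
    {P' : S.smoothSections b →ₗ[ℂ] S.smoothSections b} (h : (S.smoothSections b).subtype ∘ₗ P' = P) :
    S.incl b ∘ₗ TensorProduct.map A P' = TensorProduct.map A P := by
  rw [incl, LinearMap.lTensor_comp_map, h]

lemma incl_injective : Function.Injective (S.incl b) :=
  Module.Flat.lTensor_preserves_injective_linearMap _ (S.smoothSections b).injective_subtype

lemma mulFun_meanCurvature (i : Fin n) :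
    S.mulFun b (fun x => (S.meanCurvature b i x : ℂ)) = 0 := by
  ext s x
  by_cases hx : base x ∈ chartDomain (n := n) b
  · simp [mulFun, S.meanCurvature_eq_zero hx]
  · simp [mulFun, hx]

/-- The operator maps smooth forms to smooth forms, so it can be applied twice. This is what the
choice of a smooth preimage in `curvature` relies on. -/
lemma superconnection_eq (t : ℝ) :
    S.superconnection b t = S.incl b ∘ₗ S.smoothSuperconnection b t := by
  have h1 : S.incl b ∘ₗ TensorProduct.map (cliffordE n) (S.vertDeriv b) = S.dirac b :=
    S.incl_map b _ rfl
  have h2 : S.incl b ∘ₗ ∑ i, TensorProduct.map (LinearMap.mulLeft ℂ (dy i)) (S.horDeriv b i) =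
      S.piConnection b := by
    rw [LinearMap.comp_finset_sum, piConnection]
    refine Finset.sum_congr rfl fun i _ => ?_
    rw [mulFun_meanCurvature, smul_zero, add_zero]
    exact S.incl_map b _ rfl
  have h3 : S.incl b ∘ₗ (∑ i, ∑ j, if i < j then
      TensorProduct.map (LinearMap.mulLeft ℂ (dy i * dy j) ∘ₗ cliffordE n) (S.torsionMul b i j)
      else 0) = S.cliffordT b := by
    rw [LinearMap.comp_finset_sum, cliffordT]
    refine Finset.sum_congr rfl fun i _ => ?_
    rw [LinearMap.comp_finset_sum]
    refine Finset.sum_congr rfl fun j _ => ?_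
    split_ifs
    · exact S.incl_map b _ rfl
    · rw [LinearMap.comp_zero]
  rw [superconnection, smoothSuperconnection, LinearMap.comp_sub, LinearMap.comp_add,
    LinearMap.comp_smul, LinearMap.comp_smul, h1, h2, h3]

/-- Restriction of smooth forms to the fibre. -/
def restrict : S.LocalForms b →ₗ[ℂ] S.FibreForms b := S.restrictForm b ∘ₗ S.incl b

/-- The definition of `curvature` chooses an extension and a preimage. The preimage is unique since
`incl` is injective, and by `hL` the result does not depend on the extension. -/
lemma curvature_restrict (t : ℝ) (L : S.FibreForms b →ₗ[ℂ] S.FibreForms b)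
    (hL : ∀ W, S.restrict b (S.smoothSuperconnection b t (S.smoothSuperconnection b t W)) =
      L (S.restrict b W)) {u : S.FibreForms b} (hu : S.IsSmoothForm b u) :
    S.curvature b t u = L u := by
  have h1 : S.restrictForm b (S.incl b (S.extend b u)) = u := Classical.epsilon_spec hu
  have h2 : (Classical.epsilon fun s => S.incl b s = S.superconnection b t (S.extend b u)) =
      S.smoothSuperconnection b t (S.extend b u) := by
    have h3 : ∃ s, S.incl b s = S.superconnection b t (S.extend b u) :=
      ⟨S.smoothSuperconnection b t (S.extend b u), by rw [superconnection_eq]; rfl⟩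
    apply S.incl_injective b
    rw [Classical.epsilon_spec h3, superconnection_eq]
    rfl
  rw [curvature, h2, superconnection_eq]
  exact (hL (S.extend b u)).trans (congrArg L h1)

end Smooth

end Setting
end Geometry
end CircleEta
end

noncomputable section

namespace CircleEta

section Geometry

variable {n : ℕ} {B : Type*} [TopologicalSpace B] [ChartedSpace (Coord n) B]
  [IsManifold (𝓡 n) ∞ B]
  {E : B → Type*} [TopologicalSpace (TotalSpace Plane E)] [∀ b, NormedAddCommGroup (E b)]
  [∀ b, InnerProductSpace ℝ (E b)] [FiberBundle Plane E] [VectorBundle ℝ Plane E]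
  [ContMDiffVectorBundle ∞ Plane E (𝓡 n)] [IsContMDiffRiemannianBundle (𝓡 n) ∞ Plane E]
  [ChartedSpace (Coord (n + 1)) (UnitCircle E)] [IsManifold (𝓡 (n + 1)) ∞ (UnitCircle E)]
  {V : UnitCircle E → Type*} [TopologicalSpace (TotalSpace ℂ V)] [∀ x, NormedAddCommGroup (V x)]
  [∀ x, InnerProductSpace ℂ (V x)] [FiberBundle ℂ V] [VectorBundle ℝ ℂ V]
  [ContMDiffVectorBundle ∞ ℂ V (𝓡 (n + 1))]

namespace Setting

variable (S : Setting (n := n) E V)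

/-! ### Sections in a local frame of `V` -/

/-- `V` is only given as a real bundle with model fibre `ℂ`; the complex dimension of a fibre is
half its real dimension. -/
lemma finrank_lineFibre (x : UnitCircle E) : Module.finrank ℂ (V x) = 1 := by
  have L := (trivializationAt ℂ V x).continuousLinearEquivAt ℝ x
    (FiberBundle.mem_baseSet_trivializationAt' x)
  have h1 : Module.finrank ℝ (V x) = 2 := by
    rw [L.toLinearEquiv.finrank_eq]
    exact Complex.finrank_real_complex
  have h2 := Module.finrank_mul_finrank ℝ ℂ (V x)
  rw [h1, Complex.finrank_real_complex] at h2
  omega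

/-- The coefficient of a section of `V` in the frame `σ`. -/
def frameCoeff (σ s : Π x, V x) (x : UnitCircle E) : ℂ :=
  (inner ℂ (σ x) (s x) : ℂ) / (inner ℂ (σ x) (σ x) : ℂ)

lemma frameCoeff_smul_frame {σ : Π x, V x} (s : Π x, V x) {x : UnitCircle E} (hx : σ x ≠ 0) :
    frameCoeff σ s x • σ x = s x := by
  obtain ⟨c, hc⟩ := exists_smul_eq_of_finrank_eq_one (finrank_lineFibre x) hx (s x)
  have h1 : (inner ℂ (σ x) (σ x) : ℂ) ≠ 0 := by simpa using hx
  rw [frameCoeff, ← hc, inner_smul_right, mul_div_assoc, div_self h1, mul_one]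

lemma frameCoeff_smul {σ : Π x, V x} {s : Π x, V x} {x : UnitCircle E} (hx : σ x ≠ 0) {c : ℂ}
    (h : s x = c • σ x) : frameCoeff σ s x = c := by
  have h1 : (inner ℂ (σ x) (σ x) : ℂ) ≠ 0 := by simpa using hx
  rw [frameCoeff, h, inner_smul_right, mul_div_assoc, div_self h1, mul_one]

lemma contMDiffAt_frameCoeff (S : Setting (n := n) E V) {σ s : Π x, V x} {x : UnitCircle E} (hσ : SmoothAt (n + 1) ℂ σ x)
    (hs : SmoothAt (n + 1) ℂ s x) (hx : σ x ≠ 0) :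
    ContMDiffAt (𝓡 (n + 1)) 𝓘(ℝ, ℂ) ∞ (frameCoeff σ s) x := by
  have h1 : ContDiffAt ℝ ∞ (fun p : ℂ × ℂ => p.1 * p.2⁻¹)
      ((inner ℂ (σ x) (s x) : ℂ), (inner ℂ (σ x) (σ x) : ℂ)) :=
    contDiffAt_fst.mul (contDiffAt_snd.inv (by simpa using hx))
  exact ContMDiffAt.comp x (g := fun p : ℂ × ℂ => p.1 * p.2⁻¹) h1.contMDiffAt
    ((S.inner_smooth σ s x hσ hs).prodMk_space (S.inner_smooth σ σ x hσ hσ))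

/-- The bundle structure is real, so the multiple is split into `Re g · σ` and `Im g · iσ`;
smoothness of the multiplication by `i` is part of the setting. -/
lemma smoothAt_complex_smul (S : Setting (n := n) E V) {g : UnitCircle E → ℂ} {σ : Π x, V x} {x : UnitCircle E}
    (hg : ContMDiffAt (𝓡 (n + 1)) 𝓘(ℝ, ℂ) ∞ g x) (hσ : SmoothAt (n + 1) ℂ σ x) :
    SmoothAt (n + 1) ℂ (fun y => g y • σ y) x := by
  have hre : ContMDiffAt (𝓡 (n + 1)) 𝓘(ℝ, ℝ) ∞ (fun y => (g y).re) x :=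
    Complex.reCLM.contDiff.contMDiff.contMDiffAt.comp x hg
  have him : ContMDiffAt (𝓡 (n + 1)) 𝓘(ℝ, ℝ) ∞ (fun y => (g y).im) x :=
    Complex.imCLM.contDiff.contMDiff.contMDiffAt.comp x hg
  refine ((hre.smul_section hσ).add_section
    (him.smul_section (S.I_smul_smooth σ x hσ))).congr_of_eventuallyEq (Eventually.of_forall ?_)
  intro y
  refine congrArg (TotalSpace.mk' ℂ y) ?_
  change g y • σ y = (g y).re • σ y + (g y).im • Complex.I • σ y
  rw [← Complex.coe_smul, ← Complex.coe_smul, smul_smul, ← add_smul, Complex.re_add_im]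

/-- The real Leibniz rule applies to the real and the imaginary part of `g`, and the connection
commutes with the multiplication by `i`. -/
lemma connV_complex_smul {g : UnitCircle E → ℂ} {σ : Π x, V x} {x : UnitCircle E}
    (hg : ContMDiffAt (𝓡 (n + 1)) 𝓘(ℝ, ℂ) ∞ g x) (hσ : SmoothAt (n + 1) ℂ σ x)
    (w : TangentSpace (𝓡 (n + 1)) x) :
    S.connV (fun y => g y • σ y) x w =
      mvfderiv (𝓡 (n + 1)) g x w • σ x + g x • S.connV σ x w := by
  have hre : ContMDiffAt (𝓡 (n + 1)) 𝓘(ℝ, ℝ) ∞ (fun y => (g y).re) x :=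
    Complex.reCLM.contDiff.contMDiff.contMDiffAt.comp x hg
  have him : ContMDiffAt (𝓡 (n + 1)) 𝓘(ℝ, ℝ) ∞ (fun y => (g y).im) x :=
    Complex.imCLM.contDiff.contMDiff.contMDiffAt.comp x hg
  have hg' := (hg.mdifferentiableAt (by simp)).hasMFDerivAt
  have hre' : mvfderiv (𝓡 (n + 1)) (fun y => (g y).re) x w =
      (mvfderiv (𝓡 (n + 1)) g x w).re :=
    DFunLike.congr_fun (HasMFDerivAt.comp x Complex.reCLM.hasFDerivAt.hasMFDerivAt hg').mfderiv w
  have him' : mvfderiv (𝓡 (n + 1)) (fun y => (g y).im) x w =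
      (mvfderiv (𝓡 (n + 1)) g x w).im :=
    DFunLike.congr_fun (HasMFDerivAt.comp x Complex.imCLM.hasFDerivAt.hasMFDerivAt hg').mfderiv w
  have hIσ := S.I_smul_smooth σ x hσ
  have h0 : (fun y => g y • σ y) = (fun y => (g y).re) • σ + (fun y => (g y).im) •
      fun y => Complex.I • σ y := by
    funext y
    change g y • σ y = (g y).re • σ y + (g y).im • Complex.I • σ y
    rw [← Complex.coe_smul, ← Complex.coe_smul, smul_smul, ← add_smul, Complex.re_add_im]
  rw [h0, S.connV.isCovariantDerivativeOnUniv.add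
      ((hre.smul_section hσ).mdifferentiableAt (by simp))
      ((him.smul_section hIσ).mdifferentiableAt (by simp)),
    S.connV.isCovariantDerivativeOnUniv.leibniz (hσ.mdifferentiableAt (by simp))
      (hre.mdifferentiableAt (by simp)),
    S.connV.isCovariantDerivativeOnUniv.leibniz (hIσ.mdifferentiableAt (by simp))
      (him.mdifferentiableAt (by simp))]
  simp only [add_apply, smul_apply, ContinuousLinearMap.smulRight_apply]
  rw [hre', him', S.connV_I_smul σ x hσ]
  set z : ℂ := mvfderiv (𝓡 (n + 1)) g x w
  conv_rhs => rw [← Complex.re_add_im z, ← Complex.re_add_im (g x)]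
  simp only [← Complex.coe_smul, add_smul, mul_smul]
  abel

/-- The connection in a local eigenframe. -/
lemma IsLocalEigenframe.connV_eq {S : Setting (n := n) E V} {U : Set B} {σ : Π x, V x} {f : B → ℝ}
    {β : Π y : B, TangentSpace (𝓡 n) y →L[ℝ] ℂ} (hσ : S.IsLocalEigenframe U σ f β)
    {s : Π x, V x} {x : UnitCircle E} (hx : base x ∈ U) (hs : SmoothAt (n + 1) ℂ s x)
    (w : Π y : UnitCircle E, TangentSpace (𝓡 (n + 1)) y) :
    frameCoeff σ (fun y => S.connV s y (w y)) x =
      mvfderiv (𝓡 (n + 1)) (frameCoeff σ s) x (w x) +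
      frameCoeff σ s x *
        (Complex.I * f (base x) * S.eDual x (w x) + β (base x) (dbase (n := n) x (w x))) := by
  have hσx := hσ.smooth x hx
  have hg := S.contMDiffAt_frameCoeff hσx hs (hσ.ne_zero x hx)
  refine frameCoeff_smul (hσ.ne_zero x hx) ?_
  have h1 : S.connV s x = S.connV (fun y => frameCoeff σ s y • σ y) x := by
    refine S.connV.isCovariantDerivativeOnUniv.congr_of_eventuallyEq (hs.mdifferentiableAt (by simp))
      ((S.smoothAt_complex_smul hg hσx).mdifferentiableAt (by simp)) Filter.univ_mem ?_
    filter_upwards [(hσ.isOpen.preimage S.continuous_base).mem_nhds hx] with y hy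
    exact (frameCoeff_smul_frame s (hσ.ne_zero y hy)).symm
  rw [h1, S.connV_complex_smul hg hσx, hσ.connection x hx, smul_smul, ← add_smul]

end Setting
end Geometry
end CircleEta
end

noncomputable section

namespace CircleEta

section Geometry

variable {n : ℕ} {B : Type*} [TopologicalSpace B] [ChartedSpace (Coord n) B]
  [IsManifold (𝓡 n) ∞ B]
  {E : B → Type*} [TopologicalSpace (TotalSpace Plane E)] [∀ b, NormedAddCommGroup (E b)]
  [∀ b, InnerProductSpace ℝ (E b)] [FiberBundle Plane E] [VectorBundle ℝ Plane E]
  [ContMDiffVectorBundle ∞ Plane E (𝓡 n)] [IsContMDiffRiemannianBundle (𝓡 n) ∞ Plane E]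
  [ChartedSpace (Coord (n + 1)) (UnitCircle E)] [IsManifold (𝓡 (n + 1)) ∞ (UnitCircle E)]
  {V : UnitCircle E → Type*} [TopologicalSpace (TotalSpace ℂ V)] [∀ x, NormedAddCommGroup (V x)]
  [∀ x, InnerProductSpace ℂ (V x)] [FiberBundle ℂ V] [VectorBundle ℝ ℂ V]
  [ContMDiffVectorBundle ∞ ℂ V (𝓡 (n + 1))]

namespace Setting

variable (S : Setting (n := n) E V)

/-! ### The commutators of the derivatives -/

/-- The commutator of two first order operators `g ↦ dg(v) + θ g`. -/
lemma _root_.VectorField.commutator_first_order {F : Type*} [NormedAddCommGroup F] [NormedSpace ℝ F]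
    {g G₁ G₂ θ η : F → ℂ} {v w : F → F} {q : F} (hg : ContDiffAt ℝ ∞ g q)
    (hv : DifferentiableAt ℝ v q) (hw : DifferentiableAt ℝ w q) (hθ : DifferentiableAt ℝ θ q)
    (hη : DifferentiableAt ℝ η q) (h₁ : ∀ᶠ p in 𝓝 q, G₁ p = fderiv ℝ g p (w p) + η p * g p)
    (h₂ : ∀ᶠ p in 𝓝 q, G₂ p = fderiv ℝ g p (v p) + θ p * g p) :
    (fderiv ℝ G₁ q (v q) + θ q * G₁ q) - (fderiv ℝ G₂ q (w q) + η q * G₂ q) =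
      fderiv ℝ g q (VectorField.lieBracket ℝ v w q) +
        (fderiv ℝ η q (v q) - fderiv ℝ θ q (w q)) * g q := by
  have hg1 : DifferentiableAt ℝ g q := hg.differentiableAt (by simp)
  have hg2 : DifferentiableAt ℝ (fderiv ℝ g) q :=
    (hg.fderiv_right (m := ∞) (by simp)).differentiableAt (by simp)
  have e1 : fderiv ℝ G₁ q = fderiv ℝ (fun p => fderiv ℝ g p (w p)) q +
      (η q • fderiv ℝ g q + g q • fderiv ℝ η q) := by
    rw [Filter.EventuallyEq.fderiv_eq h₁]
    exact ((hg2.clm_apply hw).hasFDerivAt.add (hη.hasFDerivAt.mul hg1.hasFDerivAt)).fderiv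
  have e2 : fderiv ℝ G₂ q = fderiv ℝ (fun p => fderiv ℝ g p (v p)) q +
      (θ q • fderiv ℝ g q + g q • fderiv ℝ θ q) := by
    rw [Filter.EventuallyEq.fderiv_eq h₂]
    exact ((hg2.clm_apply hv).hasFDerivAt.add (hθ.hasFDerivAt.mul hg1.hasFDerivAt)).fderiv
  rw [← VectorField.fderiv_lieBracket hg hv hw, e1, e2, h₁.self_of_nhds, h₂.self_of_nhds]
  simp only [add_apply, smul_apply, smul_eq_mul]
  ring

/-- The coefficient of a section of `V` in the frame `σ`, in local coordinates. -/
def localCoeff {s₀ : Π y, E y} (hs₀ : ∀ y, ‖s₀ y‖ = 1) (b : B) (σ s : Π x, V x)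
    (q : Coord n × ℝ) : ℂ :=
  frameCoeff σ s (S.localParam hs₀ b q)

namespace IsLocalFrame

variable {S} {b : B} {W : Set B} {s₀ : Π y, E y} (h : S.IsLocalFrame b W s₀) {θ₀ : ℝ}
  {x : UnitCircle E} {U : Set B} {σ : Π x, V x} {f : B → ℝ}
  {β : Π y : B, TangentSpace (𝓡 n) y →L[ℝ] ℂ}

include h

/-- The coordinates and the parametrization have inverse differentials, so a field pulled back from
the coordinates differentiates as the original field does. -/
lemma mvfderiv_mpullback (hx : x ∈ S.localDomain s₀ W θ₀) {g : UnitCircle E → ℂ}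
    (hg : MDifferentiableAt (𝓡 (n + 1)) 𝓘(ℝ, ℂ) g x) (v : Coord n × ℝ → Coord n × ℝ) :
    mvfderiv (𝓡 (n + 1)) g x (VectorField.mpullback (𝓡 (n + 1)) 𝓘(ℝ, Coord n × ℝ)
      (S.localCoord s₀ b θ₀) v x) =
    fderiv ℝ (g ∘ S.localParam h.norm_eq b) (S.localCoord s₀ b θ₀ x)
      (v (S.localCoord s₀ b θ₀ x)) := by
  obtain ⟨G, hF, hG⟩ := h.exists_hasMFDerivAt_param hx
  have hpt := h.localParam_localCoord (θ₀ := θ₀) hx.1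
  have h1 : HasMFDerivAt (𝓡 (n + 1)) 𝓘(ℝ, ℂ) g (S.localParam h.norm_eq b (S.localCoord s₀ b θ₀ x))
      (show Coord (n + 1) →L[ℝ] ℂ from mfderiv (𝓡 (n + 1)) 𝓘(ℝ, ℂ) g x) := by
    rw [hpt]
    exact hg.hasMFDerivAt
  have h2 : HasFDerivAt (g ∘ S.localParam h.norm_eq b)
      ((show Coord (n + 1) →L[ℝ] ℂ from mfderiv (𝓡 (n + 1)) 𝓘(ℝ, ℂ) g x).comp
        (show (Coord n × ℝ) →L[ℝ] Coord (n + 1) from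
          (G : (Coord n × ℝ) →L[ℝ] TangentSpace (𝓡 (n + 1)) x))) (S.localCoord s₀ b θ₀ x) :=
    (HasMFDerivAt.comp _ h1 hG).hasFDerivAt
  rw [mpullback_eq hF, h2.fderiv]
  rfl

lemma eventually_localParam_mem (hx : x ∈ S.localDomain s₀ W θ₀) {P : UnitCircle E → Prop}
    (hP : ∀ᶠ y in 𝓝 x, P y) :
    ∀ᶠ q in 𝓝 (S.localCoord s₀ b θ₀ x), P (S.localParam h.norm_eq b q) ∧
      S.localParam h.norm_eq b q ∈ S.localDomain s₀ W θ₀ ∧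
      S.localCoord s₀ b θ₀ (S.localParam h.norm_eq b q) = q := by
  have h1 := (h.contMDiffAt_param hx).continuousAt
  rw [ContinuousAt, h.localParam_localCoord hx.1] at h1
  filter_upwards [h1.eventually hP, h1.eventually (h.isOpen_localDomain.mem_nhds hx),
    h.eventually_localCoord_localParam hx] with q hq1 hq2 hq3
  exact ⟨hq1, hq2, hq3⟩

lemma mem_chartDomain (hx : x ∈ S.localDomain s₀ W θ₀) : base x ∈ chartDomain (n := n) b :=
  h.subset hx.1

lemma contDiffAt_localCoeff (hσ : S.IsLocalEigenframe U σ f β) (hx : x ∈ S.localDomain s₀ W θ₀)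
    (hxU : base x ∈ U) (s : S.smoothSections b) :
    ContDiffAt ℝ ∞ (S.localCoeff h.norm_eq b σ s.1) (S.localCoord s₀ b θ₀ x) := by
  have h1 := S.contMDiffAt_frameCoeff (hσ.smooth x hxU) (s.2 x (h.mem_chartDomain hx))
    (hσ.ne_zero x hxU)
  have hpt := h.localParam_localCoord (θ₀ := θ₀) hx.1
  have h2 : ContMDiffAt (𝓡 (n + 1)) 𝓘(ℝ, ℂ) ∞ (frameCoeff σ s.1)
      (S.localParam h.norm_eq b (S.localCoord s₀ b θ₀ x)) := by rw [hpt]; exact h1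
  exact (ContMDiffAt.comp _ h2 (h.contMDiffAt_param hx)).contDiffAt

variable [T2Space B]

/-- In the frame `σ` and in local coordinates `∇_w` is a first order operator with an explicit term
of order zero. The identity is needed on a neighbourhood because the commutators differentiate it
once more. -/
lemma localCoeff_derivative (hσ : S.IsLocalEigenframe U σ f β) (hx : x ∈ S.localDomain s₀ W θ₀)
    (hxU : base x ∈ U) (s s' : S.smoothSections b)
    {w : Π y : UnitCircle E, TangentSpace (𝓡 (n + 1)) y} {v : Coord n × ℝ → Coord n × ℝ}
    (hw : ∀ y ∈ S.localDomain s₀ W θ₀, w y = VectorField.mpullback (𝓡 (n + 1)) 𝓘(ℝ, Coord n × ℝ)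
      (S.localCoord s₀ b θ₀) v y)
    (hs' : ∀ y, base y ∈ chartDomain (n := n) b → s'.1 y = S.connV s.1 y (w y)) :
    ∀ᶠ q in 𝓝 (S.localCoord s₀ b θ₀ x), S.localCoeff h.norm_eq b σ s'.1 q =
      fderiv ℝ (S.localCoeff h.norm_eq b σ s.1) q (v q) +
        (Complex.I * f (base (S.localParam h.norm_eq b q)) *
          S.eDual (S.localParam h.norm_eq b q) (w (S.localParam h.norm_eq b q)) +
        β (base (S.localParam h.norm_eq b q)) (dbase (n := n) (S.localParam h.norm_eq b q)
          (w (S.localParam h.norm_eq b q)))) * S.localCoeff h.norm_eq b σ s.1 q := by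
  filter_upwards [h.eventually_localParam_mem hx
    ((hσ.isOpen.preimage S.continuous_base).mem_nhds hxU)] with q ⟨hqU, hqx, hq⟩
  have hsy := s.2 _ (h.mem_chartDomain hqx)
  have h1 := hσ.connV_eq hqU hsy w
  have h2 : S.localCoeff h.norm_eq b σ s'.1 q =
      frameCoeff σ (fun y => S.connV s.1 y (w y)) (S.localParam h.norm_eq b q) := by
    simp only [localCoeff, frameCoeff]
    rw [hs' _ (h.mem_chartDomain hqx)]
  have h3 := S.contMDiffAt_frameCoeff (hσ.smooth _ hqU) hsy (hσ.ne_zero _ hqU)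
  have h4 := h.mvfderiv_mpullback hqx (h3.mdifferentiableAt (by simp)) v
  rw [h2, h1]
  nth_rewrite 1 [hw _ hqx]
  rw [h4, hq, mul_comm (frameCoeff σ s.1 _)]
  rfl

/-- As `e^*(e) = 1` and `dπ(e) = 0`, the operator `∇_e` becomes `∂_θ + i f`. -/
lemma localCoeff_vertDeriv (hσ : S.IsLocalEigenframe U σ f β) (hx : x ∈ S.localDomain s₀ W θ₀)
    (hxU : base x ∈ U) (s : S.smoothSections b) :
    ∀ᶠ q in 𝓝 (S.localCoord s₀ b θ₀ x), S.localCoeff h.norm_eq b σ (S.vertDeriv b s).1 q =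
      fderiv ℝ (S.localCoeff h.norm_eq b σ s.1) q (0, 1) +
        (Complex.I * f ((extChartAt (𝓡 n) b).symm q.1)) * S.localCoeff h.norm_eq b σ s.1 q := by
  filter_upwards [h.localCoeff_derivative hσ hx hxU s (S.vertDeriv b s)
    (fun y hy => h.e_eq_mpullback hy) (fun y hy => by simp [vertDeriv, covDeriv, hy]),
    h.eventually_localParam_mem hx (P := fun _ => True) (by simp)] with q hq ⟨_, hqx, _⟩
  rw [hq, h.eDual_e hqx, h.dbase_e hqx, map_zero, add_zero, Complex.ofReal_one, mul_one]
  rfl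

/-- On a horizontal lift `e^*` vanishes, so only `β` contributes to the term of order zero. -/
lemma localCoeff_horDeriv (hσ : S.IsLocalEigenframe U σ f β) (hx : x ∈ S.localDomain s₀ W θ₀)
    (hxU : base x ∈ U) (s : S.smoothSections b) (i : Fin n) :
    ∀ᶠ q in 𝓝 (S.localCoord s₀ b θ₀ x), S.localCoeff h.norm_eq b σ (S.horDeriv b i s).1 q =
      fderiv ℝ (S.localCoeff h.norm_eq b σ s.1) q (S.liftField s₀ b i q) +
        β ((extChartAt (𝓡 n) b).symm q.1) (coordField b i ((extChartAt (𝓡 n) b).symm q.1)) *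
          S.localCoeff h.norm_eq b σ s.1 q := by
  filter_upwards [h.localCoeff_derivative hσ hx hxU s (S.horDeriv b i s)
    (fun y hy => h.coordLift_eq_mpullback hy i) (fun y hy => by simp [horDeriv, covDeriv, hy]),
    h.eventually_localParam_mem hx (P := fun _ => True) (by simp)] with q hq ⟨_, hqx, _⟩
  rw [hq, h.eDual_coordLift hqx, h.dbase_coordLift hqx, Complex.ofReal_zero, mul_zero, zero_add]
  rfl

lemma localCoeff_torsionMul (hσ : S.IsLocalEigenframe U σ f β) (hx : x ∈ S.localDomain s₀ W θ₀)
    (hxU : base x ∈ U) (s : S.smoothSections b) (i j : Fin n) :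
    ∀ᶠ q in 𝓝 (S.localCoord s₀ b θ₀ x), S.localCoeff h.norm_eq b σ (S.torsionMul b i j s).1 q =
      (S.curvCoeff s₀ b i j q.1 : ℂ) * S.localCoeff h.norm_eq b σ s.1 q := by
  filter_upwards [h.eventually_localParam_mem hx
    ((hσ.isOpen.preimage S.continuous_base).mem_nhds hxU)] with q ⟨hqU, hqx, hq⟩
  refine frameCoeff_smul (hσ.ne_zero _ hqU) ?_
  have h1 : extChartAt (𝓡 n) b (base (S.localParam h.norm_eq b q)) = q.1 := congrArg Prod.fst hq
  have h2 : (S.torsionMul b i j s).1 (S.localParam h.norm_eq b q) =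
      (S.torsionCoeff b i j (S.localParam h.norm_eq b q) : ℂ) • s.1 (S.localParam h.norm_eq b q) := by
    simp [torsionMul, mulFun, h.mem_chartDomain hqx]
  rw [h2, h.torsionCoeff_eq hqx, h1, mul_smul, localCoeff, frameCoeff_smul_frame _ (hσ.ne_zero _ hqU)]

end IsLocalFrame

end Setting
end Geometry
end CircleEta
end

noncomputable section

namespace CircleEta

section Geometry

variable {n : ℕ} {B : Type*} [TopologicalSpace B] [ChartedSpace (Coord n) B]
  [IsManifold (𝓡 n) ∞ B]
  {E : B → Type*} [TopologicalSpace (TotalSpace Plane E)] [∀ b, NormedAddCommGroup (E b)]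
  [∀ b, InnerProductSpace ℝ (E b)] [FiberBundle Plane E] [VectorBundle ℝ Plane E]
  [ContMDiffVectorBundle ∞ Plane E (𝓡 n)] [IsContMDiffRiemannianBundle (𝓡 n) ∞ Plane E]
  [ChartedSpace (Coord (n + 1)) (UnitCircle E)] [IsManifold (𝓡 (n + 1)) ∞ (UnitCircle E)]
  {V : UnitCircle E → Type*} [TopologicalSpace (TotalSpace ℂ V)] [∀ x, NormedAddCommGroup (V x)]
  [∀ x, InnerProductSpace ℂ (V x)] [FiberBundle ℂ V] [VectorBundle ℝ ℂ V]
  [ContMDiffVectorBundle ∞ ℂ V (𝓡 (n + 1))]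

namespace Setting

variable (S : Setting (n := n) E V)

/-! ### The commutators at a point and the rotation of the fibres -/

namespace IsLocalFrame

variable {S} {b : B} {W : Set B} {s₀ : Π y, E y} (h : S.IsLocalFrame b W s₀) {θ₀ : ℝ}
  {x : UnitCircle E} {U : Set B} {σ : Π x, V x} {f : B → ℝ}
  {β : Π y : B, TangentSpace (𝓡 n) y →L[ℝ] ℂ}

/-- The partial derivative at `y` in the chart at `b`. -/
def _root_.CircleEta.chartPartial (b : B) (i : Fin n) (g : B → ℂ) (y : B) : ℂ :=
  fderiv ℝ (fun p => g ((extChartAt (𝓡 n) b).symm p)) (extChartAt (𝓡 n) b y) (stdVec i)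

lemma _root_.CircleEta.differentiableAt_comp_chart_symm {b y : B} (hy : y ∈ chartDomain (n := n) b)
    {g : B → ℂ} (hg : ContMDiffAt (𝓡 n) 𝓘(ℝ, ℂ) ∞ g y) :
    DifferentiableAt ℝ (fun p => g ((extChartAt (𝓡 n) b).symm p)) (extChartAt (𝓡 n) b y) := by
  have h1 : (extChartAt (𝓡 n) b).symm (extChartAt (𝓡 n) b y) = y :=
    (extChartAt (𝓡 n) b).left_inv (by rw [extChartAt_source]; exact hy)
  rw [← h1] at hg
  have h3 := ((contMDiffOn_extChartAt_symm b).contMDiffAt (n := ∞) (I := 𝓡 n)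
    (extChartAt_target_mem_nhds' ((extChartAt (𝓡 n) b).map_source
      (by rw [extChartAt_source]; exact hy))))
  exact (ContMDiffAt.comp _ hg h3).contDiffAt.differentiableAt (by simp)

lemma _root_.CircleEta.hasFDerivAt_chart_fst {s₀ : Π y, E y} {b : B} {x : UnitCircle E}
    (hx : base x ∈ chartDomain (n := n) b)
    {g : B → ℂ} (hg : ContMDiffAt (𝓡 n) 𝓘(ℝ, ℂ) ∞ g (base x)) :
    HasFDerivAt (fun q : Coord n × ℝ => g ((extChartAt (𝓡 n) b).symm q.1))
      ((fderiv ℝ (fun p => g ((extChartAt (𝓡 n) b).symm p)) (extChartAt (𝓡 n) b (base x))).comp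
        (ContinuousLinearMap.fst ℝ (Coord n) ℝ)) (S.localCoord s₀ b θ₀ x) :=
  HasFDerivAt.comp (g := fun p => g ((extChartAt (𝓡 n) b).symm p)) (f := Prod.fst)
    (S.localCoord s₀ b θ₀ x) (differentiableAt_comp_chart_symm hx hg).hasFDerivAt hasFDerivAt_fst

include h

lemma eq_localCoeff_smul (hσ : S.IsLocalEigenframe U σ f β) (hx : x ∈ S.localDomain s₀ W θ₀)
    (hxU : base x ∈ U) (s : Π x, V x) :
    s x = S.localCoeff h.norm_eq b σ s (S.localCoord s₀ b θ₀ x) • σ x := by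
  rw [localCoeff, h.localParam_localCoord hx.1, frameCoeff_smul_frame s (hσ.ne_zero x hxU)]

variable [T2Space B]

/-- The lift of `∂_i` commutes with `e` and `β` does not depend on the angle, so only the derivative
of `i f` is left. -/
lemma horDeriv_vertDeriv (hσ : S.IsLocalEigenframe U σ f β) (hx : x ∈ S.localDomain s₀ W θ₀)
    (hbU : b ∈ U) (hxb : base x = b) (s : S.smoothSections b) (i : Fin n) :
    (S.horDeriv b i (S.vertDeriv b s)).1 x - (S.vertDeriv b (S.horDeriv b i s)).1 x =
      (Complex.I * chartPartial b i (fun y => (f y : ℂ)) (base x)) • s.1 x := by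
  have hb := h.mem_chartDomain hx
  have hxU : base x ∈ U := hxb ▸ hbU
  -- The smoothness of `β` at a point is given in the chart at that same point, which is why the
  -- commutators are taken over `b` only.
  have hβ : ∀ i, ContMDiffAt (𝓡 n) 𝓘(ℝ, ℂ) ∞ (fun z => β z (coordField b i z)) (base x) := by
    rw [hxb]
    exact hσ.smooth_form b hbU
  have hf : ContMDiffAt (𝓡 n) 𝓘(ℝ, ℂ) ∞ (fun y => (f y : ℂ)) (base x) :=
    Complex.ofRealCLM.contDiff.contMDiff.contMDiffAt.comp _ (hσ.smooth_eigenvalue _ hxU)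
  have d1 := hasFDerivAt_chart_fst (S := S) (θ₀ := θ₀) (s₀ := s₀) hb (hβ i)
  have d2 := (hasFDerivAt_chart_fst (S := S) (θ₀ := θ₀) (s₀ := s₀) hb hf).const_mul Complex.I
  have key := VectorField.commutator_first_order (h.contDiffAt_localCoeff hσ hx hxU s)
    (h.hasFDerivAt_liftField hx i).differentiableAt
    (differentiableAt_const ((0, 1) : Coord n × ℝ)) d1.differentiableAt d2.differentiableAt
    (h.localCoeff_vertDeriv hσ hx hxU s) (h.localCoeff_horDeriv hσ hx hxU s i)
  rw [← (h.localCoeff_horDeriv hσ hx hxU (S.vertDeriv b s) i).self_of_nhds,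
    ← (h.localCoeff_vertDeriv hσ hx hxU (S.horDeriv b i s)).self_of_nhds,
    h.lieBracket_liftField_vertical hx, d1.fderiv, d2.fderiv] at key
  rw [h.eq_localCoeff_smul hσ hx hxU (S.horDeriv b i (S.vertDeriv b s)).1,
    h.eq_localCoeff_smul hσ hx hxU (S.vertDeriv b (S.horDeriv b i s)).1,
    h.eq_localCoeff_smul hσ hx hxU s.1, ← sub_smul, smul_smul, key]
  simp [liftField, chartPartial]

/-- The bracket of the lifts is `-T_{ij} e`, and differentiation along `e` in the frame is `∇_e - i
f`; this yields both `-T_{ij} ∇_e` and `i f T_{ij}`. The rest is `dβ`. -/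
lemma horDeriv_horDeriv (hσ : S.IsLocalEigenframe U σ f β) (hx : x ∈ S.localDomain s₀ W θ₀)
    (hbU : b ∈ U) (hxb : base x = b) (s : S.smoothSections b) (i j : Fin n) :
    (S.horDeriv b i (S.horDeriv b j s)).1 x - (S.horDeriv b j (S.horDeriv b i s)).1 x =
      -((S.torsionCoeff b i j x : ℂ) • (S.vertDeriv b s).1 x) +
      (Complex.I * f (base x) * S.torsionCoeff b i j x +
        (chartPartial b i (fun y => β y (coordField b j y)) (base x) -
        chartPartial b j (fun y => β y (coordField b i y)) (base x))) • s.1 x := by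
  have hb := h.mem_chartDomain hx
  have hxU : base x ∈ U := hxb ▸ hbU
  have hβ : ∀ i, ContMDiffAt (𝓡 n) 𝓘(ℝ, ℂ) ∞ (fun z => β z (coordField b i z)) (base x) := by
    rw [hxb]
    exact hσ.smooth_form b hbU
  have d : ∀ i, _ := fun i =>
    hasFDerivAt_chart_fst (S := S) (θ₀ := θ₀) (s₀ := s₀) hb (hβ i)
  have key := VectorField.commutator_first_order (h.contDiffAt_localCoeff hσ hx hxU s)
    (h.hasFDerivAt_liftField hx i).differentiableAt
    (h.hasFDerivAt_liftField hx j).differentiableAt (d i).differentiableAt (d j).differentiableAt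
    (h.localCoeff_horDeriv hσ hx hxU s j) (h.localCoeff_horDeriv hσ hx hxU s i)
  have hv := (h.localCoeff_vertDeriv hσ hx hxU s).self_of_nhds
  have h1 : (extChartAt (𝓡 n) b).symm (S.localCoord s₀ b θ₀ x).1 = base x :=
    (extChartAt (𝓡 n) b).left_inv (by rw [extChartAt_source]; exact hb)
  rw [h1] at hv
  have h2 : ((0 : Coord n), -S.curvCoeff s₀ b i j (extChartAt (𝓡 n) b (base x))) =
      (-S.curvCoeff s₀ b i j (extChartAt (𝓡 n) b (base x))) • ((0 : Coord n), (1 : ℝ)) := by simp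
  rw [← (h.localCoeff_horDeriv hσ hx hxU (S.horDeriv b j s) i).self_of_nhds,
    ← (h.localCoeff_horDeriv hσ hx hxU (S.horDeriv b i s) j).self_of_nhds,
    h.lieBracket_liftField hx, (d i).fderiv, (d j).fderiv, h2, map_smul,
    eq_sub_iff_add_eq.2 hv.symm] at key
  rw [h.eq_localCoeff_smul hσ hx hxU (S.horDeriv b i (S.horDeriv b j s)).1,
    h.eq_localCoeff_smul hσ hx hxU (S.horDeriv b j (S.horDeriv b i s)).1,
    h.eq_localCoeff_smul hσ hx hxU (S.vertDeriv b s).1,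
    h.eq_localCoeff_smul hσ hx hxU s.1, ← sub_smul, smul_smul, smul_smul, ← neg_smul, ← add_smul,
    key, h.torsionCoeff_eq hx]
  congr 1
  simp only [liftField, chartPartial, ContinuousLinearMap.comp_apply, ContinuousLinearMap.coe_fst',
    Complex.real_smul]
  push_cast
  ring

/-- The torsion is a function on the base, so the commutator is the multiplication by `∂_k T_{ij}`.
-/
lemma horDeriv_torsionMul (hσ : S.IsLocalEigenframe U σ f β) (hx : x ∈ S.localDomain s₀ W θ₀)
    (hxU : base x ∈ U) (s : S.smoothSections b) (i j k : Fin n) :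
    (S.horDeriv b k (S.torsionMul b i j s)).1 x - (S.torsionMul b i j (S.horDeriv b k s)).1 x =
      (fderiv ℝ (S.curvCoeff s₀ b i j) (extChartAt (𝓡 n) b (base x)) (stdVec k) : ℂ) • s.1 x := by
  have hq : (S.localCoord s₀ b θ₀ x).1 = extChartAt (𝓡 n) b (base x) := rfl
  have d1 : HasFDerivAt (fun q : Coord n × ℝ => (S.curvCoeff s₀ b i j q.1 : ℂ))
      (Complex.ofRealCLM.comp ((fderiv ℝ (S.curvCoeff s₀ b i j) (extChartAt (𝓡 n) b (base x))).comp
        (ContinuousLinearMap.fst ℝ (Coord n) ℝ))) (S.localCoord s₀ b θ₀ x) := by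
    have h1 := ((h.contDiffAt_curvCoeff hx.1 i j).differentiableAt (by simp)).hasFDerivAt
    exact Complex.ofRealCLM.hasFDerivAt.comp _
      (HasFDerivAt.comp (g := S.curvCoeff s₀ b i j) (f := Prod.fst) (S.localCoord s₀ b θ₀ x) h1
        hasFDerivAt_fst)
  have d2 := ((h.contDiffAt_localCoeff hσ hx hxU s).differentiableAt (by simp)).hasFDerivAt
  have e1 : fderiv ℝ (S.localCoeff h.norm_eq b σ (S.torsionMul b i j s).1)
      (S.localCoord s₀ b θ₀ x) = _ :=
    (Filter.EventuallyEq.fderiv_eq (h.localCoeff_torsionMul hσ hx hxU s i j)).trans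
      (d1.mul d2).fderiv
  have k1 := (h.localCoeff_horDeriv hσ hx hxU (S.torsionMul b i j s) k).self_of_nhds
  rw [e1, (h.localCoeff_torsionMul hσ hx hxU s i j).self_of_nhds] at k1
  have k2 := (h.localCoeff_torsionMul hσ hx hxU (S.horDeriv b k s) i j).self_of_nhds
  rw [(h.localCoeff_horDeriv hσ hx hxU s k).self_of_nhds] at k2
  rw [h.eq_localCoeff_smul hσ hx hxU (S.horDeriv b k (S.torsionMul b i j s)).1,
    h.eq_localCoeff_smul hσ hx hxU (S.torsionMul b i j (S.horDeriv b k s)).1,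
    h.eq_localCoeff_smul hσ hx hxU s.1, ← sub_smul, smul_smul, k1, k2]
  congr 1
  simp [liftField, localCoord]
  ring

omit [T2Space B] in
lemma torsionMul_apply [T2Space B] (hx : base x ∈ chartDomain (n := n) b)
    (s : S.smoothSections b) (i j : Fin n) :
    (S.torsionMul b i j s).1 x = (S.torsionCoeff b i j x : ℂ) • s.1 x := by
  simp [torsionMul, mulFun, hx]

end IsLocalFrame

/-- Near every angle the orbit is the image of a straight line under the smooth local
parametrization. -/
lemma contMDiff_rot (x : UnitCircle E) :
    ContMDiff 𝓘(ℝ, ℝ) (𝓡 (n + 1)) ∞ (fun θ : ℝ => S.rot θ x) := by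
  intro θ₁
  obtain ⟨W, s₀, h, hxW, -⟩ := S.exists_isLocalFrame (b := base x) (S.rot θ₁ x)
    (mem_chart_source (Coord n) (base x))
  obtain ⟨θ₀, hθ⟩ := h.exists_mem_localDomain hxW
  have h1 : (extChartAt (𝓡 n) (base x)).symm (extChartAt (𝓡 n) (base x) (base x)) = base x :=
    extChartAt_to_inv (I := 𝓡 n) (base x)
  have h2 : (fun θ : ℝ => S.rot θ x) = S.localParam h.norm_eq (base x) ∘
      (fun θ : ℝ => S.localCoord s₀ (base x) θ₀ (S.rot θ₁ x) + ((0 : Coord n), θ - θ₁)) := by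
    funext θ
    have h3 : (S.localCoord s₀ (base x) θ₀ (S.rot θ₁ x) + ((0 : Coord n), θ - θ₁)).1 =
        extChartAt (𝓡 n) (base x) (base x) := by
      simp [localCoord]
    simp only [Function.comp, localParam]
    rw [h3, h1]
    have h4 : S.rot θ x = S.rot (θ - θ₁) (S.rot θ₁ x) := by
      rw [S.rot_rot, sub_add_cancel]
    rw [h4]
    conv_lhs => rw [← h.rot_unitPoint (θ₀ := θ₀) (S.rot θ₁ x)]
    rw [S.rot_rot, add_comm]
    rfl
  have h5 : ContDiff ℝ ∞
      (fun θ : ℝ => S.localCoord s₀ (base x) θ₀ (S.rot θ₁ x) + ((0 : Coord n), θ - θ₁)) := by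
    fun_prop
  have h6 : S.localCoord s₀ (base x) θ₀ (S.rot θ₁ x) + ((0 : Coord n), θ₁ - θ₁) =
      S.localCoord s₀ (base x) θ₀ (S.rot θ₁ x) := by simp
  rw [h2]
  have h7 := h.contMDiffAt_param hθ
  rw [← h6] at h7
  exact ContMDiffAt.comp θ₁ h7 h5.contMDiff.contMDiffAt

/-- By definition `e` is the velocity of the rotation at angle zero; the group law carries any angle
to zero. -/
lemma hasDerivAt_comp_rot (x : UnitCircle E) {g : UnitCircle E → ℂ} {θ : ℝ}
    (hg : MDifferentiableAt (𝓡 (n + 1)) 𝓘(ℝ, ℂ) g (S.rot θ x)) :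
    HasDerivAt (fun τ : ℝ => g (S.rot τ x)) (mvfderiv (𝓡 (n + 1)) g (S.rot θ x) (S.e (S.rot θ x)))
      θ := by
  have h1 : (fun τ : ℝ => g (S.rot τ x)) = (g ∘ fun τ : ℝ => S.rot τ (S.rot θ x)) ∘ (fun τ => τ - θ) := by
    funext τ
    simp only [Function.comp]
    rw [S.rot_rot, sub_add_cancel]
  have h2 := ((S.contMDiff_rot (S.rot θ x)) 0).mdifferentiableAt (by simp) |>.hasMFDerivAt
  have h0 : S.rot 0 (S.rot θ x) = S.rot θ x := S.rot_zero _
  have h3 : HasMFDerivAt (𝓡 (n + 1)) 𝓘(ℝ, ℂ) g (S.rot 0 (S.rot θ x))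
      (show Coord (n + 1) →L[ℝ] ℂ from mfderiv (𝓡 (n + 1)) 𝓘(ℝ, ℂ) g (S.rot θ x)) := by
    rw [h0]
    exact hg.hasMFDerivAt
  have h4 : HasFDerivAt (g ∘ fun τ : ℝ => S.rot τ (S.rot θ x))
      ((show Coord (n + 1) →L[ℝ] ℂ from mfderiv (𝓡 (n + 1)) 𝓘(ℝ, ℂ) g (S.rot θ x)).comp
        (show ℝ →L[ℝ] Coord (n + 1) from
          mfderiv 𝓘(ℝ, ℝ) (𝓡 (n + 1)) (fun τ : ℝ => S.rot τ (S.rot θ x)) 0)) (θ - θ) := by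
    rw [sub_self]
    exact (HasMFDerivAt.comp (0 : ℝ) (g := g) (f := fun τ : ℝ => S.rot τ (S.rot θ x)) h3 h2).hasFDerivAt
  rw [h1]
  exact h4.hasDerivAt.comp_sub_const θ θ

end Setting
end Geometry
end CircleEta
end

noncomputable section

namespace CircleEta

/-! ### Rapidly decreasing sequences and smooth periodic functions -/

/-- The rapidly decreasing sequences. -/
def RapidSeq : Submodule ℂ (ℤ → ℂ) where
  carrier := {c | ∀ k : ℕ, Summable fun m : ℤ => (1 + |(m : ℝ)|) ^ k * ‖c m‖}
  add_mem' {c d} hc hd k := by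
    refine Summable.of_nonneg_of_le (fun m => by positivity) (fun m => ?_) ((hc k).add (hd k))
    rw [← mul_add]
    gcongr
    exact norm_add_le _ _
  zero_mem' k := by simp
  smul_mem' a c hc k := by
    refine ((hc k).mul_left ‖a‖).congr fun m => ?_
    simp only [Pi.smul_apply, smul_eq_mul, norm_mul]
    ring

namespace RapidSeq

/-- The factor `a m` grows at most polynomially in `m`. -/
def PolyGrowth (a : ℤ → ℂ) : Prop := ∃ (C : ℝ) (N : ℕ), ∀ m : ℤ, ‖a m‖ ≤ C * (1 + |(m : ℝ)|) ^ N

lemma mul_mem {a : ℤ → ℂ} (ha : PolyGrowth a) {c : ℤ → ℂ} (hc : c ∈ RapidSeq) :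
    (fun m => a m * c m) ∈ RapidSeq := by
  obtain ⟨C, N, h⟩ := ha
  intro k
  refine Summable.of_nonneg_of_le (fun m => by positivity) (fun m => ?_) ((hc (k + N)).mul_left C)
  rw [norm_mul]
  calc (1 + |(m : ℝ)|) ^ k * (‖a m‖ * ‖c m‖)
      ≤ (1 + |(m : ℝ)|) ^ k * ((C * (1 + |(m : ℝ)|) ^ N) * ‖c m‖) := by gcongr; exact h m
    _ = C * ((1 + |(m : ℝ)|) ^ (k + N) * ‖c m‖) := by ring

/-- Multiplication with a sequence of polynomial growth. -/
def mulSeq (a : ℤ → ℂ) (ha : PolyGrowth a) : RapidSeq →ₗ[ℂ] RapidSeq where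
  toFun c := ⟨fun m => a m * c.1 m, mul_mem ha c.2⟩
  map_add' c d := by ext m; simp [mul_add]
  map_smul' r c := by ext m; simp; ring

@[simp] lemma mulSeq_apply (a : ℤ → ℂ) (ha : PolyGrowth a) (c : RapidSeq) (m : ℤ) :
    (mulSeq a ha c).1 m = a m * c.1 m := rfl

lemma polyGrowth_of_bounded {a : ℤ → ℂ} {C : ℝ} (h : ∀ m, ‖a m‖ ≤ C) : PolyGrowth a :=
  ⟨C, 0, by simpa using h⟩

lemma polyGrowth_linear (α β : ℂ) : PolyGrowth fun m => α * m + β := by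
  refine ⟨‖α‖ + ‖β‖, 1, fun m => ?_⟩
  have h1 : ‖α * m + β‖ ≤ ‖α‖ * |(m : ℝ)| + ‖β‖ := by
    refine (norm_add_le _ _).trans ?_
    simp
  have h2 := mul_nonneg (norm_nonneg β) (abs_nonneg (m : ℝ))
  nlinarith [norm_nonneg α]

lemma summable_norm (c : RapidSeq) : Summable fun m => ‖c.1 m‖ := by simpa using c.2 0

lemma summable (c : RapidSeq) : Summable c.1 := (summable_norm c).of_norm

end RapidSeq

/-- The exponential `e^{imθ}`. -/
def expMode (m : ℤ) (θ : ℝ) : ℂ := Complex.exp (m * θ * Complex.I)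

lemma norm_expMode (m : ℤ) (θ : ℝ) : ‖expMode m θ‖ = 1 := by
  rw [expMode, show (m * θ * Complex.I : ℂ) = ((m * θ : ℝ) : ℂ) * Complex.I by push_cast; ring,
    Complex.norm_exp_ofReal_mul_I]

lemma expMode_add_two_pi (m : ℤ) (θ : ℝ) : expMode m (θ + 2 * Real.pi) = expMode m θ := by
  rw [expMode, expMode]
  push_cast
  rw [show (m * (θ + 2 * Real.pi) * Complex.I : ℂ) =
    m * θ * Complex.I + m * (2 * Real.pi * Complex.I) by ring, Complex.exp_add,
    Complex.exp_int_mul_two_pi_mul_I, mul_one]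

lemma expMode_mul (m k : ℤ) (θ : ℝ) : expMode m θ * expMode k θ = expMode (m + k) θ := by
  rw [expMode, expMode, expMode, ← Complex.exp_add]
  congr 1
  push_cast
  ring

lemma conj_expMode (m : ℤ) (θ : ℝ) : (starRingEnd ℂ) (expMode m θ) = expMode (-m) θ := by
  rw [expMode, expMode, ← Complex.exp_conj]
  simp

lemma hasDerivAt_expMode (m : ℤ) (θ : ℝ) :
    HasDerivAt (expMode m) (Complex.I * m * expMode m θ) θ := by
  have h1 : HasDerivAt (fun x : ℝ => (m * x * Complex.I : ℂ)) (m * Complex.I) θ := by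
    have := ((Complex.ofRealCLM.hasDerivAt (x := θ)).const_mul (m : ℂ)).mul_const Complex.I
    simpa using this
  have h2 := h1.cexp
  rw [mul_comm, mul_comm Complex.I]
  exact h2

lemma continuous_expMode (m : ℤ) : Continuous (expMode m) :=
  continuous_iff_continuousAt.2 fun θ => (hasDerivAt_expMode m θ).continuousAt

lemma integral_expMode (m : ℤ) :
    ∫ θ in (0 : ℝ)..2 * Real.pi, expMode m θ = if m = 0 then (2 * Real.pi : ℂ) else 0 := by
  split_ifs with h
  · subst h
    simp [expMode]
  · have h1 : (Complex.I * m : ℂ) ≠ 0 := mul_ne_zero Complex.I_ne_zero (by exact_mod_cast h)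
    have h2 : ∀ θ ∈ Set.uIcc 0 (2 * Real.pi),
        HasDerivAt (fun x => (Complex.I * m)⁻¹ * expMode m x) (expMode m θ) θ := fun θ _ => by
      have h3 := (hasDerivAt_expMode m θ).const_mul ((Complex.I * m : ℂ)⁻¹)
      rwa [← mul_assoc, inv_mul_cancel₀ h1, one_mul] at h3
    rw [intervalIntegral.integral_eq_sub_of_hasDerivAt h2
      ((continuous_expMode m).intervalIntegrable _ _), ← zero_add (2 * Real.pi),
      expMode_add_two_pi, sub_self]

/-- The function with the Fourier coefficients `c`. -/
def fourierSum (c : RapidSeq) (θ : ℝ) : ℂ := ∑' m, c.1 m * expMode m θ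

namespace RapidSeq

lemma summable_mul_expMode (c : RapidSeq) (θ : ℝ) : Summable fun m => c.1 m * expMode m θ := by
  refine Summable.of_norm ?_
  simpa [norm_expMode] using (summable_norm c)

lemma fourierSum_add (c d : RapidSeq) (θ : ℝ) :
    fourierSum (c + d) θ = fourierSum c θ + fourierSum d θ := by
  rw [fourierSum, fourierSum, fourierSum, ← ((summable_mul_expMode c θ)).tsum_add
    ((summable_mul_expMode d θ))]
  simp [add_mul]

lemma fourierSum_smul (r : ℂ) (c : RapidSeq) (θ : ℝ) :
    fourierSum (r • c) θ = r * fourierSum c θ := by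
  rw [fourierSum, fourierSum, ← tsum_mul_left]
  simp [mul_assoc]

/-- Multiplication by `i m` preserves rapid decrease and so gives a summable bound for the
differentiated series. -/
lemma hasDerivAt_fourierSum (c : RapidSeq) (θ : ℝ) :
    HasDerivAt (fourierSum c)
      (fourierSum (mulSeq _ (polyGrowth_linear Complex.I 0) c) θ) θ := by
  have h := hasDerivAt_tsum (u := fun m => ‖(mulSeq _ (polyGrowth_linear Complex.I 0) c).1 m‖)
    (g := fun m x => c.1 m * expMode m x)
    (g' := fun m x => (mulSeq _ (polyGrowth_linear Complex.I 0) c).1 m * expMode m x) (y₀ := 0)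
    (summable_norm _) (fun m x => ?_) (fun m x => ?_) ((summable_mul_expMode c 0)) θ
  · exact h
  · have h1 := (hasDerivAt_expMode m x).const_mul (c.1 m)
    rw [show c.1 m * (Complex.I * m * expMode m x) =
      (mulSeq _ (polyGrowth_linear Complex.I 0) c).1 m * expMode m x by
        rw [mulSeq_apply]; ring] at h1
    exact h1
  · rw [norm_mul, norm_expMode, mul_one]

lemma contDiff_fourierSum (c : RapidSeq) : ContDiff ℝ ∞ (fourierSum c) := by
  rw [contDiff_infty]
  intro N
  induction N generalizing c with
  | zero =>
    rw [Nat.cast_zero, contDiff_zero]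
    exact continuous_iff_continuousAt.2 fun θ => ((hasDerivAt_fourierSum c θ)).continuousAt
  | succ N ih =>
    rw [Nat.cast_succ, contDiff_succ_iff_deriv]
    refine ⟨fun θ => ((hasDerivAt_fourierSum c θ)).differentiableAt, by simp, ?_⟩
    rw [show deriv (fourierSum c) = _ from funext fun θ => ((hasDerivAt_fourierSum c θ)).deriv]
    exact ih _

lemma continuous_fourierSum (c : RapidSeq) : Continuous (fourierSum c) :=
  (contDiff_fourierSum c).continuous

lemma hasSum_integral_mul_fourierSum (c : RapidSeq) {φ : ℝ → ℂ} (hφ : Continuous φ) :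
    HasSum (fun m => c.1 m * ∫ θ in (0 : ℝ)..2 * Real.pi, φ θ * expMode m θ)
      (∫ θ in (0 : ℝ)..2 * Real.pi, φ θ * fourierSum c θ) := by
  obtain ⟨C, hC⟩ := isCompact_uIcc (a := (0 : ℝ)) (b := 2 * Real.pi) |>.exists_bound_of_continuousOn
    hφ.continuousOn
  have h := intervalIntegral.hasSum_integral_of_dominated_convergence (a := 0) (b := 2 * Real.pi)
    (μ := MeasureTheory.volume) (F := fun m θ => φ θ * (c.1 m * expMode m θ))
    (f := fun θ => φ θ * fourierSum c θ) (fun m _ => C * ‖c.1 m‖)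
    (fun m => (hφ.mul (continuous_const.mul (continuous_expMode m))).aestronglyMeasurable)
    (fun m => Filter.Eventually.of_forall fun θ hθ => ?_)
    (Filter.Eventually.of_forall fun θ _ => (summable_norm c).mul_left C)
    (by simp) (Filter.Eventually.of_forall fun θ _ => ((summable_mul_expMode c θ)).hasSum.mul_left _)
  · refine h.congr_fun ?_
    intro m
    rw [← intervalIntegral.integral_const_mul]
    congr 1
    funext θ
    ring
  · rw [norm_mul, norm_mul, norm_expMode, mul_one]
    gcongr
    exact hC θ (Set.uIoc_subset_uIcc hθ)

lemma integral_expMode_mul_fourierSum (c : RapidSeq) (k : ℤ) :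
    ∫ θ in (0 : ℝ)..2 * Real.pi, expMode (-k) θ * fourierSum c θ = 2 * Real.pi * c.1 k := by
  refine (hasSum_integral_mul_fourierSum c (continuous_expMode (-k))).unique ?_
  have h := hasSum_ite_eq k (2 * Real.pi * c.1 k : ℂ)
  refine h.congr_fun fun m => ?_
  simp_rw [expMode_mul]
  rw [integral_expMode]
  by_cases hm : m = k
  · subst hm; simp; ring
  · have : -k + m ≠ 0 := by omega
    simp [hm, this]

/-- Parseval's identity. -/
lemma hasSum_integral_conj_fourierSum (c d : RapidSeq) :
    HasSum (fun m => (2 * Real.pi : ℂ) * ((starRingEnd ℂ) (c.1 m) * d.1 m))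
      (∫ θ in (0 : ℝ)..2 * Real.pi, (starRingEnd ℂ) (fourierSum c θ) * fourierSum d θ) := by
  refine (hasSum_integral_mul_fourierSum d (φ := fun θ => (starRingEnd ℂ) (fourierSum c θ))
    (Complex.continuous_conj.comp (continuous_fourierSum c))).congr_fun fun m => ?_
  have h1 : ∫ θ in (0 : ℝ)..2 * Real.pi, (starRingEnd ℂ) (fourierSum c θ) * expMode m θ =
      (starRingEnd ℂ) (∫ θ in (0 : ℝ)..2 * Real.pi, expMode (-m) θ * fourierSum c θ) := by
    rw [← intervalIntegral.intervalIntegral_conj]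
    congr 1
    funext θ
    rw [map_mul, conj_expMode, neg_neg, mul_comm]
  rw [h1, integral_expMode_mul_fourierSum, map_mul, map_mul, Complex.conj_ofReal, map_ofNat]
  ring

lemma fourierSum_injective {c d : RapidSeq} (h : ∀ θ, fourierSum c θ = fourierSum d θ) : c = d := by
  ext k
  have h1 := integral_expMode_mul_fourierSum c k
  simp_rw [h] at h1
  rw [integral_expMode_mul_fourierSum d] at h1
  exact (mul_left_cancel₀ (by simp [Real.pi_ne_zero]) h1).symm

end RapidSeq

/-- The Fourier coefficients of a function on `[0, 2π]`. -/
def fourierInt (g : ℝ → ℂ) (m : ℤ) : ℂ :=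
  (2 * Real.pi : ℂ)⁻¹ * ∫ θ in (0 : ℝ)..2 * Real.pi, expMode (-m) θ * g θ

/-- Integration by parts; the boundary terms cancel by periodicity. -/
lemma fourierInt_deriv {g : ℝ → ℂ} (hg : ContDiff ℝ ∞ g) (hper : ∀ θ, g (θ + 2 * Real.pi) = g θ)
    (m : ℤ) : fourierInt (deriv g) m = Complex.I * m * fourierInt g m := by
  have hd := (contDiff_infty_iff_deriv.1 hg)
  have h1 : ∀ θ ∈ Set.uIcc 0 (2 * Real.pi), HasDerivAt (fun x => expMode (-m) x * g x)
      (Complex.I * ((-m : ℤ) : ℂ) * expMode (-m) θ * g θ + expMode (-m) θ * deriv g θ) θ := fun θ _ =>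
    (hasDerivAt_expMode (-m) θ).mul (hd.1 θ).hasDerivAt
  have c1 : Continuous fun θ => Complex.I * ((-m : ℤ) : ℂ) * expMode (-m) θ * g θ :=
    (continuous_const.mul (continuous_expMode _)).mul hg.continuous
  have c2 : Continuous fun θ => expMode (-m) θ * deriv g θ :=
    (continuous_expMode _).mul hd.2.continuous
  have h2 := intervalIntegral.integral_eq_sub_of_hasDerivAt h1
    ((c1.add c2).intervalIntegrable _ _)
  rw [intervalIntegral.integral_add (c1.intervalIntegrable _ _) (c2.intervalIntegrable _ _)] at h2
  have h3 : expMode (-m) (2 * Real.pi) * g (2 * Real.pi) = expMode (-m) 0 * g 0 := by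
    rw [← zero_add (2 * Real.pi), expMode_add_two_pi, hper]
  rw [h3, sub_self] at h2
  simp_rw [mul_assoc (Complex.I * ((-m : ℤ) : ℂ))] at h2
  rw [intervalIntegral.integral_const_mul] at h2
  rw [fourierInt, fourierInt]
  push_cast at h2
  linear_combination (2 * Real.pi : ℂ)⁻¹ * h2

lemma exists_norm_fourierInt_le {g : ℝ → ℂ} (hg : Continuous g) :
    ∃ C, ∀ m : ℤ, ‖fourierInt g m‖ ≤ C := by
  obtain ⟨C, hC⟩ := isCompact_uIcc (a := (0 : ℝ)) (b := 2 * Real.pi) |>.exists_bound_of_continuousOn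
    hg.continuousOn
  refine ⟨‖(2 * Real.pi : ℂ)⁻¹‖ * (C * |2 * Real.pi - 0|), fun m => ?_⟩
  rw [fourierInt, norm_mul]
  gcongr
  refine intervalIntegral.norm_integral_le_of_norm_le_const fun θ hθ => ?_
  rw [norm_mul, norm_expMode, one_mul]
  exact hC θ (Set.uIoc_subset_uIcc hθ)

/-- Each factor `|m|` is traded for a derivative of `g`, which is again smooth and periodic. -/
lemma exists_pow_mul_norm_fourierInt_le (k : ℕ) {g : ℝ → ℂ} (hg : ContDiff ℝ ∞ g)
    (hper : ∀ θ, g (θ + 2 * Real.pi) = g θ) :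
    ∃ C, ∀ m : ℤ, (1 + |(m : ℝ)|) ^ k * ‖fourierInt g m‖ ≤ C := by
  induction k generalizing g with
  | zero => simpa using exists_norm_fourierInt_le hg.continuous
  | succ k ih =>
    obtain ⟨C₁, h₁⟩ := ih hg hper
    have hper' : ∀ θ, deriv g (θ + 2 * Real.pi) = deriv g θ := fun θ => by
      rw [← deriv_comp_add_const]
      congr 1
      exact funext hper
    obtain ⟨C₂, h₂⟩ := ih (contDiff_infty_iff_deriv.1 hg).2 hper'
    refine ⟨C₁ + C₂, fun m => ?_⟩
    have h3 := h₂ m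
    rw [fourierInt_deriv hg hper, norm_mul, norm_mul, Complex.norm_I, one_mul, Complex.norm_intCast]
      at h3
    calc (1 + |(m : ℝ)|) ^ (k + 1) * ‖fourierInt g m‖
        = (1 + |(m : ℝ)|) ^ k * ‖fourierInt g m‖ +
          (1 + |(m : ℝ)|) ^ k * (|(m : ℝ)| * ‖fourierInt g m‖) := by ring
      _ ≤ _ := add_le_add (h₁ m) h3

lemma fourierInt_mem {g : ℝ → ℂ} (hg : ContDiff ℝ ∞ g) (hper : ∀ θ, g (θ + 2 * Real.pi) = g θ) :
    fourierInt g ∈ RapidSeq := by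
  intro k
  -- Two powers more than required leave the summable factor `(1 + |m|)^{-2}`.
  obtain ⟨C, hC⟩ := exists_pow_mul_norm_fourierInt_le (k + 2) hg hper
  have h1 : Summable fun m : ℤ => ((1 + |(m : ℝ)|) ^ 2)⁻¹ := by
    have h2 : Summable fun m : ℤ => 1 / (m : ℝ) ^ 2 := Real.summable_one_div_int_pow.2 one_lt_two
    have h0 : ({0}ᶜ : Set ℤ) ∈ Filter.cofinite := (Set.finite_singleton 0).compl_mem_cofinite
    refine Summable.of_norm_bounded_eventually h2 ?_
    filter_upwards [h0] with m hm
    have hm' : (0 : ℝ) < |(m : ℝ)| := by simpa using hm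
    rw [Real.norm_of_nonneg (by positivity), one_div]
    refine inv_anti₀ (by rw [← sq_abs]; positivity) ?_
    rw [← sq_abs (m : ℝ)]
    exact pow_le_pow_left₀ (abs_nonneg _) (by linarith) 2
  refine Summable.of_nonneg_of_le (fun m => by positivity) (fun m => ?_) (h1.mul_left C)
  have h3 : (0 : ℝ) < (1 + |(m : ℝ)|) ^ 2 := by positivity
  rw [← div_eq_mul_inv, le_div_iff₀ h3]
  calc _ = (1 + |(m : ℝ)|) ^ (k + 2) * ‖fourierInt g m‖ := by ring
    _ ≤ C := hC m

/-- A smooth periodic function is the sum of its Fourier series. -/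
lemma exists_fourierSum_eq {g : ℝ → ℂ} (hg : ContDiff ℝ ∞ g)
    (hper : ∀ θ, g (θ + 2 * Real.pi) = g θ) : ∃ c : RapidSeq, ∀ θ, fourierSum c θ = g θ := by
  refine ⟨⟨_, fourierInt_mem hg hper⟩, fun θ => ?_⟩
  have : Fact (0 < 2 * Real.pi) := ⟨Real.two_pi_pos⟩
  have hp : Function.Periodic g (2 * Real.pi) := hper
  -- The function descends to the circle, where a continuous function with summable Fourier
  -- coefficients is the pointwise sum of its series.
  let G : C(AddCircle (2 * Real.pi), ℂ) := ⟨hp.lift, continuous_coinduced_dom.2 hg.continuous⟩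
  have h1 : ∀ (m : ℤ) (x : ℝ), fourier m (x : AddCircle (2 * Real.pi)) = expMode m x := fun m x => by
    rw [fourier_coe_apply, expMode]
    congr 1
    have : (Real.pi : ℂ) ≠ 0 := by exact_mod_cast Real.pi_ne_zero
    push_cast
    field_simp
  have h2 : ∀ m, fourierCoeff G m = fourierInt g m := fun m => by
    rw [fourierCoeff_eq_intervalIntegral _ _ 0, fourierInt, zero_add, Complex.real_smul]
    simp_rw [h1]
    push_cast
    rw [one_div]
    rfl
  have h3 : Summable (fourierCoeff G) := by
    rw [show fourierCoeff G = fourierInt g from funext h2]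
    exact RapidSeq.summable ⟨_, fourierInt_mem hg hper⟩
  have h4 := has_pointwise_sum_fourier_series_of_summable h3 (θ : AddCircle (2 * Real.pi))
  rw [fourierSum]
  refine Eq.trans ?_ h4.tsum_eq
  congr 1
  funext m
  rw [h2, h1, smul_eq_mul]

end CircleEta
end

noncomputable section

namespace CircleEta

section Geometry

variable {n : ℕ} {B : Type*} [TopologicalSpace B] [ChartedSpace (Coord n) B]
  [IsManifold (𝓡 n) ∞ B]
  {E : B → Type*} [TopologicalSpace (TotalSpace Plane E)] [∀ b, NormedAddCommGroup (E b)]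
  [∀ b, InnerProductSpace ℝ (E b)] [FiberBundle Plane E] [VectorBundle ℝ Plane E]
  [ContMDiffVectorBundle ∞ Plane E (𝓡 n)] [IsContMDiffRiemannianBundle (𝓡 n) ∞ Plane E]
  [ChartedSpace (Coord (n + 1)) (UnitCircle E)] [IsManifold (𝓡 (n + 1)) ∞ (UnitCircle E)]
  {V : UnitCircle E → Type*} [TopologicalSpace (TotalSpace ℂ V)] [∀ x, NormedAddCommGroup (V x)]
  [∀ x, InnerProductSpace ℂ (V x)] [FiberBundle ℂ V] [VectorBundle ℝ ℂ V]
  [ContMDiffVectorBundle ∞ ℂ V (𝓡 (n + 1))]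

namespace Setting

variable (S : Setting (n := n) E V)

/-! ### The sections over a fibre in an eigenframe -/

lemma _root_.CircleEta.expMode_eq_zpow (m : ℤ) (θ : ℝ) :
    expMode m θ = Complex.exp (θ * Complex.I) ^ m := by
  rw [expMode, ← Complex.exp_int_mul, mul_assoc]

lemma _root_.CircleEta.RapidSeq.fourierSum_congr (c : RapidSeq) {θ θ' : ℝ}
    (h : Complex.exp (θ * Complex.I) = Complex.exp (θ' * Complex.I)) :
    fourierSum c θ = fourierSum c θ' := by
  simp only [fourierSum, expMode_eq_zpow, h]

section Fibre

variable (b : B)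

lemma exists_frame_circle : ∃ W s, ∃ h : S.IsLocalFrame b W s, b ∈ W ∧
    ∀ θ, S.frameCoord s (S.circle b θ).1 = Complex.exp (θ * Complex.I) ∧
      S.circle b θ = S.rot θ (unitPoint s h.norm_eq b) := by
  have hx := (S.exists_base b).choose_spec
  obtain ⟨W, s, h, hW, hs⟩ := S.exists_isLocalFrame (b := b) (S.exists_base b).choose
    (by rw [hx]; exact mem_chart_source (Coord n) b)
  have h1 : unitPoint s h.norm_eq b = (S.exists_base b).choose := by
    have h2 : unitPoint s h.norm_eq (base (S.exists_base b).choose) = (S.exists_base b).choose := by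
      apply Subtype.ext
      refine Eq.trans ?_ (show TotalSpace.mk' Plane _ (S.exists_base b).choose.1.2 = _ from rfl)
      exact congrArg (TotalSpace.mk' Plane _) hs
    rwa [hx] at h2
  refine ⟨W, s, h, hx ▸ hW, fun θ => ?_⟩
  have h3 : (S.circle b θ : UnitCircle E) = S.rot θ (unitPoint s h.norm_eq b) := by
    rw [h1]; rfl
  exact ⟨by rw [h3, S.frameCoord_rot_unitPoint], h3⟩

lemma exp_eq_of_circle_eq {θ θ' : ℝ} (h : S.circle b θ = S.circle b θ') :
    Complex.exp (θ * Complex.I) = Complex.exp (θ' * Complex.I) := by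
  obtain ⟨W, s, hf, -, hs⟩ := S.exists_frame_circle b
  rw [← (hs θ).1, ← (hs θ').1, h]

/-- The section over `M_b` with given Fourier coefficients with respect to the frame `σ`. -/
def fibreSection (σ : Π x, V x) : RapidSeq →ₗ[ℂ] S.FibreSections b where
  toFun c x := fourierSum c (S.circle_surjective b x).choose • σ x.1
  map_add' c d := by
    funext x
    rw [RapidSeq.fourierSum_add, add_smul]
    rfl
  map_smul' r c := by
    funext x
    rw [RapidSeq.fourierSum_smul, mul_smul]
    rfl

variable {b}

/-- The definition of `fibreSection` chooses an angle for each point of the circle; a Fourier sum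
depends only on `exp(iθ)` and does not see the choice. -/
lemma fibreSection_circle (σ : Π x, V x) (c : RapidSeq) (θ : ℝ) :
    S.fibreSection b σ c (S.circle b θ) = fourierSum c θ • σ (S.circle b θ).1 := by
  have h := (S.circle_surjective b (S.circle b θ)).choose_spec
  change (fourierSum c (S.circle_surjective b (S.circle b θ)).choose : ℂ) • σ (S.circle b θ).1 = _
  rw [RapidSeq.fourierSum_congr c (S.exp_eq_of_circle_eq b h)]

variable {S}
variable {U : Set B} {σ : Π x, V x} {f : B → ℝ} {β : Π y : B, TangentSpace (𝓡 n) y →L[ℝ] ℂ}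
  (hσ : S.IsLocalEigenframe U σ f β) (hb : b ∈ U)

lemma base_circle_mem (hb : b ∈ U) (θ : ℝ) : base (S.circle b θ).1 ∈ U := by
  rw [(S.circle b θ).2]; exact hb

include hσ hb

namespace IsLocalEigenframe

lemma ne_zero_circle (θ : ℝ) : σ (S.circle b θ).1 ≠ 0 := hσ.ne_zero _ (base_circle_mem hb θ)

lemma fibreSection_injective : Function.Injective (S.fibreSection b σ) := by
  intro c d h
  refine RapidSeq.fourierSum_injective fun θ => ?_
  have h1 := congrFun h (S.circle b θ)
  rw [S.fibreSection_circle, S.fibreSection_circle] at h1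
  exact smul_left_injective ℂ (hσ.ne_zero_circle hb θ) h1

/-- The coefficient of a smooth section in the frame is a smooth periodic function of the angle,
hence a Fourier series. -/
lemma exists_fibreSection_eq {v : S.FibreSections b} (hv : S.IsSmoothSection b v) :
    ∃ c, S.fibreSection b σ c = v := by
  obtain ⟨s, rfl⟩ := hv
  have hg : ContDiff ℝ ∞ fun θ => frameCoeff σ s.1 (S.circle b θ).1 := by
    rw [← contMDiff_iff_contDiff]
    intro θ
    have h1 := S.contMDiffAt_frameCoeff (hσ.smooth _ (base_circle_mem hb θ))
      (s.2 (S.circle b θ).1 (by rw [(S.circle b θ).2]; exact mem_chart_source (Coord n) b))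
      (hσ.ne_zero_circle hb θ)
    exact ContMDiffAt.comp θ (g := frameCoeff σ s.1)
      (f := fun θ => S.rot θ (S.exists_base b).choose) h1 (S.contMDiff_rot _ θ)
  obtain ⟨c, hc⟩ := exists_fourierSum_eq hg fun θ => by
    rw [show S.circle b (θ + 2 * Real.pi) = S.circle b θ from Subtype.ext (S.rot_add_two_pi θ _)]
  refine ⟨c, funext fun x => ?_⟩
  obtain ⟨θ, rfl⟩ := S.circle_surjective b x
  rw [S.fibreSection_circle, hc, frameCoeff_smul_frame _ (hσ.ne_zero_circle hb θ)]
  rfl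

/-- The same Fourier coefficients, read with the angle to a local unit section of `E`, define the
section over the neighbouring circles; a cutoff on the base makes it global. -/
lemma isSmoothSection_fibreSection [T2Space B] (c : RapidSeq) :
    S.IsSmoothSection b (S.fibreSection b σ c) := by
  obtain ⟨W, s, h, hbW, hs⟩ := S.exists_frame_circle b
  obtain ⟨χ, hχ, hχU, hχ1⟩ := exists_smooth_cutoff (n := n)
    ((hσ.isOpen.inter h.isOpen).mem_nhds ⟨hb, hbW⟩)
  have h0 : ∀ x, Complex.exp (Complex.arg (S.frameCoord s x) * Complex.I) = S.frameCoord s x :=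
    fun x => by
      have := Complex.norm_mul_exp_arg_mul_I (S.frameCoord s x)
      rwa [S.norm_frameCoord h.norm_eq, Complex.ofReal_one, one_mul] at this
  -- The argument jumps, but `G` does not: near each point the argument may be replaced by a smooth
  -- angle coordinate with the same exponential.
  let G : UnitCircle E → ℂ := fun x => fourierSum c (Complex.arg (S.frameCoord s x))
  have hG : ∀ x, base x ∈ W → ContMDiffAt (𝓡 (n + 1)) 𝓘(ℝ, ℂ) ∞ G x := by
    intro x hx
    obtain ⟨θ₀, hθ⟩ := h.exists_mem_localDomain hx
    have h1 : ContDiff ℝ ∞ fun q : Coord n × ℝ => fourierSum c q.2 :=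
      (RapidSeq.contDiff_fourierSum c).comp contDiff_snd
    have h2 : G = (fun q : Coord n × ℝ => fourierSum c q.2) ∘ S.localCoord s b θ₀ := by
      funext y
      exact RapidSeq.fourierSum_congr c ((h0 y).trans (h.frameCoord_eq y))
    rw [h2]
    exact ContMDiffAt.comp x h1.contMDiff.contMDiffAt (h.contMDiffAt_localCoord hθ)
  have hO : IsOpen (base ⁻¹' (U ∩ W) : Set (UnitCircle E)) :=
    (hσ.isOpen.inter h.isOpen).preimage S.continuous_base
  have h1 : tsupport (fun y : UnitCircle E => χ (base y)) ⊆ base ⁻¹' (U ∩ W) :=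
    (tsupport_comp_subset_preimage χ S.continuous_base).trans (Set.preimage_mono hχU)
  have h2 : ContMDiff (𝓡 (n + 1)) ((𝓡 (n + 1)).prod 𝓘(ℝ, ℂ)) ∞ fun x =>
      TotalSpace.mk' ℂ x (((fun y : UnitCircle E => χ (base y)) • fun x => G x • σ x) x) :=
    ContMDiffOn.smul_section_of_tsupport ((hχ.comp S.contMDiff_base).contMDiffOn) hO h1
      fun x hx => (S.smoothAt_complex_smul (hG x hx.2) (hσ.smooth x hx.1)).contMDiffWithinAt
  refine ⟨⟨_, fun x _ => h2 x⟩, funext fun x => ?_⟩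
  obtain ⟨θ, rfl⟩ := S.circle_surjective b x
  rw [S.fibreSection_circle]
  change χ (base (S.circle b θ).1) • fourierSum c (Complex.arg (S.frameCoord s (S.circle b θ).1)) •
    σ (S.circle b θ).1 = _
  rw [(S.circle b θ).2, hχ1.self_of_nhds, one_smul,
    RapidSeq.fourierSum_congr c ((h0 _).trans (hs θ).1)]

lemma connV_e {x : UnitCircle E} (hx : base x ∈ U) :
    S.connV σ x (S.e x) = (Complex.I * f (base x)) • σ x := by
  have h := congrArg (fun v => Complex.I • v) (hσ.eigen x hx)
  simpa only [smul_smul, mul_neg, neg_mul, Complex.I_mul_I, neg_neg, one_smul] using h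

/-- Along `e` the function `⟨σ, σ⟩` has derivative `(-i f + i f) ⟨σ, σ⟩ = 0`, because the connection
is metric and `f` is real. So the modes `e^{imθ} σ` are orthogonal and have one common norm. -/
lemma norm_circle (θ : ℝ) : ‖σ (S.circle b θ).1‖ = ‖σ (S.circle b 0).1‖ := by
  have hd : ∀ θ, HasDerivAt (fun τ : ℝ => (inner ℂ (σ (S.rot τ (S.exists_base b).choose))
      (σ (S.rot τ (S.exists_base b).choose)) : ℂ)) 0 θ := fun θ => by
    have hx : base (S.rot θ (S.exists_base b).choose) ∈ U := base_circle_mem (S := S) hb θ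
    have hs := hσ.smooth _ hx
    have h1 := S.hasDerivAt_comp_rot (S.exists_base b).choose (θ := θ)
      (g := fun y => (inner ℂ (σ y) (σ y) : ℂ))
      ((S.inner_smooth σ σ _ hs hs).mdifferentiableAt (by simp))
    have h2 := S.connV_metric σ σ _ hs hs (S.e (S.rot θ (S.exists_base b).choose))
    rw [hσ.connV_e hb hx, inner_smul_left, inner_smul_right] at h2
    have h3 : mvfderiv (𝓡 (n + 1)) (fun y => (inner ℂ (σ y) (σ y) : ℂ))
        (S.rot θ (S.exists_base b).choose) (S.e (S.rot θ (S.exists_base b).choose)) = 0 := by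
      refine Eq.trans h2 ?_
      simp
    rwa [h3] at h1
  have h1 := is_const_of_deriv_eq_zero (fun θ => (hd θ).differentiableAt) (fun θ => (hd θ).deriv) θ 0
  simp only [inner_self_eq_norm_sq_to_K] at h1
  have h2 : ‖σ (S.circle b θ).1‖ ^ 2 = ‖σ (S.circle b 0).1‖ ^ 2 := by exact_mod_cast h1
  exact (pow_left_inj₀ (norm_nonneg _) (norm_nonneg _) two_ne_zero).1 h2

omit hσ hb in
/-- The square of the norm of the frame over `M_b`. -/
def _root_.CircleEta.Setting.fibreWeight (S : Setting (n := n) E V) (b : B) (σ : Π x, V x) : ℝ :=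
  2 * Real.pi * ‖σ (S.circle b 0).1‖ ^ 2

lemma fibreWeight_pos : 0 < S.fibreWeight b σ :=
  mul_pos Real.two_pi_pos (pow_pos (norm_pos_iff.2 (hσ.ne_zero_circle hb 0)) 2)

lemma hasSum_fibreInner (c d : RapidSeq) :
    HasSum (fun m => (S.fibreWeight b σ : ℂ) * ((starRingEnd ℂ) (c.1 m) * d.1 m))
      (S.fibreInner b (S.fibreSection b σ c) (S.fibreSection b σ d)) := by
  have h1 : ∀ θ, (inner ℂ (S.fibreSection b σ c (S.circle b θ)) (S.fibreSection b σ d (S.circle b θ)) : ℂ)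
      = ((‖σ (S.circle b 0).1‖ ^ 2 : ℝ) : ℂ) *
        ((starRingEnd ℂ) (fourierSum c θ) * fourierSum d θ) := fun θ => by
    rw [S.fibreSection_circle, S.fibreSection_circle, inner_smul_left, inner_smul_right,
      inner_self_eq_norm_sq_to_K, hσ.norm_circle hb θ]
    push_cast
    simp only [Complex.coe_algebraMap]
    ring
  rw [fibreInner]
  simp_rw [h1]
  rw [intervalIntegral.integral_const_mul]
  refine ((RapidSeq.hasSum_integral_conj_fourierSum c d).mul_left _).congr_fun fun m => ?_
  rw [fibreWeight]
  push_cast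
  ring

omit hσ hb in
lemma _root_.CircleEta.Setting.fibreInner_self (v : S.FibreSections b) :
    S.fibreInner b v v = (S.fibreNormSq b v : ℂ) := by
  rw [fibreInner, fibreNormSq, ← intervalIntegral.integral_ofReal]
  congr 1
  funext θ
  rw [inner_self_eq_norm_sq_to_K]
  simp

lemma hasSum_fibreNormSq (c : RapidSeq) :
    HasSum (fun m => S.fibreWeight b σ * ‖c.1 m‖ ^ 2) (S.fibreNormSq b (S.fibreSection b σ c)) := by
  have h := hσ.hasSum_fibreInner hb c c
  rw [fibreInner_self] at h
  rw [← Complex.hasSum_ofReal]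
  refine h.congr_fun fun m => ?_
  rw [← Complex.normSq_eq_conj_mul_self, Complex.normSq_eq_norm_sq]
  push_cast
  rfl

/-- In the frame `∇_e` is `∂_θ + i f` with `f` constant on the fibre, which on the mode `m` is the
number `i (m + f(b))`. -/
lemma restrict_vertDeriv [T2Space B] {s : S.smoothSections b} {c : RapidSeq}
    (hs : S.restrictSection b s.1 = S.fibreSection b σ c) :
    S.restrictSection b (S.vertDeriv b s).1 = S.fibreSection b σ
      (RapidSeq.mulSeq _ (RapidSeq.polyGrowth_linear Complex.I (Complex.I * f b)) c) := by
  funext x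
  obtain ⟨θ, rfl⟩ := S.circle_surjective b x
  have hx := base_circle_mem (S := S) hb θ
  have hxb : base (S.circle b θ).1 ∈ chartDomain (n := n) b := by
    rw [(S.circle b θ).2]; exact mem_chart_source (Coord n) b
  have h0 : ∀ τ, frameCoeff σ s.1 (S.rot τ (S.exists_base b).choose) = fourierSum c τ := fun τ => by
    refine frameCoeff_smul (hσ.ne_zero_circle hb τ) ?_
    rw [← S.fibreSection_circle, ← hs]
    rfl
  have h1 := hσ.connV_eq hx (s.2 _ hxb) S.e
  have h2 := S.hasDerivAt_comp_rot (S.exists_base b).choose (θ := θ) (g := frameCoeff σ s.1)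
    ((S.contMDiffAt_frameCoeff (hσ.smooth _ hx) (s.2 _ hxb)
      (hσ.ne_zero_circle hb θ)).mdifferentiableAt (by simp))
  rw [funext h0] at h2
  have h3 := h2.unique (RapidSeq.hasDerivAt_fourierSum c θ)
  obtain ⟨W, s₀, h, hbW, -⟩ := S.exists_frame_circle b
  obtain ⟨θ₀, hθ⟩ := h.exists_mem_localDomain (x := (S.circle b θ).1)
    (by rw [(S.circle b θ).2]; exact hbW)
  rw [h.eDual_e hθ, h.dbase_e hθ, map_zero, (S.circle b θ).2] at h1
  have h4 : S.restrictSection b (S.vertDeriv b s).1 (S.circle b θ) =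
      S.connV s.1 (S.circle b θ).1 (S.e (S.circle b θ).1) := by
    change S.covDeriv b S.e s (S.circle b θ).1 = _
    simp [covDeriv, hxb]
  rw [h4, S.fibreSection_circle,
    ← frameCoeff_smul_frame (fun y => S.connV s.1 y (S.e y)) (hσ.ne_zero_circle hb θ), h1]
  congr 1
  have h5 : RapidSeq.mulSeq _ (RapidSeq.polyGrowth_linear Complex.I (Complex.I * f b)) c =
      RapidSeq.mulSeq _ (RapidSeq.polyGrowth_linear Complex.I 0) c + (Complex.I * f b) • c := by
    ext m
    change (Complex.I * m + Complex.I * f b) * c.1 m =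
      (Complex.I * m + 0) * c.1 m + (Complex.I * f b) * c.1 m
    ring
  rw [h5, RapidSeq.fourierSum_add, RapidSeq.fourierSum_smul, ← h3]
  have h6 : frameCoeff σ s.1 (S.circle b θ).1 = fourierSum c θ := h0 θ
  rw [h6, Complex.ofReal_one]
  change mvfderiv (𝓡 (n + 1)) (frameCoeff σ s.1) (S.circle b θ).1 (S.e (S.circle b θ).1) + _ =
    mvfderiv (𝓡 (n + 1)) (frameCoeff σ s.1) (S.circle b θ).1 (S.e (S.circle b θ).1) + _
  ring

end IsLocalEigenframe

end Fibre

end Setting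
end Geometry
end CircleEta
end

noncomputable section

namespace CircleEta

/-! ### The exterior algebra in the coordinate frame -/

section Algebra

variable {n : ℕ}

lemma dy_mul_dy_swap (i j : Fin n) : dy j * dy i = -(dy i * dy j : Forms n) :=
  eq_neg_of_add_eq_zero_left (ExteriorAlgebra.ι_add_mul_swap _ _)

lemma dy_mul_self (i : Fin n) : dy i * dy i = (0 : Forms n) := ExteriorAlgebra.ι_sq_zero _

lemma parity_mul (a a' : Forms n) : parity n (a * a') = parity n a * parity n a' := by
  simp [parity]

lemma parity_dy (i : Fin n) : parity n (dy i) = -dy i := by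
  simp [parity, dy, ExteriorAlgebra.map_apply_ι]

lemma parity_parity (a : Forms n) : parity n (parity n a) = a := by
  have h : (ExteriorAlgebra.map (-LinearMap.id : (Coord n →ₗ[ℝ] ℂ) →ₗ[ℂ] _)).comp
      (ExteriorAlgebra.map (-LinearMap.id)) = AlgHom.id ℂ (Forms n) := by
    rw [ExteriorAlgebra.map_comp_map]
    simp
  exact DFunLike.congr_fun h a

lemma parity_dy_mul (i : Fin n) (a : Forms n) : parity n (dy i * a) = -(dy i * parity n a) := by
  rw [parity_mul, parity_dy, neg_mul]

lemma cliffordE_dy_mul (i : Fin n) (a : Forms n) :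
    Setting.cliffordE n (dy i * a) = -(dy i * Setting.cliffordE n a) := by
  simp only [Setting.cliffordE, LinearMap.smul_apply, parity_dy_mul, smul_neg, mul_smul_comm]

lemma cliffordE_dy_mul_dy_mul (i j : Fin n) (a : Forms n) :
    Setting.cliffordE n (dy i * dy j * a) = dy i * dy j * Setting.cliffordE n a := by
  rw [mul_assoc, cliffordE_dy_mul, cliffordE_dy_mul, mul_neg, neg_neg, mul_assoc]

lemma cliffordE_cliffordE (a : Forms n) : Setting.cliffordE n (Setting.cliffordE n a) = -a := by
  simp only [Setting.cliffordE, LinearMap.smul_apply, map_smul, parity_parity, smul_smul]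
  simp

/-- The pairs `i < j`. -/
def pairs (n : ℕ) : Finset (Fin n × Fin n) := Finset.univ.filter fun p => p.1 < p.2

lemma sum_ite_lt {M : Type*} [AddCommMonoid M] (g : Fin n → Fin n → M) :
    (∑ i, ∑ j, if i < j then g i j else 0) = ∑ p ∈ pairs n, g p.1 p.2 := by
  rw [pairs, Finset.sum_filter, ← Finset.univ_product_univ, Finset.sum_product]

lemma sum_eq_sum_pairs {M : Type*} [AddCommMonoid M] (g : Fin n → Fin n → M)
    (hg : ∀ i, g i i = 0) : (∑ i, ∑ j, g i j) = ∑ p ∈ pairs n, (g p.1 p.2 + g p.2 p.1) := by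
  rw [Finset.sum_add_distrib, ← sum_ite_lt, ← sum_ite_lt fun i j => g j i,
    Finset.sum_comm (f := fun i j => if i < j then g j i else 0), ← Finset.sum_add_distrib]
  refine Finset.sum_congr rfl fun i _ => ?_
  rw [← Finset.sum_add_distrib]
  refine Finset.sum_congr rfl fun j _ => ?_
  rcases lt_trichotomy i j with h | h | h
  · simp [h, h.le.not_gt]
  · subst h; simp [hg]
  · simp [h, h.le.not_gt]

lemma twoForm_eq (c : Fin n → Fin n → ℂ) :
    twoForm c = ∑ p ∈ pairs n, c p.1 p.2 • (dy p.1 * dy p.2 : Forms n) := by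
  rw [twoForm, sum_ite_lt]

/-! ### The square of a superconnection -/

section Square

variable {𝓢 M : Type*} [AddCommGroup 𝓢] [Module ℂ 𝓢] [AddCommGroup M] [Module ℂ M]
  (D : 𝓢 →ₗ[ℂ] 𝓢) (X : Fin n → 𝓢 →ₗ[ℂ] 𝓢) (T : Fin n → Fin n → 𝓢 →ₗ[ℂ] 𝓢)

/-- The part of degree zero of a superconnection. -/
def superDirac : Forms n ⊗[ℂ] 𝓢 →ₗ[ℂ] Forms n ⊗[ℂ] 𝓢 := TensorProduct.map (Setting.cliffordE n) D

/-- The part of degree one of a superconnection. -/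
def superConn : Forms n ⊗[ℂ] 𝓢 →ₗ[ℂ] Forms n ⊗[ℂ] 𝓢 :=
  ∑ i, TensorProduct.map (LinearMap.mulLeft ℂ (dy i)) (X i)

/-- The part of degree two of a superconnection. -/
def superTorsion : Forms n ⊗[ℂ] 𝓢 →ₗ[ℂ] Forms n ⊗[ℂ] 𝓢 :=
  ∑ i, ∑ j, if i < j then
    TensorProduct.map (LinearMap.mulLeft ℂ (dy i * dy j) ∘ₗ Setting.cliffordE n) (T i j) else 0

lemma superDirac_tmul (a : Forms n) (s : 𝓢) :
    superDirac D (a ⊗ₜ s) = Setting.cliffordE n a ⊗ₜ[ℂ] D s := rfl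

lemma superConn_tmul (a : Forms n) (s : 𝓢) :
    superConn X (a ⊗ₜ s) = ∑ i, (dy i * a) ⊗ₜ[ℂ] X i s := by
  simp [superConn, LinearMap.sum_apply]

lemma superTorsion_tmul (a : Forms n) (s : 𝓢) :
    superTorsion T (a ⊗ₜ s) =
      ∑ p ∈ pairs n, (dy p.1 * dy p.2 * Setting.cliffordE n a) ⊗ₜ[ℂ] T p.1 p.2 s := by
  rw [superTorsion, sum_ite_lt, LinearMap.sum_apply]
  rfl

variable {D X T} {r : 𝓢 →ₗ[ℂ] M} {F : Fin n → ℂ} {τ μ : Fin n → Fin n → ℂ}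
  {κ : Fin n → Fin n → Fin n → ℂ} (a : Forms n) (s : 𝓢)

/-- Here `D` plays the role of `∇_e` without its Clifford factor, and that factor squares to `-1`.
-/
lemma superDirac_sq :
    r.lTensor (Forms n) (superDirac D (superDirac D (a ⊗ₜ s))) = -(a ⊗ₜ[ℂ] r (D (D s))) := by
  rw [superDirac_tmul, superDirac_tmul, cliffordE_cliffordE, LinearMap.lTensor_tmul,
    TensorProduct.neg_tmul]

/-- The Clifford operator anticommutes with `dy_i`, so the anticommutator reduces to the commutators
of `X_i` and `D`. -/
lemma superDirac_superConn (hF : ∀ i s, r (X i (D s)) - r (D (X i s)) = F i • r s) :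
    r.lTensor (Forms n) (superDirac D (superConn X (a ⊗ₜ s))) +
      r.lTensor (Forms n) (superConn X (superDirac D (a ⊗ₜ s))) =
      ((∑ i, F i • dy i) * Setting.cliffordE n a) ⊗ₜ[ℂ] r s := by
  rw [superDirac_tmul, superConn_tmul, superConn_tmul, map_sum, map_sum, map_sum,
    ← Finset.sum_add_distrib, Finset.sum_mul, TensorProduct.sum_tmul]
  refine Finset.sum_congr rfl fun i _ => ?_
  rw [superDirac_tmul, LinearMap.lTensor_tmul, LinearMap.lTensor_tmul, cliffordE_dy_mul,
    TensorProduct.neg_tmul, neg_add_eq_sub, ← TensorProduct.tmul_sub, hF, smul_mul_assoc,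
    TensorProduct.smul_tmul]

/-- Two-forms commute with the Clifford operator, so the two products add up instead of cancelling.
-/
lemma superDirac_superTorsion (hT : ∀ i j s, r (T i j s) = τ i j • r s)
    (hD : ∀ i j s, r (D (T i j s)) = τ i j • r (D s)) :
    r.lTensor (Forms n) (superDirac D (superTorsion T (a ⊗ₜ s))) +
      r.lTensor (Forms n) (superTorsion T (superDirac D (a ⊗ₜ s))) =
      -((2 : ℂ) • ((twoForm τ * a) ⊗ₜ[ℂ] r (D s))) := by
  have h : (twoForm τ * a) ⊗ₜ[ℂ] r (D s) =
      ∑ p ∈ pairs n, (dy p.1 * dy p.2 * a) ⊗ₜ[ℂ] (τ p.1 p.2 • r (D s)) := by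
    rw [twoForm_eq, Finset.sum_mul, TensorProduct.sum_tmul]
    refine Finset.sum_congr rfl fun p _ => ?_
    rw [smul_mul_assoc, TensorProduct.smul_tmul]
  rw [superDirac_tmul, superTorsion_tmul, superTorsion_tmul, map_sum, map_sum, map_sum, h,
    two_smul, neg_add, ← Finset.sum_neg_distrib]
  congr 1
  · refine Finset.sum_congr rfl fun p _ => ?_
    rw [superDirac_tmul, cliffordE_dy_mul_dy_mul, cliffordE_cliffordE, LinearMap.lTensor_tmul, hD,
      mul_neg, TensorProduct.neg_tmul]
  · refine Finset.sum_congr rfl fun p _ => ?_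
    rw [cliffordE_cliffordE, LinearMap.lTensor_tmul, hT, mul_neg, TensorProduct.neg_tmul]

/-- By the antisymmetry of `dy_i dy_j` only the commutators of the `X_i` enter. -/
lemma superConn_sq (hX : ∀ i j s, r (X i (X j s)) - r (X j (X i s)) =
      -(τ i j • r (D s)) + μ i j • r s) :
    r.lTensor (Forms n) (superConn X (superConn X (a ⊗ₜ s))) =
      -((twoForm τ * a) ⊗ₜ[ℂ] r (D s)) + (twoForm μ * a) ⊗ₜ[ℂ] r s := by
  have h0 : r.lTensor (Forms n) (superConn X (superConn X (a ⊗ₜ s))) =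
      ∑ j, ∑ i, (dy j * dy i * a) ⊗ₜ[ℂ] r (X j (X i s)) := by
    rw [superConn_tmul, map_sum, map_sum, Finset.sum_comm]
    refine Finset.sum_congr rfl fun i _ => ?_
    rw [superConn_tmul, map_sum]
    refine Finset.sum_congr rfl fun j _ => ?_
    rw [LinearMap.lTensor_tmul, mul_assoc]
  rw [h0, sum_eq_sum_pairs _ fun i => by rw [dy_mul_self, zero_mul, TensorProduct.zero_tmul],
    twoForm_eq, twoForm_eq, Finset.sum_mul, Finset.sum_mul, TensorProduct.sum_tmul,
    TensorProduct.sum_tmul, ← Finset.sum_neg_distrib, ← Finset.sum_add_distrib]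
  refine Finset.sum_congr rfl fun p _ => ?_
  rw [dy_mul_dy_swap p.1 p.2, neg_mul, TensorProduct.neg_tmul, ← sub_eq_add_neg, ← TensorProduct.tmul_sub,
    hX, smul_mul_assoc, smul_mul_assoc, TensorProduct.smul_tmul, TensorProduct.smul_tmul,
    TensorProduct.tmul_add, TensorProduct.tmul_neg]

/-- The sign from moving `dy_k` past the Clifford operator produces a commutator. The resulting
three-form is left as it is: later only its parity matters. -/
lemma superConn_superTorsion
    (hκ : ∀ k i j s, r (X k (T i j s)) - r (T i j (X k s)) = κ k i j • r s) :
    r.lTensor (Forms n) (superConn X (superTorsion T (a ⊗ₜ s))) +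
      r.lTensor (Forms n) (superTorsion T (superConn X (a ⊗ₜ s))) =
      ((∑ k, ∑ p ∈ pairs n, κ k p.1 p.2 • (dy k * dy p.1 * dy p.2)) * Setting.cliffordE n a) ⊗ₜ[ℂ] r s := by
  have h1 : r.lTensor (Forms n) (superConn X (superTorsion T (a ⊗ₜ s))) = ∑ k, ∑ p ∈ pairs n,
      (dy k * dy p.1 * dy p.2 * Setting.cliffordE n a) ⊗ₜ[ℂ] r (X k (T p.1 p.2 s)) := by
    rw [superTorsion_tmul, map_sum, map_sum, Finset.sum_comm]
    refine Finset.sum_congr rfl fun p _ => ?_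
    rw [superConn_tmul, map_sum]
    refine Finset.sum_congr rfl fun k _ => ?_
    rw [LinearMap.lTensor_tmul, ← mul_assoc, ← mul_assoc]
  have h2 : r.lTensor (Forms n) (superTorsion T (superConn X (a ⊗ₜ s))) = ∑ k, ∑ p ∈ pairs n,
      -((dy k * dy p.1 * dy p.2 * Setting.cliffordE n a) ⊗ₜ[ℂ] r (T p.1 p.2 (X k s))) := by
    rw [superConn_tmul, map_sum, map_sum]
    refine Finset.sum_congr rfl fun k _ => ?_
    rw [superTorsion_tmul, map_sum]
    refine Finset.sum_congr rfl fun p _ => ?_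
    have h3 : dy p.1 * dy p.2 * dy k = (dy k * dy p.1 * dy p.2 : Forms n) := by
      rw [mul_assoc, dy_mul_dy_swap k p.2, mul_neg, ← mul_assoc, dy_mul_dy_swap k p.1, neg_mul,
        neg_neg]
    rw [LinearMap.lTensor_tmul, cliffordE_dy_mul, mul_neg, TensorProduct.neg_tmul, ← mul_assoc, h3]
  rw [h1, h2, ← Finset.sum_add_distrib, Finset.sum_mul, TensorProduct.sum_tmul]
  refine Finset.sum_congr rfl fun k _ => ?_
  rw [← Finset.sum_add_distrib, Finset.sum_mul, TensorProduct.sum_tmul]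
  refine Finset.sum_congr rfl fun p _ => ?_
  rw [← sub_eq_add_neg, ← TensorProduct.tmul_sub, hκ, smul_mul_assoc, TensorProduct.smul_tmul]

lemma superTorsion_sq (hT : ∀ i j s, r (T i j s) = τ i j • r s) :
    r.lTensor (Forms n) (superTorsion T (superTorsion T (a ⊗ₜ s))) =
      -((twoForm τ * twoForm τ * a) ⊗ₜ[ℂ] r s) := by
  rw [superTorsion_tmul, map_sum, map_sum, twoForm_eq, mul_assoc, Finset.sum_mul _ _ a,
    Finset.sum_mul_sum, Finset.sum_comm, TensorProduct.sum_tmul, ← Finset.sum_neg_distrib]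
  refine Finset.sum_congr rfl fun p _ => ?_
  rw [TensorProduct.sum_tmul, superTorsion_tmul, map_sum, ← Finset.sum_neg_distrib]
  refine Finset.sum_congr rfl fun p' _ => ?_
  rw [LinearMap.lTensor_tmul, hT, hT, cliffordE_dy_mul_dy_mul, cliffordE_cliffordE, smul_mul_assoc,
    smul_mul_assoc, mul_smul_comm, TensorProduct.smul_tmul, TensorProduct.smul_tmul, mul_neg,
    mul_neg, TensorProduct.neg_tmul, smul_comm]

/-- The square of a superconnection whose coefficients have scalar commutators. -/
lemma superconnection_sq (hF : ∀ i s, r (X i (D s)) - r (D (X i s)) = F i • r s)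
    (hT : ∀ i j s, r (T i j s) = τ i j • r s)
    (hD : ∀ i j s, r (D (T i j s)) = τ i j • r (D s))
    (hX : ∀ i j s, r (X i (X j s)) - r (X j (X i s)) = -(τ i j • r (D s)) + μ i j • r s)
    (hκ : ∀ k i j s, r (X k (T i j s)) - r (T i j (X k s)) = κ k i j • r s) {z q : ℂ}
    (hz : 4 * (z * q) = 1) {A : Forms n ⊗[ℂ] 𝓢 →ₗ[ℂ] Forms n ⊗[ℂ] 𝓢}
    (hA : A = z • superDirac D + superConn X - q • superTorsion T) :
    r.lTensor (Forms n) (A (A (a ⊗ₜ s))) =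
      -(z ^ 2) • (a ⊗ₜ[ℂ] r (D (D s))) - (2⁻¹ : ℂ) • ((twoForm τ * a) ⊗ₜ[ℂ] r (D s)) +
      ((twoForm μ - q ^ 2 • (twoForm τ * twoForm τ)) * a) ⊗ₜ[ℂ] r s +
      ((z • (∑ i, F i • dy i) - q • ∑ k, ∑ p ∈ pairs n, κ k p.1 p.2 • (dy k * dy p.1 * dy p.2)) *
        Setting.cliffordE n a) ⊗ₜ[ℂ] r s := by
  have h1 := superDirac_sq (D := D) (r := r) a s
  have h2 := superDirac_superConn a s hF
  have h3 := superDirac_superTorsion a s hT hD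
  have h4 := superConn_sq a s hX
  have h5 := superConn_superTorsion a s hκ
  have h6 := superTorsion_sq a s hT
  have h7 : r.lTensor (Forms n) (A (A (a ⊗ₜ s))) =
      z ^ 2 • r.lTensor (Forms n) (superDirac D (superDirac D (a ⊗ₜ s))) +
      z • (r.lTensor (Forms n) (superDirac D (superConn X (a ⊗ₜ s))) +
        r.lTensor (Forms n) (superConn X (superDirac D (a ⊗ₜ s)))) -
      (z * q) • (r.lTensor (Forms n) (superDirac D (superTorsion T (a ⊗ₜ s))) +
        r.lTensor (Forms n) (superTorsion T (superDirac D (a ⊗ₜ s)))) +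
      r.lTensor (Forms n) (superConn X (superConn X (a ⊗ₜ s))) -
      q • (r.lTensor (Forms n) (superConn X (superTorsion T (a ⊗ₜ s))) +
        r.lTensor (Forms n) (superTorsion T (superConn X (a ⊗ₜ s)))) +
      q ^ 2 • r.lTensor (Forms n) (superTorsion T (superTorsion T (a ⊗ₜ s))) := by
    subst hA
    simp only [LinearMap.sub_apply, LinearMap.add_apply, LinearMap.smul_apply, map_add, map_sub,
      map_smul]
    module
  -- The constant `1/4` in the superconnection enters here: the cross term of the Dirac operator and
  -- the torsion is `+½ T D`, the square of the connection gives `-T D`, and `-½ T D` remains.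
  have h8 : z * q = 4⁻¹ := by linear_combination 4⁻¹ * hz
  rw [h7, h1, h2, h3, h4, h5, h6, h8, sub_mul, sub_mul, smul_mul_assoc, smul_mul_assoc,
    smul_mul_assoc, TensorProduct.sub_tmul, TensorProduct.sub_tmul, ← TensorProduct.smul_tmul',
    ← TensorProduct.smul_tmul', ← TensorProduct.smul_tmul']
  module

end Square

end Algebra

end CircleEta
end

noncomputable section

namespace CircleEta

section Geometry

variable {n : ℕ} {B : Type*} [TopologicalSpace B] [ChartedSpace (Coord n) B]
  [IsManifold (𝓡 n) ∞ B]
  {E : B → Type*} [TopologicalSpace (TotalSpace Plane E)] [∀ b, NormedAddCommGroup (E b)]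
  [∀ b, InnerProductSpace ℝ (E b)] [FiberBundle Plane E] [VectorBundle ℝ Plane E]
  [ContMDiffVectorBundle ∞ Plane E (𝓡 n)] [IsContMDiffRiemannianBundle (𝓡 n) ∞ Plane E]
  [ChartedSpace (Coord (n + 1)) (UnitCircle E)] [IsManifold (𝓡 (n + 1)) ∞ (UnitCircle E)]
  {V : UnitCircle E → Type*} [TopologicalSpace (TotalSpace ℂ V)] [∀ x, NormedAddCommGroup (V x)]
  [∀ x, InnerProductSpace ℂ (V x)] [FiberBundle ℂ V] [VectorBundle ℝ ℂ V]
  [ContMDiffVectorBundle ∞ ℂ V (𝓡 (n + 1))]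

namespace Setting

variable (S : Setting (n := n) E V)

/-! ### The curvature in Fourier modes -/

section Modes

lemma _root_.CircleEta.partialAt_eq {b : B} {g : B → ℂ} (hg : ContMDiffAt (𝓡 n) 𝓘(ℝ, ℂ) ∞ g b)
    (i : Fin n) : partialAt i g b = chartPartial b i g b := by
  have h1 := (hg.mdifferentiableAt (by simp)).mfderiv
  have h2 : writtenInExtChartAt (𝓡 n) 𝓘(ℝ, ℂ) b g = fun p => g ((extChartAt (𝓡 n) b).symm p) := by
    funext p
    rfl
  rw [h2, ModelWithCorners.range_eq_univ, fderivWithin_univ] at h1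
  exact congrArg (fun L : Coord n →L[ℝ] ℂ => L (stdVec i)) h1

/-- Multiplication of the `m`-th Fourier coefficient by `m + r`. -/
def _root_.CircleEta.shiftedFreq (r : ℝ) : RapidSeq →ₗ[ℂ] RapidSeq :=
  RapidSeq.mulSeq _ (RapidSeq.polyGrowth_linear 1 r)

/-- The operator on Fourier coefficients given by the curvature of the superconnection. -/
def _root_.CircleEta.modeCurvature (t r : ℝ) (T Ω ρ : Forms n) :
    Forms n ⊗[ℂ] RapidSeq →ₗ[ℂ] Forms n ⊗[ℂ] RapidSeq :=
  (t : ℂ) • TensorProduct.map LinearMap.id (shiftedFreq r ∘ₗ shiftedFreq r) +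
    TensorProduct.map (LinearMap.mulLeft ℂ (-(Complex.I / 2) • T)) (shiftedFreq r) +
    TensorProduct.map (LinearMap.mulLeft ℂ (Ω - (1 / (16 * t) : ℂ) • (T * T)) +
      LinearMap.mulLeft ℂ ρ ∘ₗ parity n) LinearMap.id

variable {S} {b : B} {U : Set B} {σ : Π x, V x} {f : B → ℝ}
  {β : Π y : B, TangentSpace (𝓡 n) y →L[ℝ] ℂ} (hσ : S.IsLocalEigenframe U σ f β) (hb : b ∈ U)

lemma restrict_eq [T2Space B] : S.restrict b =
    (S.restrictSection b ∘ₗ (S.smoothSections b).subtype).lTensor (Forms n) :=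
  (LinearMap.lTensor_comp _ _ _).symm

lemma torsionCoeff_eq_of_base_eq [T2Space B] {x y : UnitCircle E} (hx : base x = b)
    (hy : base y = b) (i j : Fin n) : S.torsionCoeff b i j x = S.torsionCoeff b i j y := by
  obtain ⟨W, s, h, hW, -⟩ := S.exists_frame_circle b
  obtain ⟨θ, hθ⟩ := h.exists_mem_localDomain (x := x) (by rw [hx]; exact hW)
  obtain ⟨θ', hθ'⟩ := h.exists_mem_localDomain (x := y) (by rw [hy]; exact hW)
  rw [h.torsionCoeff_eq hθ, h.torsionCoeff_eq hθ', hx, hy]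

omit [IsManifold (𝓡 n) ∞ B] in
lemma lTensor_modeCurvature {M : Type*} [AddCommGroup M] [Module ℂ M] (Ψ : RapidSeq →ₗ[ℂ] M)
    (t r : ℝ) (T Ω ρ a : Forms n) (c : RapidSeq) :
    Ψ.lTensor (Forms n) (modeCurvature t r T Ω (-Complex.I • ρ) (a ⊗ₜ c)) =
      -(t : ℂ) • (a ⊗ₜ[ℂ] (-Ψ (shiftedFreq r (shiftedFreq r c)))) -
        (2⁻¹ : ℂ) • ((T * a) ⊗ₜ[ℂ] (Complex.I • Ψ (shiftedFreq r c))) +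
      ((Ω - (1 / (16 * t) : ℂ) • (T * T)) * a) ⊗ₜ[ℂ] Ψ c + (ρ * cliffordE n a) ⊗ₜ[ℂ] Ψ c := by
  simp only [modeCurvature, LinearMap.add_apply, LinearMap.smul_apply, TensorProduct.map_tmul,
    map_add, map_smul, LinearMap.lTensor_tmul, LinearMap.id_apply, LinearMap.comp_apply,
    LinearMap.mulLeft_apply, TensorProduct.add_tmul]
  simp only [cliffordE, LinearMap.smul_apply, mul_smul_comm, smul_mul_assoc, neg_smul,
    TensorProduct.tmul_neg, TensorProduct.neg_tmul, TensorProduct.tmul_smul, neg_mul, mul_neg,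
    ← TensorProduct.smul_tmul']
  module

include hσ hb

lemma isSmoothForm_lTensor [T2Space B] (w : Forms n ⊗[ℂ] RapidSeq) :
    S.IsSmoothForm b ((S.fibreSection b σ).lTensor (Forms n) w) := by
  obtain ⟨Q, hQ⟩ : ∃ Q : RapidSeq → S.smoothSections b,
      ∀ c, S.restrictSection b (Q c).1 = S.fibreSection b σ c :=
    Classical.axiomOfChoice fun c => hσ.isSmoothSection_fibreSection hb c
  induction w with
  | zero => exact ⟨0, by simp⟩
  | tmul a c =>
    refine ⟨a ⊗ₜ Q c, ?_⟩
    rw [LinearMap.lTensor_tmul, ← hQ]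
    rfl
  | add w w' hw hw' =>
    obtain ⟨v, hv⟩ := hw
    obtain ⟨v', hv'⟩ := hw'
    exact ⟨v + v', by rw [map_add, map_add, map_add, hv, hv']⟩

set_option maxHeartbeats 1000000 in
-- On the fibre all commutators are scalar, so `superconnection_sq` applies, and the Fourier modes
-- diagonalize `∇_e`. The remainder `ρ` collects the terms with `df` and `∂_k T_{ij}`; only its
-- parity is recorded, as an odd `ρ` cannot reach the even part of the trace.
lemma exists_curvature_fibreSection [T2Space B] {x₀ : UnitCircle E} (hx₀ : base x₀ = b) {t : ℝ}
    (ht : 0 < t) : ∃ ρ : Forms n, parity n ρ = -ρ ∧ ∀ W : Forms n ⊗[ℂ] RapidSeq,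
      S.curvature b t ((S.fibreSection b σ).lTensor (Forms n) W) =
        (S.fibreSection b σ).lTensor (Forms n) (modeCurvature t (f b) (S.torsionForm b x₀)
          (extDerivAt β b + (Complex.I * f b) • S.torsionForm b x₀) ρ W) := by
  obtain ⟨W, s₀, h, hW, -⟩ := S.exists_frame_circle b
  let r : S.smoothSections b →ₗ[ℂ] S.FibreSections b :=
    S.restrictSection b ∘ₗ (S.smoothSections b).subtype
  let τ : Fin n → Fin n → ℂ := fun i j => S.torsionCoeff b i j x₀
  let F : Fin n → ℂ := fun i => Complex.I * chartPartial b i (fun y => (f y : ℂ)) b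
  let dβ : Fin n → Fin n → ℂ := fun i j => chartPartial b i (fun y => β y (coordField b j y)) b -
    chartPartial b j (fun y => β y (coordField b i y)) b
  let κ : Fin n → Fin n → Fin n → ℂ := fun k i j =>
    (fderiv ℝ (S.curvCoeff s₀ b i j) (extChartAt (𝓡 n) b b) (stdVec k) : ℂ)
  have hdom : ∀ x : {x : UnitCircle E // base x = b}, ∃ θ₀, x.1 ∈ S.localDomain s₀ W θ₀ := fun x =>
    h.exists_mem_localDomain (by rw [x.2]; exact hW)
  have hτ : ∀ (x : {x : UnitCircle E // base x = b}) i j, (S.torsionCoeff b i j x.1 : ℂ) = τ i j :=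
    fun x i j => congrArg _ (torsionCoeff_eq_of_base_eq x.2 hx₀ i j)
  have hc : ∀ s, ∃ c, S.fibreSection b σ c = r s := fun s =>
    hσ.exists_fibreSection_eq hb ⟨s, rfl⟩
  have hV : ∀ (s : S.smoothSections b) c, S.fibreSection b σ c = r s →
      r (S.vertDeriv b s) = Complex.I • S.fibreSection b σ (shiftedFreq (f b) c) := fun s c hs => by
    have h1 := hσ.restrict_vertDeriv hb hs.symm
    rw [← map_smul]
    refine h1.trans (congrArg _ ?_)
    ext m
    change (Complex.I * m + Complex.I * f b) * c.1 m = Complex.I * ((1 * m + f b) * c.1 m)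
    ring
  have hF : ∀ i s, r (S.horDeriv b i (S.vertDeriv b s)) - r (S.vertDeriv b (S.horDeriv b i s)) =
      F i • r s := fun i s => funext fun x => by
    obtain ⟨θ₀, hθ⟩ := hdom x
    have := h.horDeriv_vertDeriv hσ hθ hb x.2 s i
    rw [x.2] at this
    exact this
  have hT : ∀ i j s, r (S.torsionMul b i j s) = τ i j • r s := fun i j s => funext fun x => by
    have := h.torsionMul_apply (x := x.1)
      (by rw [x.2]; exact mem_chart_source (Coord n) b) s i j
    rw [hτ] at this
    exact this
  -- The torsion is constant on the fibre, so in Fourier coefficients this is the linearity of the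
  -- vertical derivative.
  have hD : ∀ i j s, r (S.vertDeriv b (S.torsionMul b i j s)) = τ i j • r (S.vertDeriv b s) :=
    fun i j s => by
      obtain ⟨c, hcs⟩ := hc s
      rw [hV s c hcs, hV (S.torsionMul b i j s) (τ i j • c) (by rw [map_smul, hcs, hT]), map_smul,
        map_smul, smul_comm]
  have hX : ∀ i j s, r (S.horDeriv b i (S.horDeriv b j s)) - r (S.horDeriv b j (S.horDeriv b i s)) =
      -(τ i j • r (S.vertDeriv b s)) + (Complex.I * f b * τ i j + dβ i j) • r s :=
    fun i j s => funext fun x => by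
      obtain ⟨θ₀, hθ⟩ := hdom x
      have := h.horDeriv_horDeriv hσ hθ hb x.2 s i j
      rw [x.2, hτ] at this
      exact this
  have hκ : ∀ k i j s, r (S.horDeriv b k (S.torsionMul b i j s)) -
      r (S.torsionMul b i j (S.horDeriv b k s)) = κ k i j • r s :=
    fun k i j s => funext fun x => by
      obtain ⟨θ₀, hθ⟩ := hdom x
      have := h.horDeriv_torsionMul hσ hθ (by rw [x.2]; exact hb) s i j k
      rw [x.2] at this
      exact this
  have hs0 : (Real.sqrt t : ℂ) ≠ 0 := by exact_mod_cast (Real.sqrt_pos.2 ht).ne'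
  have hs2 : (Real.sqrt t : ℂ) ^ 2 = t := by exact_mod_cast Real.sq_sqrt ht.le
  have hz : 4 * ((Real.sqrt t : ℂ) * (1 / (4 * Real.sqrt t) : ℂ)) = 1 := by field_simp
  have hq : (1 / (4 * Real.sqrt t) : ℂ) ^ 2 = 1 / (16 * t) := by
    rw [div_pow, mul_pow, hs2]; norm_num
  have hΩ : twoForm (fun i j => Complex.I * f b * τ i j + dβ i j) =
      extDerivAt β b + (Complex.I * f b) • S.torsionForm b x₀ := by
    have h1 : extDerivAt β b = twoForm dβ := by
      refine congrArg twoForm (funext fun i => funext fun j => ?_)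
      rw [partialAt_eq (hσ.smooth_form b hb j), partialAt_eq (hσ.smooth_form b hb i)]
    rw [h1, torsionForm, twoForm_eq, twoForm_eq, twoForm_eq, Finset.smul_sum,
      ← Finset.sum_add_distrib]
    refine Finset.sum_congr rfl fun p _ => ?_
    rw [smul_smul, ← add_smul, add_comm]
  let ρ : Forms n := ((Real.sqrt t : ℂ) • (∑ i, F i • dy i) -
    (1 / (4 * Real.sqrt t) : ℂ) • ∑ k, ∑ p ∈ pairs n, κ k p.1 p.2 • (dy k * dy p.1 * dy p.2))
  have hρ : parity n ρ = -ρ := by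
    simp only [ρ, map_smul, map_sub, map_sum, parity_mul, parity_dy, mul_neg, neg_mul, smul_neg,
      Finset.sum_neg_distrib, neg_neg, neg_sub, sub_neg_eq_add, neg_add_eq_sub]
  -- `curvature_restrict` asks for an operator on all fibre forms, smooth or not; a linear left
  -- inverse of `fibreSection` carries the operator on coefficients over to them.
  obtain ⟨P, hP⟩ := LinearMap.exists_leftInverse_of_injective (S.fibreSection b σ)
    (LinearMap.ker_eq_bot.2 (hσ.fibreSection_injective hb))
  let L := modeCurvature t (f b) (S.torsionForm b x₀)
    (extDerivAt β b + (Complex.I * f b) • S.torsionForm b x₀) (-Complex.I • ρ)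
  have hP' : ∀ w, P.lTensor (Forms n) ((S.fibreSection b σ).lTensor (Forms n) w) = w := fun w => by
    rw [← LinearMap.comp_apply, ← LinearMap.lTensor_comp, hP, LinearMap.lTensor_id, LinearMap.id_apply]
  have key : S.restrict b ∘ₗ S.smoothSuperconnection b t ∘ₗ S.smoothSuperconnection b t =
      ((S.fibreSection b σ).lTensor (Forms n) ∘ₗ L ∘ₗ P.lTensor (Forms n)) ∘ₗ S.restrict b := by
    refine TensorProduct.ext' fun a s => ?_
    obtain ⟨c, hcs⟩ := hc s
    have h1 := superconnection_sq (A := S.smoothSuperconnection b t) a s hF hT hD hX hκ hz rfl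
    have h2 : r (S.vertDeriv b (S.vertDeriv b s)) =
        -S.fibreSection b σ (shiftedFreq (f b) (shiftedFreq (f b) c)) := by
      rw [hV (S.vertDeriv b s) (Complex.I • shiftedFreq (f b) c)
        (by rw [map_smul, hV s c hcs]), map_smul, map_smul, smul_smul, Complex.I_mul_I,
        neg_one_smul]
    rw [LinearMap.comp_apply, LinearMap.comp_apply, restrict_eq]
    refine h1.trans ?_
    have h3 : ((S.fibreSection b σ).lTensor (Forms n) ∘ₗ L ∘ₗ P.lTensor (Forms n))
        (r.lTensor (Forms n) (a ⊗ₜ s)) = (S.fibreSection b σ).lTensor (Forms n) (L (a ⊗ₜ c)) := by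
      rw [LinearMap.comp_apply, LinearMap.comp_apply, LinearMap.lTensor_tmul, ← hcs,
        ← LinearMap.lTensor_tmul, hP']
    refine Eq.trans ?_ h3.symm
    rw [h2, hV s c hcs, ← hcs, hs2, hq, hΩ]
    exact (lTensor_modeCurvature _ _ _ _ _ _ _ _).symm
  refine ⟨-Complex.I • ρ, by rw [map_smul, hρ, smul_neg], fun w => ?_⟩
  rw [S.curvature_restrict b t
    ((S.fibreSection b σ).lTensor (Forms n) ∘ₗ L ∘ₗ P.lTensor (Forms n)) (fun w => LinearMap.congr_fun key w)
    (isSmoothForm_lTensor hσ hb w), LinearMap.comp_apply,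
    LinearMap.comp_apply, hP']

end Modes

end Setting
end Geometry
end CircleEta
end

noncomputable section

namespace CircleEta

/-! ### Even forms, nilpotency, and power series of forms -/

section Algebra

variable {n : ℕ}

lemma ι_mul_eq (v : Coord n →ₗ[ℝ] ℂ) (x : Forms n) :
    ExteriorAlgebra.ι ℂ v * x = parity n x * ExteriorAlgebra.ι ℂ v := by
  induction x using ExteriorAlgebra.induction with
  | algebraMap r => simp [parity, Algebra.commutes]
  | ι w =>
    rw [show parity n (ExteriorAlgebra.ι ℂ w) = -ExteriorAlgebra.ι ℂ w by
      simp [parity, ExteriorAlgebra.map_apply_ι], neg_mul]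
    exact eq_neg_of_add_eq_zero_left (ExteriorAlgebra.ι_add_mul_swap _ _)
  | mul a b ha hb => rw [← mul_assoc, ha, mul_assoc, hb, ← mul_assoc, parity_mul]
  | add a b ha hb => rw [mul_add, map_add, add_mul, ha, hb]

/-- Even forms commute with one-forms, and one-forms generate the algebra. -/
lemma commute_of_even {a : Forms n} (ha : parity n a = a) (x : Forms n) : Commute a x := by
  induction x using ExteriorAlgebra.induction with
  | algebraMap r => exact (Algebra.commutes r a).symm
  | ι w => exact ((ι_mul_eq w a).trans (by rw [ha])).symm
  | mul x y hx hy => exact hx.mul_right hy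
  | add x y hx hy => exact hx.add_right hy

lemma mul_eq_of_odd {a : Forms n} (ha : parity n a = -a) (x : Forms n) : a * x = parity n x * a := by
  induction x using ExteriorAlgebra.induction with
  | algebraMap r => simp [parity, Algebra.commutes]
  | ι w =>
    have h := ι_mul_eq w a
    rw [ha] at h
    rw [show parity n (ExteriorAlgebra.ι ℂ w) = -ExteriorAlgebra.ι ℂ w by
      simp [parity, ExteriorAlgebra.map_apply_ι], neg_mul, h, neg_mul, neg_neg]
  | mul x y hx hy => rw [← mul_assoc, hx, mul_assoc, hy, ← mul_assoc, parity_mul]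
  | add x y hx hy => rw [mul_add, map_add, add_mul, hx, hy]

/-- An odd form anticommutes with itself, and `2` is invertible. -/
lemma mul_self_of_odd {a : Forms n} (ha : parity n a = -a) : a * a = 0 := by
  have h := mul_eq_of_odd ha a
  rw [ha, neg_mul] at h
  have h1 : (2 : ℂ) • (a * a) = 0 := by rw [two_smul]; exact add_eq_zero_iff_eq_neg.2 h
  exact (smul_eq_zero.1 h1).resolve_left two_ne_zero

lemma parity_one : parity n 1 = 1 := by simp [parity]

lemma parity_pow_of_even {a : Forms n} (ha : parity n a = a) (k : ℕ) : parity n (a ^ k) = a ^ k := by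
  induction k with
  | zero => rw [pow_zero, parity_one]
  | succ k ih => rw [pow_succ, parity_mul, ih, ha]

lemma parity_twoForm (c : Fin n → Fin n → ℂ) : parity n (twoForm c) = twoForm c := by
  simp only [twoForm_eq, map_sum, map_smul, parity_mul, parity_dy, neg_mul_neg]

lemma evenPart_of_even {a : Forms n} (ha : parity n a = a) : evenPart a = a := by
  rw [evenPart, ha, ← two_smul ℂ a, smul_smul, inv_mul_cancel₀ two_ne_zero, one_smul]

lemma evenPart_of_odd {a : Forms n} (ha : parity n a = -a) : evenPart a = 0 := by
  rw [evenPart, ha, add_neg_cancel, smul_zero]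

lemma evenPart_add (a b : Forms n) : evenPart (a + b) = evenPart a + evenPart b := by
  simp only [evenPart, map_add]
  module

lemma twoForm_mem (c : Fin n → Fin n → ℂ) : twoForm c ∈ ⋀[ℂ]^2 (Coord n →ₗ[ℝ] ℂ) := by
  rw [twoForm_eq]
  refine Submodule.sum_mem _ fun p _ => Submodule.smul_mem _ _ ?_
  change dy p.1 * dy p.2 ∈ LinearMap.range (ExteriorAlgebra.ι ℂ) ^ 2
  rw [pow_two]
  exact Submodule.mul_mem_mul (LinearMap.mem_range_self _ _) (LinearMap.mem_range_self _ _)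

/-- The complex valued functionals form a complex vector space of dimension `n`, so more than `n` of
them are linearly dependent. -/
lemma eq_zero_of_mem_exteriorPower {k : ℕ} (hk : n < k) {x : Forms n}
    (hx : x ∈ ⋀[ℂ]^k (Coord n →ₗ[ℝ] ℂ)) : x = 0 := by
  rw [← ExteriorAlgebra.ιMulti_span_fixedDegree] at hx
  have h0 : Set.range (ExteriorAlgebra.ιMulti ℂ k (M := Coord n →ₗ[ℝ] ℂ)) ⊆ {0} := by
    rintro _ ⟨v, rfl⟩
    refine AlternatingMap.map_linearDependent _ v fun hv => ?_
    have h1 := hv.fintype_card_le_finrank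
    rw [Module.finrank_linearMap_self, finrank_euclideanSpace, Fintype.card_fin,
      Fintype.card_fin] at h1
    omega
  have h1 := Submodule.span_mono (R := ℂ) h0 hx
  simpa using h1

lemma pow_mem_exteriorPower {x : Forms n} (hx : x ∈ ⋀[ℂ]^2 (Coord n →ₗ[ℝ] ℂ)) (k : ℕ) :
    x ^ k ∈ ⋀[ℂ]^(2 * k) (Coord n →ₗ[ℝ] ℂ) := by
  have := SetLike.pow_mem_graded (A := fun i : ℕ => ⋀[ℂ]^i (Coord n →ₗ[ℝ] ℂ)) k hx
  rwa [smul_eq_mul, mul_comm] at this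

lemma pow_eq_zero_of_mem {x : Forms n} (hx : x ∈ ⋀[ℂ]^2 (Coord n →ₗ[ℝ] ℂ)) {k : ℕ} (hk : n < k) :
    x ^ k = 0 := eq_zero_of_mem_exteriorPower (by omega) (pow_mem_exteriorPower hx k)

/-- The rescaling on forms of even degree. -/
lemma rescaleForm_of_mem {k : ℕ} {x : Forms n} (hx : x ∈ ⋀[ℂ]^(2 * k) (Coord n →ₗ[ℝ] ℂ)) :
    rescaleForm x = ((2 * Real.pi * Complex.I : ℂ) ^ k)⁻¹ • x := by
  by_cases hk : n < 2 * k
  · rw [eq_zero_of_mem_exteriorPower hk hx, smul_zero, rescaleForm]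
    simp [degreePart]
  · rw [rescaleForm, Finset.sum_eq_single_of_mem k (Finset.mem_range.2 (by omega)) fun j _ hj => ?_]
    · congr 1
      exact DirectSum.decompose_of_mem_same (fun i : ℕ => ⋀[ℂ]^i (Coord n →ₗ[ℝ] ℂ)) hx
    · rw [show degreePart (2 * j) x = 0 from
        DirectSum.decompose_of_mem_ne
          (fun i : ℕ => ⋀[ℂ]^i (Coord n →ₗ[ℝ] ℂ)) hx (by omega), smul_zero]

lemma rescaleForm_add (x y : Forms n) : rescaleForm (x + y) = rescaleForm x + rescaleForm y := by
  simp only [rescaleForm, degreePart, map_add, smul_add, Finset.sum_add_distrib]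

lemma rescaleForm_smul (c : ℂ) (x : Forms n) : rescaleForm (c • x) = c • rescaleForm x := by
  have h : ∀ k, degreePart k (c • x) = c • degreePart k x := fun k => by
    simp only [degreePart, GradedRing.proj_apply, DirectSum.decompose_smul, DirectSum.smul_apply]
    rfl
  simp only [rescaleForm, h, Finset.smul_sum]
  exact Finset.sum_congr rfl fun j _ => smul_comm _ _ _

lemma evalAtForm_eq_aeval {η : Forms n} (hη : η ^ (n + 1) = 0) (p : Polynomial ℂ) :
    evalAtForm (p : PowerSeries ℂ) η = Polynomial.aeval η p := by
  rw [Polynomial.aeval_eq_sum_range' (n := p.natDegree + 1 + (n + 1)) (by omega), evalAtForm]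
  have h : ∀ k, n + 1 ≤ k → p.coeff k • η ^ k = 0 := fun k hk => by
    rw [← Nat.sub_add_cancel hk, pow_add, hη, mul_zero, smul_zero]
  rw [← Finset.sum_subset (Finset.range_mono (Nat.le_add_left (n + 1) (p.natDegree + 1)))
    fun k _ hk => h k (by simpa using hk)]
  simp

lemma evalAtForm_trunc (p : PowerSeries ℂ) (η : Forms n) :
    evalAtForm (PowerSeries.trunc (n + 1) p : PowerSeries ℂ) η = evalAtForm p η := by
  refine Finset.sum_congr rfl fun k hk => ?_
  rw [Polynomial.coeff_coe, PowerSeries.coeff_trunc, if_pos (Finset.mem_range.1 hk)]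

/-- Evaluation ignores the coefficients beyond degree `n`. On polynomials it is the evaluation
homomorphism, since `η` is nilpotent, and the truncation of a product depends only on the truncated
factors. -/
lemma evalAtForm_mul {η : Forms n} (hη : η ^ (n + 1) = 0) (p q : PowerSeries ℂ) :
    evalAtForm (p * q) η = evalAtForm p η * evalAtForm q η := by
  rw [← evalAtForm_trunc (p * q), ← PowerSeries.trunc_trunc_mul_trunc, evalAtForm_trunc,
    ← Polynomial.coe_mul, evalAtForm_eq_aeval hη, map_mul, ← evalAtForm_eq_aeval hη,
    ← evalAtForm_eq_aeval hη, evalAtForm_trunc, evalAtForm_trunc]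

lemma evalAtForm_smul (r : ℂ) (p : PowerSeries ℂ) (η : Forms n) :
    evalAtForm p (r • η) = evalAtForm (PowerSeries.rescale r p) η := by
  refine Finset.sum_congr rfl fun k _ => ?_
  rw [smul_pow, PowerSeries.coeff_rescale, smul_smul, mul_comm]

lemma parity_evalAtForm {η : Forms n} (hη : parity n η = η) (p : PowerSeries ℂ) :
    parity n (evalAtForm p η) = evalAtForm p η := by
  simp only [evalAtForm, map_sum, map_smul, parity_pow_of_even hη]

/-- The rescaling of a product of power series in forms of degree two. -/
lemma rescaleForm_mul {x y : Forms n} (hx : x ∈ ⋀[ℂ]^2 (Coord n →ₗ[ℝ] ℂ))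
    (hy : y ∈ ⋀[ℂ]^2 (Coord n →ₗ[ℝ] ℂ)) (p q : PowerSeries ℂ) :
    rescaleForm (evalAtForm p x * evalAtForm q y) =
      evalAtForm p ((2 * Real.pi * Complex.I : ℂ)⁻¹ • x) *
        evalAtForm q ((2 * Real.pi * Complex.I : ℂ)⁻¹ • y) := by
  have h0 : ∀ (s : Finset (ℕ × ℕ)) (g : ℕ × ℕ → Forms n),
      rescaleForm (∑ i ∈ s, g i) = ∑ i ∈ s, rescaleForm (g i) := fun s g => by
    classical
    induction s using Finset.induction_on with
    | empty => simp [rescaleForm, degreePart]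
    | insert i s hi ih => rw [Finset.sum_insert hi, rescaleForm_add, ih, Finset.sum_insert hi]
  simp only [evalAtForm]
  rw [Finset.sum_mul_sum, ← Finset.sum_product', h0, Finset.sum_mul_sum, ← Finset.sum_product']
  refine Finset.sum_congr rfl fun i _ => ?_
  have h1 : x ^ i.1 * y ^ i.2 ∈ ⋀[ℂ]^(2 * (i.1 + i.2)) (Coord n →ₗ[ℝ] ℂ) := by
    rw [mul_add]
    exact SetLike.mul_mem_graded (A := fun i : ℕ => ⋀[ℂ]^i (Coord n →ₗ[ℝ] ℂ))
      (pow_mem_exteriorPower hx _) (pow_mem_exteriorPower hy _)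
  rw [smul_mul_smul_comm, rescaleForm_smul, rescaleForm_of_mem h1, smul_pow, smul_pow,
    smul_mul_smul_comm, smul_mul_smul_comm, pow_add, mul_inv, inv_pow, inv_pow]

/-! ### Exponentials of nilpotent forms -/

lemma exp_eq_evalAtForm {x : Forms n} (hx : x ^ (n + 1) = 0) :
    IsNilpotent.exp x = evalAtForm (PowerSeries.exp ℂ) x := by
  rw [IsNilpotent.exp_eq_sum hx, evalAtForm]
  refine Finset.sum_congr rfl fun k _ => ?_
  rw [PowerSeries.coeff_exp, ← Rat.cast_smul_eq_qsmul ℂ]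
  simp

/-- The power series `exp(c X²)`. -/
def gaussSeries (c : ℂ) : PowerSeries ℂ :=
  PowerSeries.mk fun k => if Even k then c ^ (k / 2) / ((k / 2).factorial : ℂ) else 0

lemma _root_.Finset.sum_range_two_mul {M : Type*} [AddCommMonoid M] (g : ℕ → M) (m : ℕ) :
    ∑ k ∈ Finset.range (2 * m), g k = ∑ l ∈ Finset.range m, (g (2 * l) + g (2 * l + 1)) := by
  induction m with
  | zero => simp
  | succ m ih => rw [mul_add, Finset.sum_range_succ, Finset.sum_range_succ, ih,
      Finset.sum_range_succ, add_assoc]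

lemma exp_smul_sq {x : Forms n} (hx : x ^ (n + 1) = 0) (c : ℂ) :
    IsNilpotent.exp (c • (x * x)) = evalAtForm (gaussSeries c) x := by
  have h1 : (c • (x * x)) ^ (n + 1) = 0 := by
    rw [smul_pow, ← pow_two, ← pow_mul, mul_comm, pow_mul, hx, zero_pow two_ne_zero, smul_zero]
  -- The range is doubled so that even and odd exponents can be paired; the additional terms vanish.
  have h2 : evalAtForm (gaussSeries c) x =
      ∑ k ∈ Finset.range (2 * (n + 1)), PowerSeries.coeff k (gaussSeries c) • x ^ k := by
    refine Finset.sum_subset (Finset.range_mono (by omega)) fun k _ hk => ?_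
    have hk' : n + 1 ≤ k := by simpa using hk
    rw [← Nat.sub_add_cancel hk', pow_add, hx, mul_zero, smul_zero]
  rw [h2, Finset.sum_range_two_mul, IsNilpotent.exp_eq_sum h1]
  refine Finset.sum_congr rfl fun l _ => ?_
  have h3 : ¬ Even (2 * l + 1) := by simp
  rw [gaussSeries, PowerSeries.coeff_mk, PowerSeries.coeff_mk, if_pos (even_two_mul l), if_neg h3,
    zero_smul, add_zero, Nat.mul_div_cancel_left _ two_pos, smul_pow, pow_mul, pow_two,
    ← Rat.cast_smul_eq_qsmul ℂ, smul_smul]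
  congr 1
  push_cast
  rw [div_eq_inv_mul]

/-- The powers of the sum of the multiplication with an even form and of an odd operator of square zero,
applied to the form `1`. -/
lemma pow_apply_one {x ρ : Forms n} (hx : parity n x = x) (hρ : parity n ρ = -ρ) (k : ℕ) :
    ((LinearMap.mulLeft ℂ x - LinearMap.mulLeft ℂ ρ ∘ₗ parity n) ^ k) 1 =
      x ^ k - (k : ℂ) • (x ^ (k - 1) * ρ) := by
  induction k with
  | zero => simp
  | succ k ih =>
    rw [pow_succ', Module.End.mul_apply, ih]
    simp only [LinearMap.sub_apply, LinearMap.mulLeft_apply, LinearMap.comp_apply, map_sub, map_smul,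
      parity_mul, parity_pow_of_even hx, hρ, mul_neg]
    -- Powers of `x` are central and `ρ² = 0`, so no term with two factors `ρ` survives.
    have h1 : ρ * (x ^ (k - 1) * ρ) = 0 := by
      rw [← mul_assoc, ← ((commute_of_even hx ρ).pow_left (k - 1)).eq, mul_assoc, mul_self_of_odd hρ,
        mul_zero]
    have h2 : (k : ℂ) • (x * (x ^ (k - 1) * ρ)) = (k : ℂ) • (x ^ k * ρ) := by
      rcases k with _ | k
      · simp
      · rw [Nat.add_sub_cancel, ← mul_assoc, ← pow_succ']
    rw [h1, neg_zero, sub_zero, h2, ← pow_succ', ← ((commute_of_even hx ρ).pow_left k).eq,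
      Nat.add_sub_cancel]
    push_cast
    module

/-- The two summands commute because `x` is central. The first vanishes in the power `K`, the second
already in the power two, as `ρ² = 0`. -/
lemma exists_pow_eq_zero {x ρ : Forms n} (hx : parity n x = x) (hρ : parity n ρ = -ρ) {K : ℕ}
    (hK : x ^ K = 0) : (LinearMap.mulLeft ℂ x - LinearMap.mulLeft ℂ ρ ∘ₗ parity n) ^ (K + 1) = 0 := by
  have h1 : Commute (LinearMap.mulLeft ℂ x) (LinearMap.mulLeft ℂ ρ ∘ₗ parity n) := by
    refine LinearMap.ext fun a => ?_
    simp only [Module.End.mul_apply, LinearMap.mulLeft_apply, LinearMap.comp_apply, parity_mul, hx]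
    rw [← mul_assoc, ← mul_assoc, (commute_of_even hx ρ).eq]
  have h2 : (LinearMap.mulLeft ℂ ρ ∘ₗ parity n) ^ 2 = 0 := by
    refine LinearMap.ext fun a => ?_
    rw [pow_two]
    simp only [Module.End.mul_apply, LinearMap.mulLeft_apply, LinearMap.comp_apply, parity_mul, hρ,
      parity_parity]
    rw [neg_mul, mul_neg, ← mul_assoc, mul_self_of_odd hρ]
    simp
  have h3 : (LinearMap.mulLeft ℂ x) ^ K = 0 := by
    rw [LinearMap.pow_mulLeft, hK, LinearMap.mulLeft_zero_eq_zero]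
  have h4 := h1.neg_right.add_pow_eq_zero_of_add_le_succ_of_pow_eq_zero (k := K + 1) h3
    (n := 2) (by rw [neg_sq, h2]) (by omega)
  rwa [← sub_eq_add_neg] at h4

/-- The powers applied to `1` are `x^k - k x^{k-1} ρ`, and division by `k!` turns the second part
into an index shift of the same exponential series. -/
lemma sum_pow_apply_one {x ρ : Forms n} (hx : parity n x = x) (hρ : parity n ρ = -ρ) {K : ℕ}
    (hK : x ^ K = 0) : ∑ k ∈ Finset.range (K + 1), ((k.factorial : ℂ)⁻¹) •
      ((LinearMap.mulLeft ℂ x - LinearMap.mulLeft ℂ ρ ∘ₗ parity n) ^ k) 1 =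
      IsNilpotent.exp x * (1 - ρ) := by
  have h0 : IsNilpotent.exp x = ∑ k ∈ Finset.range K, ((k.factorial : ℂ)⁻¹) • x ^ k := by
    rw [IsNilpotent.exp_eq_sum hK]
    refine Finset.sum_congr rfl fun k _ => ?_
    rw [← Rat.cast_smul_eq_qsmul ℂ]
    simp
  simp only [pow_apply_one hx hρ, smul_sub, Finset.sum_sub_distrib]
  rw [mul_sub, mul_one, h0]
  congr 1
  · rw [Finset.sum_range_succ, hK, smul_zero, add_zero]
  · rw [Finset.sum_range_succ', Finset.sum_mul]
    simp only [Nat.cast_zero, zero_smul, smul_zero, add_zero]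
    refine Finset.sum_congr rfl fun k _ => ?_
    rw [Nat.add_sub_cancel, smul_smul, smul_mul_assoc]
    congr 1
    rw [Nat.factorial_succ]
    have : ((k : ℂ) + 1) ≠ 0 := Nat.cast_add_one_ne_zero k
    have : (k.factorial : ℂ) ≠ 0 := by exact_mod_cast k.factorial_ne_zero
    push_cast
    field_simp

end Algebra

end CircleEta
end

noncomputable section

namespace CircleEta

/-! ### Fourier modes of forms with values in sections -/

section ModeAlgebra

variable {n : ℕ}

/-- The `m`-th Fourier coefficient of a form. -/
def modeEval (m : ℤ) : Forms n ⊗[ℂ] RapidSeq →ₗ[ℂ] Forms n :=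
  (TensorProduct.rid ℂ (Forms n)).toLinearMap ∘ₗ
    (LinearMap.proj m ∘ₗ RapidSeq.subtype).lTensor (Forms n)

lemma modeEval_tmul (m : ℤ) (a : Forms n) (c : RapidSeq) : modeEval m (a ⊗ₜ c) = c.1 m • a := rfl

/-- The coefficient of a form for a linear functional. -/
def seqCoeff (φ : Module.Dual ℂ (Forms n)) : Forms n ⊗[ℂ] RapidSeq →ₗ[ℂ] RapidSeq :=
  (TensorProduct.lid ℂ RapidSeq).toLinearMap ∘ₗ LinearMap.rTensor RapidSeq φ

lemma seqCoeff_apply (φ : Module.Dual ℂ (Forms n)) (w : Forms n ⊗[ℂ] RapidSeq) (m : ℤ) :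
    (seqCoeff φ w).1 m = φ (modeEval m w) := by
  induction w with
  | zero => simp
  | tmul a c =>
    rw [modeEval_tmul, map_smul, smul_eq_mul, mul_comm]
    rfl
  | add w w' hw hw' =>
    rw [map_add, map_add, map_add, ← hw, ← hw']
    rfl

/-- Over a field the first factor has a basis, and the coordinates of a tensor in it are obtained
from the coordinate functionals. -/
lemma eq_zero_of_forall_lid_rTensor {F M : Type*} [AddCommGroup F] [Module ℂ F] [AddCommGroup M]
    [Module ℂ M] {w : F ⊗[ℂ] M}
    (h : ∀ φ : Module.Dual ℂ F, TensorProduct.lid ℂ M (LinearMap.rTensor M φ w) = 0) : w = 0 := by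
  classical
  let 𝓑 := Module.Basis.ofVectorSpace ℂ F
  have h1 : ∀ (w : F ⊗[ℂ] M) i, TensorProduct.equivFinsuppOfBasisLeft 𝓑 w i =
      TensorProduct.lid ℂ M (LinearMap.rTensor M (𝓑.coord i) w) := fun w i => by
    induction w with
    | zero => simp
    | tmul a c => simp
    | add w w' hw hw' => rw [map_add, map_add, map_add, ← hw, ← hw', Finsupp.add_apply]
  apply (TensorProduct.equivFinsuppOfBasisLeft 𝓑).injective
  ext i
  rw [h1, h, map_zero, Finsupp.zero_apply]

lemma eq_zero_of_forall_modeEval {w : Forms n ⊗[ℂ] RapidSeq} (h : ∀ m, modeEval m w = 0) :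
    w = 0 := by
  refine eq_zero_of_forall_lid_rTensor fun φ => Subtype.ext (funext fun m => ?_)
  exact (seqCoeff_apply φ w m).trans (by rw [h, map_zero]; rfl)

lemma modeEval_map (m : ℤ) (A : Forms n →ₗ[ℂ] Forms n) (a : ℤ → ℂ) (ha : RapidSeq.PolyGrowth a)
    (w : Forms n ⊗[ℂ] RapidSeq) :
    modeEval m (TensorProduct.map A (RapidSeq.mulSeq a ha) w) = a m • A (modeEval m w) := by
  induction w with
  | zero => simp
  | tmul x c =>
    rw [TensorProduct.map_tmul, modeEval_tmul, modeEval_tmul, RapidSeq.mulSeq_apply, map_smul,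
      smul_smul]
  | add w w' hw hw' => rw [map_add, map_add, hw, hw', map_add, map_add, smul_add]

lemma modeEval_map_id (m : ℤ) (A : Forms n →ₗ[ℂ] Forms n) (w : Forms n ⊗[ℂ] RapidSeq) :
    modeEval m (TensorProduct.map A LinearMap.id w) = A (modeEval m w) := by
  induction w with
  | zero => simp
  | tmul x c => rw [TensorProduct.map_tmul, modeEval_tmul, modeEval_tmul, map_smul, LinearMap.id_apply]
  | add w w' hw hw' => rw [map_add, map_add, hw, hw', map_add, map_add]

/-- The even part of the exponent at a Fourier mode. -/
def modeExponent (t l : ℝ) (T Ω : Forms n) : Forms n :=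
  (Complex.I * l / 2) • T + (1 / (16 * t) : ℂ) • (T * T) - Ω

/-- The nilpotent part of `-𝔸_t²`. -/
def modeNilpotent (t r : ℝ) (T Ω ρ : Forms n) :
    Forms n ⊗[ℂ] RapidSeq →ₗ[ℂ] Forms n ⊗[ℂ] RapidSeq :=
  TensorProduct.map (LinearMap.mulLeft ℂ ((Complex.I / 2) • T)) (shiftedFreq r) +
    TensorProduct.map (LinearMap.mulLeft ℂ ((1 / (16 * t) : ℂ) • (T * T) - Ω) -
      LinearMap.mulLeft ℂ ρ ∘ₗ parity n) LinearMap.id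

lemma modeEval_modeNilpotent (t r : ℝ) (T Ω ρ : Forms n) (m : ℤ) (w : Forms n ⊗[ℂ] RapidSeq) :
    modeEval m (modeNilpotent t r T Ω ρ w) =
      (LinearMap.mulLeft ℂ (modeExponent t (m + r) T Ω) - LinearMap.mulLeft ℂ ρ ∘ₗ parity n)
        (modeEval m w) := by
  rw [modeNilpotent, LinearMap.add_apply, map_add, modeEval_map_id, shiftedFreq, modeEval_map]
  simp only [LinearMap.sub_apply, LinearMap.mulLeft_apply, LinearMap.comp_apply, modeExponent,
    add_mul, sub_mul, smul_mul_assoc]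
  push_cast
  module

lemma modeEval_modeNilpotent_pow (t r : ℝ) (T Ω ρ : Forms n) (m : ℤ) (k : ℕ)
    (w : Forms n ⊗[ℂ] RapidSeq) : modeEval m ((modeNilpotent t r T Ω ρ ^ k) w) =
      ((LinearMap.mulLeft ℂ (modeExponent t (m + r) T Ω) - LinearMap.mulLeft ℂ ρ ∘ₗ parity n) ^ k)
        (modeEval m w) := by
  induction k with
  | zero => simp
  | succ k ih => rw [pow_succ', pow_succ', Module.End.mul_apply, Module.End.mul_apply,
      modeEval_modeNilpotent, ih]

lemma modeEval_modeCurvature (t r : ℝ) (T Ω ρ : Forms n) (m : ℤ) (w : Forms n ⊗[ℂ] RapidSeq) :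
    modeEval m (modeCurvature t r T Ω ρ w) = ((t * (m + r) ^ 2 : ℝ) : ℂ) • modeEval m w -
      modeEval m (modeNilpotent t r T Ω ρ w) := by
  have h1 : modeEval m (TensorProduct.map LinearMap.id (shiftedFreq r ∘ₗ shiftedFreq r) w) =
      ((1 : ℂ) * m + r) • ((1 : ℂ) * m + r) • modeEval m w := by
    rw [← LinearMap.id_comp (LinearMap.id : Forms n →ₗ[ℂ] Forms n), TensorProduct.map_comp,
      LinearMap.comp_apply]
    simp only [shiftedFreq]
    rw [modeEval_map, modeEval_map, LinearMap.id_apply, LinearMap.id_apply]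
  rw [modeEval_modeNilpotent, modeCurvature, LinearMap.add_apply, LinearMap.add_apply, map_add,
    map_add, modeEval_map_id, LinearMap.smul_apply, map_smul, h1, shiftedFreq, modeEval_map]
  simp only [LinearMap.sub_apply, LinearMap.add_apply, LinearMap.mulLeft_apply,
    LinearMap.comp_apply, modeExponent, add_mul, sub_mul, smul_mul_assoc]
  push_cast
  module

lemma parity_modeExponent {t l : ℝ} {T Ω : Forms n} (hT : parity n T = T) (hΩ : parity n Ω = Ω) :
    parity n (modeExponent t l T Ω) = modeExponent t l T Ω := by
  simp only [modeExponent, map_sub, map_add, map_smul, parity_mul, hT, hΩ]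

/-- The first two summands are divisible by `T`, so the exponent is a sum of two commuting elements
whose powers `n + 1` vanish. -/
lemma modeExponent_pow {t l : ℝ} {T Ω : Forms n} (hT : parity n T = T) (hT0 : T ^ (n + 1) = 0)
    (hΩ0 : Ω ^ (n + 1) = 0) : modeExponent t l T Ω ^ (2 * n + 1) = 0 := by
  have h1 : modeExponent t l T Ω =
      T * (algebraMap ℂ _ (Complex.I * l / 2) + (1 / (16 * t) : ℂ) • T) + -Ω := by
    rw [modeExponent, mul_add, mul_smul_comm, ← Algebra.commutes, ← Algebra.smul_def, sub_eq_add_neg]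
  have h2 : (T * (algebraMap ℂ _ (Complex.I * l / 2) + (1 / (16 * t) : ℂ) • T)) ^ (n + 1) = 0 := by
    rw [(commute_of_even hT _).mul_pow, hT0, zero_mul]
  have h3 : (-Ω) ^ (n + 1) = 0 := by rw [neg_pow, hΩ0, mul_zero]
  rw [h1]
  refine Commute.add_pow_eq_zero_of_add_le_succ_of_pow_eq_zero ?_ h2 h3 (by omega)
  refine Commute.mul_left (commute_of_even hT _) ?_
  refine Commute.add_left (Algebra.commutes _ _) (Commute.smul_left (commute_of_even hT _) _)

/-- The exponent depends on the mode but its order of nilpotency does not, so the operator itself is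
nilpotent. One power more than in `modeExponent_pow` accounts for `ρ`. -/
lemma modeNilpotent_pow {t r : ℝ} {T Ω ρ : Forms n} (hT : parity n T = T) (hΩ : parity n Ω = Ω)
    (hρ : parity n ρ = -ρ) (hT0 : T ^ (n + 1) = 0) (hΩ0 : Ω ^ (n + 1) = 0)
    (w : Forms n ⊗[ℂ] RapidSeq) : (modeNilpotent t r T Ω ρ ^ (2 * n + 2)) w = 0 := by
  refine eq_zero_of_forall_modeEval fun m => ?_
  rw [modeEval_modeNilpotent_pow, exists_pow_eq_zero (parity_modeExponent hT hΩ) hρ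
    (modeExponent_pow hT hT0 hΩ0), LinearMap.zero_apply]

/-- The operator on Fourier coefficients given by the derivative of the superconnection. -/
def modeDot (t r : ℝ) (T : Forms n) : Forms n ⊗[ℂ] RapidSeq →ₗ[ℂ] Forms n ⊗[ℂ] RapidSeq :=
  (1 / (2 * Real.sqrt t) : ℂ) • TensorProduct.map (parity n) (shiftedFreq r) -
    (Complex.I / (8 * t * Real.sqrt t) : ℂ) •
      TensorProduct.map (LinearMap.mulLeft ℂ T ∘ₗ parity n) LinearMap.id

lemma modeEval_modeDot (t r : ℝ) (T : Forms n) (m : ℤ) (w : Forms n ⊗[ℂ] RapidSeq) :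
    modeEval m (modeDot t r T w) = (algebraMap ℂ _ (((m + r : ℝ) : ℂ) / (2 * Real.sqrt t)) -
      (Complex.I / (8 * t * Real.sqrt t) : ℂ) • T) * parity n (modeEval m w) := by
  rw [modeDot, LinearMap.sub_apply, LinearMap.smul_apply, LinearMap.smul_apply, map_sub, map_smul,
    map_smul, modeEval_map_id, shiftedFreq, modeEval_map, sub_mul, ← Algebra.smul_def, smul_mul_assoc,
    smul_smul]
  congr 2
  push_cast
  ring

end ModeAlgebra

/-! ### The derivative of the superconnection in Fourier modes. -/

section Geometry

variable {n : ℕ} {B : Type*} [TopologicalSpace B] [ChartedSpace (Coord n) B]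
  [IsManifold (𝓡 n) ∞ B]
  {E : B → Type*} [TopologicalSpace (TotalSpace Plane E)] [∀ b, NormedAddCommGroup (E b)]
  [∀ b, InnerProductSpace ℝ (E b)] [FiberBundle Plane E] [VectorBundle ℝ Plane E]
  [ContMDiffVectorBundle ∞ Plane E (𝓡 n)] [IsContMDiffRiemannianBundle (𝓡 n) ∞ Plane E]
  [ChartedSpace (Coord (n + 1)) (UnitCircle E)] [IsManifold (𝓡 (n + 1)) ∞ (UnitCircle E)]
  {V : UnitCircle E → Type*} [TopologicalSpace (TotalSpace ℂ V)] [∀ x, NormedAddCommGroup (V x)]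
  [∀ x, InnerProductSpace ℂ (V x)] [FiberBundle ℂ V] [VectorBundle ℝ ℂ V]
  [ContMDiffVectorBundle ∞ ℂ V (𝓡 (n + 1))]

namespace Setting

variable (S : Setting (n := n) E V)

section ModeDot

variable {S} {b : B} {U : Set B} {σ : Π x, V x} {f : B → ℝ}
  {β : Π y : B, TangentSpace (𝓡 n) y →L[ℝ] ℂ}

lemma coeff_lTensor (φ : Module.Dual ℂ (Forms n)) (w : Forms n ⊗[ℂ] RapidSeq) :
    S.coeff b φ ((S.fibreSection b σ).lTensor (Forms n) w) = S.fibreSection b σ (seqCoeff φ w) := by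
  induction w with
  | zero => simp
  | tmul a c =>
    change TensorProduct.lid ℂ _ (φ a ⊗ₜ S.fibreSection b σ c) =
      S.fibreSection b σ (TensorProduct.lid ℂ _ (φ a ⊗ₜ c))
    rw [TensorProduct.lid_tmul, TensorProduct.lid_tmul, map_smul]
  | add w w' hw hw' => rw [map_add, map_add, map_add, map_add, hw, hw']

variable (hσ : S.IsLocalEigenframe U σ f β) (hb : b ∈ U)
include hσ hb

lemma exists_lTensor_eq {u : S.FibreForms b} (hu : S.IsSmoothForm b u) :
    ∃ w, (S.fibreSection b σ).lTensor (Forms n) w = u := by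
  obtain ⟨s, rfl⟩ := hu
  induction s using TensorProduct.induction_on with
  | zero => exact ⟨0, by simp⟩
  | tmul a s =>
    obtain ⟨c, hc⟩ := hσ.exists_fibreSection_eq hb ⟨s, rfl⟩
    exact ⟨a ⊗ₜ c, by rw [LinearMap.lTensor_tmul, hc]; rfl⟩
  | add s s' hs hs' =>
    obtain ⟨w, hw⟩ := hs
    obtain ⟨w', hw'⟩ := hs'
    exact ⟨w + w', by rw [map_add, map_add, map_add, hw, hw']⟩

lemma lTensor_fibreSection_injective :
    Function.Injective ((S.fibreSection b σ).lTensor (Forms n)) :=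
  Module.Flat.lTensor_preserves_injective_linearMap _ (hσ.fibreSection_injective hb)

lemma fibreDot_lTensor [T2Space B] {x₀ : UnitCircle E} (hx₀ : base x₀ = b) (t : ℝ)
    (w : Forms n ⊗[ℂ] RapidSeq) :
    S.fibreDot b t ((S.fibreSection b σ).lTensor (Forms n) w) =
      (S.fibreSection b σ).lTensor (Forms n) (modeDot t (f b) (S.torsionForm b x₀) w) := by
  let r : S.smoothSections b →ₗ[ℂ] S.FibreSections b :=
    S.restrictSection b ∘ₗ (S.smoothSections b).subtype
  -- `extend` chooses some smooth extension, so the identity is proved for every local form that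
  -- restricts to the given coefficients.
  have key : ∀ (s : S.LocalForms b) w, r.lTensor (Forms n) s =
      (S.fibreSection b σ).lTensor (Forms n) w → S.restrictForm b (S.superconnectionDot b t s) =
      (S.fibreSection b σ).lTensor (Forms n) (modeDot t (f b) (S.torsionForm b x₀) w) := by
    intro s
    induction s using TensorProduct.induction_on with
    | zero =>
      intro w hw
      rw [map_zero] at hw
      rw [(map_eq_zero_iff _ (lTensor_fibreSection_injective hσ hb)).1 hw.symm]
      simp
    | tmul a s =>
      intro w hw
      obtain ⟨c, hc⟩ := hσ.exists_fibreSection_eq hb ⟨s, rfl⟩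
      have h1 : w = a ⊗ₜ c := by
        apply lTensor_fibreSection_injective hσ hb
        rw [← hw, LinearMap.lTensor_tmul, LinearMap.lTensor_tmul, hc]
        rfl
      have h2 : S.restrictForm b (S.dirac b (a ⊗ₜ s)) = parity n a ⊗ₜ[ℂ]
          S.fibreSection b σ (shiftedFreq (f b) c) := by
        have h3 := hσ.restrict_vertDeriv hb hc.symm
        have h4 : RapidSeq.mulSeq _ (RapidSeq.polyGrowth_linear Complex.I (Complex.I * f b)) c =
            Complex.I • shiftedFreq (f b) c := by
          ext m
          change (Complex.I * m + Complex.I * f b) * c.1 m = Complex.I * ((1 * m + f b) * c.1 m)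
          ring
        have h5 : S.restrictForm b (S.dirac b (a ⊗ₜ s)) =
            cliffordE n a ⊗ₜ[ℂ] S.restrictSection b (S.vertDeriv b s).1 := rfl
        rw [h5, h3, h4, map_smul, cliffordE, LinearMap.smul_apply, ← TensorProduct.smul_tmul',
          TensorProduct.tmul_smul, smul_smul, neg_mul, Complex.I_mul_I, neg_neg, one_smul]
      have h6 : S.restrictForm b (S.cliffordT b (a ⊗ₜ s)) =
          -Complex.I • ((S.torsionForm b x₀ * parity n a) ⊗ₜ[ℂ] S.fibreSection b σ c) := by
        rw [cliffordT, sum_ite_lt, LinearMap.sum_apply, map_sum, torsionForm, twoForm_eq,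
          Finset.sum_mul, TensorProduct.sum_tmul, Finset.smul_sum]
        refine Finset.sum_congr rfl fun p _ => ?_
        have h7 : S.restrictSection b (S.mulFun b (fun x => (S.torsionCoeff b p.1 p.2 x : ℂ)) s) =
            (S.torsionCoeff b p.1 p.2 x₀ : ℂ) • S.fibreSection b σ c := by
          rw [hc]
          funext x
          have hx : base x.1 ∈ chartDomain (n := n) b := by
            rw [x.2]; exact mem_chart_source (Coord n) b
          change (open Classical in if base x.1 ∈ chartDomain (n := n) b then
            (S.torsionCoeff b p.1 p.2 x.1 : ℂ) • s.1 x.1 else 0) =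
              (S.torsionCoeff b p.1 p.2 x₀ : ℂ) • s.1 x.1
          rw [if_pos hx, torsionCoeff_eq_of_base_eq hx₀ x.2]
        change (dy p.1 * dy p.2 * cliffordE n a) ⊗ₜ[ℂ] (S.restrictSection b _) = _
        rw [h7, cliffordE, LinearMap.smul_apply, mul_smul_comm, ← TensorProduct.smul_tmul',
          smul_mul_assoc, TensorProduct.tmul_smul, ← TensorProduct.smul_tmul']
      rw [h1, superconnectionDot, LinearMap.add_apply, LinearMap.smul_apply, LinearMap.smul_apply,
        map_add, map_smul, map_smul, h2, h6, modeDot, LinearMap.sub_apply, LinearMap.smul_apply,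
        LinearMap.smul_apply, map_sub, map_smul, map_smul, TensorProduct.map_tmul,
        TensorProduct.map_tmul, LinearMap.lTensor_tmul, LinearMap.lTensor_tmul, LinearMap.id_apply,
        LinearMap.comp_apply, LinearMap.mulLeft_apply, smul_smul, sub_eq_add_neg]
      congr 1
      rw [show (1 / (8 * t * Real.sqrt t) * -Complex.I : ℂ) = -(Complex.I / (8 * t * Real.sqrt t)) by
        ring]
      exact neg_smul (R := ℂ) (M := Forms n ⊗[ℂ] S.FibreSections b) _ _
    | add s s' hs hs' =>
      intro w hw
      have hex : ∀ s : S.LocalForms b, ∃ w, (S.fibreSection b σ).lTensor (Forms n) w =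
          r.lTensor (Forms n) s := fun s =>
        exists_lTensor_eq hσ hb ⟨s, (LinearMap.congr_fun (LinearMap.lTensor_comp _ _ _) s).symm⟩
      obtain ⟨w₁, h₁⟩ := hex s
      obtain ⟨w₂, h₂⟩ := hex s'
      have h3 : w = w₁ + w₂ := by
        apply lTensor_fibreSection_injective hσ hb
        rw [← hw, map_add, map_add, h₁, h₂]
      rw [h3, map_add, map_add, map_add, map_add, hs w₁ h₁.symm, hs' w₂ h₂.symm]
  refine key _ w ?_
  have h := Classical.epsilon_spec (isSmoothForm_lTensor hσ hb w)
  exact (LinearMap.congr_fun (LinearMap.lTensor_comp _ _ _) _).trans h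

end ModeDot

end Setting
end Geometry
end CircleEta
end

noncomputable section

namespace CircleEta

/-! ### Families of exponential polynomials -/

/-- Differentiability of a curve of sequences in `ℓ²`. By the mean value inequality the difference
quotients are bounded by `C m`, like the derivatives, so `4 (C m)²` dominates the summands. -/
lemma tendsto_tsum_norm_slope_sq {G G' : ℝ → ℤ → ℂ} {C : ℤ → ℝ} {a b τ : ℝ} (hτ : τ ∈ Set.Ioo a b)
    (hC : Summable fun m => C m ^ 2)
    (hG : ∀ m, ∀ x ∈ Set.Ioo a b, HasDerivAt (fun y => G y m) (G' x m) x)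
    (hb : ∀ m, ∀ x ∈ Set.Ioo a b, ‖G' x m‖ ≤ C m) :
    Tendsto (fun h : ℝ => ∑' m, ‖(h : ℂ)⁻¹ * (G (τ + h) m - G τ m) - G' τ m‖ ^ 2) (𝓝[≠] 0)
      (𝓝 0) := by
  have h0 : Tendsto (fun h : ℝ => ∑' m, ‖(h : ℂ)⁻¹ * (G (τ + h) m - G τ m) - G' τ m‖ ^ 2) (𝓝[≠] 0)
      (𝓝 (∑' _ : ℤ, (0 : ℝ))) := by
    refine tendsto_tsum_of_dominated_convergence (bound := fun m => 4 * C m ^ 2) (hC.mul_left 4)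
      (fun m => ?_) ?_
    · have h1 := hasDerivAt_iff_tendsto_slope_zero.1 (hG m τ hτ)
      have h2 := ((h1.sub_const (G' τ m)).norm).pow 2
      simp only [sub_self, norm_zero, ne_eq, OfNat.ofNat_ne_zero, not_false_eq_true, zero_pow] at h2
      refine h2.congr fun h => ?_
      rw [Complex.real_smul, Complex.ofReal_inv]
    · have h1 : ∀ᶠ h : ℝ in 𝓝[≠] 0, τ + h ∈ Set.Ioo a b := by
        refine nhdsWithin_le_nhds ?_
        have : ContinuousAt (fun h : ℝ => τ + h) 0 := by fun_prop
        exact this.preimage_mem_nhds (Ioo_mem_nhds (by simpa using hτ.1) (by simpa using hτ.2))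
      filter_upwards [h1, self_mem_nhdsWithin] with h hh hne m
      have h2 := (convex_Ioo a b).norm_image_sub_le_of_norm_hasDerivWithin_le
        (fun x hx => (hG m x hx).hasDerivWithinAt) (hb m) hτ hh
      rw [add_sub_cancel_left] at h2
      have h3 : 0 < ‖h‖ := norm_pos_iff.2 hne
      have h4 : ‖(h : ℂ)⁻¹ * (G (τ + h) m - G τ m)‖ ≤ C m := by
        rw [norm_mul, norm_inv, Complex.norm_real, inv_mul_le_iff₀ h3, mul_comm]
        exact h2
      have h5 : ‖(h : ℂ)⁻¹ * (G (τ + h) m - G τ m) - G' τ m‖ ≤ 2 * C m :=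
        (norm_sub_le _ _).trans (by linarith [hb m τ hτ])
      rw [Real.norm_of_nonneg (by positivity)]
      calc _ ≤ (2 * C m) ^ 2 := pow_le_pow_left₀ (norm_nonneg _) h5 2
        _ = 4 * C m ^ 2 := by ring
  simpa using h0

/-- The function `e^{-sτ} ∑_{k < K} τ^k/k! y_k`. -/
def heatPoly (K : ℕ) (s : ℝ) (y : ℕ → ℂ) (τ : ℝ) : ℂ :=
  Complex.exp (-(s * τ)) * ∑ k ∈ Finset.range K, ((τ : ℂ) ^ k / (k.factorial : ℂ)) * y k

/-- The truncated exponential series differentiates to its shift; `y K = 0` makes up for the top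
term that the truncation loses. -/
lemma hasDerivAt_heatPoly {K : ℕ} {s : ℝ} {y : ℕ → ℂ} (hK : y K = 0) (τ : ℝ) :
    HasDerivAt (heatPoly K s y)
      (-(s * heatPoly K s y τ) + heatPoly K s (fun k => y (k + 1)) τ) τ := by
  have h1 : HasDerivAt (fun x : ℝ => Complex.exp (-(s * x))) (Complex.exp (-(s * τ)) * -(s * 1)) τ :=
    (((Complex.ofRealCLM.hasDerivAt (x := τ)).const_mul (s : ℂ)).neg).cexp
  have h2 : HasDerivAt (fun x : ℝ => ∑ k ∈ Finset.range K, ((x : ℂ) ^ k / (k.factorial : ℂ)) * y k)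
      (∑ k ∈ Finset.range K, (((k : ℂ) * (τ : ℂ) ^ (k - 1) * 1) / (k.factorial : ℂ)) * y k) τ :=
    HasDerivAt.fun_sum fun k _ =>
      (((Complex.ofRealCLM.hasDerivAt (x := τ)).pow k).div_const _).mul_const _
  have h3 : ∑ k ∈ Finset.range K, (((k : ℂ) * (τ : ℂ) ^ (k - 1) * 1) / (k.factorial : ℂ)) * y k =
      ∑ k ∈ Finset.range K, ((τ : ℂ) ^ k / (k.factorial : ℂ)) * y (k + 1) := by
    rcases K with _ | K
    · simp
    · rw [Finset.sum_range_succ', Finset.sum_range_succ, hK, Nat.cast_zero, zero_mul, zero_mul,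
        zero_div, zero_mul, mul_zero]
      congr 1
      refine Finset.sum_congr rfl fun k _ => ?_
      congr 1
      rw [Nat.factorial_succ]
      have : ((k : ℂ) + 1) ≠ 0 := Nat.cast_add_one_ne_zero k
      have : (k.factorial : ℂ) ≠ 0 := by exact_mod_cast k.factorial_ne_zero
      push_cast
      field_simp
  rw [h3] at h2
  refine (h1.mul h2).congr_deriv ?_
  rw [heatPoly, heatPoly]
  ring

lemma norm_heatPoly_le {K : ℕ} {s : ℝ} (hs : 0 ≤ s) (y : ℕ → ℂ) {τ R : ℝ} (hτ : 0 ≤ τ) (hR : τ ≤ R) :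
    ‖heatPoly K s y τ‖ ≤ ∑ k ∈ Finset.range K, R ^ k / (k.factorial : ℝ) * ‖y k‖ := by
  have h1 : ‖Complex.exp (-(s * τ))‖ ≤ 1 := by
    rw [Complex.norm_exp]
    have : (-(s * τ : ℂ)).re = -(s * τ) := by
      rw [← Complex.ofReal_mul, Complex.neg_re, Complex.ofReal_re]
    rw [this, Real.exp_le_one_iff]
    nlinarith
  rw [heatPoly, norm_mul]
  refine (mul_le_of_le_one_left (norm_nonneg _) h1).trans ((norm_sum_le _ _).trans ?_)
  refine Finset.sum_le_sum fun k _ => ?_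
  rw [norm_mul, norm_div, norm_pow, Complex.norm_real, Complex.norm_natCast, Real.norm_of_nonneg hτ]
  gcongr

/-- The terms of a summable sequence are eventually less than one, and then their squares are
smaller than the terms. -/
lemma RapidSeq.summable_sq_sum {K : ℕ} (a : ℕ → ℝ) (y : ℕ → RapidSeq) (ha : ∀ k, 0 ≤ a k) :
    Summable fun m => (∑ k ∈ Finset.range K, a k * ‖(y k).1 m‖) ^ 2 := by
  have h0 : Summable fun m => ∑ k ∈ Finset.range K, a k * ‖(y k).1 m‖ :=
    summable_sum fun k _ => (RapidSeq.summable_norm (y k)).mul_left (a k)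
  have h1 := h0.tendsto_cofinite_zero.eventually (gt_mem_nhds (zero_lt_one (α := ℝ)))
  refine Summable.of_norm_bounded_eventually h0 ?_
  filter_upwards [h1] with m hm
  have h2 : 0 ≤ ∑ k ∈ Finset.range K, a k * ‖(y k).1 m‖ :=
    Finset.sum_nonneg fun k _ => mul_nonneg (ha k) (norm_nonneg _)
  rw [Real.norm_of_nonneg (by positivity), sq]
  exact mul_le_of_le_one_left h2 hm.le

/-- The time derivative of the polynomial with coefficients `y_k` is minus the one with coefficients
`z_k = s y_k - y_{k+1}`. These are again rapidly decreasing, which gives a bound uniform in time. -/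
lemma tendsto_tsum_heatPoly_slope {K : ℕ} {s : ℤ → ℝ} (hs : ∀ m, 0 ≤ s m) {y z : ℕ → RapidSeq}
    (hK : y K = 0) (hz : ∀ k m, (z k).1 m = s m * (y k).1 m - (y (k + 1)).1 m) {τ : ℝ} (hτ : 0 < τ) :
    Tendsto (fun h : ℝ => ∑' m, ‖(h : ℂ)⁻¹ * (heatPoly K (s m) (fun k => (y k).1 m) (τ + h) -
      heatPoly K (s m) (fun k => (y k).1 m) τ) +
        (s m * heatPoly K (s m) (fun k => (y k).1 m) τ -
          heatPoly K (s m) (fun k => (y (k + 1)).1 m) τ)‖ ^ 2) (𝓝[≠] 0) (𝓝 0) := by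
  have h0 : ∀ m, (y K).1 m = 0 := fun m => by rw [hK]; rfl
  have hz' : ∀ m x, -heatPoly K (s m) (fun k => (z k).1 m) x =
      -(s m * heatPoly K (s m) (fun k => (y k).1 m) x) +
        heatPoly K (s m) (fun k => (y (k + 1)).1 m) x := fun m x => by
    simp only [heatPoly, hz, mul_sub, Finset.sum_sub_distrib]
    rw [neg_sub, sub_eq_neg_add, mul_left_comm (s m : ℂ), Finset.mul_sum (a := (s m : ℂ))]
    congr 4
    funext k
    ring
  have h1 := tendsto_tsum_norm_slope_sq (a := 0) (b := 2 * τ) (τ := τ)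
    (G := fun x m => heatPoly K (s m) (fun k => (y k).1 m) x)
    (G' := fun x m => -heatPoly K (s m) (fun k => (z k).1 m) x)
    (C := fun m => ∑ k ∈ Finset.range K, (2 * τ) ^ k / (k.factorial : ℝ) * ‖(z k).1 m‖)
    ⟨hτ, by linarith⟩ (RapidSeq.summable_sq_sum _ z fun k => by positivity)
    (fun m x _ => by rw [hz']; exact hasDerivAt_heatPoly (h0 m) x)
    (fun m x hx => by rw [norm_neg]; exact norm_heatPoly_le (hs m) _ hx.1.le hx.2.le)
  refine h1.congr fun h => tsum_congr fun m => ?_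
  rw [hz']
  congr 2
  ring

lemma tendsto_tsum_heatPoly_initial {K : ℕ} {s : ℤ → ℝ} (hs : ∀ m, 0 ≤ s m) (y : ℕ → RapidSeq) :
    Tendsto (fun τ : ℝ => ∑' m, ‖heatPoly (K + 1) (s m) (fun k => (y k).1 m) τ - (y 0).1 m‖ ^ 2)
      (𝓝[>] 0) (𝓝 0) := by
  have h0 : Tendsto (fun τ : ℝ => ∑' m,
      ‖heatPoly (K + 1) (s m) (fun k => (y k).1 m) τ - (y 0).1 m‖ ^ 2) (𝓝[>] 0)
      (𝓝 (∑' _ : ℤ, (0 : ℝ))) := by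
    refine tendsto_tsum_of_dominated_convergence (bound := fun m =>
      4 * (∑ k ∈ Finset.range (K + 1), 1 ^ k / (k.factorial : ℝ) * ‖(y k).1 m‖) ^ 2)
      ((RapidSeq.summable_sq_sum _ y fun k => by positivity).mul_left 4) (fun m => ?_) ?_
    · have h1 : heatPoly (K + 1) (s m) (fun k => (y k).1 m) 0 = (y 0).1 m := by
        rw [heatPoly, Finset.sum_range_succ']
        simp
      have h2 : Continuous fun τ : ℝ => ‖heatPoly (K + 1) (s m) (fun k => (y k).1 m) τ - (y 0).1 m‖ ^ 2 := by
        unfold heatPoly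
        fun_prop
      have h3 := h2.tendsto 0
      simp only [h1, sub_self, norm_zero, ne_eq, OfNat.ofNat_ne_zero, not_false_eq_true,
        zero_pow] at h3
      exact h3.mono_left nhdsWithin_le_nhds
    · filter_upwards [Ioo_mem_nhdsGT (zero_lt_one (α := ℝ))] with τ hτ m
      have h1 := norm_heatPoly_le (K := K + 1) (hs m) (fun k => (y k).1 m) hτ.1.le hτ.2.le
      have h2 : ‖(y 0).1 m‖ ≤ ∑ k ∈ Finset.range (K + 1), 1 ^ k / (k.factorial : ℝ) * ‖(y k).1 m‖ := by
        refine le_trans (by simp) (Finset.single_le_sum (f := fun k : ℕ =>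
          (1 : ℝ) ^ k / (k.factorial : ℝ) * ‖(y k).1 m‖) (fun k _ => by positivity)
          (Finset.mem_range.2 K.succ_pos))
      have h3 := (norm_sub_le _ _).trans (add_le_add h1 h2)
      rw [Real.norm_of_nonneg (by positivity)]
      calc _ ≤ _ := pow_le_pow_left₀ (norm_nonneg _) h3 2
        _ = _ := by ring
  simpa using h0

/-- A solution of `z' = -s z` on the positive half line with limit `0` at `0` vanishes. -/
lemma eq_zero_of_hasDerivAt {z : ℝ → ℂ} {s : ℂ} (hz : ∀ τ > 0, HasDerivAt z (-(s * z τ)) τ)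
    (h0 : Tendsto z (𝓝[>] 0) (𝓝 0)) {τ : ℝ} (hτ : 0 < τ) : z τ = 0 := by
  have h1 : ∀ x : ℝ, 0 < x → HasDerivAt (fun x : ℝ => Complex.exp (s * x) * z x) 0 x := fun x hx => by
    have h2 : HasDerivAt (fun x : ℝ => Complex.exp (s * x)) (Complex.exp (s * x) * (s * 1)) x :=
      ((Complex.ofRealCLM.hasDerivAt (x := x)).const_mul s).cexp
    refine (h2.mul (hz x hx)).congr_deriv ?_
    ring
  have h2 : ∀ x : ℝ, 0 < x → Complex.exp (s * x) * z x = Complex.exp (s * τ) * z τ := fun x hx =>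
    isOpen_Ioi.is_const_of_deriv_eq_zero (isPreconnected_Ioi)
      (fun y hy => (h1 y hy).differentiableAt.differentiableWithinAt)
      (fun y hy => (h1 y hy).deriv) hx hτ
  have h3 : Tendsto (fun x : ℝ => Complex.exp (s * x) * z x) (𝓝[>] 0) (𝓝 (Complex.exp (s * 0) * 0)) := by
    refine Tendsto.mul ?_ h0
    have : Continuous fun x : ℝ => Complex.exp (s * x) := by fun_prop
    simpa using (this.tendsto 0).mono_left (nhdsWithin_le_nhds (s := Set.Ioi 0))
  have h4 : Tendsto (fun x : ℝ => Complex.exp (s * x) * z x) (𝓝[>] 0)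
      (𝓝 (Complex.exp (s * τ) * z τ)) := by
    refine tendsto_const_nhds.congr' ?_
    filter_upwards [self_mem_nhdsWithin] with x hx using (h2 x hx).symm
  have h5 := tendsto_nhds_unique h3 h4
  rw [mul_zero] at h5
  exact (mul_eq_zero.1 h5.symm).resolve_left (Complex.exp_ne_zero _)

end CircleEta
end

noncomputable section

namespace CircleEta

/-! ### The heat flow on Fourier coefficients -/

/-- A solution of `D' = -(s - N) D`, with `N` nilpotent, that tends to `0` at `0` vanishes. -/
lemma eq_zero_of_weak_ode {F : Type*} [AddCommGroup F] [Module ℂ F] {N : F →ₗ[ℂ] F} {K : ℕ}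
    (hN : N ^ K = 0) {s : ℂ} {D : ℝ → F} (hD : ∀ φ : Module.Dual ℂ F, ∀ τ > 0,
      HasDerivAt (fun x => φ (D x)) (-φ (s • D τ - N (D τ))) τ)
    (h0 : ∀ φ : Module.Dual ℂ F, Tendsto (fun x => φ (D x)) (𝓝[>] 0) (𝓝 0)) {τ : ℝ} (hτ : 0 < τ) :
    D τ = 0 := by
  -- Downward induction on the power of `N`: once `N^{p+1} D` vanishes, `N^p D` solves the scalar
  -- equation without the nilpotent term.
  have key : ∀ k ≤ K, ∀ φ : Module.Dual ℂ F, ∀ τ > 0, φ ((N ^ (K - k)) (D τ)) = 0 := by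
    intro k
    induction k with
    | zero => intro _ φ τ _; rw [Nat.sub_zero, hN, LinearMap.zero_apply, map_zero]
    | succ k ih =>
      intro hk φ τ hτ
      refine eq_zero_of_hasDerivAt (z := fun x => φ ((N ^ (K - (k + 1))) (D x))) (s := s)
        (fun x hx => ?_) (h0 (φ ∘ₗ N ^ (K - (k + 1)))) hτ
      refine (hD (φ ∘ₗ N ^ (K - (k + 1))) x hx).congr_deriv ?_
      have h1 : (N ^ (K - (k + 1))) (N (D x)) = (N ^ (K - k)) (D x) := by
        rw [← Module.End.mul_apply, ← pow_succ]
        congr 2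
        omega
      rw [LinearMap.comp_apply, map_sub, map_sub, h1, ih (by omega) φ x hx, sub_zero, map_smul,
        map_smul, smul_eq_mul]
  refine (Module.forall_dual_apply_eq_zero_iff ℂ _).1 fun φ => ?_
  simpa using key K le_rfl φ τ hτ

section ModeFlow

variable {n : ℕ}

/-- The multipliers `e^{-τ t (m + r)²}`, cut off for negative `τ`. -/
def heatFactor (t r τ : ℝ) (m : ℤ) : ℂ := Complex.exp (-(max (τ * (t * (m + r) ^ 2)) 0 : ℝ))

lemma heatFactor_polyGrowth (t r τ : ℝ) : RapidSeq.PolyGrowth (heatFactor t r τ) :=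
  RapidSeq.polyGrowth_of_bounded (C := 1) fun m => by
    rw [heatFactor, ← Complex.ofReal_neg, Complex.norm_exp, Complex.ofReal_re, Real.exp_le_one_iff]
    simp

lemma heatFactor_of_nonneg {t r τ : ℝ} (ht : 0 ≤ t) (hτ : 0 ≤ τ) (m : ℤ) :
    heatFactor t r τ m = Complex.exp (-(((t * (m + r) ^ 2 : ℝ) : ℂ) * τ)) := by
  rw [heatFactor, max_eq_left (by positivity), mul_comm τ]
  push_cast
  rfl

/-- The solution of the heat equation. -/
def modeFlow (t r : ℝ) (T Ω ρ : Forms n) (w : Forms n ⊗[ℂ] RapidSeq) (τ : ℝ) :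
    Forms n ⊗[ℂ] RapidSeq :=
  ∑ k ∈ Finset.range (2 * n + 2), ((τ : ℂ) ^ k / (k.factorial : ℂ)) •
    TensorProduct.map LinearMap.id (RapidSeq.mulSeq _ (heatFactor_polyGrowth t r τ))
      ((modeNilpotent t r T Ω ρ ^ k) w)

lemma modeEval_modeFlow {t r : ℝ} {T Ω ρ : Forms n} (w : Forms n ⊗[ℂ] RapidSeq) {τ : ℝ}
    (ht : 0 ≤ t) (hτ : 0 ≤ τ) (m : ℤ) : modeEval m (modeFlow t r T Ω ρ w τ) =
      Complex.exp (-(((t * (m + r) ^ 2 : ℝ) : ℂ) * τ)) • ∑ k ∈ Finset.range (2 * n + 2),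
        ((τ : ℂ) ^ k / (k.factorial : ℂ)) • modeEval m ((modeNilpotent t r T Ω ρ ^ k) w) := by
  rw [modeFlow, map_sum, Finset.smul_sum]
  refine Finset.sum_congr rfl fun k _ => ?_
  rw [map_smul, modeEval_map, heatFactor_of_nonneg ht hτ, smul_comm, LinearMap.id_apply]

lemma seqCoeff_modeFlow {t r : ℝ} {T Ω ρ : Forms n} (w : Forms n ⊗[ℂ] RapidSeq) {τ : ℝ}
    (ht : 0 ≤ t) (hτ : 0 ≤ τ) (φ : Module.Dual ℂ (Forms n)) (m : ℤ) :
    (seqCoeff φ (modeFlow t r T Ω ρ w τ)).1 m = heatPoly (2 * n + 2) (t * (m + r) ^ 2)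
      (fun k => (seqCoeff φ ((modeNilpotent t r T Ω ρ ^ k) w)).1 m) τ := by
  rw [seqCoeff_apply, modeEval_modeFlow w ht hτ, map_smul, map_sum, smul_eq_mul, heatPoly]
  congr 1
  refine Finset.sum_congr rfl fun k _ => ?_
  rw [map_smul, smul_eq_mul, seqCoeff_apply]

lemma seqCoeff_modeCurvature_modeFlow {t r : ℝ} {T Ω ρ : Forms n} (w : Forms n ⊗[ℂ] RapidSeq) {τ : ℝ}
    (ht : 0 ≤ t) (hτ : 0 ≤ τ) (φ : Module.Dual ℂ (Forms n)) (m : ℤ) :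
    (seqCoeff φ (modeCurvature t r T Ω ρ (modeFlow t r T Ω ρ w τ))).1 m =
      ((t * (m + r) ^ 2 : ℝ) : ℂ) * heatPoly (2 * n + 2) (t * (m + r) ^ 2)
        (fun k => (seqCoeff φ ((modeNilpotent t r T Ω ρ ^ k) w)).1 m) τ -
      heatPoly (2 * n + 2) (t * (m + r) ^ 2)
        (fun k => (seqCoeff φ ((modeNilpotent t r T Ω ρ ^ (k + 1)) w)).1 m) τ := by
  rw [← seqCoeff_modeFlow w ht hτ, seqCoeff_apply, seqCoeff_apply, modeEval_modeCurvature, map_sub,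
    map_smul, smul_eq_mul]
  congr 1
  rw [modeEval_modeNilpotent, modeEval_modeFlow w ht hτ, map_smul, map_sum, map_smul, map_sum,
    smul_eq_mul, heatPoly]
  congr 1
  refine Finset.sum_congr rfl fun k _ => ?_
  rw [map_smul, map_smul, smul_eq_mul, ← modeEval_modeNilpotent, seqCoeff_apply, pow_succ',
    Module.End.mul_apply]

lemma seqCoeff_modeCurvature {t r : ℝ} {T Ω ρ : Forms n} (w : Forms n ⊗[ℂ] RapidSeq)
    (φ : Module.Dual ℂ (Forms n)) (m : ℤ) : (seqCoeff φ (modeCurvature t r T Ω ρ w)).1 m =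
      ((t * (m + r) ^ 2 : ℝ) : ℂ) * (seqCoeff φ w).1 m -
        (seqCoeff φ (modeNilpotent t r T Ω ρ w)).1 m := by
  rw [seqCoeff_apply, seqCoeff_apply, seqCoeff_apply, modeEval_modeCurvature, map_sub, map_smul,
    smul_eq_mul]

end ModeFlow

/-! ### Existence and uniqueness of the heat flow on a fibre. -/

section Geometry

variable {n : ℕ} {B : Type*} [TopologicalSpace B] [ChartedSpace (Coord n) B]
  [IsManifold (𝓡 n) ∞ B]
  {E : B → Type*} [TopologicalSpace (TotalSpace Plane E)] [∀ b, NormedAddCommGroup (E b)]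
  [∀ b, InnerProductSpace ℝ (E b)] [FiberBundle Plane E] [VectorBundle ℝ Plane E]
  [ContMDiffVectorBundle ∞ Plane E (𝓡 n)] [IsContMDiffRiemannianBundle (𝓡 n) ∞ Plane E]
  [ChartedSpace (Coord (n + 1)) (UnitCircle E)] [IsManifold (𝓡 (n + 1)) ∞ (UnitCircle E)]
  {V : UnitCircle E → Type*} [TopologicalSpace (TotalSpace ℂ V)] [∀ x, NormedAddCommGroup (V x)]
  [∀ x, InnerProductSpace ℂ (V x)] [FiberBundle ℂ V] [VectorBundle ℝ ℂ V]
  [ContMDiffVectorBundle ∞ ℂ V (𝓡 (n + 1))]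

namespace Setting

variable (S : Setting (n := n) E V)

section HeatFlow

variable {S} {b : B} {U : Set B} {σ : Π x, V x} {f : B → ℝ}
  {β : Π y : B, TangentSpace (𝓡 n) y →L[ℝ] ℂ} (hσ : S.IsLocalEigenframe U σ f β) (hb : b ∈ U)
include hσ hb

lemma fibreNormSq_coeff_lTensor (φ : Module.Dual ℂ (Forms n)) (w : Forms n ⊗[ℂ] RapidSeq) :
    S.fibreNormSq b (S.coeff b φ ((S.fibreSection b σ).lTensor (Forms n) w)) =
      S.fibreWeight b σ * ∑' m, ‖(seqCoeff φ w).1 m‖ ^ 2 := by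
  rw [coeff_lTensor, ← (hσ.hasSum_fibreNormSq hb _).tsum_eq, tsum_mul_left]

lemma norm_sq_modeEval_le (φ : Module.Dual ℂ (Forms n)) (w : Forms n ⊗[ℂ] RapidSeq) (m : ℤ) :
    ‖φ (modeEval m w)‖ ^ 2 ≤ (S.fibreWeight b σ)⁻¹ *
      S.fibreNormSq b (S.coeff b φ ((S.fibreSection b σ).lTensor (Forms n) w)) := by
  have hκ := hσ.fibreWeight_pos hb
  rw [coeff_lTensor, ← seqCoeff_apply, le_inv_mul_iff₀ hκ]
  exact le_hasSum (hσ.hasSum_fibreNormSq hb (seqCoeff φ w)) m fun j _ => by positivity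

/-- On the mode `m` the curvature is the number `t (m + r)²` minus a nilpotent operator, so its heat
operator is an exponential factor times a finite exponential series. -/
lemma isHeatFlow_modeFlow [T2Space B] {t r : ℝ} (ht : 0 < t) {T Ω ρ : Forms n}
    (hT : parity n T = T) (hΩ : parity n Ω = Ω) (hρ : parity n ρ = -ρ) (hT0 : T ^ (n + 1) = 0)
    (hΩ0 : Ω ^ (n + 1) = 0)
    (hL : ∀ W, S.curvature b t ((S.fibreSection b σ).lTensor (Forms n) W) =
      (S.fibreSection b σ).lTensor (Forms n) (modeCurvature t r T Ω ρ W))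
    (w : Forms n ⊗[ℂ] RapidSeq) :
    S.IsHeatFlow b t ((S.fibreSection b σ).lTensor (Forms n) w)
      fun τ => (S.fibreSection b σ).lTensor (Forms n) (modeFlow t r T Ω ρ w τ) where
  smooth τ _ := isSmoothForm_lTensor hσ hb _
  deriv τ hτ φ := by
    have h1 := tendsto_tsum_heatPoly_slope (K := 2 * n + 2) (s := fun m : ℤ => t * (m + r) ^ 2)
      (y := fun k => seqCoeff φ ((modeNilpotent t r T Ω ρ ^ k) w))
      (z := fun k => seqCoeff φ (modeCurvature t r T Ω ρ ((modeNilpotent t r T Ω ρ ^ k) w)))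
      (fun m => by positivity) (by rw [modeNilpotent_pow hT hΩ hρ hT0 hΩ0, map_zero])
      (fun k m => by
        rw [seqCoeff_modeCurvature, pow_succ' (modeNilpotent t r T Ω ρ), Module.End.mul_apply]) hτ
    have h2 := h1.const_mul (S.fibreWeight b σ)
    rw [mul_zero] at h2
    refine h2.congr' ?_
    -- For `h > -τ` the time `τ + h` is positive and the cutoff in `heatFactor` has no effect.
    have h3 : ∀ᶠ h : ℝ in 𝓝[≠] 0, -τ < h := nhdsWithin_le_nhds (lt_mem_nhds (by linarith))
    filter_upwards [h3] with h hh
    have h4 : (h : ℂ)⁻¹ • ((S.fibreSection b σ).lTensor (Forms n) (modeFlow t r T Ω ρ w (τ + h)) -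
        (S.fibreSection b σ).lTensor (Forms n) (modeFlow t r T Ω ρ w τ)) +
        S.curvature b t ((S.fibreSection b σ).lTensor (Forms n) (modeFlow t r T Ω ρ w τ)) =
        (S.fibreSection b σ).lTensor (Forms n) ((h : ℂ)⁻¹ • (modeFlow t r T Ω ρ w (τ + h) -
          modeFlow t r T Ω ρ w τ) + modeCurvature t r T Ω ρ (modeFlow t r T Ω ρ w τ)) := by
      rw [map_add, map_smul, map_sub, hL]
    rw [h4, fibreNormSq_coeff_lTensor hσ hb]
    congr 1
    refine tsum_congr fun m => ?_
    rw [← seqCoeff_modeCurvature_modeFlow w ht.le hτ.le, ← seqCoeff_modeFlow w ht.le hτ.le,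
      ← seqCoeff_modeFlow w ht.le (by linarith), map_add, map_smul, map_sub]
    rfl
  initial φ := by
    have h1 := tendsto_tsum_heatPoly_initial (K := 2 * n + 1) (s := fun m : ℤ => t * (m + r) ^ 2)
      (fun m => by positivity) (fun k => seqCoeff φ ((modeNilpotent t r T Ω ρ ^ k) w))
    have h2 := h1.const_mul (S.fibreWeight b σ)
    rw [mul_zero] at h2
    refine h2.congr' ?_
    filter_upwards [self_mem_nhdsWithin] with τ hτ
    rw [← map_sub ((S.fibreSection b σ).lTensor (Forms n)), fibreNormSq_coeff_lTensor hσ hb]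
    congr 1
    refine tsum_congr fun m => ?_
    rw [← seqCoeff_modeFlow w ht.le (le_of_lt hτ), map_sub]
    rfl

/-- By Parseval's identity convergence in `L²` implies convergence of each Fourier coefficient. So
an arbitrary heat flow yields a solution of an ordinary differential equation on every mode. -/
lemma IsHeatFlow.exists_modes {t r : ℝ} {T Ω ρ : Forms n}
    (hL : ∀ W, S.curvature b t ((S.fibreSection b σ).lTensor (Forms n) W) =
      (S.fibreSection b σ).lTensor (Forms n) (modeCurvature t r T Ω ρ W))
    {w₀ : Forms n ⊗[ℂ] RapidSeq} {u : ℝ → S.FibreForms b}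
    (hu : S.IsHeatFlow b t ((S.fibreSection b σ).lTensor (Forms n) w₀) u) :
    ∃ w : ℝ → Forms n ⊗[ℂ] RapidSeq,
      (∀ τ > 0, (S.fibreSection b σ).lTensor (Forms n) (w τ) = u τ) ∧
      (∀ (φ : Module.Dual ℂ (Forms n)) (m : ℤ), ∀ τ > 0, HasDerivAt (fun x => φ (modeEval m (w x)))
        (-φ (modeEval m (modeCurvature t r T Ω ρ (w τ)))) τ) ∧
      ∀ (φ : Module.Dual ℂ (Forms n)) (m : ℤ),
        Tendsto (fun x => φ (modeEval m (w x))) (𝓝[>] 0) (𝓝 (φ (modeEval m w₀))) := by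
  have hκ := hσ.fibreWeight_pos hb
  have h0 : ∀ τ : ℝ, ∃ w, 0 < τ → (S.fibreSection b σ).lTensor (Forms n) w = u τ := fun τ => by
    by_cases hτ : 0 < τ
    · obtain ⟨w, hw⟩ := exists_lTensor_eq hσ hb (hu.smooth τ hτ)
      exact ⟨w, fun _ => hw⟩
    · exact ⟨0, fun h => absurd h hτ⟩
  choose w hw using h0
  have sq0 : ∀ {l : Filter ℝ} {g : ℝ → ℂ} {G : ℝ → ℝ}, Tendsto G l (𝓝 0) →
      (∀ᶠ x in l, ‖g x‖ ^ 2 ≤ (S.fibreWeight b σ)⁻¹ * G x) → Tendsto g l (𝓝 0) := by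
    intro l g G hG hle
    rw [tendsto_zero_iff_norm_tendsto_zero]
    have h1 : Tendsto (fun x => ‖g x‖ ^ 2) l (𝓝 0) := by
      refine squeeze_zero' (Eventually.of_forall fun x => by positivity) hle ?_
      simpa using hG.const_mul (S.fibreWeight b σ)⁻¹
    have h2 := h1.sqrt
    simpa using h2
  refine ⟨w, hw, fun φ m τ hτ => ?_, fun φ m => ?_⟩
  · rw [hasDerivAt_iff_tendsto_slope_zero]
    have h1 : Tendsto (fun h : ℝ => h⁻¹ • (φ (modeEval m (w (τ + h))) - φ (modeEval m (w τ))) +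
        φ (modeEval m (modeCurvature t r T Ω ρ (w τ)))) (𝓝[≠] 0) (𝓝 0) := by
      refine sq0 (hu.deriv τ hτ φ) ?_
      have h3 : ∀ᶠ h : ℝ in 𝓝[≠] 0, -τ < h := nhdsWithin_le_nhds (lt_mem_nhds (by linarith))
      filter_upwards [h3] with h hh
      have h4 := norm_sq_modeEval_le hσ hb φ ((h : ℂ)⁻¹ • (w (τ + h) - w τ) +
        modeCurvature t r T Ω ρ (w τ)) m
      rw [map_add, map_add, map_smul, map_smul, map_sub, map_sub, map_add, map_smul, map_sub, ← hL,
        hw _ hτ, hw _ (by linarith : 0 < τ + h)] at h4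
      rw [← Complex.coe_smul, Complex.ofReal_inv]
      exact h4
    have h2 := h1.sub_const (φ (modeEval m (modeCurvature t r T Ω ρ (w τ))))
    rw [zero_sub] at h2
    exact h2.congr fun h => by ring
  · have h1 : Tendsto (fun x => φ (modeEval m (w x)) - φ (modeEval m w₀)) (𝓝[>] 0) (𝓝 0) := by
      refine sq0 (hu.initial φ) ?_
      filter_upwards [self_mem_nhdsWithin] with x hx
      have h4 := norm_sq_modeEval_le hσ hb φ (w x - w₀) m
      rw [map_sub, map_sub, map_sub, hw _ hx] at h4
      exact h4
    simpa using h1.add_const (φ (modeEval m w₀))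

/-- On each mode the difference of two flows solves a linear equation, scalar up to a nilpotent
term, with limit zero at time zero; `eq_zero_of_weak_ode` applies. -/
lemma IsHeatFlow.eq_of_isHeatFlow {t r : ℝ} {T Ω ρ : Forms n}
    (hT : parity n T = T) (hΩ : parity n Ω = Ω) (hρ : parity n ρ = -ρ) (hT0 : T ^ (n + 1) = 0)
    (hΩ0 : Ω ^ (n + 1) = 0)
    (hL : ∀ W, S.curvature b t ((S.fibreSection b σ).lTensor (Forms n) W) =
      (S.fibreSection b σ).lTensor (Forms n) (modeCurvature t r T Ω ρ W))
    {w₀ : Forms n ⊗[ℂ] RapidSeq} {u u' : ℝ → S.FibreForms b}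
    (hu : S.IsHeatFlow b t ((S.fibreSection b σ).lTensor (Forms n) w₀) u)
    (hu' : S.IsHeatFlow b t ((S.fibreSection b σ).lTensor (Forms n) w₀) u') {τ : ℝ} (hτ : 0 < τ) :
    u τ = u' τ := by
  obtain ⟨w, hw, hwd, hw0⟩ := IsHeatFlow.exists_modes hσ hb hL hu
  obtain ⟨w', hw', hwd', hw0'⟩ := IsHeatFlow.exists_modes hσ hb hL hu'
  rw [← hw τ hτ, ← hw' τ hτ]
  congr 1
  rw [← sub_eq_zero]
  refine eq_zero_of_forall_modeEval fun m => ?_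
  refine eq_zero_of_weak_ode (N := LinearMap.mulLeft ℂ (modeExponent t (m + r) T Ω) -
    LinearMap.mulLeft ℂ ρ ∘ₗ parity n) (D := fun x => modeEval m (w x - w' x))
    (exists_pow_eq_zero (parity_modeExponent hT hΩ) hρ (modeExponent_pow hT hT0 hΩ0))
    (s := ((t * (m + r) ^ 2 : ℝ) : ℂ)) (fun φ x hx => ?_) (fun φ => ?_) hτ
  · rw [← modeEval_modeNilpotent, ← modeEval_modeCurvature]
    simp only [map_sub]
    refine ((hwd φ m x hx).sub (hwd' φ m x hx)).congr_deriv ?_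
    ring
  · simp only [map_sub]
    simpa using (hw0 φ m).sub (hw0' φ m)

variable [T2Space B] {x₀ : UnitCircle E} (hx₀ : base x₀ = b) {t : ℝ} (ht : 0 < t)
include hx₀ ht

lemma exists_isHeatFlow : ∃ ρ : Forms n, parity n ρ = -ρ ∧
    ∀ w, S.IsHeatFlow b t ((S.fibreSection b σ).lTensor (Forms n) w) (fun τ =>
        (S.fibreSection b σ).lTensor (Forms n) (modeFlow t (f b) (S.torsionForm b x₀)
          (extDerivAt β b + (Complex.I * f b) • S.torsionForm b x₀) ρ w τ)) ∧
      ∀ u₁, S.IsHeatValue b t ((S.fibreSection b σ).lTensor (Forms n) w) u₁ →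
        u₁ = (S.fibreSection b σ).lTensor (Forms n) (modeFlow t (f b) (S.torsionForm b x₀)
          (extDerivAt β b + (Complex.I * f b) • S.torsionForm b x₀) ρ w 1) := by
  obtain ⟨ρ, hρ, hL⟩ := exists_curvature_fibreSection hσ hb hx₀ ht
  have hT2 : S.torsionForm b x₀ ∈ ⋀[ℂ]^2 (Coord n →ₗ[ℝ] ℂ) := twoForm_mem _
  have hΩ2 : extDerivAt β b + (Complex.I * f b) • S.torsionForm b x₀ ∈
      ⋀[ℂ]^2 (Coord n →ₗ[ℝ] ℂ) := add_mem (twoForm_mem _) (Submodule.smul_mem _ _ hT2)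
  have hT : parity n (S.torsionForm b x₀) = S.torsionForm b x₀ := parity_twoForm _
  have hΩ : parity n (extDerivAt β b + (Complex.I * f b) • S.torsionForm b x₀) =
      extDerivAt β b + (Complex.I * f b) • S.torsionForm b x₀ := by
    rw [map_add, map_smul, hT, extDerivAt, parity_twoForm]
  have h := isHeatFlow_modeFlow hσ hb ht hT hΩ hρ (pow_eq_zero_of_mem hT2 n.lt_succ_self)
    (pow_eq_zero_of_mem hΩ2 n.lt_succ_self) hL
  refine ⟨ρ, hρ, fun w => ⟨h w, ?_⟩⟩
  rintro _ ⟨u, hu, rfl⟩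
  exact IsHeatFlow.eq_of_isHeatFlow hσ hb hT hΩ hρ (pow_eq_zero_of_mem hT2 n.lt_succ_self)
    (pow_eq_zero_of_mem hΩ2 n.lt_succ_self) hL hu (h w) one_pos

omit hx₀ in
lemma existsUnique_isHeatValue {u₀ : S.FibreForms b} (hu₀ : S.IsSmoothForm b u₀) :
    ∃! u₁, S.IsHeatValue b t u₀ u₁ := by
  obtain ⟨x₀, hx₀⟩ := S.exists_base b
  obtain ⟨w, rfl⟩ := exists_lTensor_eq hσ hb hu₀
  obtain ⟨ρ, -, h⟩ := exists_isHeatFlow hσ hb hx₀ ht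
  exact ⟨_, ⟨_, (h w).1, rfl⟩, (h w).2⟩

lemma exists_expNegCurvature_eq : ∃ ρ : Forms n, parity n ρ = -ρ ∧
    ∀ w, S.expNegCurvature b t ((S.fibreSection b σ).lTensor (Forms n) w) =
      (S.fibreSection b σ).lTensor (Forms n) (modeFlow t (f b) (S.torsionForm b x₀)
        (extDerivAt β b + (Complex.I * f b) • S.torsionForm b x₀) ρ w 1) := by
  obtain ⟨ρ, hρ, h⟩ := exists_isHeatFlow hσ hb hx₀ ht
  refine ⟨ρ, hρ, fun w => (h w).2 _ ?_⟩
  exact Classical.epsilon_spec (p := S.IsHeatValue b t _) ⟨_, _, (h w).1, rfl⟩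

end HeatFlow

end Setting
end Geometry
end CircleEta
end

noncomputable section

namespace CircleEta

/-! ### The trace on Fourier modes -/

/-- The sequence with a single entry `1`. -/
def RapidSeq.single (k : ℤ) : RapidSeq :=
  ⟨Pi.single k 1, fun j => summable_of_ne_finset_zero (s := {k}) fun m hm => by
    rw [Pi.single_eq_of_ne (by simpa using hm), norm_zero, mul_zero]⟩

lemma RapidSeq.single_apply (k m : ℤ) : (RapidSeq.single k).1 m = if m = k then 1 else 0 :=
  Pi.single_apply k (1 : ℂ) m

/-- The power series `e^{-tl²} (l/(2√t) - iX/(8t√t)) e^{ilX/2}`. -/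
def modeSeries (t l : ℝ) : PowerSeries ℂ :=
  PowerSeries.C (Complex.exp (-(t * l ^ 2 : ℝ))) * ((PowerSeries.C ((l : ℂ) / (2 * Real.sqrt t)) -
    PowerSeries.C (Complex.I / (8 * t * Real.sqrt t) : ℂ) * PowerSeries.X) *
      PowerSeries.rescale (Complex.I * l / 2) (PowerSeries.exp ℂ))

/-- The sum of the series `modeSeries t (m + r)` over all integers `m`. -/
def modeSeriesSum (t r : ℝ) : PowerSeries ℂ :=
  PowerSeries.mk fun j => ∑' m : ℤ, PowerSeries.coeff j (modeSeries t (m + r))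

section ModeTrace

variable {n : ℕ}

lemma evalAtForm_C (c : ℂ) (η : Forms n) : evalAtForm (PowerSeries.C c) η = algebraMap ℂ _ c := by
  rw [evalAtForm, Finset.sum_range_succ', Finset.sum_eq_zero fun k _ => by
    rw [PowerSeries.coeff_C, if_neg k.succ_ne_zero, zero_smul], zero_add, pow_zero,
    PowerSeries.coeff_C, if_pos rfl, Algebra.algebraMap_eq_smul_one]

lemma evalAtForm_X {η : Forms n} (hη : η ^ (n + 1) = 0) : evalAtForm PowerSeries.X η = η := by
  rw [← Polynomial.coe_X, evalAtForm_eq_aeval hη, Polynomial.aeval_X]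

lemma evalAtForm_sub (p q : PowerSeries ℂ) (η : Forms n) :
    evalAtForm (p - q) η = evalAtForm p η - evalAtForm q η := by
  simp only [evalAtForm, map_sub, sub_smul, Finset.sum_sub_distrib]

/-- The three summands of the exponent are even, hence commute, and the exponential is the product
of their exponentials. -/
lemma exp_modeExponent {t l : ℝ} {T Ω : Forms n} (hT : parity n T = T) (hΩ : parity n Ω = Ω)
    (hT0 : T ^ (n + 1) = 0) (hΩ0 : Ω ^ (n + 1) = 0) : IsNilpotent.exp (modeExponent t l T Ω) =
      evalAtForm (PowerSeries.rescale (Complex.I * l / 2) (PowerSeries.exp ℂ)) T *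
        evalAtForm (gaussSeries (1 / (16 * t))) T * evalAtForm (PowerSeries.exp ℂ) (-Ω) := by
  have h1 : ((Complex.I * l / 2 : ℂ) • T) ^ (n + 1) = 0 := by rw [smul_pow, hT0, smul_zero]
  have h2 : ((1 / (16 * t) : ℂ) • (T * T)) ^ (n + 1) = 0 := by
    rw [smul_pow, ← pow_two, ← pow_mul, mul_comm 2 (n + 1), pow_mul, hT0, zero_pow two_ne_zero, smul_zero]
  have h3 : (-Ω) ^ (n + 1) = 0 := by rw [neg_pow, hΩ0, mul_zero]
  have hc : Commute ((Complex.I * l / 2 : ℂ) • T) ((1 / (16 * t) : ℂ) • (T * T)) :=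
    ((commute_of_even hT (T * T)).smul_left _).smul_right _
  have hc' : Commute ((Complex.I * l / 2 : ℂ) • T + (1 / (16 * t) : ℂ) • (T * T)) (-Ω) :=
    (commute_of_even (by rw [map_neg, hΩ]) _).symm
  have h12 : IsNilpotent ((Complex.I * l / 2 : ℂ) • T + (1 / (16 * t) : ℂ) • (T * T)) :=
    hc.isNilpotent_add ⟨_, h1⟩ ⟨_, h2⟩
  rw [modeExponent, sub_eq_add_neg, IsNilpotent.exp_add_of_commute hc' h12 ⟨_, h3⟩,
    IsNilpotent.exp_add_of_commute hc ⟨_, h1⟩ ⟨_, h2⟩, exp_eq_evalAtForm h1, exp_eq_evalAtForm h3,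
    exp_smul_sq hT0, evalAtForm_smul]

lemma parity_exp_modeExponent {t l : ℝ} {T Ω : Forms n} (hT : parity n T = T)
    (hΩ : parity n Ω = Ω) (hT0 : T ^ (n + 1) = 0) (hΩ0 : Ω ^ (n + 1) = 0) :
    parity n (IsNilpotent.exp (modeExponent t l T Ω)) = IsNilpotent.exp (modeExponent t l T Ω) := by
  rw [exp_modeExponent hT hΩ hT0 hΩ0, parity_mul, parity_mul, parity_evalAtForm hT,
    parity_evalAtForm hT, parity_evalAtForm (by rw [map_neg, hΩ])]

/-- The heat operator applied to the form `1` gives `exp(x) (1 - ρ)` on a mode, by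
`sum_pow_apply_one`. The parity contained in `modeDot` turns `1 - ρ` into `1 + ρ`. -/
lemma modeEval_modeDot_modeFlow {t r : ℝ} (ht : 0 ≤ t) {T Ω ρ : Forms n} (hT : parity n T = T)
    (hΩ : parity n Ω = Ω) (hρ : parity n ρ = -ρ) (hT0 : T ^ (n + 1) = 0) (hΩ0 : Ω ^ (n + 1) = 0)
    (c : RapidSeq) (m : ℤ) : modeEval m (modeDot t r T (modeFlow t r T Ω ρ (1 ⊗ₜ c) 1)) =
      c.1 m • (evalAtForm (modeSeries t (m + r)) T * (evalAtForm (gaussSeries (1 / (16 * t))) T *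
        evalAtForm (PowerSeries.exp ℂ) (-Ω) * (1 + ρ))) := by
  have h1 : modeEval m (modeFlow t r T Ω ρ (1 ⊗ₜ c) 1) =
      Complex.exp (-(t * (m + r) ^ 2 : ℝ)) • c.1 m •
        (IsNilpotent.exp (modeExponent t (m + r) T Ω) * (1 - ρ)) := by
    rw [modeEval_modeFlow _ ht zero_le_one, Complex.ofReal_one, mul_one,
      ← sum_pow_apply_one (parity_modeExponent hT hΩ) hρ (modeExponent_pow hT hT0 hΩ0)]
    congr 1
    rw [Finset.smul_sum]
    refine Finset.sum_congr rfl fun k _ => ?_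
    rw [modeEval_modeNilpotent_pow, modeEval_tmul, map_smul, one_pow, one_div, smul_comm]
  rw [modeEval_modeDot, h1, map_smul, map_smul, parity_mul, parity_exp_modeExponent hT hΩ hT0 hΩ0,
    map_sub, parity_one, hρ, sub_neg_eq_add, exp_modeExponent hT hΩ hT0 hΩ0, modeSeries,
    evalAtForm_mul hT0, evalAtForm_mul hT0, evalAtForm_sub, evalAtForm_C, evalAtForm_C,
    evalAtForm_mul hT0, evalAtForm_C, evalAtForm_X hT0, ← Algebra.smul_def, ← Algebra.smul_def,
    mul_smul_comm, mul_smul_comm, smul_comm]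
  simp only [smul_mul_assoc, mul_assoc]

lemma map_evalAtForm_mul (p : PowerSeries ℂ) (T R : Forms n) (φ : Module.Dual ℂ (Forms n)) :
    φ (evalAtForm p T * R) =
      ∑ k ∈ Finset.range (n + 1), PowerSeries.coeff k p * φ (T ^ k * R) := by
  rw [evalAtForm, Finset.sum_mul _ _ R, map_sum]
  simp only [smul_mul_assoc, map_smul, smul_eq_mul]

lemma hasSum_evalAtForm_mul {p : ℤ → PowerSeries ℂ}
    (hp : ∀ j, Summable fun m => PowerSeries.coeff j (p m)) (T R : Forms n)
    (φ : Module.Dual ℂ (Forms n)) : HasSum (fun m => φ (evalAtForm (p m) T * R))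
      (φ (evalAtForm (PowerSeries.mk fun j => ∑' m, PowerSeries.coeff j (p m)) T * R)) := by
  simp only [map_evalAtForm_mul, PowerSeries.coeff_mk]
  exact hasSum_sum fun k _ => (hp k).hasSum.mul_right _

lemma evenPart_mul_one_add {x ρ : Forms n} (hx : parity n x = x) (hρ : parity n ρ = -ρ) :
    evenPart (x * (1 + ρ)) = x := by
  rw [mul_add, mul_one, evenPart_add, evenPart_of_even hx, evenPart_of_odd (by
    rw [parity_mul, hx, hρ, mul_neg]), add_zero]

end ModeTrace

/-! ### The trace of the heat operator on a fibre. -/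

section Geometry

variable {n : ℕ} {B : Type*} [TopologicalSpace B] [ChartedSpace (Coord n) B]
  [IsManifold (𝓡 n) ∞ B]
  {E : B → Type*} [TopologicalSpace (TotalSpace Plane E)] [∀ b, NormedAddCommGroup (E b)]
  [∀ b, InnerProductSpace ℝ (E b)] [FiberBundle Plane E] [VectorBundle ℝ Plane E]
  [ContMDiffVectorBundle ∞ Plane E (𝓡 n)] [IsContMDiffRiemannianBundle (𝓡 n) ∞ Plane E]
  [ChartedSpace (Coord (n + 1)) (UnitCircle E)] [IsManifold (𝓡 (n + 1)) ∞ (UnitCircle E)]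
  {V : UnitCircle E → Type*} [TopologicalSpace (TotalSpace ℂ V)] [∀ x, NormedAddCommGroup (V x)]
  [∀ x, InnerProductSpace ℂ (V x)] [FiberBundle ℂ V] [VectorBundle ℝ ℂ V]
  [ContMDiffVectorBundle ∞ ℂ V (𝓡 (n + 1))]

namespace Setting

variable (S : Setting (n := n) E V)

section Trace

variable {S} {b : B} {U : Set B} {σ : Π x, V x} {f : B → ℝ}
  {β : Π y : B, TangentSpace (𝓡 n) y →L[ℝ] ℂ} (hσ : S.IsLocalEigenframe U σ f β) (hb : b ∈ U)
include hσ hb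

lemma fibreInner_single (c : RapidSeq) (m : ℤ) :
    S.fibreInner b (S.fibreSection b σ c) (S.fibreSection b σ (RapidSeq.single m)) =
      S.fibreWeight b σ * (starRingEnd ℂ) (c.1 m) := by
  refine (hσ.hasSum_fibreInner hb c _).unique ?_
  have h := hasSum_single (f := fun k => (S.fibreWeight b σ : ℂ) *
    ((starRingEnd ℂ) (c.1 k) * (RapidSeq.single m).1 k)) m fun k hk => by
      simp only [RapidSeq.single_apply, if_neg hk, mul_zero]
  simpa [RapidSeq.single_apply] using h

lemma fibreNormSq_single (m : ℤ) :
    S.fibreNormSq b (S.fibreSection b σ (RapidSeq.single m)) = S.fibreWeight b σ := by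
  have h := S.fibreInner_self (b := b) (S.fibreSection b σ (RapidSeq.single m))
  rw [fibreInner_single hσ hb, RapidSeq.single_apply, if_pos rfl, map_one, mul_one] at h
  exact_mod_cast h.symm

/-- The modes `e^{imθ} σ` divided by their common norm, enumerated by the natural numbers. -/
lemma exists_isOrthonormalBasis [T2Space B] : ∃ ψ, S.IsOrthonormalBasis b ψ := by
  have hκ := hσ.fibreWeight_pos hb
  have hs : ((Real.sqrt (S.fibreWeight b σ) : ℂ))⁻¹ * (Real.sqrt (S.fibreWeight b σ) : ℂ)⁻¹ *
      S.fibreWeight b σ = 1 := by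
    rw [← mul_inv, ← Complex.ofReal_mul, Real.mul_self_sqrt hκ.le]
    exact inv_mul_cancel₀ (by exact_mod_cast hκ.ne')
  let c : ℕ → RapidSeq := fun k =>
    ((Real.sqrt (S.fibreWeight b σ) : ℂ))⁻¹ • RapidSeq.single (Equiv.intEquivNat.symm k)
  have hc : ∀ k m, (c k).1 m = (Real.sqrt (S.fibreWeight b σ) : ℂ)⁻¹ *
      if m = Equiv.intEquivNat.symm k then 1 else 0 := fun k m => by
    rw [← RapidSeq.single_apply]
    rfl
  have h1 : ∀ k d, S.fibreInner b (S.fibreSection b σ (c k)) (S.fibreSection b σ d) =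
      S.fibreWeight b σ * ((Real.sqrt (S.fibreWeight b σ) : ℂ)⁻¹ *
        d.1 (Equiv.intEquivNat.symm k)) := fun k d => by
    refine (hσ.hasSum_fibreInner hb _ d).unique ?_
    have h := hasSum_single (f := fun m => (S.fibreWeight b σ : ℂ) *
      ((starRingEnd ℂ) ((c k).1 m) * d.1 m)) (Equiv.intEquivNat.symm k) fun m hm => by
        rw [hc, if_neg hm, mul_zero, map_zero, zero_mul, mul_zero]
    rw [hc, if_pos rfl, mul_one, map_inv₀, Complex.conj_ofReal] at h
    exact h
  refine ⟨fun k => S.fibreSection b σ (c k), fun k => hσ.isSmoothSection_fibreSection hb _,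
    fun k l => ?_, fun v hv => ?_⟩
  · rw [h1, hc]
    by_cases hkl : k = l
    · rw [if_pos hkl, if_pos (by rw [hkl]), mul_one, mul_comm, hs]
    · rw [if_neg hkl, if_neg (fun h => hkl (Equiv.intEquivNat.symm.injective h)), mul_zero, mul_zero,
        mul_zero]
  · obtain ⟨d, rfl⟩ := hσ.exists_fibreSection_eq hb hv
    have h2 := (Equiv.hasSum_iff Equiv.intEquivNat.symm).2 (hσ.hasSum_fibreNormSq hb d)
    refine h2.congr_fun fun k => ?_
    rw [h1, norm_mul, norm_mul, norm_inv, Complex.norm_real, Complex.norm_real,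
      Real.norm_of_nonneg hκ.le, Real.norm_of_nonneg (Real.sqrt_nonneg _), mul_pow, mul_pow, inv_pow,
      Real.sq_sqrt hκ.le, Function.comp_apply]
    field_simp

/-- The trace of an operator that is diagonal on the Fourier modes. -/
lemma isTrace_of_modes [T2Space B] {K : S.FibreSections b → S.FibreForms b}
    {W : RapidSeq → Forms n ⊗[ℂ] RapidSeq} {κ : ℤ → Forms n} {ξ : Forms n}
    (hK : ∀ c, K (S.fibreSection b σ c) = (S.fibreSection b σ).lTensor (Forms n) (W c))
    (hW : ∀ c m, modeEval m (W c) = c.1 m • κ m)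
    (hκ : ∀ φ : Module.Dual ℂ (Forms n), HasSum (fun m => φ (κ m)) (φ ξ)) : S.IsTrace b K ξ := by
  refine ⟨exists_isOrthonormalBasis hσ hb, fun ψ hψ φ => ?_⟩
  have hw := hσ.fibreWeight_pos hb
  have hex := fun k => hσ.exists_fibreSection_eq hb (hψ.smooth k)
  choose c hc using hex
  -- Parseval's identity for the basis `ψ`, applied to the mode `m`.
  have h1 : ∀ m, HasSum (fun k => S.fibreWeight b σ * ‖(c k).1 m‖ ^ 2) 1 := fun m => by
    have h := hψ.parseval _ (hσ.isSmoothSection_fibreSection hb (RapidSeq.single m))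
    rw [fibreNormSq_single hσ hb] at h
    have h' := h.mul_left (S.fibreWeight b σ)⁻¹
    rw [inv_mul_cancel₀ hw.ne'] at h'
    refine h'.congr_fun fun k => ?_
    rw [← hc k, fibreInner_single hσ hb, norm_mul, RCLike.norm_conj, Complex.norm_real,
      Real.norm_of_nonneg hw.le]
    field_simp
  -- This double series is absolutely summable. Summing over the basis first gives `∑ φ (κ m)`, and
  -- summing over the modes first gives the diagonal entries in the basis `ψ`.
  let F : ℤ × ℕ → ℂ := fun p => ((S.fibreWeight b σ * ‖(c p.2).1 p.1‖ ^ 2 : ℝ) : ℂ) * φ (κ p.1)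
  have hF : Summable F := by
    refine Summable.of_norm ?_
    have hn : ∀ p, ‖F p‖ = S.fibreWeight b σ * ‖(c p.2).1 p.1‖ ^ 2 * ‖φ (κ p.1)‖ := fun p => by
      rw [norm_mul, Complex.norm_real, Real.norm_of_nonneg (by positivity)]
    refine (summable_prod_of_nonneg fun p => norm_nonneg _).2 ⟨fun m => ?_, ?_⟩
    · simp only [hn]
      exact ((h1 m).mul_right _).summable
    · simp only [hn]
      have : ∀ m, ∑' k, S.fibreWeight b σ * ‖(c k).1 m‖ ^ 2 * ‖φ (κ m)‖ = ‖φ (κ m)‖ := fun m => by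
        rw [((h1 m).mul_right _).tsum_eq, one_mul]
      simp only [this]
      exact (hκ φ).summable.norm
  have h2 : HasSum F (φ ξ) := by
    have h3 : HasSum (fun m => φ (κ m)) (∑' p, F p) := hF.hasSum.prod_fiberwise fun m => by
      have := (Complex.hasSum_ofReal.2 (h1 m)).mul_right (φ (κ m))
      rwa [Complex.ofReal_one, one_mul] at this
    rw [(hκ φ).unique h3]
    exact hF.hasSum
  have h3 : HasSum (F ∘ Equiv.prodComm ℕ ℤ) (φ ξ) := (Equiv.hasSum_iff _).2 h2
  refine h3.prod_fiberwise fun k => ?_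
  rw [← hc k, hK, coeff_lTensor]
  refine (hσ.hasSum_fibreInner hb (c k) _).congr_fun fun m => ?_
  change ((S.fibreWeight b σ * ‖(c k).1 m‖ ^ 2 : ℝ) : ℂ) * φ (κ m) = _
  rw [seqCoeff_apply, hW, map_smul, smul_eq_mul, ← mul_assoc ((starRingEnd ℂ) _),
    ← Complex.normSq_eq_conj_mul_self, Complex.normSq_eq_norm_sq]
  push_cast
  ring

/-- All factors on a mode are even except `1 + ρ`, so taking the even part just removes `ρ`. -/
lemma isTraceEv [T2Space B] {x₀ : UnitCircle E} (hx₀ : base x₀ = b) {t : ℝ} (ht : 0 < t)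
    (hs : ∀ j, Summable fun m : ℤ => PowerSeries.coeff j (modeSeries t (m + f b))) :
    S.IsTraceEv b t
      (evalAtForm (modeSeriesSum t (f b) * gaussSeries (1 / (16 * t))) (S.torsionForm b x₀) *
        evalAtForm (PowerSeries.exp ℂ)
          (-(extDerivAt β b + (Complex.I * f b) • S.torsionForm b x₀))) := by
  obtain ⟨ρ, hρ, h⟩ := exists_expNegCurvature_eq hσ hb hx₀ ht
  have hT2 : S.torsionForm b x₀ ∈ ⋀[ℂ]^2 (Coord n →ₗ[ℝ] ℂ) := twoForm_mem _
  have hΩ2 : extDerivAt β b + (Complex.I * f b) • S.torsionForm b x₀ ∈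
      ⋀[ℂ]^2 (Coord n →ₗ[ℝ] ℂ) := add_mem (twoForm_mem _) (Submodule.smul_mem _ _ hT2)
  have hT : parity n (S.torsionForm b x₀) = S.torsionForm b x₀ := parity_twoForm _
  have hΩ : parity n (extDerivAt β b + (Complex.I * f b) • S.torsionForm b x₀) =
      extDerivAt β b + (Complex.I * f b) • S.torsionForm b x₀ := by
    rw [map_add, map_smul, hT, extDerivAt, parity_twoForm]
  have hT0 := pow_eq_zero_of_mem hT2 n.lt_succ_self
  have hΩ0 := pow_eq_zero_of_mem hΩ2 n.lt_succ_self
  refine ⟨_, isTrace_of_modes hσ hb (W := fun c => modeDot t (f b) (S.torsionForm b x₀)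
    (modeFlow t (f b) (S.torsionForm b x₀)
      (extDerivAt β b + (Complex.I * f b) • S.torsionForm b x₀) ρ (1 ⊗ₜ c) 1)) (fun c => ?_)
    (modeEval_modeDot_modeFlow ht.le hT hΩ hρ hT0 hΩ0)
    (hasSum_evalAtForm_mul hs (S.torsionForm b x₀) _), ?_⟩
  · rw [← fibreDot_lTensor hσ hb hx₀, ← h, LinearMap.lTensor_tmul]
  · rw [← mul_assoc, ← mul_assoc, ← evalAtForm_mul hT0, evenPart_mul_one_add _ hρ]
    · rfl
    · rw [parity_mul, parity_evalAtForm hT, parity_evalAtForm (by rw [map_neg, hΩ])]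

end Trace

end Setting
end Geometry
end CircleEta
end

noncomputable section

namespace CircleEta

/-! ### The Poisson summation formula for the trace -/

/-- Comparison with the bound for the terms of a theta series; the shift by `r` costs a linear term
in `|m|` and a constant factor. -/
lemma summable_exp_neg_sq_add {t : ℝ} (ht : 0 < t) (c r : ℝ) :
    Summable fun m : ℤ => Real.exp (-t * (m + r) ^ 2 + |c| * |m + r|) := by
  have h := (summable_pow_mul_jacobiTheta₂_term_bound ((2 * t * |r| + |c|) / (2 * Real.pi))
    (T := t / Real.pi) (by positivity) 0).mul_left (Real.exp (|c| * |r|))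
  refine Summable.of_nonneg_of_le (fun m => (Real.exp_pos _).le) (fun m => ?_) h
  rw [pow_zero, one_mul, ← Real.exp_add, Real.exp_le_exp]
  have h1 : -Real.pi * (t / Real.pi * (m : ℝ) ^ 2 -
      2 * ((2 * t * |r| + |c|) / (2 * Real.pi)) * ((|m| : ℤ) : ℝ)) =
      -t * (m : ℝ) ^ 2 + (2 * t * |r| + |c|) * |(m : ℝ)| := by
    rw [Int.cast_abs]
    field_simp
    ring
  rw [h1]
  have h2 : |(m : ℝ) + r| ≤ |(m : ℝ)| + |r| := abs_add_le _ _
  have h3 : -(|(m : ℝ)| * |r|) ≤ m * r := by rw [← abs_mul]; exact neg_abs_le _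
  have h4 := mul_le_mul_of_nonneg_left h2 (abs_nonneg c)
  have h5 := mul_le_mul_of_nonneg_left h3 ht.le
  nlinarith [mul_nonneg ht.le (sq_nonneg r)]

/-- The linear factor is absorbed by `1 + x ≤ e^x`, which raises `|c|` by one. -/
lemma summable_abs_mul_exp {t : ℝ} (ht : 0 < t) (c r : ℝ) :
    Summable fun m : ℤ => (1 + |(m : ℝ) + r|) * Real.exp (-t * (m + r) ^ 2 + |c| * |m + r|) := by
  refine Summable.of_nonneg_of_le (fun m => by positivity) (fun m => ?_)
    (summable_exp_neg_sq_add ht (|c| + 1) r)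
  have h1 := Real.add_one_le_exp |(m : ℝ) + r|
  calc (1 + |(m : ℝ) + r|) * Real.exp (-t * (m + r) ^ 2 + |c| * |m + r|)
      ≤ Real.exp |(m : ℝ) + r| * Real.exp (-t * (m + r) ^ 2 + |c| * |m + r|) := by
        gcongr
        linarith
    _ = Real.exp (-t * (m + r) ^ 2 + |(|c| + 1)| * |m + r|) := by
        rw [← Real.exp_add, abs_of_nonneg (by positivity : 0 ≤ |c| + 1)]
        congr 1
        ring

/-- The Jacobi identity for the derivative of the theta function, as a Poisson summation formula. -/
lemma hasSum_mul_exp_neg_sq {t : ℝ} (ht : 0 < t) (z : ℂ) :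
    HasSum (fun m : ℤ => (m + z) * Complex.exp (-t * (m + z) ^ 2))
      (∑' k : ℤ, -(Real.pi * Complex.I / t * Real.sqrt (Real.pi / t)) *
        (k * Complex.exp (2 * Real.pi * Complex.I * k * z) *
          Complex.exp (-(Real.pi ^ 2 * k ^ 2 / t)))) := by
  have hπ : (Real.pi : ℂ) ≠ 0 := by exact_mod_cast Real.pi_ne_zero
  have htc : (t : ℂ) ≠ 0 := by exact_mod_cast ht.ne'
  -- With this `τ` the inverted parameter is `-1/τ = it/π`, so the theta series at `(z/τ, -1/τ)` is,
  -- up to the factor that completes the square, the Gaussian sum over `m`.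
  set τ : ℂ := Complex.I * (Real.pi / t : ℝ) with hτ
  have hτ_im : 0 < τ.im := by
    rw [hτ, Complex.I_mul_im, Complex.ofReal_re]
    positivity
  have hτ_eq : τ = Complex.I * Real.pi / t := by rw [hτ]; push_cast; ring
  have hτ_inv : -1 / τ = Complex.I * (t / Real.pi : ℝ) := by
    rw [hτ_eq]
    push_cast
    field_simp
    rw [Complex.I_sq]
  have hτ_inv_im : 0 < (-1 / τ).im := by
    rw [hτ_inv, Complex.I_mul_im, Complex.ofReal_re]
    positivity
  have hz : z / τ = -Complex.I * t * z / Real.pi := by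
    rw [hτ_eq]
    field_simp
    rw [Complex.I_sq]
    ring
  have hsq : (-Complex.I * τ) ^ (1 / 2 : ℂ) = (Real.sqrt (Real.pi / t) : ℂ) := by
    have : -Complex.I * τ = ((Real.pi / t : ℝ) : ℂ) := by
      rw [hτ, ← mul_assoc, neg_mul, Complex.I_mul_I, neg_neg, one_mul]
    rw [this, Real.sqrt_eq_rpow, Complex.ofReal_cpow (by positivity)]
    norm_num
  have hs0 : (Real.sqrt (Real.pi / t) : ℂ) ≠ 0 := by
    exact_mod_cast (Real.sqrt_pos.2 (by positivity)).ne'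
  have hss : (Real.sqrt (Real.pi / t) : ℂ) ^ 2 = Real.pi / t := by
    rw [← Complex.ofReal_pow, Real.sq_sqrt (by positivity)]
    push_cast
    rfl
  -- This combination produces the factor `2πi (m - z)`; the reflection `m ↦ -m` and the factor
  -- `i/(2π)` turn it into `m + z`.
  have h1 := (hasSum_jacobiTheta₂'_term (z / τ) hτ_inv_im).sub
    ((hasSum_jacobiTheta₂_term (z / τ) hτ_inv_im).mul_left (2 * Real.pi * Complex.I * z))
  have h2 := (Equiv.hasSum_iff (Equiv.neg ℤ)).2 (h1.mul_left
    (Complex.exp (-Real.pi * Complex.I * z ^ 2 / τ) * (Complex.I / (2 * Real.pi))))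
  have h3 : Complex.exp (-Real.pi * Complex.I * z ^ 2 / τ) * (Complex.I / (2 * Real.pi)) *
      (jacobiTheta₂' (z / τ) (-1 / τ) -
        2 * Real.pi * Complex.I * z * jacobiTheta₂ (z / τ) (-1 / τ)) =
      -(Real.sqrt (Real.pi / t) / (2 * t)) * jacobiTheta₂' z τ := by
    rw [jacobiTheta₂'_functional_equation z τ, hsq]
    generalize jacobiTheta₂' (z / τ) (-1 / τ) -
      2 * Real.pi * Complex.I * z * jacobiTheta₂ (z / τ) (-1 / τ) = A
    generalize Complex.exp (-Real.pi * Complex.I * z ^ 2 / τ) = A'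
    rw [hτ_eq]
    field_simp
    linear_combination A' * A * Complex.I_sq
  rw [h3, ← (hasSum_jacobiTheta₂'_term z hτ_im).tsum_eq, ← tsum_mul_left] at h2
  have h4 : ∀ k : ℤ, -(Real.sqrt (Real.pi / t) / (2 * t)) * jacobiTheta₂'_term k z τ =
      -(Real.pi * Complex.I / t * Real.sqrt (Real.pi / t)) *
        (k * Complex.exp (2 * Real.pi * Complex.I * k * z) *
          Complex.exp (-(Real.pi ^ 2 * k ^ 2 / t))) := fun k => by
    rw [jacobiTheta₂'_term, jacobiTheta₂_term, mul_assoc (k : ℂ), ← Complex.exp_add]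
    have e1 : 2 * Real.pi * Complex.I * k * z + -(Real.pi ^ 2 * k ^ 2 / t) =
        2 * Real.pi * Complex.I * k * z + Real.pi * Complex.I * (k : ℂ) ^ 2 * τ := by
      rw [hτ_eq]
      linear_combination (-(Real.pi : ℂ) ^ 2 * k ^ 2 / t) * Complex.I_sq
    rw [e1]
    ring
  rw [tsum_congr h4] at h2
  refine h2.congr_fun fun m => ?_
  rw [Function.comp_apply, Equiv.neg_apply, jacobiTheta₂'_term, jacobiTheta₂_term, hz, hτ_inv]
  have e1 : Complex.exp (-t * (m + z) ^ 2) = Complex.exp (-Real.pi * Complex.I * z ^ 2 / τ) *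
      Complex.exp (2 * Real.pi * Complex.I * ((-m : ℤ) : ℂ) * (-Complex.I * t * z / Real.pi) +
        Real.pi * Complex.I * ((-m : ℤ) : ℂ) ^ 2 * (Complex.I * (t / Real.pi : ℝ))) := by
    rw [← Complex.exp_add, hτ_eq]
    congr 1
    push_cast
    field_simp
    ring_nf
    rw [Complex.I_sq]
    ring
  rw [e1]
  push_cast
  field_simp
  ring_nf
  rw [Complex.I_sq]
  ring

/-- Absolute summability of the coefficients allows the exchange of the two sums on the closed unit
disc. -/
lemma hasSum_tsum_mul_pow {ι : Type*} {a : ι → ℕ → ℂ} (ha : Summable fun p : ι × ℕ => ‖a p.1 p.2‖)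
    {x : ℂ} (hx : ‖x‖ ≤ 1) {g : ι → ℂ} (hg : ∀ i, HasSum (fun j => a i j * x ^ j) (g i)) :
    HasSum (fun j => (∑' i, a i j) * x ^ j) (∑' i, g i) := by
  let F : ι × ℕ → ℂ := fun p => a p.1 p.2 * x ^ p.2
  have h1 : Summable F := by
    refine Summable.of_norm_bounded ha fun p => ?_
    rw [norm_mul, norm_pow]
    exact mul_le_of_le_one_right (norm_nonneg _) (pow_le_one₀ (norm_nonneg _) hx)
  have h2 : HasSum g (∑' p, F p) := h1.hasSum.prod_fiberwise hg
  rw [h2.tsum_eq]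
  have h3 : HasSum (F ∘ Equiv.prodComm ℕ ι) (∑' p, F p) := (Equiv.hasSum_iff _).2 h1.hasSum
  refine h3.prod_fiberwise fun j => ?_
  have hinj : Function.Injective fun i : ι => (i, j) := fun _ _ h => (Prod.mk.inj h).1
  have h4 : Summable fun i => a i j := (ha.comp_injective hinj).of_norm
  exact h4.hasSum.mul_right (x ^ j)

/-- A convergent power series is determined by its sum near zero. So identities between formal
series in the nilpotent form `T` may be checked with a complex number in its place. -/
lemma powerSeries_eq_of_hasSum {p q : PowerSeries ℂ} {G : ℂ → ℂ}
    (hp : ∀ x : ℂ, ‖x‖ ≤ 1 → HasSum (fun j => PowerSeries.coeff j p * x ^ j) (G x))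
    (hq : ∀ x : ℂ, ‖x‖ ≤ 1 → HasSum (fun j => PowerSeries.coeff j q * x ^ j) (G x)) : p = q := by
  have key : ∀ p : PowerSeries ℂ,
      (∀ x : ℂ, ‖x‖ ≤ 1 → HasSum (fun j => PowerSeries.coeff j p * x ^ j) (G x)) →
      HasFPowerSeriesAt G (FormalMultilinearSeries.ofScalars ℂ fun j => PowerSeries.coeff j p) 0 := by
    intro p hp
    rw [hasFPowerSeriesAt_iff]
    filter_upwards [Metric.closedBall_mem_nhds (0 : ℂ) one_pos] with x hx
    rw [zero_add]
    refine (hp x (by simpa using hx)).congr_fun fun j => ?_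
    rw [FormalMultilinearSeries.coeff_ofScalars, smul_eq_mul, mul_comm]
  have h := (key p hp).eq_formalMultilinearSeries (key q hq)
  ext j
  have h1 := congrArg (fun s => FormalMultilinearSeries.coeff s j) h
  simpa [FormalMultilinearSeries.coeff_ofScalars] using h1

lemma hasSum_rescale_exp (z x : ℂ) : HasSum (fun j =>
    PowerSeries.coeff j (PowerSeries.rescale z (PowerSeries.exp ℂ)) * x ^ j) (Complex.exp (z * x)) := by
  have h := NormedSpace.expSeries_div_hasSum_exp (z * x)
  rw [← Complex.exp_eq_exp_ℂ] at h
  refine h.congr_fun fun j => ?_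
  rw [PowerSeries.coeff_rescale, PowerSeries.coeff_exp, mul_pow]
  simp
  ring

lemma hasSum_gaussSeries (c x : ℂ) :
    HasSum (fun j => PowerSeries.coeff j (gaussSeries c) * x ^ j) (Complex.exp (c * x ^ 2)) := by
  have h := NormedSpace.expSeries_div_hasSum_exp (c * x ^ 2)
  rw [← Complex.exp_eq_exp_ℂ] at h
  have hinj : Function.Injective fun l : ℕ => 2 * l := fun a b h => by simpa using h
  refine (hinj.hasSum_iff fun j hj => ?_).1 (h.congr_fun fun l => ?_)
  · have : ¬ Even j := fun ⟨l, hl⟩ => hj ⟨l, by simp only; omega⟩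
    rw [gaussSeries, PowerSeries.coeff_mk, if_neg this, zero_mul]
  · rw [Function.comp_apply, gaussSeries, PowerSeries.coeff_mk, if_pos (even_two_mul l),
      Nat.mul_div_cancel_left _ two_pos, mul_pow, ← pow_mul]
    ring

lemma hasSum_coeff_mul {p q : PowerSeries ℂ} {x a b : ℂ}
    (hp : HasSum (fun j => PowerSeries.coeff j p * x ^ j) a)
    (hq : HasSum (fun j => PowerSeries.coeff j q * x ^ j) b) :
    HasSum (fun j => PowerSeries.coeff j (p * q) * x ^ j) (a * b) := by
  have h1 := (summable_norm_sum_mul_antidiagonal_of_summable_norm hp.summable.norm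
    hq.summable.norm).of_norm.hasSum
  rw [← tsum_mul_tsum_eq_tsum_sum_antidiagonal_of_summable_norm hp.summable.norm hq.summable.norm,
    hp.tsum_eq, hq.tsum_eq] at h1
  refine h1.congr_fun fun j => ?_
  rw [PowerSeries.coeff_mul, Finset.sum_mul]
  refine Finset.sum_congr rfl fun i hi => ?_
  rw [← Finset.HasAntidiagonal.mem_antidiagonal.1 hi, pow_add]
  ring

end CircleEta
end

/-! ### Absolute convergence and the dual series of the trace. -/

noncomputable section

namespace CircleEta

lemma hasSum_norm_rescale_exp (z : ℂ) : HasSum (fun j =>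
    ‖PowerSeries.coeff j (PowerSeries.rescale z (PowerSeries.exp ℂ))‖) (Real.exp ‖z‖) := by
  have h := NormedSpace.expSeries_div_hasSum_exp (‖z‖ : ℝ)
  rw [← Real.exp_eq_exp_ℝ] at h
  refine h.congr_fun fun j => ?_
  rw [PowerSeries.coeff_rescale, PowerSeries.coeff_exp, norm_mul, norm_pow]
  simp [div_eq_mul_inv]

lemma hasSum_C (c x : ℂ) : HasSum (fun j => PowerSeries.coeff j (PowerSeries.C c) * x ^ j) c := by
  have h := hasSum_single (f := fun j => PowerSeries.coeff j (PowerSeries.C c) * x ^ j) 0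
    fun j hj => by rw [PowerSeries.coeff_C, if_neg hj, zero_mul]
  simpa using h

lemma hasSum_X (x : ℂ) : HasSum (fun j => PowerSeries.coeff j PowerSeries.X * x ^ j) x := by
  have h := hasSum_single (f := fun j => PowerSeries.coeff j (PowerSeries.X : PowerSeries ℂ) * x ^ j) 1
    fun j hj => by rw [PowerSeries.coeff_X, if_neg hj, zero_mul]
  simpa using h

lemma hasSum_linear_mul_exp (E u v z x : ℂ) : HasSum (fun j => PowerSeries.coeff j
    (PowerSeries.C E * ((PowerSeries.C u - PowerSeries.C v * PowerSeries.X) *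
      PowerSeries.rescale z (PowerSeries.exp ℂ))) * x ^ j)
    (E * ((u - v * x) * Complex.exp (z * x))) := by
  refine hasSum_coeff_mul (hasSum_C E x) (hasSum_coeff_mul ?_ (hasSum_rescale_exp z x))
  have h := (hasSum_C u x).sub (hasSum_coeff_mul (hasSum_C v x) (hasSum_X x))
  exact h.congr_fun fun j => by rw [map_sub, sub_mul]

/-- Multiplication by `X` only shifts the coefficients, and the absolute sum of those of `e^{zX}` is
`e^{|z|}`. -/
lemma tsum_norm_linear_mul_exp_le (E u v z : ℂ) : ∑' j, ‖PowerSeries.coeff j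
    (PowerSeries.C E * ((PowerSeries.C u - PowerSeries.C v * PowerSeries.X) *
      PowerSeries.rescale z (PowerSeries.exp ℂ)))‖ ≤ ‖E‖ * ((‖u‖ + ‖v‖) * Real.exp ‖z‖) := by
  set P := PowerSeries.rescale z (PowerSeries.exp ℂ) with hP
  have h1 : HasSum (fun j => ‖PowerSeries.coeff j P‖) (Real.exp ‖z‖) := hasSum_norm_rescale_exp z
  have h2 : HasSum (fun j => ‖PowerSeries.coeff j (PowerSeries.X * P)‖) (Real.exp ‖z‖) := by
    refine (hasSum_nat_add_iff' 1).1 ?_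
    simpa [PowerSeries.coeff_succ_X_mul] using h1
  have h3 := ((h1.mul_left ‖u‖).add (h2.mul_left ‖v‖)).mul_left ‖E‖
  have hle : ∀ j, ‖PowerSeries.coeff j
      (PowerSeries.C E * ((PowerSeries.C u - PowerSeries.C v * PowerSeries.X) * P))‖ ≤
      ‖E‖ * (‖u‖ * ‖PowerSeries.coeff j P‖ + ‖v‖ * ‖PowerSeries.coeff j (PowerSeries.X * P)‖) := by
    intro j
    rw [PowerSeries.coeff_C_mul, sub_mul, map_sub, PowerSeries.coeff_C_mul, mul_assoc,
      PowerSeries.coeff_C_mul, norm_mul, ← norm_mul u, ← norm_mul v]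
    exact mul_le_mul_of_nonneg_left (norm_sub_le _ _) (norm_nonneg _)
  have h4 : Summable fun j => ‖PowerSeries.coeff j
      (PowerSeries.C E * ((PowerSeries.C u - PowerSeries.C v * PowerSeries.X) * P))‖ :=
    Summable.of_nonneg_of_le (fun j => norm_nonneg _) hle h3.summable
  refine (h4.tsum_le_tsum hle h3.summable).trans_eq ?_
  rw [h3.tsum_eq]
  ring

lemma summable_norm_coeff {ι : Type*} {E u v z : ι → ℂ}
    (h : Summable fun i => ‖E i‖ * ((‖u i‖ + ‖v i‖) * Real.exp ‖z i‖)) :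
    Summable fun p : ι × ℕ => ‖PowerSeries.coeff p.2
      (PowerSeries.C (E p.1) * ((PowerSeries.C (u p.1) - PowerSeries.C (v p.1) * PowerSeries.X) *
        PowerSeries.rescale (z p.1) (PowerSeries.exp ℂ)))‖ := by
  refine (summable_prod_of_nonneg fun p => norm_nonneg _).2 ⟨fun i => ?_, ?_⟩
  · have h1 := (hasSum_linear_mul_exp (E i) (u i) (v i) (z i) 1).summable.norm
    simpa using h1
  · exact Summable.of_nonneg_of_le (fun i => tsum_nonneg fun j => norm_nonneg _)
      (fun i => tsum_norm_linear_mul_exp_le (E i) (u i) (v i) (z i)) h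

lemma hasSum_modeSeries (t l : ℝ) (x : ℂ) :
    HasSum (fun j => PowerSeries.coeff j (modeSeries t l) * x ^ j) (Complex.exp (-(t * l ^ 2 : ℝ)) *
      (((l : ℂ) / (2 * Real.sqrt t) - Complex.I / (8 * t * Real.sqrt t) * x) *
        Complex.exp (Complex.I * l / 2 * x))) := by
  unfold modeSeries
  exact hasSum_linear_mul_exp _ _ _ _ _

lemma summable_norm_modeSeries {t : ℝ} (ht : 0 < t) (r : ℝ) :
    Summable fun p : ℤ × ℕ => ‖PowerSeries.coeff p.2 (modeSeries t (p.1 + r))‖ := by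
  have key := summable_norm_coeff (E := fun m : ℤ => Complex.exp (-(t * ((m : ℝ) + r) ^ 2 : ℝ)))
    (u := fun m : ℤ => (((m : ℝ) + r : ℝ) : ℂ) / (2 * Real.sqrt t))
    (v := fun _ => (Complex.I / (8 * t * Real.sqrt t) : ℂ))
    (z := fun m : ℤ => Complex.I * ((m : ℝ) + r : ℝ) / 2)
  unfold modeSeries
  refine key ?_
  have hs : 0 < Real.sqrt t := Real.sqrt_pos.2 ht
  refine Summable.of_nonneg_of_le (fun m => by positivity) (fun m => ?_)
    ((summable_abs_mul_exp ht (1 / 2) r).mul_left (1 / (2 * Real.sqrt t) + 1 / (8 * t * Real.sqrt t)))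
  have h1 : ‖Complex.exp (-(t * ((m : ℝ) + r) ^ 2 : ℝ))‖ = Real.exp (-t * ((m : ℝ) + r) ^ 2) := by
    rw [← Complex.ofReal_neg, Complex.norm_exp, Complex.ofReal_re, neg_mul]
  have h2 : ‖(((m : ℝ) + r : ℝ) : ℂ) / (2 * Real.sqrt t)‖ = |(m : ℝ) + r| * (1 / (2 * Real.sqrt t)) := by
    rw [norm_div, Complex.norm_real, norm_mul, Complex.norm_real, Real.norm_of_nonneg hs.le,
      Complex.norm_ofNat, Real.norm_eq_abs]
    ring
  have h3 : ‖(Complex.I / (8 * t * Real.sqrt t) : ℂ)‖ = 1 / (8 * t * Real.sqrt t) := by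
    rw [norm_div, Complex.norm_I, norm_mul, norm_mul, Complex.norm_real, Complex.norm_real,
      Real.norm_of_nonneg hs.le, Real.norm_of_nonneg ht.le, Complex.norm_ofNat]
  have h4 : ‖Complex.I * ((m : ℝ) + r : ℝ) / 2‖ = |(1 / 2 : ℝ)| * |(m : ℝ) + r| := by
    rw [norm_div, norm_mul, Complex.norm_I, Complex.norm_real, Complex.norm_ofNat, Real.norm_eq_abs,
      abs_of_pos (by norm_num : (0 : ℝ) < 1 / 2)]
    ring
  rw [h1, h2, h3, h4, Real.exp_add]
  have h5 : |(m : ℝ) + r| * (1 / (2 * Real.sqrt t)) + 1 / (8 * t * Real.sqrt t) ≤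
      (1 / (2 * Real.sqrt t) + 1 / (8 * t * Real.sqrt t)) * (1 + |(m : ℝ) + r|) := by
    have : 0 ≤ 1 / (8 * t * Real.sqrt t) * |(m : ℝ) + r| := by positivity
    have : 0 ≤ 1 / (2 * Real.sqrt t) := by positivity
    nlinarith
  calc _ = (|(m : ℝ) + r| * (1 / (2 * Real.sqrt t)) + 1 / (8 * t * Real.sqrt t)) *
        (Real.exp (-t * ((m : ℝ) + r) ^ 2) * Real.exp (|(1 / 2 : ℝ)| * |(m : ℝ) + r|)) := by ring
    _ ≤ _ := mul_le_mul_of_nonneg_right h5 (by positivity)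
    _ = _ := by ring

/-- The `k`-th term of the series that is dual to `modeSeriesSum`. -/
def poissonSeries (t r : ℝ) (k : ℤ) : PowerSeries ℂ :=
  PowerSeries.C (-(Real.pi * Complex.I * Real.sqrt Real.pi / (2 * t ^ 2)) *
    (k * Complex.exp (2 * Real.pi * Complex.I * k * r) * Complex.exp (-(Real.pi ^ 2 * k ^ 2 / t)))) *
    ((PowerSeries.C 1 - PowerSeries.C 0 * PowerSeries.X) *
      PowerSeries.rescale (Real.pi * k / (2 * t) : ℂ) (PowerSeries.exp ℂ))

lemma hasSum_poissonSeries (t r : ℝ) (k : ℤ) (x : ℂ) :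
    HasSum (fun j => PowerSeries.coeff j (poissonSeries t r k) * x ^ j)
      (-(Real.pi * Complex.I * Real.sqrt Real.pi / (2 * t ^ 2)) *
        (k * Complex.exp (2 * Real.pi * Complex.I * k * r) *
          Complex.exp (-(Real.pi ^ 2 * k ^ 2 / t))) *
        ((1 - 0 * x) * Complex.exp (Real.pi * k / (2 * t) * x))) := by
  unfold poissonSeries
  exact hasSum_linear_mul_exp _ _ _ _ _

lemma coeff_poissonSeries (t r : ℝ) (k : ℤ) (j : ℕ) : PowerSeries.coeff j (poissonSeries t r k) =
    -(Real.pi * Complex.I * Real.sqrt Real.pi / (2 * t ^ 2)) *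
      (k * Complex.exp (2 * Real.pi * Complex.I * k * r) * Complex.exp (-(Real.pi ^ 2 * k ^ 2 / t))) *
      ((Real.pi * k / (2 * t)) ^ j / j.factorial) := by
  rw [poissonSeries, PowerSeries.coeff_C_mul, map_one, map_zero, zero_mul, sub_zero, one_mul,
    PowerSeries.coeff_rescale, PowerSeries.coeff_exp]
  simp [div_eq_mul_inv]

lemma norm_exp_two_pi_I (k : ℤ) (r : ℝ) : ‖Complex.exp (2 * Real.pi * Complex.I * k * r)‖ = 1 := by
  rw [show (2 * Real.pi * Complex.I * k * r : ℂ) = ((2 * Real.pi * k * r : ℝ) : ℂ) * Complex.I by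
    push_cast; ring, Complex.norm_exp_ofReal_mul_I]

lemma summable_norm_poissonSeries {t : ℝ} (ht : 0 < t) (r : ℝ) :
    Summable fun p : ℤ × ℕ => ‖PowerSeries.coeff p.2 (poissonSeries t r p.1)‖ := by
  have key := summable_norm_coeff (E := fun k : ℤ => -(Real.pi * Complex.I * Real.sqrt Real.pi / (2 * t ^ 2)) *
    (k * Complex.exp (2 * Real.pi * Complex.I * k * r) * Complex.exp (-(Real.pi ^ 2 * k ^ 2 / t))))
    (u := fun _ => 1) (v := fun _ => 0) (z := fun k : ℤ => (Real.pi * k / (2 * t) : ℂ))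
  unfold poissonSeries
  refine key ?_
  have h0 := (summable_abs_mul_exp (t := Real.pi ^ 2 / t) (by positivity) (Real.pi / (2 * t)) 0).mul_left
    ‖-(Real.pi * Complex.I * Real.sqrt Real.pi / (2 * t ^ 2) : ℂ)‖
  refine Summable.of_nonneg_of_le (fun m => by positivity) (fun k => ?_) h0
  have h1 : ‖Complex.exp (-(Real.pi ^ 2 * k ^ 2 / t))‖ = Real.exp (-(Real.pi ^ 2 / t) * (k : ℝ) ^ 2) := by
    rw [show (-(Real.pi ^ 2 * k ^ 2 / t) : ℂ) = ((-(Real.pi ^ 2 / t) * (k : ℝ) ^ 2 : ℝ) : ℂ) by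
      push_cast; ring, Complex.norm_exp, Complex.ofReal_re]
  have h2 : ‖(Real.pi * k / (2 * t) : ℂ)‖ = |Real.pi / (2 * t)| * |(k : ℝ)| := by
    rw [show (Real.pi * k / (2 * t) : ℂ) = ((Real.pi / (2 * t) * k : ℝ) : ℂ) by push_cast; ring,
      Complex.norm_real, norm_mul, Real.norm_eq_abs, Real.norm_eq_abs]
  rw [norm_mul, norm_mul, norm_mul, norm_exp_two_pi_I, h1, h2, norm_one, norm_zero, add_zero, add_zero,
    one_mul, mul_one, Real.exp_add, Complex.norm_intCast]
  have h3 : |(k : ℝ)| ≤ 1 + |(k : ℝ)| := by linarith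
  refine le_trans (le_of_eq ?_) (mul_le_mul_of_nonneg_left (mul_le_mul_of_nonneg_right h3
    (mul_nonneg (Real.exp_pos _).le (Real.exp_pos _).le)) (norm_nonneg _))
  ring

/-- The trace of the heat operator as a sum over the dual lattice. -/
lemma modeSeriesSum_mul_gaussSeries {t : ℝ} (ht : 0 < t) (r : ℝ) :
    modeSeriesSum t r * gaussSeries (1 / (16 * t)) =
      PowerSeries.mk fun j => ∑' k : ℤ, PowerSeries.coeff j (poissonSeries t r k) := by
  have hs : 0 < Real.sqrt t := Real.sqrt_pos.2 ht
  have hsc : (Real.sqrt t : ℂ) ≠ 0 := by exact_mod_cast hs.ne'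
  have htc : (t : ℂ) ≠ 0 := by exact_mod_cast ht.ne'
  have hss : (Real.sqrt t : ℂ) ^ 2 = t := by rw [← Complex.ofReal_pow, Real.sq_sqrt ht.le]
  have hsπ : (Real.sqrt (Real.pi / t) : ℂ) = Real.sqrt Real.pi / Real.sqrt t := by
    rw [Real.sqrt_div Real.pi_pos.le]
    push_cast
    rfl
  -- Both sides are compared as functions of a number `x` that replaces `T`.
  refine powerSeries_eq_of_hasSum (G := fun x => (∑' m : ℤ, Complex.exp (-(t * ((m : ℝ) + r) ^ 2 : ℝ)) *
    (((((m : ℝ) + r : ℝ) : ℂ) / (2 * Real.sqrt t) - Complex.I / (8 * t * Real.sqrt t) * x) *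
      Complex.exp (Complex.I * ((m : ℝ) + r : ℝ) / 2 * x))) * Complex.exp (1 / (16 * t) * x ^ 2))
    (fun x hx => ?_) (fun x hx => ?_)
  · refine hasSum_coeff_mul ?_ (hasSum_gaussSeries _ x)
    simp only [modeSeriesSum, PowerSeries.coeff_mk]
    exact hasSum_tsum_mul_pow (a := fun (m : ℤ) j => PowerSeries.coeff j (modeSeries t (m + r)))
      (summable_norm_modeSeries ht r) hx fun m => hasSum_modeSeries t (m + r) x
  · simp only [PowerSeries.coeff_mk]
    have h1 := hasSum_tsum_mul_pow (a := fun (k : ℤ) j => PowerSeries.coeff j (poissonSeries t r k))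
      (summable_norm_poissonSeries ht r) hx fun k => hasSum_poissonSeries t r k x
    refine (congrArg (fun y => HasSum _ y) ?_).mp h1
    rw [← tsum_mul_right]
    -- Poisson summation at the complex point `z = r - ix/(4t)`: the factor of `d𝔸_t/dt`, the
    -- exponential linear in `x` and the Gaussian in `x²/(16t)` combine to `(m + z) e^{-t(m+z)²}`.
    have h2 := (hasSum_mul_exp_neg_sq ht (r - Complex.I * x / (4 * t))).mul_left (1 / (2 * Real.sqrt t) : ℂ)
    rw [← tsum_mul_left] at h2
    have h3 : ∀ k : ℤ, (1 / (2 * Real.sqrt t) : ℂ) *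
        (-(Real.pi * Complex.I / t * Real.sqrt (Real.pi / t)) *
        (k * Complex.exp (2 * Real.pi * Complex.I * k * (r - Complex.I * x / (4 * t))) *
          Complex.exp (-(Real.pi ^ 2 * k ^ 2 / t)))) =
        -(Real.pi * Complex.I * Real.sqrt Real.pi / (2 * t ^ 2)) *
          (k * Complex.exp (2 * Real.pi * Complex.I * k * r) *
            Complex.exp (-(Real.pi ^ 2 * k ^ 2 / t))) *
          ((1 - 0 * x) * Complex.exp (Real.pi * k / (2 * t) * x)) := fun k => by
      have e1 : Complex.exp (2 * Real.pi * Complex.I * k * (r - Complex.I * x / (4 * t))) =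
          Complex.exp (2 * Real.pi * Complex.I * k * r) *
            Complex.exp (Real.pi * k / (2 * t) * x) := by
        rw [← Complex.exp_add]
        congr 1
        linear_combination (-(2 * Real.pi * k * x / (4 * t) : ℂ)) * Complex.I_sq
      rw [e1, hsπ, zero_mul, sub_zero, one_mul]
      have e2 : (1 / (2 * Real.sqrt t) : ℂ) * (Real.pi * Complex.I / t * (Real.sqrt Real.pi / Real.sqrt t)) =
          Real.pi * Complex.I * Real.sqrt Real.pi / (2 * t ^ 2) := by
        field_simp
        rw [hss]
      linear_combination (-(k * Complex.exp (2 * Real.pi * Complex.I * k * r) *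
        Complex.exp (Real.pi * k / (2 * t) * x) * Complex.exp (-(Real.pi ^ 2 * k ^ 2 / t)))) * e2
    rw [tsum_congr h3] at h2
    rw [← h2.tsum_eq]
    refine tsum_congr fun m => ?_
    have e1 : Complex.exp (-t * (m + (r - Complex.I * x / (4 * t))) ^ 2) =
        Complex.exp (-(t * ((m : ℝ) + r) ^ 2 : ℝ)) *
          Complex.exp (Complex.I * ((m : ℝ) + r : ℝ) / 2 * x) *
          Complex.exp (1 / (16 * t) * x ^ 2) := by
      rw [← Complex.exp_add, ← Complex.exp_add]
      congr 1
      push_cast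
      field_simp
      linear_combination (-32 * x ^ 2) * Complex.I_sq
    rw [e1]
    have e2 : (1 / (2 * Real.sqrt t) : ℂ) * (m + (r - Complex.I * x / (4 * t))) =
        (((m : ℝ) + r : ℝ) : ℂ) / (2 * Real.sqrt t) - Complex.I / (8 * t * Real.sqrt t) * x := by
      push_cast
      field_simp
      ring
    rw [← e2]
    ring

end CircleEta
end

noncomputable section

namespace CircleEta

/-! ### The integrals over the time parameter -/

/-- The function `e^{-y} ∑_{i ≤ j} y^i/i!`. -/
def gammaTail (j : ℕ) (y : ℝ) : ℝ :=
  Real.exp (-y) * ∑ i ∈ Finset.range (j + 1), y ^ i / (i.factorial : ℝ)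

/-- The derivative of the sum is the sum without its top term, so everything else cancels. -/
lemma hasDerivAt_gammaTail (j : ℕ) (y : ℝ) :
    HasDerivAt (gammaTail j) (-(Real.exp (-y) * (y ^ j / (j.factorial : ℝ)))) y := by
  have h1 : HasDerivAt (fun y : ℝ => Real.exp (-y)) (-Real.exp (-y)) y := by
    simpa using (hasDerivAt_neg y).exp
  have h2 : HasDerivAt (fun y : ℝ => ∑ i ∈ Finset.range (j + 1), y ^ i / (i.factorial : ℝ))
      (∑ i ∈ Finset.range j, y ^ i / (i.factorial : ℝ)) y := by
    have h3 : HasDerivAt (fun y : ℝ => ∑ i ∈ Finset.range (j + 1), y ^ i / (i.factorial : ℝ))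
        (∑ i ∈ Finset.range (j + 1), ((i : ℝ) * y ^ (i - 1)) / (i.factorial : ℝ)) y :=
      HasDerivAt.fun_sum fun i _ => (hasDerivAt_pow i y).div_const _
    rw [Finset.sum_range_succ', Nat.cast_zero, zero_mul, zero_div, add_zero] at h3
    refine h3.congr_deriv (Finset.sum_congr rfl fun i _ => ?_)
    rw [Nat.factorial_succ, Nat.add_sub_cancel]
    push_cast
    have : (i : ℝ) + 1 ≠ 0 := by positivity
    field_simp
  refine (h1.mul h2).congr_deriv ?_
  rw [Finset.sum_range_succ]
  ring

lemma gammaTail_nonneg (j : ℕ) {y : ℝ} (hy : 0 ≤ y) : 0 ≤ gammaTail j y :=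
  mul_nonneg (Real.exp_pos _).le (Finset.sum_nonneg fun i _ => by positivity)

lemma gammaTail_le_one (j : ℕ) {y : ℝ} (hy : 0 ≤ y) : gammaTail j y ≤ 1 := by
  rw [gammaTail, Real.exp_neg, inv_mul_le_iff₀ (Real.exp_pos _), mul_one]
  exact Real.sum_le_exp_of_nonneg hy _

lemma tendsto_gammaTail_zero (j : ℕ) : Tendsto (gammaTail j) (𝓝 0) (𝓝 1) := by
  have h := (hasDerivAt_gammaTail j 0).continuousAt.tendsto
  have h1 : gammaTail j 0 = 1 := by
    rw [gammaTail, Finset.sum_range_succ', Finset.sum_eq_zero fun i _ => by simp]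
    simp
  rwa [h1] at h

lemma tendsto_gammaTail_atTop (j : ℕ) : Tendsto (gammaTail j) atTop (𝓝 0) := by
  have h : Tendsto (fun y : ℝ => ∑ i ∈ Finset.range (j + 1),
      (y ^ i * Real.exp (-y)) / (i.factorial : ℝ)) atTop
      (𝓝 (∑ i ∈ Finset.range (j + 1), 0 / (i.factorial : ℝ))) :=
    tendsto_finsetSum _ fun i _ => (Real.tendsto_pow_mul_exp_neg_atTop_nhds_zero i).div_const _
  simp only [zero_div, Finset.sum_const_zero] at h
  refine h.congr fun y => ?_
  rw [gammaTail, Finset.mul_sum]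
  exact Finset.sum_congr rfl fun i _ => by ring

/-- One term of the exponential series at `A / t`; the bound does not depend on `t`. -/
lemma inv_pow_mul_exp_le (m : ℕ) {A t : ℝ} (hA : 0 < A) (ht : 0 < t) :
    (t ^ m)⁻¹ * Real.exp (-(A / t)) ≤ m.factorial / A ^ m := by
  have h1 := Real.pow_div_factorial_le_exp (A / t) (by positivity) m
  rw [Real.exp_neg, div_pow, div_le_iff₀ (by positivity)] at *
  rw [le_div_iff₀ (by positivity), ← mul_inv]
  rw [div_le_iff₀ (by positivity)] at h1
  rw [inv_mul_le_iff₀ (by positivity)]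
  linarith

lemma intervalIntegrable_inv_pow_mul_exp (m : ℕ) {A s : ℝ} (hA : 0 < A) (hs : 0 ≤ s) :
    IntervalIntegrable (fun t => (t ^ m)⁻¹ * Real.exp (-(A / t))) MeasureTheory.volume 0 s := by
  rw [intervalIntegrable_iff_integrableOn_Ioc_of_le hs]
  refine MeasureTheory.Measure.integrableOn_of_bounded (M := m.factorial / A ^ m) (by simp) ?_ ?_
  · refine Measurable.aestronglyMeasurable ?_
    fun_prop
  · refine MeasureTheory.ae_restrict_of_forall_mem measurableSet_Ioc fun t ht => ?_
    rw [Real.norm_of_nonneg (mul_nonneg (inv_nonneg.2 (pow_nonneg ht.1.le _)) (Real.exp_pos _).le)]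
    exact inv_pow_mul_exp_le m hA ht.1

/-- With `y = A / t` this is an incomplete gamma integral; `gammaTail` is its antiderivative and
tends to zero at infinity, that is as `t → 0`. -/
lemma integral_inv_pow_mul_exp (j : ℕ) {A s : ℝ} (hA : 0 < A) (hs : 0 < s) :
    ∫ t in (0 : ℝ)..s, (t ^ (j + 2))⁻¹ * Real.exp (-(A / t)) =
      j.factorial / A ^ (j + 1) * gammaTail j (A / s) := by
  have hd : ∀ x : ℝ, 0 < x → HasDerivAt (fun x => j.factorial / A ^ (j + 1) * gammaTail j (A / x))
      ((x ^ (j + 2))⁻¹ * Real.exp (-(A / x))) x := fun x hx => by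
    have h1 : HasDerivAt (fun x : ℝ => A / x) (A * -(x ^ 2)⁻¹) x := by
      simpa [div_eq_mul_inv] using (hasDerivAt_inv hx.ne').const_mul A
    refine (((hasDerivAt_gammaTail j (A / x)).comp x h1).const_mul _).congr_deriv ?_
    have : (j.factorial : ℝ) ≠ 0 := by positivity
    rw [div_pow]
    field_simp
    ring
  have h := intervalIntegral.integral_eq_sub_of_hasDerivAt_of_tendsto hs
    (f := fun x => j.factorial / A ^ (j + 1) * gammaTail j (A / x)) (fa := 0)
    (fb := j.factorial / A ^ (j + 1) * gammaTail j (A / s)) (fun x hx => hd x hx.1)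
    (intervalIntegrable_inv_pow_mul_exp (j + 2) hA hs.le) ?_ ?_
  · rw [h, sub_zero]
  · have h1 : Tendsto (fun x : ℝ => A / x) (𝓝[>] 0) atTop := by
      simpa [div_eq_mul_inv] using tendsto_inv_nhdsGT_zero.const_mul_atTop hA
    simpa using ((tendsto_gammaTail_atTop j).comp h1).const_mul (j.factorial / A ^ (j + 1) : ℝ)
  · exact ((hd s hs).continuousAt.tendsto).mono_left nhdsWithin_le_nhds

/-- The coefficient of a term of the dual series, without its dependence on time. -/
def poissonWeight (r : ℝ) (j : ℕ) (k : ℤ) : ℂ :=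
  -(Real.pi * Complex.I * Real.sqrt Real.pi / 2) * ((Real.pi / 2) ^ j / j.factorial) *
    ((k : ℂ) ^ (j + 1) * Complex.exp (2 * Real.pi * Complex.I * k * r))

lemma coeff_poissonSeries_eq {t : ℝ} (ht : t ≠ 0) (r : ℝ) (j : ℕ) (k : ℤ) :
    PowerSeries.coeff j (poissonSeries t r k) = poissonWeight r j k *
      (((t ^ (j + 2))⁻¹ * Real.exp (-(Real.pi ^ 2 * (k : ℝ) ^ 2 / t)) : ℝ) : ℂ) := by
  have htc : (t : ℂ) ≠ 0 := by exact_mod_cast ht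
  rw [coeff_poissonSeries, poissonWeight]
  push_cast
  have : (j.factorial : ℂ) ≠ 0 := by exact_mod_cast j.factorial_ne_zero
  simp only [div_pow, mul_pow]
  field_simp
  ring

lemma poissonWeight_zero (r : ℝ) (j : ℕ) : poissonWeight r j 0 = 0 := by
  simp [poissonWeight]

lemma norm_poissonWeight (r : ℝ) (j : ℕ) (k : ℤ) : ‖poissonWeight r j k‖ =
    Real.pi * Real.sqrt Real.pi / 2 * ((Real.pi / 2) ^ j / j.factorial) * |(k : ℝ)| ^ (j + 1) := by
  rw [poissonWeight, norm_mul, norm_mul, norm_mul, norm_exp_two_pi_I, norm_neg, norm_div, norm_mul,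
    norm_mul, Complex.norm_I, norm_div, norm_pow, norm_div, norm_pow, Complex.norm_real,
    Complex.norm_real, Complex.norm_natCast, Complex.norm_ofNat, Complex.norm_intCast,
    Real.norm_of_nonneg Real.pi_pos.le, Real.norm_of_nonneg (Real.sqrt_nonneg _), mul_one, mul_one]

/-- A bound for the terms of the dual series that is uniform in time. -/
def poissonBound (j : ℕ) (k : ℤ) : ℝ :=
  Real.pi * Real.sqrt Real.pi / 2 * ((Real.pi / 2) ^ j / j.factorial) *
    ((j + 2).factorial / (Real.pi ^ 2) ^ (j + 2)) * (1 / |(k : ℝ)| ^ (j + 3))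

lemma summable_poissonBound (j : ℕ) : Summable (poissonBound j) := by
  refine Summable.mul_left _ ?_
  have h := Real.summable_one_div_int_pow (p := j + 3)
  have h1 := (h.2 (by omega)).abs
  refine h1.congr fun k => ?_
  rw [abs_div, abs_one, abs_pow]

/-- The Gaussian pays for `t^{-j-2}` with `(k²)^{-j-2}`; against the factor `|k|^{j+1}` of the
weight this leaves `|k|^{-j-3}`, uniformly in time. -/
lemma norm_coeff_poissonSeries_le {t : ℝ} (ht : 0 < t) (r : ℝ) (j : ℕ) (k : ℤ) :
    ‖PowerSeries.coeff j (poissonSeries t r k)‖ ≤ poissonBound j k := by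
  rw [coeff_poissonSeries_eq ht.ne', norm_mul, Complex.norm_real, norm_poissonWeight, poissonBound]
  by_cases hk : k = 0
  · simp [hk]
  have hk' : 0 < |(k : ℝ)| := abs_pos.2 (by exact_mod_cast hk)
  rw [Real.norm_of_nonneg (by positivity), mul_assoc, mul_assoc (Real.pi * Real.sqrt Real.pi / 2 *
    ((Real.pi / 2) ^ j / j.factorial))]
  refine mul_le_mul_of_nonneg_left ?_ (by positivity)
  have h1 := inv_pow_mul_exp_le (j + 2) (A := Real.pi ^ 2 * (k : ℝ) ^ 2)
    (by rw [← sq_abs (k : ℝ)]; positivity) ht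
  refine (mul_le_mul_of_nonneg_left h1 (by positivity)).trans_eq ?_
  rw [← sq_abs (k : ℝ), mul_pow]
  field_simp
  ring

/-- The coefficients of the trace. -/
def traceCoeff (r : ℝ) (j : ℕ) (t : ℝ) : ℂ := ∑' k : ℤ, PowerSeries.coeff j (poissonSeries t r k)

lemma summable_coeff_poissonSeries {t : ℝ} (ht : 0 < t) (r : ℝ) (j : ℕ) :
    Summable fun k : ℤ => PowerSeries.coeff j (poissonSeries t r k) :=
  Summable.of_norm_bounded (summable_poissonBound j) fun k => norm_coeff_poissonSeries_le ht r j k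

lemma continuousOn_coeff_poissonSeries (r : ℝ) (j : ℕ) (k : ℤ) :
    ContinuousOn (fun t => PowerSeries.coeff j (poissonSeries t r k)) (Set.Ioi 0) := by
  refine ContinuousOn.congr (f := fun t : ℝ => poissonWeight r j k *
    (((t ^ (j + 2))⁻¹ * Real.exp (-(Real.pi ^ 2 * (k : ℝ) ^ 2 / t)) : ℝ) : ℂ)) ?_
    fun t ht => coeff_poissonSeries_eq (ne_of_gt ht) r j k
  refine ContinuousOn.mul continuousOn_const (Complex.continuous_ofReal.comp_continuousOn ?_)
  refine ContinuousOn.mul (ContinuousOn.inv₀ (by fun_prop) fun t ht => ?_) ?_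
  · exact pow_ne_zero _ (ne_of_gt ht)
  · refine Real.continuous_exp.comp_continuousOn (ContinuousOn.neg ?_)
    exact ContinuousOn.div continuousOn_const continuousOn_id fun t ht => ne_of_gt ht

/-- The summable bound that is uniform in time gives continuity on `(0, s]` and boundedness up to
time zero. -/
lemma intervalIntegrable_traceCoeff (r : ℝ) (j : ℕ) {s : ℝ} (hs : 0 ≤ s) :
    IntervalIntegrable (traceCoeff r j) MeasureTheory.volume 0 s := by
  have hc : ContinuousOn (traceCoeff r j) (Set.Ioi 0) :=
    continuousOn_tsum (continuousOn_coeff_poissonSeries r j) (summable_poissonBound j)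
      fun k t ht => norm_coeff_poissonSeries_le ht r j k
  rw [intervalIntegrable_iff_integrableOn_Ioc_of_le hs]
  refine MeasureTheory.Integrable.of_bound
    ((hc.mono Set.Ioc_subset_Ioi_self).aestronglyMeasurable measurableSet_Ioc)
    (∑' k, poissonBound j k) ?_
  refine MeasureTheory.ae_restrict_of_forall_mem measurableSet_Ioc fun t ht => ?_
  exact tsum_of_norm_bounded (summable_poissonBound j).hasSum
    fun k => norm_coeff_poissonSeries_le ht.1 r j k

/-- Integration term by term. The factor `1/(π²k²)^{j+1}` from the time integral leaves `1/k^{j+1}`,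
the coefficient in the Fourier series of a Bernoulli polynomial. -/
lemma hasSum_integral_traceCoeff (r : ℝ) (j : ℕ) {s : ℝ} (hs : 0 < s) :
    HasSum (fun k : ℤ => -Complex.I / (2 * Real.pi) ^ (j + 1) * (1 / (k : ℂ) ^ (j + 1) *
      Complex.exp (2 * Real.pi * Complex.I * k * r)) *
        (gammaTail j (Real.pi ^ 2 * (k : ℝ) ^ 2 / s) : ℂ))
      ((1 / Real.sqrt Real.pi : ℂ) * ∫ t in (0 : ℝ)..s, traceCoeff r j t) := by
  have hmem : ∀ t ∈ Set.uIoc 0 s, 0 < t := fun t ht => by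
    rw [Set.uIoc_of_le hs.le] at ht
    exact ht.1
  have h1 : HasSum (fun k : ℤ => ∫ t in (0 : ℝ)..s, PowerSeries.coeff j (poissonSeries t r k))
      (∫ t in (0 : ℝ)..s, traceCoeff r j t) := by
    refine intervalIntegral.hasSum_integral_of_dominated_convergence (fun k _ => poissonBound j k)
      (fun k => ?_) (fun k => Eventually.of_forall fun t ht =>
        norm_coeff_poissonSeries_le (hmem t ht) r j k)
      (Eventually.of_forall fun _ _ => summable_poissonBound j) intervalIntegrable_const
      (Eventually.of_forall fun t ht => (summable_coeff_poissonSeries (hmem t ht) r j).hasSum)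
    exact ((continuousOn_coeff_poissonSeries r j k).mono hmem).aestronglyMeasurable
      measurableSet_uIoc
  refine (h1.mul_left (1 / Real.sqrt Real.pi : ℂ)).congr_fun fun k => ?_
  have h2 : ∫ t in (0 : ℝ)..s, PowerSeries.coeff j (poissonSeries t r k) =
      poissonWeight r j k * ((∫ t in (0 : ℝ)..s, (t ^ (j + 2))⁻¹ *
        Real.exp (-(Real.pi ^ 2 * (k : ℝ) ^ 2 / t)) : ℝ) : ℂ) := by
    rw [← intervalIntegral.integral_ofReal, ← intervalIntegral.integral_const_mul]
    refine intervalIntegral.integral_congr_ae (Eventually.of_forall fun t ht => ?_)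
    exact coeff_poissonSeries_eq (hmem t ht).ne' r j k
  rw [h2]
  -- For `k = 0` both sides vanish: the weight has a factor `k`, and `1 / 0 = 0`.
  by_cases hk : k = 0
  · rw [hk, poissonWeight_zero]
    simp
  have hk' : (k : ℂ) ≠ 0 := by exact_mod_cast hk
  have hA : 0 < Real.pi ^ 2 * (k : ℝ) ^ 2 := by
    have : (k : ℝ) ≠ 0 := by exact_mod_cast hk
    positivity
  have hπ : (Real.pi : ℂ) ≠ 0 := by exact_mod_cast Real.pi_ne_zero
  have hsπ : (Real.sqrt Real.pi : ℂ) ≠ 0 := by exact_mod_cast (Real.sqrt_pos.2 Real.pi_pos).ne'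
  have hf : (j.factorial : ℂ) ≠ 0 := by exact_mod_cast j.factorial_ne_zero
  rw [integral_inv_pow_mul_exp j hA hs, poissonWeight]
  push_cast
  simp only [div_pow, mul_pow]
  field_simp
  ring

end CircleEta
end

noncomputable section

namespace CircleEta

/-! ### The limit for large times -/

lemma tendsto_gammaTail_div (j : ℕ) (A : ℝ) :
    Tendsto (fun s : ℝ => gammaTail j (A / s)) atTop (𝓝 1) :=
  (tendsto_gammaTail_zero j).comp (tendsto_const_nhds.div_atTop tendsto_id)

/-- As `gammaTail` lies between zero and one, the series `∑ 1/|k|^{j+1}` dominates; it converges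
because `j ≥ 1`. -/
lemma tendsto_integral_traceCoeff_tsum (r : ℝ) {j : ℕ} (hj : j ≠ 0) :
    Tendsto (fun s : ℝ => (1 / Real.sqrt Real.pi : ℂ) * ∫ t in (0 : ℝ)..s, traceCoeff r j t) atTop
      (𝓝 (∑' k : ℤ, -Complex.I / (2 * Real.pi) ^ (j + 1) * (1 / (k : ℂ) ^ (j + 1) *
        Complex.exp (2 * Real.pi * Complex.I * k * r)))) := by
  have h1 : Tendsto (fun s : ℝ => ∑' k : ℤ, -Complex.I / (2 * Real.pi) ^ (j + 1) *
      (1 / (k : ℂ) ^ (j + 1) * Complex.exp (2 * Real.pi * Complex.I * k * r)) *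
        (gammaTail j (Real.pi ^ 2 * (k : ℝ) ^ 2 / s) : ℂ)) atTop
      (𝓝 (∑' k : ℤ, -Complex.I / (2 * Real.pi) ^ (j + 1) * (1 / (k : ℂ) ^ (j + 1) *
        Complex.exp (2 * Real.pi * Complex.I * k * r)))) := by
    refine tendsto_tsum_of_dominated_convergence (bound := fun k : ℤ =>
      ‖(-Complex.I / (2 * Real.pi) ^ (j + 1) : ℂ)‖ * |1 / (k : ℝ) ^ (j + 1)|)
      ((Real.summable_one_div_int_pow.2 (by omega)).abs.mul_left _) (fun k => ?_) ?_
    · have h := (tendsto_gammaTail_div j (Real.pi ^ 2 * (k : ℝ) ^ 2)).ofReal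
      simpa using h.const_mul (-Complex.I / (2 * Real.pi) ^ (j + 1) *
        (1 / (k : ℂ) ^ (j + 1) * Complex.exp (2 * Real.pi * Complex.I * k * r)))
    · filter_upwards [eventually_gt_atTop 0] with s hs k
      have hy : 0 ≤ Real.pi ^ 2 * (k : ℝ) ^ 2 / s := by positivity
      rw [norm_mul, norm_mul, norm_mul, norm_exp_two_pi_I, mul_one, Complex.norm_real,
        Real.norm_of_nonneg (gammaTail_nonneg j hy)]
      have h2 : ‖(1 / (k : ℂ) ^ (j + 1))‖ = |1 / (k : ℝ) ^ (j + 1)| := by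
        rw [norm_div, norm_one, norm_pow, Complex.norm_intCast, abs_div, abs_one, abs_pow]
      rw [h2]
      exact mul_le_of_le_one_right (by positivity) (gammaTail_le_one j hy)
  refine h1.congr' ?_
  filter_upwards [eventually_gt_atTop 0] with s hs
  exact (hasSum_integral_traceCoeff r j hs).tsum_eq

lemma ofReal_bernoulliFun (k : ℕ) (a : ℝ) :
    (bernoulliFun k a : ℂ) = Polynomial.aeval (a : ℂ) (Polynomial.bernoulli k) := by
  rw [bernoulliFun, Polynomial.eval_map_algebraMap]
  exact (Polynomial.aeval_algebraMap_apply ℂ a _).symm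

lemma tendsto_integral_traceCoeff_of_ne_zero {a : ℝ} (ha : a ∈ Set.Icc (0 : ℝ) 1) {j : ℕ}
    (hj : j ≠ 0) : Tendsto (fun s : ℝ => (1 / Real.sqrt Real.pi : ℂ) *
      ∫ t in (0 : ℝ)..s, traceCoeff a j t) atTop
      (𝓝 (Complex.I ^ j * PowerSeries.coeff j (bernoulliSeriesOff a))) := by
  have h1 := (hasSum_one_div_pow_mul_fourier_mul_bernoulliFun (k := j + 1) (by omega) ha).mul_left
    (-Complex.I / (2 * Real.pi) ^ (j + 1) : ℂ)
  have h2 := tendsto_integral_traceCoeff_tsum a hj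
  have h3 : ∀ k : ℤ, (fourier k (a : UnitAddCircle) : ℂ) =
      Complex.exp (2 * Real.pi * Complex.I * k * a) := fun k => by
    rw [fourier_coe_apply, Complex.ofReal_one, div_one]
  simp only [h3] at h1
  rw [h1.tsum_eq] at h2
  have hπ : (Real.pi : ℂ) ≠ 0 := by exact_mod_cast Real.pi_ne_zero
  have hf : ((j + 1).factorial : ℂ) ≠ 0 := by exact_mod_cast (j + 1).factorial_ne_zero
  have h4 : -Complex.I / (2 * Real.pi) ^ (j + 1) * (-(2 * Real.pi * Complex.I) ^ (j + 1) /
      ((j + 1).factorial : ℂ) * (bernoulliFun (j + 1) a : ℂ)) =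
      Complex.I ^ j * PowerSeries.coeff j (bernoulliSeriesOff a) := by
    rw [bernoulliSeriesOff, map_neg, PowerSeries.coeff_mk, ofReal_bernoulliFun, mul_pow _ Complex.I]
    have hI := Complex.I_sq
    field_simp
    linear_combination (Complex.I ^ j * Polynomial.aeval (a : ℂ) (Polynomial.bernoulli (j + 1))) * hI
  rwa [h4] at h2

/-- The Jacobi identity for the theta function, as a Poisson summation formula. -/
lemma hasSum_exp_neg_sq {t : ℝ} (ht : 0 < t) (z : ℂ) :
    HasSum (fun m : ℤ => Complex.exp (-t * (m + z) ^ 2))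
      (∑' k : ℤ, (Real.sqrt (Real.pi / t) : ℂ) * (Complex.exp (2 * Real.pi * Complex.I * k * z) *
        Complex.exp (-(Real.pi ^ 2 * k ^ 2 / t)))) := by
  have hπ : (Real.pi : ℂ) ≠ 0 := by exact_mod_cast Real.pi_ne_zero
  have htc : (t : ℂ) ≠ 0 := by exact_mod_cast ht.ne'
  set τ : ℂ := Complex.I * (Real.pi / t : ℝ) with hτ
  have hτ_im : 0 < τ.im := by
    rw [hτ, Complex.I_mul_im, Complex.ofReal_re]
    positivity
  have hτ_eq : τ = Complex.I * Real.pi / t := by rw [hτ]; push_cast; ring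
  have hτ_inv : -1 / τ = Complex.I * (t / Real.pi : ℝ) := by
    rw [hτ_eq]
    push_cast
    field_simp
    rw [Complex.I_sq]
  have hτ_inv_im : 0 < (-1 / τ).im := by
    rw [hτ_inv, Complex.I_mul_im, Complex.ofReal_re]
    positivity
  have hz : z / τ = -Complex.I * t * z / Real.pi := by
    rw [hτ_eq]
    field_simp
    rw [Complex.I_sq]
    ring
  have hsq : (-Complex.I * τ) ^ (1 / 2 : ℂ) = (Real.sqrt (Real.pi / t) : ℂ) := by
    have : -Complex.I * τ = ((Real.pi / t : ℝ) : ℂ) := by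
      rw [hτ, ← mul_assoc, neg_mul, Complex.I_mul_I, neg_neg, one_mul]
    rw [this, Real.sqrt_eq_rpow, Complex.ofReal_cpow (by positivity)]
    norm_num
  have hs0 : (Real.sqrt (Real.pi / t) : ℂ) ≠ 0 := by
    exact_mod_cast (Real.sqrt_pos.2 (by positivity)).ne'
  have h2 := (Equiv.hasSum_iff (Equiv.neg ℤ)).2 ((hasSum_jacobiTheta₂_term (z / τ) hτ_inv_im).mul_left
    (Complex.exp (-Real.pi * Complex.I * z ^ 2 / τ)))
  have h3 : Complex.exp (-Real.pi * Complex.I * z ^ 2 / τ) * jacobiTheta₂ (z / τ) (-1 / τ) =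
      Real.sqrt (Real.pi / t) * jacobiTheta₂ z τ := by
    rw [jacobiTheta₂_functional_equation z τ, hsq]
    field_simp
  rw [h3, ← (hasSum_jacobiTheta₂_term z hτ_im).tsum_eq, ← tsum_mul_left] at h2
  have h4 : ∀ k : ℤ, (Real.sqrt (Real.pi / t) : ℂ) * jacobiTheta₂_term k z τ =
      Real.sqrt (Real.pi / t) * (Complex.exp (2 * Real.pi * Complex.I * k * z) *
        Complex.exp (-(Real.pi ^ 2 * k ^ 2 / t))) := fun k => by
    rw [jacobiTheta₂_term, ← Complex.exp_add]
    have e1 : 2 * Real.pi * Complex.I * k * z + -(Real.pi ^ 2 * k ^ 2 / t) =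
        2 * Real.pi * Complex.I * k * z + Real.pi * Complex.I * (k : ℂ) ^ 2 * τ := by
      rw [hτ_eq]
      linear_combination (-(Real.pi : ℂ) ^ 2 * k ^ 2 / t) * Complex.I_sq
    rw [e1]
  rw [tsum_congr h4] at h2
  refine h2.congr_fun fun m => ?_
  rw [Function.comp_apply, Equiv.neg_apply, jacobiTheta₂_term, hz, hτ_inv, ← Complex.exp_add, hτ_eq]
  congr 1
  push_cast
  field_simp
  ring_nf
  rw [Complex.I_sq]
  ring

lemma summable_exp_neg_div {s : ℝ} (hs : 0 < s) :
    Summable fun k : ℤ => Real.exp (-(Real.pi ^ 2 * (k : ℝ) ^ 2 / s)) := by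
  refine (summable_exp_neg_sq_add (t := Real.pi ^ 2 / s) (by positivity) 0 0).congr fun k => ?_
  rw [abs_zero, zero_mul, add_zero, add_zero]
  congr 1
  ring

lemma norm_exp_neg_div (k : ℤ) (s : ℝ) : ‖Complex.exp (-(Real.pi ^ 2 * k ^ 2 / s))‖ =
    Real.exp (-(Real.pi ^ 2 * (k : ℝ) ^ 2 / s)) := by
  rw [show (-(Real.pi ^ 2 * k ^ 2 / s) : ℂ) = ((-(Real.pi ^ 2 * (k : ℝ) ^ 2 / s) : ℝ) : ℂ) by
    push_cast; ring, Complex.norm_exp, Complex.ofReal_re]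

/-- Poisson summation gives a sum of `e^{-s(m+ρ)²}`, and `|m + ρ| ≥ δ` for all integers `m`, so it
decays exponentially in `s`. One unit of `s` is set aside for the summability over `m`. -/
lemma norm_theta_le {s ρ δ : ℝ} (hs : 1 ≤ s) (hδ : 0 < δ) (hρ : ρ ∈ Set.Icc δ (1 - δ)) :
    ‖∑' k : ℤ, Complex.exp (2 * Real.pi * Complex.I * k * ρ) *
      Complex.exp (-(Real.pi ^ 2 * k ^ 2 / s))‖ ≤
    Real.sqrt s * Real.exp (-(s - 1) * δ ^ 2) * ∑' m : ℤ, Real.exp (1 - (m : ℝ) ^ 2 / 2) := by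
  have hs0 : 0 < s := by linarith
  have hsum : Summable fun m : ℤ => Real.exp (1 - (m : ℝ) ^ 2 / 2) := by
    refine ((summable_exp_neg_sq_add (t := 1 / 2) (by norm_num) 0 0).mul_left (Real.exp 1)).congr
      fun k => ?_
    rw [abs_zero, zero_mul, add_zero, add_zero, ← Real.exp_add]
    congr 1
    ring
  have h1 := (hasSum_exp_neg_sq hs0 ρ).tsum_eq
  rw [tsum_mul_left] at h1
  have hle : ∀ m : ℤ, ‖Complex.exp (-s * (m + ρ) ^ 2)‖ ≤
      Real.exp (-(s - 1) * δ ^ 2) * Real.exp (1 - (m : ℝ) ^ 2 / 2) := fun m => by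
    rw [show (-s * (m + ρ) ^ 2 : ℂ) = ((-s * ((m : ℝ) + ρ) ^ 2 : ℝ) : ℂ) by push_cast; ring,
      Complex.norm_exp, Complex.ofReal_re, ← Real.exp_add, Real.exp_le_exp]
    have h2 : δ ^ 2 ≤ ((m : ℝ) + ρ) ^ 2 := by
      rcases le_or_gt 0 m with hm | hm
      · have : (0 : ℝ) ≤ m := by exact_mod_cast hm
        exact pow_le_pow_left₀ hδ.le (by linarith [hρ.1]) 2
      · have : (m : ℝ) ≤ -1 := by exact_mod_cast (by omega : m ≤ -1)
        rw [← neg_sq ((m : ℝ) + ρ)]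
        exact pow_le_pow_left₀ hδ.le (by linarith [hρ.2]) 2
    have h3 : (m : ℝ) ^ 2 / 2 - 1 ≤ ((m : ℝ) + ρ) ^ 2 := by
      have h4 : ρ ^ 2 ≤ 1 := pow_le_one₀ (by linarith [hρ.1]) (by linarith [hρ.2])
      nlinarith [sq_nonneg ((m : ℝ) + 2 * ρ)]
    nlinarith [mul_le_mul_of_nonneg_left h2 (by linarith : 0 ≤ s - 1)]
  have h3 := tsum_of_norm_bounded (hsum.mul_left (Real.exp (-(s - 1) * δ ^ 2))).hasSum hle
  rw [tsum_mul_left] at h3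
  have hq : 0 < Real.sqrt (Real.pi / s) := Real.sqrt_pos.2 (by positivity)
  rw [h1, norm_mul, Complex.norm_real, Real.norm_of_nonneg hq.le] at h3
  -- The prefactor of the Poisson formula is divided out at the cost of `√s`.
  have h4 : 1 ≤ Real.sqrt s * Real.sqrt (Real.pi / s) := by
    rw [← Real.sqrt_mul hs0.le, mul_div_cancel₀ _ hs0.ne', Real.one_le_sqrt]
    linarith [Real.pi_gt_three]
  rw [mul_assoc (Real.sqrt s)]
  refine le_trans ?_ (mul_le_mul_of_nonneg_left h3 (Real.sqrt_nonneg s))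
  rw [← mul_assoc]
  exact le_mul_of_one_le_left (norm_nonneg _) h4

/-- The function `∑_{k ≠ 0} e^{2πikr} e^{-π²k²/s}/k`. -/
def sawtooth (s r : ℝ) : ℂ := ∑' k : ℤ, 1 / (k : ℂ) * (Complex.exp (2 * Real.pi * Complex.I * k * r) *
  Complex.exp (-(Real.pi ^ 2 * k ^ 2 / s)))

/-- At integers and half-integers the terms are odd in `k`. -/
lemma sawtooth_eq_zero {s r : ℝ} (n : ℤ) (hr : 2 * r = n) : sawtooth s r = 0 := by
  have h1 : sawtooth s r = -sawtooth s r := by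
    conv_lhs => rw [sawtooth, ← (Equiv.neg ℤ).tsum_eq]
    rw [sawtooth, ← tsum_neg]
    refine tsum_congr fun k => ?_
    have h2 : Complex.exp (2 * Real.pi * Complex.I * ((-k : ℤ) : ℂ) * r) =
        Complex.exp (2 * Real.pi * Complex.I * k * r) := by
      rw [Complex.exp_eq_exp_iff_exists_int]
      refine ⟨-(k * n), ?_⟩
      have h3 : (2 * r : ℂ) = n := by exact_mod_cast congrArg (fun x : ℝ => (x : ℂ)) hr
      push_cast
      linear_combination (-(2 * Real.pi * Complex.I * k)) * h3
    rw [Equiv.neg_apply, h2]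
    push_cast
    rw [neg_sq, one_div, one_div, inv_neg, neg_mul]
  exact self_eq_neg.1 h1

/-- The linear term supplies the term `k = 0` of the theta series, which the division by `k` leaves
out. -/
lemma hasDerivAt_sawtooth {s : ℝ} (hs : 0 < s) (r : ℝ) :
    HasDerivAt (fun r : ℝ => sawtooth s r + 2 * Real.pi * Complex.I * r)
      (2 * Real.pi * Complex.I * ∑' k : ℤ, Complex.exp (2 * Real.pi * Complex.I * k * r) *
        Complex.exp (-(Real.pi ^ 2 * k ^ 2 / s))) r := by
  have hn : ∀ (k : ℤ) (r : ℝ), ‖Complex.exp (2 * Real.pi * Complex.I * k * r) *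
      Complex.exp (-(Real.pi ^ 2 * k ^ 2 / s))‖ = Real.exp (-(Real.pi ^ 2 * (k : ℝ) ^ 2 / s)) :=
    fun k r => by rw [norm_mul, norm_exp_two_pi_I, one_mul, norm_exp_neg_div]
  have h0 : Summable fun k : ℤ => Complex.exp (2 * Real.pi * Complex.I * k * r) *
      Complex.exp (-(Real.pi ^ 2 * k ^ 2 / s)) :=
    Summable.of_norm ((summable_exp_neg_div hs).congr fun k => (hn k r).symm)
  have h1 : HasDerivAt (fun r : ℝ => sawtooth s r) (∑' k : ℤ, if k = 0 then (0 : ℂ) else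
      2 * Real.pi * Complex.I * (Complex.exp (2 * Real.pi * Complex.I * k * r) *
        Complex.exp (-(Real.pi ^ 2 * k ^ 2 / s)))) r := by
    refine hasDerivAt_tsum (𝕜 := ℝ) (F := ℂ) (g := fun (k : ℤ) (r : ℝ) => 1 / (k : ℂ) *
      (Complex.exp (2 * Real.pi * Complex.I * k * r) * Complex.exp (-(Real.pi ^ 2 * k ^ 2 / s))))
      (g' := fun (k : ℤ) (r : ℝ) => if k = 0 then (0 : ℂ) else 2 * Real.pi * Complex.I *
        (Complex.exp (2 * Real.pi * Complex.I * k * r) * Complex.exp (-(Real.pi ^ 2 * k ^ 2 / s))))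
      (y₀ := 0) (u := fun k : ℤ => 2 * Real.pi *
      Real.exp (-(Real.pi ^ 2 * (k : ℝ) ^ 2 / s))) ((summable_exp_neg_div hs).mul_left _)
      (fun k y => ?_) (fun k y => ?_) ?_ r
    · have h2 : HasDerivAt (fun y : ℝ => Complex.exp (2 * Real.pi * Complex.I * k * y))
          (Complex.exp (2 * Real.pi * Complex.I * k * y) * (2 * Real.pi * Complex.I * k * 1)) y :=
        ((Complex.ofRealCLM.hasDerivAt (x := y)).const_mul (2 * Real.pi * Complex.I * k : ℂ)).cexp
      refine ((h2.mul_const _).const_mul _).congr_deriv ?_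
      by_cases hk : k = 0
      · simp [hk]
      · have : (k : ℂ) ≠ 0 := by exact_mod_cast hk
        rw [if_neg hk]
        field_simp
    · by_cases hk : k = 0
      · rw [if_pos hk, norm_zero]
        positivity
      · rw [if_neg hk, norm_mul, hn, norm_mul, norm_mul, Complex.norm_I, Complex.norm_real,
          Real.norm_of_nonneg Real.pi_pos.le, Complex.norm_ofNat, mul_one]
    · refine Summable.of_norm_bounded (summable_exp_neg_div hs) fun k => ?_
      rw [norm_mul, hn]
      refine mul_le_of_le_one_left (Real.exp_pos _).le ?_
      by_cases hk : k = 0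
      · simp [hk]
      · rw [norm_div, norm_one, Complex.norm_intCast]
        refine div_le_one_of_le₀ ?_ (abs_nonneg _)
        exact_mod_cast Int.one_le_abs hk
  have h2 : HasDerivAt (fun r : ℝ => 2 * Real.pi * Complex.I * (r : ℂ))
      (2 * Real.pi * Complex.I * 1) r :=
    (Complex.ofRealCLM.hasDerivAt (x := r)).const_mul (2 * Real.pi * Complex.I : ℂ)
  refine (h1.add h2).congr_deriv ?_
  rw [← tsum_mul_left, (h0.mul_left (2 * Real.pi * Complex.I)).tsum_eq_add_tsum_ite 0, add_comm]
  simp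

/-- On `[δ, 1 - δ]` the derivative of `sawtooth + 2πi r` tends to zero uniformly, so this function
becomes constant there. At `r = 1/2` the series vanishes by symmetry, which determines the constant.
-/
lemma tendsto_sawtooth {r : ℝ} (hr : r ∈ Set.Ioo (0 : ℝ) 1) :
    Tendsto (fun s : ℝ => sawtooth s r) atTop (𝓝 (2 * Real.pi * Complex.I * (1 / 2 - r))) := by
  set δ := min r (1 - r) with hδ
  have hδ0 : 0 < δ := lt_min hr.1 (by linarith [hr.2])
  have hδr : r ∈ Set.Icc δ (1 - δ) := ⟨min_le_left _ _, by linarith [min_le_right r (1 - r)]⟩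
  have hδh : (1 / 2 : ℝ) ∈ Set.Icc δ (1 - δ) := by
    have h1 := min_le_left r (1 - r)
    have h2 := min_le_right r (1 - r)
    constructor <;> linarith
  set C : ℝ := ∑' m : ℤ, Real.exp (1 - (m : ℝ) ^ 2 / 2)
  have h1 : ∀ s : ℝ, 1 ≤ s → ‖sawtooth s r - 2 * Real.pi * Complex.I * (1 / 2 - r)‖ ≤
      2 * Real.pi * (Real.sqrt s * Real.exp (-(s - 1) * δ ^ 2) * C) * ‖r - 1 / 2‖ := fun s hs => by
    have h2 := (convex_Icc δ (1 - δ)).norm_image_sub_le_of_norm_hasDerivWithin_le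
      (f := fun r : ℝ => sawtooth s r + 2 * Real.pi * Complex.I * r)
      (C := 2 * Real.pi * (Real.sqrt s * Real.exp (-(s - 1) * δ ^ 2) * C))
      (fun x _ => (hasDerivAt_sawtooth (by linarith) x).hasDerivWithinAt) (fun x hx => ?_) hδh hδr
    · rw [sawtooth_eq_zero (r := 1 / 2) 1 (by norm_num)] at h2
      refine le_trans (le_of_eq ?_) h2
      congr 1
      push_cast
      ring
    · rw [norm_mul, norm_mul, norm_mul, Complex.norm_I, Complex.norm_real,
        Real.norm_of_nonneg Real.pi_pos.le, Complex.norm_ofNat, mul_one]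
      exact mul_le_mul_of_nonneg_left (norm_theta_le hs hδ0 hx) (by positivity)
  have h2 : Tendsto (fun s : ℝ => 2 * Real.pi * (Real.sqrt s * Real.exp (-(s - 1) * δ ^ 2) * C) *
      ‖r - 1 / 2‖) atTop (𝓝 0) := by
    have h3 := (tendsto_rpow_mul_exp_neg_mul_atTop_nhds_zero (1 / 2) (δ ^ 2) (by positivity)).mul_const
      (2 * Real.pi * Real.exp (δ ^ 2) * C * ‖r - 1 / 2‖)
    rw [zero_mul] at h3
    refine h3.congr fun s => ?_
    rw [Real.sqrt_eq_rpow, show -(s - 1) * δ ^ 2 = -δ ^ 2 * s + δ ^ 2 by ring, Real.exp_add]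
    ring
  rw [tendsto_iff_norm_sub_tendsto_zero]
  refine squeeze_zero' (Eventually.of_forall fun s => norm_nonneg _) ?_ h2
  filter_upwards [eventually_ge_atTop 1] with s hs using h1 s hs

lemma integral_traceCoeff_zero (r : ℝ) {s : ℝ} (hs : 0 < s) :
    (1 / Real.sqrt Real.pi : ℂ) * ∫ t in (0 : ℝ)..s, traceCoeff r 0 t =
      -Complex.I / (2 * Real.pi) * sawtooth s r := by
  rw [← (hasSum_integral_traceCoeff r 0 hs).tsum_eq, sawtooth, ← tsum_mul_left]
  refine tsum_congr fun k => ?_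
  have h : gammaTail 0 (Real.pi ^ 2 * (k : ℝ) ^ 2 / s) =
      Real.exp (-(Real.pi ^ 2 * (k : ℝ) ^ 2 / s)) := by simp [gammaTail]
  rw [h]
  push_cast
  ring

/-- The integral of the trace for large times. -/
lemma tendsto_integral_traceCoeff {a : ℝ} (ha : a ∈ Set.Ico (0 : ℝ) 1) (j : ℕ) :
    Tendsto (fun s : ℝ => (1 / Real.sqrt Real.pi : ℂ) * ∫ t in (0 : ℝ)..s, traceCoeff a j t) atTop
      (𝓝 (Complex.I ^ j * PowerSeries.coeff j
        (if a = 0 then bernoulliSeriesOn else bernoulliSeriesOff a))) := by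
  have hπ : (Real.pi : ℂ) ≠ 0 := by exact_mod_cast Real.pi_ne_zero
  by_cases hj : j = 0
  · subst hj
    by_cases h0 : a = 0
    -- At `a = 0` the coefficient vanishes for every `s` by symmetry; this is where `B_1` drops out
    -- over `B₀`.
    · rw [if_pos h0]
      have h1 : Complex.I ^ 0 * PowerSeries.coeff 0 bernoulliSeriesOn = 0 := by
        simp [bernoulliSeriesOn]
      rw [h1]
      refine tendsto_const_nhds.congr' ?_
      filter_upwards [eventually_gt_atTop 0] with s hs
      rw [integral_traceCoeff_zero a hs, sawtooth_eq_zero 0 (by simp [h0]), mul_zero]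
    · rw [if_neg h0]
      have h1 := (tendsto_sawtooth ⟨lt_of_le_of_ne ha.1 (Ne.symm h0), ha.2⟩).const_mul
        (-Complex.I / (2 * Real.pi) : ℂ)
      have h2 : -Complex.I / (2 * Real.pi) * (2 * Real.pi * Complex.I * (1 / 2 - a)) =
          Complex.I ^ 0 * PowerSeries.coeff 0 (bernoulliSeriesOff a) := by
        rw [bernoulliSeriesOff, map_neg, PowerSeries.coeff_mk, ← ofReal_bernoulliFun, zero_add,
          bernoulliFun_one]
        push_cast
        field_simp
        linear_combination (2 * (a : ℂ) - 1) * Complex.I_sq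
      rw [h2] at h1
      refine h1.congr' ?_
      filter_upwards [eventually_gt_atTop 0] with s hs using (integral_traceCoeff_zero a hs).symm
  · have h1 := tendsto_integral_traceCoeff_of_ne_zero ⟨ha.1, ha.2.le⟩ hj
    by_cases h0 : a = 0
    · rw [if_pos h0]
      -- For `j ≥ 1` the two series agree at `a = 0`, because the Bernoulli numbers with odd index
      -- above one vanish.
      have h2 : PowerSeries.coeff j (bernoulliSeriesOff a) = PowerSeries.coeff j bernoulliSeriesOn := by
        rw [bernoulliSeriesOff, bernoulliSeriesOn, map_neg, map_neg, PowerSeries.coeff_mk,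
          PowerSeries.coeff_mk, ← ofReal_bernoulliFun, h0, bernoulliFun_eval_zero]
        by_cases ho : Odd j
        · rw [if_pos ho]
          push_cast
          rfl
        · have h3 : bernoulli (j + 1) = 0 := by
            refine bernoulli_eq_zero_of_odd ?_ (by omega)
            exact Even.add_one (Nat.not_odd_iff_even.1 ho)
          rw [if_neg ho, h3]
          simp
      rwa [h2] at h1
    · rwa [if_neg h0]

end CircleEta
end

noncomputable section

namespace CircleEta

/-! ### Bernoulli series -/

lemma X_mul_invTodd : PowerSeries.X * (PowerSeries.mk fun k => (((k + 1).factorial : ℂ))⁻¹) =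
    PowerSeries.exp ℂ - 1 := by
  ext k
  rcases k with _ | k
  · simp
  · rw [PowerSeries.coeff_succ_X_mul, PowerSeries.coeff_mk, map_sub, PowerSeries.coeff_exp,
      PowerSeries.coeff_one, if_neg k.succ_ne_zero, sub_zero]
    simp

/-- The generating function of the Bernoulli polynomials, after one factor `X` is cancelled from
`e^X - 1`. -/
lemma toddSeries_mul_rescale_exp (a : ℂ) :
    toddSeries * PowerSeries.rescale a (PowerSeries.exp ℂ) = PowerSeries.mk fun k =>
      Polynomial.aeval a (Polynomial.bernoulli k) / (k.factorial : ℂ) := by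
  have h1 := Polynomial.bernoulli_generating_function a
  rw [← X_mul_invTodd, mul_left_comm] at h1
  have h2 := mul_left_cancel₀ PowerSeries.X_ne_zero h1
  have h3 : PowerSeries.constantCoeff (PowerSeries.mk fun k => (((k + 1).factorial : ℂ))⁻¹) ≠ 0 := by
    simp
  rw [toddSeries, ← h2, mul_left_comm, PowerSeries.inv_mul_cancel _ h3, mul_one]
  ext k
  rw [PowerSeries.coeff_mk, PowerSeries.coeff_mk, map_smul, ← Rat.cast_smul_eq_qsmul ℂ, smul_eq_mul]
  push_cast
  ring

lemma closedSeriesOff_eq (a : ℝ) : closedSeriesOff a = bernoulliSeriesOff a := by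
  ext k
  rw [closedSeriesOff, bernoulliSeriesOff, toddSeries_mul_rescale_exp, map_neg, map_neg, divX,
    PowerSeries.coeff_mk, PowerSeries.coeff_mk, map_sub, PowerSeries.coeff_mk, PowerSeries.coeff_one,
    if_neg k.succ_ne_zero, sub_zero]

lemma toddSeries_eq :
    toddSeries = PowerSeries.mk fun k => ((bernoulli k : ℚ) : ℂ) / (k.factorial : ℂ) := by
  have h1 := toddSeries_mul_rescale_exp 0
  have h2 : PowerSeries.rescale (0 : ℂ) (PowerSeries.exp ℂ) = 1 := by
    ext k
    rw [PowerSeries.coeff_rescale, PowerSeries.coeff_exp, PowerSeries.coeff_one]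
    by_cases hk : k = 0 <;> simp [hk]
  rw [h2, mul_one] at h1
  rw [h1]
  ext k
  have h3 := ofReal_bernoulliFun k 0
  rw [bernoulliFun_eval_zero, Complex.ofReal_zero] at h3
  rw [PowerSeries.coeff_mk, PowerSeries.coeff_mk, ← h3]
  push_cast
  rfl

/-- The summand `X/2` cancels `B_1 = -1/2`; the other Bernoulli numbers with odd index vanish
anyway. -/
lemma closedSeriesOn_eq : closedSeriesOn = bernoulliSeriesOn := by
  ext k
  rw [closedSeriesOn, bernoulliSeriesOn, toddSeries_eq, map_neg, map_neg, divX,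
    PowerSeries.coeff_mk, PowerSeries.coeff_mk, map_add, map_sub, PowerSeries.coeff_mk,
    PowerSeries.coeff_one, if_neg k.succ_ne_zero, sub_zero, PowerSeries.coeff_C_mul,
    PowerSeries.coeff_X]
  by_cases ho : Odd k
  · have h1 : k + 1 ≠ 1 := by
      intro h
      have : k = 0 := by omega
      exact absurd ho (by simp [this])
    rw [if_pos ho, if_neg h1, mul_zero, add_zero]
  · rw [if_neg ho]
    by_cases h0 : k = 0
    · subst h0
      norm_num [bernoulli_one]
    · have h3 : bernoulli (k + 1) = 0 :=
        bernoulli_eq_zero_of_odd (Nat.not_odd_iff_even.1 ho).add_one (by omega)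
      rw [h3, if_neg (by omega)]
      simp

/-- The coefficients of the trace depend only on the class of `r` modulo the integers. -/
lemma traceCoeff_add_int (r : ℝ) (m : ℤ) : traceCoeff (r + m) = traceCoeff r := by
  funext j t
  refine tsum_congr fun k => ?_
  have h : Complex.exp (2 * Real.pi * Complex.I * k * ((r + m : ℝ) : ℂ)) =
      Complex.exp (2 * Real.pi * Complex.I * k * r) := by
    rw [Complex.exp_eq_exp_iff_exists_int]
    refine ⟨k * m, ?_⟩
    push_cast
    ring
  rw [coeff_poissonSeries, coeff_poissonSeries, h]

/-! ### The trace and its time integral as forms. -/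

section TraceForm

variable {n : ℕ}

/-- The trace as a form. -/
def traceForm (r : ℝ) (T R : Forms n) (t : ℝ) : Forms n :=
  evalAtForm (PowerSeries.mk fun j => traceCoeff r j t) T * R

/-- The integral of the trace as a form. -/
def traceIntegral (r : ℝ) (T R : Forms n) (s : ℝ) : Forms n :=
  evalAtForm (PowerSeries.mk fun j => (1 / Real.sqrt Real.pi : ℂ) *
    ∫ t in (0 : ℝ)..s, traceCoeff r j t) T * R

lemma intervalIntegrable_traceForm (r : ℝ) (T R : Forms n) {s : ℝ} (hs : 0 ≤ s)
    (φ : Module.Dual ℂ (Forms n)) :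
    IntervalIntegrable (fun t => φ (traceForm r T R t)) MeasureTheory.volume 0 s := by
  simp only [traceForm, map_evalAtForm_mul, PowerSeries.coeff_mk]
  have h := IntervalIntegrable.sum (Finset.range (n + 1)) fun k _ =>
    (intervalIntegrable_traceCoeff r k hs).mul_const (φ (T ^ k * R))
  rwa [Finset.sum_fn] at h

lemma map_traceIntegral (r : ℝ) (T R : Forms n) {s : ℝ} (hs : 0 ≤ s) (φ : Module.Dual ℂ (Forms n)) :
    φ (traceIntegral r T R s) =
      (1 / Real.sqrt Real.pi : ℂ) * ∫ t in (0 : ℝ)..s, φ (traceForm r T R t) := by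
  simp only [traceForm, traceIntegral, map_evalAtForm_mul, PowerSeries.coeff_mk]
  rw [intervalIntegral.integral_finsetSum fun k _ =>
    (intervalIntegrable_traceCoeff r k hs).mul_const _, Finset.mul_sum]
  refine Finset.sum_congr rfl fun k _ => ?_
  rw [intervalIntegral.integral_mul_const, mul_assoc]

/-- Only the class of `r` modulo the integers matters, so `r` is replaced by `a`. The factors `i^j`
of the limits are collected by rescaling the series by `i`. -/
lemma tendsto_traceIntegral {a r : ℝ} (ha : a ∈ Set.Ico (0 : ℝ) 1) {m : ℤ} (hr : r = a + m)
    (T R : Forms n) (φ : Module.Dual ℂ (Forms n)) :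
    Tendsto (fun s => φ (traceIntegral r T R s)) atTop (𝓝 (φ (evalAtForm (PowerSeries.rescale
      Complex.I (if a = 0 then bernoulliSeriesOn else bernoulliSeriesOff a)) T * R))) := by
  subst hr
  simp only [traceIntegral, map_evalAtForm_mul, PowerSeries.coeff_mk, PowerSeries.coeff_rescale,
    traceCoeff_add_int]
  exact tendsto_finsetSum _ fun k _ => (tendsto_integral_traceCoeff ha k).mul_const _

end TraceForm

/-! ### Holonomy and the eigenvalue of the frame. -/

section Geometry

variable {n : ℕ} {B : Type*} [TopologicalSpace B] [ChartedSpace (Coord n) B]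
  [IsManifold (𝓡 n) ∞ B]
  {E : B → Type*} [TopologicalSpace (TotalSpace Plane E)] [∀ b, NormedAddCommGroup (E b)]
  [∀ b, InnerProductSpace ℝ (E b)] [FiberBundle Plane E] [VectorBundle ℝ Plane E]
  [ContMDiffVectorBundle ∞ Plane E (𝓡 n)] [IsContMDiffRiemannianBundle (𝓡 n) ∞ Plane E]
  [ChartedSpace (Coord (n + 1)) (UnitCircle E)] [IsManifold (𝓡 (n + 1)) ∞ (UnitCircle E)]
  {V : UnitCircle E → Type*} [TopologicalSpace (TotalSpace ℂ V)] [∀ x, NormedAddCommGroup (V x)]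
  [∀ x, InnerProductSpace ℂ (V x)] [FiberBundle ℂ V] [VectorBundle ℝ ℂ V]
  [ContMDiffVectorBundle ∞ ℂ V (𝓡 (n + 1))]

namespace Setting

variable (S : Setting (n := n) E V)

section Holonomy

variable {S} {b : B} {U : Set B} {σ : Π x, V x} {f : B → ℝ}
  {β : Π y : B, TangentSpace (𝓡 n) y →L[ℝ] ℂ} (hσ : S.IsLocalEigenframe U σ f β) (hb : b ∈ U)
include hσ hb

/-- The holonomy around a fibre is given by the eigenvalue of the local eigensection. -/
lemma holonomy_eq {a : B → UnitAddCircle} (ha : S.IsHolonomy a) : a b = (f b : UnitAddCircle) := by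
  obtain ⟨x, hx⟩ := S.exists_base b
  have hbase : ∀ θ, base (S.rot θ x) = b := fun θ => hx
  have hU : ∀ θ, base (S.rot θ x) ∈ U := fun θ => by rw [hbase]; exact hb
  -- Since `∇_e σ = i f σ`, the section `e^{-ifθ} σ` is parallel along the fibre.
  have h1 : S.IsParallel x fun θ => Complex.exp (-(Complex.I * f b) * θ) • σ (S.rot θ x) := by
    intro θ
    have hd : HasDerivAt (fun θ : ℝ => Complex.exp (-(Complex.I * f b) * θ))
        (Complex.exp (-(Complex.I * f b) * θ) * (-(Complex.I * f b) * 1)) θ :=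
      ((Complex.ofRealCLM.hasDerivAt (x := θ)).const_mul (-(Complex.I * f b) : ℂ)).cexp
    refine ⟨σ, _, _, hσ.smooth _ (hU θ), Eventually.of_forall fun _ => rfl, hd, ?_⟩
    rw [hσ.connV_e hb (hU θ), hbase, smul_smul, ← add_smul]
    have : Complex.exp (-(Complex.I * f b) * θ) * (-(Complex.I * f b) * 1) +
        Complex.exp (-(Complex.I * f b) * θ) * (Complex.I * f b) = 0 := by ring
    rw [this, zero_smul]
  have h2 := ha x _ h1
  have hrot : S.rot (2 * Real.pi) x = S.rot 0 x := by
    simp only [rot, Real.cos_two_pi, Real.sin_two_pi, Real.cos_zero, Real.sin_zero]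
  -- `rot (2π) x` and `rot 0 x` are equal but not by definition, so vectors over them are compared
  -- in the total space.
  have h3 : ∀ (y : UnitCircle E) (c : ℂ), y = S.rot 0 x →
      (⟨y, c • σ y⟩ : TotalSpace ℂ V) = ⟨S.rot 0 x, c • σ (S.rot 0 x)⟩ := fun y c h => by rw [h]
  have h4 := (h3 _ _ hrot).symm.trans h2
  have h5 := TotalSpace.mk_inj.1 h4
  rw [Complex.ofReal_zero, mul_zero, Complex.exp_zero, one_smul, hx] at h5
  have h6 : Complex.exp (-(Complex.I * f b) * (2 * Real.pi : ℝ)) =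
      ((AddCircle.toCircle (a b))⁻¹ : ℂ) := smul_left_injective ℂ (hσ.ne_zero _ (hU 0)) h5
  apply AddCircle.injective_toCircle one_ne_zero
  apply Circle.ext
  rw [AddCircle.toCircle_apply_mk, Circle.coe_exp]
  rw [← inv_inj, ← h6, ← Complex.exp_neg]
  congr 1
  push_cast
  ring

omit hσ hb in
lemma torsionForm_eq_of_base_eq [T2Space B] {x y : UnitCircle E} (hx : base x = b) (hy : base y = b) :
    S.torsionForm b x = S.torsionForm b y := by
  simp only [torsionForm, torsionCoeff_eq_of_base_eq hx hy]

end Holonomy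

end Setting
end Geometry
end CircleEta
end

/-! ### The eta form of the circle bundle. -/

theorem mainTheorem4 {n : ℕ} {B : Type*} [TopologicalSpace B] [T2Space B] [CompactSpace B]
    [ConnectedSpace B] [ChartedSpace (CircleEta.Coord n) B] [IsManifold (𝓡 n) ∞ B]
    (E : B → Type*) [TopologicalSpace (TotalSpace CircleEta.Plane E)]
    [∀ b, NormedAddCommGroup (E b)] [∀ b, InnerProductSpace ℝ (E b)]
    [FiberBundle CircleEta.Plane E] [VectorBundle ℝ CircleEta.Plane E]
    [ContMDiffVectorBundle ∞ CircleEta.Plane E (𝓡 n)]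
    [IsContMDiffRiemannianBundle (𝓡 n) ∞ CircleEta.Plane E]
    [ChartedSpace (CircleEta.Coord (n + 1)) (CircleEta.UnitCircle E)]
    [IsManifold (𝓡 (n + 1)) ∞ (CircleEta.UnitCircle E)]
    (V : CircleEta.UnitCircle E → Type*) [TopologicalSpace (TotalSpace ℂ V)]
    [∀ x, NormedAddCommGroup (V x)] [∀ x, InnerProductSpace ℂ (V x)] [FiberBundle ℂ V]
    [VectorBundle ℝ ℂ V] [ContMDiffVectorBundle ∞ ℂ V (𝓡 (n + 1))]
    (S : CircleEta.Setting (n := n) E V)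
    (a : B → UnitAddCircle) (ha : S.IsHolonomy a)
    (ha₀ : CircleEta.CrossesZeroTransversally n a)
    (b : B) (U : Set B) (hb : b ∈ U) (σ : Π x, V x) (f : B → ℝ)
    (β : Π y : B, TangentSpace (𝓡 n) y →L[ℝ] ℂ) (hσ : S.IsLocalEigenframe U σ f β) :
    (∀ t > 0, ∀ u₀, S.IsSmoothForm b u₀ → ∃! u₁, S.IsHeatValue b t u₀ u₁) ∧
    ∃ (h α : ℝ → CircleEta.Forms n) (η : CircleEta.Forms n),
      (∀ t > 0, S.IsTraceEv b t (h t)) ∧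
      (∀ T > 0, ∀ φ : Module.Dual ℂ (CircleEta.Forms n),
        IntervalIntegrable (fun t => φ (h t)) MeasureTheory.volume 0 T ∧
        φ (α T) = (1 / Real.sqrt Real.pi : ℂ) * ∫ t in (0 : ℝ)..T, φ (h t)) ∧
      (∀ φ : Module.Dual ℂ (CircleEta.Forms n),
        Tendsto (fun T => φ (α T)) atTop (𝓝 (φ η))) ∧
      CircleEta.evenPart η = η ∧
      ∀ x : CircleEta.UnitCircle E, CircleEta.base x = b →
        CircleEta.rescaleForm η =
          CircleEta.evalAtForm (PowerSeries.exp ℂ)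
              (-(2 * Real.pi * Complex.I : ℂ)⁻¹ •
                (CircleEta.extDerivAt β b + (Complex.I * f b) • S.torsionForm b x)) *
            CircleEta.evalAtForm
              (open Classical in if a b = 0 then CircleEta.bernoulliSeriesOn
                else CircleEta.bernoulliSeriesOff (AddCircle.equivIco 1 0 (a b)).1)
              ((2 * Real.pi : ℂ)⁻¹ • S.torsionForm b x) ∧
        CircleEta.rescaleForm η =
          CircleEta.evalAtForm (PowerSeries.exp ℂ)
              (-(2 * Real.pi * Complex.I : ℂ)⁻¹ •
                (CircleEta.extDerivAt β b + (Complex.I * f b) • S.torsionForm b x)) *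
            CircleEta.evalAtForm
              (open Classical in if a b = 0 then CircleEta.closedSeriesOn
                else CircleEta.closedSeriesOff (AddCircle.equivIco 1 0 (a b)).1)
              ((2 * Real.pi : ℂ)⁻¹ • S.torsionForm b x) := by
  obtain ⟨x₀, hx₀⟩ := S.exists_base b
  refine ⟨fun t ht u₀ hu₀ => CircleEta.Setting.existsUnique_isHeatValue hσ hb ht hu₀, ?_⟩
  set T := S.torsionForm b x₀ with hT_def
  set Ω := CircleEta.extDerivAt β b + (Complex.I * f b) • T with hΩ_def
  set a₀ : ℝ := (AddCircle.equivIco 1 0 (a b)).1 with ha₀_def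
  have hmem : a₀ ∈ Set.Ico (0 : ℝ) 1 := by
    have h : a₀ ∈ Set.Ico (0 : ℝ) (0 + 1) := (AddCircle.equivIco 1 0 (a b)).2
    rwa [zero_add] at h
  have hcoe : (a₀ : UnitAddCircle) = a b := (AddCircle.equivIco 1 0).symm_apply_apply (a b)
  have hzero : a b = 0 ↔ a₀ = 0 := by
    constructor
    · intro h
      rw [ha₀_def, h]
      exact congrArg Subtype.val (AddCircle.equivIco_coe_eq (p := (1 : ℝ)) (a := 0) (x := 0) (by simp))
    · intro h
      rw [← hcoe, h, AddCircle.coe_zero]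
  -- The holonomy determines the eigenvalue `f(b)` modulo the integers, and `a₀` is the
  -- representative of `a(b)` in `[0, 1)`.
  obtain ⟨m, hm⟩ : ∃ m : ℤ, f b = a₀ + m := by
    have h := CircleEta.Setting.holonomy_eq hσ hb ha
    rw [← hcoe, eq_comm, ← sub_eq_zero, ← AddCircle.coe_sub, AddCircle.coe_eq_zero_iff] at h
    obtain ⟨m, hm⟩ := h
    exact ⟨m, by rw [zsmul_one] at hm; linarith⟩
  have hT2 : T ∈ ⋀[ℂ]^2 (CircleEta.Coord n →ₗ[ℝ] ℂ) := CircleEta.twoForm_mem _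
  have hΩ2 : Ω ∈ ⋀[ℂ]^2 (CircleEta.Coord n →ₗ[ℝ] ℂ) :=
    add_mem (CircleEta.twoForm_mem _) (Submodule.smul_mem _ _ hT2)
  have hT : CircleEta.parity n T = T := CircleEta.parity_twoForm _
  have hΩ : CircleEta.parity n Ω = Ω := by
    rw [hΩ_def, map_add, map_smul, hT, CircleEta.extDerivAt, CircleEta.parity_twoForm]
  set P := if a₀ = 0 then CircleEta.bernoulliSeriesOn else CircleEta.bernoulliSeriesOff a₀ with hP
  set R := CircleEta.evalAtForm (PowerSeries.exp ℂ) (-Ω) with hR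
  have hR_even : CircleEta.parity n R = R := CircleEta.parity_evalAtForm (by rw [map_neg, hΩ]) _
  have hP_even : ∀ p, CircleEta.parity n (CircleEta.evalAtForm p T * R) =
      CircleEta.evalAtForm p T * R := fun p => by
    rw [CircleEta.parity_mul, CircleEta.parity_evalAtForm hT, hR_even]
  refine ⟨CircleEta.traceForm (f b) T R, CircleEta.traceIntegral (f b) T R,
    CircleEta.evalAtForm (PowerSeries.rescale Complex.I P) T * R, fun t ht => ?_, fun s hs φ =>
      ⟨CircleEta.intervalIntegrable_traceForm _ T R hs.le φ,
        CircleEta.map_traceIntegral _ T R hs.le φ⟩,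
    CircleEta.tendsto_traceIntegral hmem hm T R, CircleEta.evenPart_of_even (hP_even _),
    fun x hx => ?_⟩
  · have h := CircleEta.Setting.isTraceEv hσ hb hx₀ ht fun j =>
      ((CircleEta.summable_norm_modeSeries ht (f b)).comp_injective
        (i := fun m : ℤ => (m, j)) fun _ _ h => (Prod.mk.inj h).1).of_norm
    -- The sum over the eigenvalues is exchanged for the dual series, whose coefficients are bounded
    -- as `t → 0`.
    rw [CircleEta.modeSeriesSum_mul_gaussSeries ht] at h
    exact h
  · have hη : CircleEta.rescaleForm (CircleEta.evalAtForm (PowerSeries.rescale Complex.I P) T * R) =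
        CircleEta.evalAtForm (PowerSeries.exp ℂ) (-(2 * Real.pi * Complex.I : ℂ)⁻¹ • Ω) *
          CircleEta.evalAtForm P ((2 * Real.pi : ℂ)⁻¹ • T) := by
      have hπ : (Real.pi : ℂ) ≠ 0 := by exact_mod_cast Real.pi_ne_zero
      rw [hR, CircleEta.rescaleForm_mul hT2 (neg_mem hΩ2), ← CircleEta.evalAtForm_smul, smul_smul,
        smul_neg, ← neg_smul]
      -- The factor `i` from the limit cancels the one in `(2πi)^{-1}` and leaves the real argument
      -- `T / 2π`.
      rw [show Complex.I * ((2 : ℂ) * Real.pi * Complex.I)⁻¹ = ((2 : ℂ) * Real.pi)⁻¹ by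
        field_simp]
      exact (CircleEta.commute_of_even (CircleEta.parity_evalAtForm (by rw [map_smul, hT]) _) _).eq
    rw [CircleEta.Setting.torsionForm_eq_of_base_eq hx hx₀, ← hT_def, ← hΩ_def, hη]
    have hif : (open Classical in if a b = 0 then CircleEta.bernoulliSeriesOn
        else CircleEta.bernoulliSeriesOff a₀) = P := by
      rw [hP]
      by_cases h0 : a₀ = 0
      · rw [if_pos h0, if_pos (hzero.2 h0)]
      · rw [if_neg h0, if_neg (fun h => h0 (hzero.1 h))]
    rw [CircleEta.closedSeriesOn_eq, CircleEta.closedSeriesOff_eq, hif]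
    exact ⟨rfl, rfl⟩
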